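/- Let $b>0$, let $L$ be a real càdlàg Lévy process and let $X$ solve $dX_s=-bX_s\,ds+dL_s$, i.e. $X_s=X_0-b\int_0^sX_v\,dv+L_s$ for all $s\ge 0$ a.s. For $r\ge 0$ and $t>0$ let $Z=X_{r+t}-e^{-bt}X_r=\int_r^{r+t}e^{-b(r+t-s)}\,dL_s$; its law depends only on $t$. **Processes.** A *tempered stable* (TS) exponent has parameters $\alpha_p,\alpha_n<2$, $\beta_p,\beta_n>0$, $c_p,c_n\ge 0$ not both $0$, $\gamma_c\in\mathbb R$, and is $$\psi(u)=iu\gamma_c+c_p\,g_{\alpha_p,\beta_p}(iu)+c_n\,g_{\alpha_n,\beta_n}(-iu),$$ where $g_{\alpha,\beta}(w)=\Gamma(-\alpha)\beta^\alpha\big[(1-\tfrac w\beta)^\alpha-1+\tfrac{\alpha w}{\beta}\big]$ for $\alpha\ne 0,1$, $g_{0,\beta}(w)=-\tfrac w\beta-\log(1-\tfrac w\beta)$, $g_{1,\beta}(w)=w+(\beta-w)\log(1-\tfrac w\beta)$. Let $\bar\alpha$ be $\max\{\alpha_p,\alpha_n\}$ taken over the sides with $c>0$; put $(p_-,p_+)=(-\beta_p,\beta_n)$,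 where $p_-=-\infty$ if $c_p=0$ and $p_+=+\infty$ if $c_n=0$; and let $\delta=\gamma_c-c_p\Gamma(1-\alpha_p)\beta_p^{\alpha_p-1}+c_n\Gamma(1-\alpha_n)\beta_n^{\alpha_n-1}$, a side with $c=0$ contributing $0$ here and below. A *normal tempered stable* (NTS) exponent has parameters $\alpha<1$, $\kappa,\sigma>0$, $\theta\in\mathbb R$, and is $$\psi(u)=\tfrac{1-\alpha}{\kappa\alpha}\Big[1-\Big(1-\tfrac{i\kappa}{1-\alpha}\big(\theta u+\tfrac{i u^2\sigma^2}{2}\big)\Big)^\alpha\Big]\ (\alpha\neq0),\qquad \psi(u)=-\tfrac1\kappa\log\big(\tfrac{\sigma^2u^2\kappa}{2}-i\theta\kappa u+1\big)\ (\alpha=0);$$ put $p_\pm=(\theta\pm A)/\sigma^2$ with $A=\sqrt{\theta^2+2\sigma^2(1-\alpha)/\kappa}$. $X$ is an OU-TS (OU-NTS) process if $E[e^{iuL_s}]=e^{s\psi(u)}$ with a TS (NTS) exponent. It is a TS-OU (NTS-OU) process if the equation has a stationary law with characteristic function $e^{\psi}$; in this case the stability parameters (of the sides with $c>0$) are assumed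 to be non-negative. **Numerical error.** For a law $\rho$ on $\mathbb R$ with distribution function $P$ and $\phi(z)=\int e^{izy}\rho(dy)$, a shift $a\ne 0$, a step $h>0$ and $N\ge 1$ grid points, let $$\hat P(x)=\mathbf 1_{a<0}-\frac{he^{ax}}{\pi}\,\Re\sum_{n=0}^{N-1}\frac{\phi((n+\frac12)h+ia)}{i(n+\frac12)h-a}\,e^{-ix(n+\frac12)h},\qquad \mathcal E(x)=|P(x)-\hat P(x)|,$$ and $D_h(x)=\dfrac{1+e^{2ax}\phi(2ia)}{e^{2\pi|a|/h}-e^{-2\pi|a|/h}}$. *The error decays exponentially with exponent $\omega>0$* if there is $\ell>0$ such that for every $a\in(\frac12p_-,\frac12p_+)\setminus\{0\}$: $\int e^{-2ay}\rho(dy)<\infty$; there is $B>0$ such that for all $x\in\mathbb R$, $h>0$, $N\ge1$ $$\mathcal E(x)\le\frac{Be^{ax}}{\pi\omega}\,\frac{e^{-\ell(Nh)^\omega}}{\ell(Nh)^\omega}+D_h(x);$$ and, with $h(N)=\big(\frac{2\pi|a|}{\ell N^\omega}\big)^{1/(\omega+1)}$, for every $x$, $\mathcal E(x)=O\big(\exp\{-\ell^{\frac1{\omega+1}}(2\pi|a|)^{\frac{\omega}{\omega+1}}N^{\frac\omega{\omega+1}}\}\big)$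 as $N\to\infty$. *The error decays as a power law with exponent $\omega>0$* if for every $a\in(\frac12p_-,\frac12p_+)\setminus\{0\}$: $\int e^{-2ay}\rho(dy)<\infty$; there is $B>0$ such that for all $x\in\mathbb R$, $h>0$, $N\ge1$ $$\mathcal E(x)\le\frac{Be^{ax}}{\pi\omega}(Nh)^{-\omega}+D_h(x);$$ for every $x$ and $\varepsilon>0$ there are a fixed step $h>0$ and $C$ with $\mathcal E(x)\le CN^{-\omega}+\varepsilon$ for all $N\ge 1$; and with $h(N)=2\pi|a|/(\omega\log N)$, for every $x$, $\mathcal E(x)=O((\log N/N)^{\omega})$ as $N\to\infty$. **Bernoulli decomposition.** $Z$ *has the decomposition $(V,\Lambda,\mu)$*, where $\Lambda>0$, if $Z$ is equal in law to $\mu+V$ with probability $1-e^{-\Lambda}$ and to $\mu$ with probability $e^{-\Lambda}$, and $E[e^{iuV}]=(e^{\Lambda\phi_J(u)}-1)/(e^\Lambda-1)$ for the characteristic function $\phi_J$ of an absolutely continuous law. **Activity.** In each case below the law of $Z$ is infinitely divisible without Gaussian part, with a Lévy measure $\nu_Z$; FA means $\nu_Z(\mathbb R)<\infty$; FV (IV)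 means $\nu_Z(\mathbb R)=\infty$ and $\int_{|x|\le1}|x|\,\nu_Z(dx)<\infty$ ($=\infty$). **Proposition.** 1. *OU-TS.* If $\bar\alpha<0$: FA, and $Z$ has the decomposition $(V,\Lambda,\mu)$ with $\Lambda=t\,(c_p\Gamma(-\alpha_p)\beta_p^{\alpha_p}+c_n\Gamma(-\alpha_n)\beta_n^{\alpha_n})$ and $\mu=\frac{1-e^{-bt}}b\,\delta$, where the error for the law of $V$ decays as a power law with exponent $|\bar\alpha|$. If $\bar\alpha=0$: FV, and the error for $Z$ decays as a power law with exponent $t$ times the sum of the $c$'s of the sides with stability parameter $0$. If $\bar\alpha\in(0,1)$: FV, and if $\bar\alpha\in[1,2)$: IV, and in both cases the error for $Z$ decays exponentially with exponent $\bar\alpha$. 2. *TS-OU.* If $\bar\alpha=0$: FA, and $Z$ has the decomposition $(V,(c_p+c_n)bt,(1-e^{-bt})\delta)$, where the error for $V$ decays as a power law with exponent $1$. If $\bar\alpha\in(0,1)$: FV, and if $\bar\alpha\in[1,2)$: IV, and in both cases the error for $Z$ decays exponentially with exponent $\bar\alpha$. 3. *OU-NTS.* If $\alpha<0$: FA, and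 $Z$ has the decomposition $(V,\frac{1-\alpha}{\kappa|\alpha|}t,0)$, where the error for $V$ decays as a power law with exponent $2|\alpha|$. If $\alpha=0$: FV, and the error for $Z$ decays as a power law with exponent $2t/\kappa$. If $\alpha\in(0,\frac12)$: FV, and if $\alpha\in[\frac12,1)$: IV, and in both cases the error for $Z$ decays exponentially with exponent $2\alpha$. 4. *NTS-OU.* If $\alpha=0$: FA, and $Z$ has the decomposition $(V,\frac{2b}{\kappa}t,0)$, where the error for $V$ decays as a power law with exponent $1$. If $\alpha\in(0,\frac12)$: FV, and if $\alpha\in[\frac12,1)$: IV, and in both cases the error for $Z$ decays exponentially with exponent $2\alpha$. -/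

import Mathlib

open MeasureTheory ProbabilityTheory Filter Topology Asymptotics
open scoped NNReal ENNReal

noncomputable section

namespace LevyOU

/-! ### Lévy processes and Ornstein–Uhlenbeck processes driven by them -/

/-- A path on `[0, ∞)` that is right-continuous with left limits. -/
def IsCadlagPath (f : ℝ≥0 → ℝ) : Prop :=
  ∀ t, ContinuousWithinAt f (Set.Ici t) t ∧ ∃ l, Tendsto f (𝓝[<] t) (𝓝 l)

/-- A real Lévy process: it starts at `0`, has independent and stationary increments, and almost
all of its paths are càdlàg. -/
structure IsLevyProcess {Ω : Type*} [MeasurableSpace Ω] (P : Measure Ω) (L : ℝ≥0 → Ω → ℝ) :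
    Prop where
  measurable : ∀ t, Measurable (L t)
  zero : ∀ᵐ ω ∂P, L 0 ω = 0
  indep : HasIndepIncrements L P
  stationary : ∀ s t, IdentDistrib (fun ω => L (s + t) ω - L s ω) (L t) P P
  cadlag : ∀ᵐ ω ∂P, IsCadlagPath fun t => L t ω

/-- `ψ` is the characteristic exponent of `L`: `E[exp(i u L_t)] = exp(t ψ(u))`. -/
def HasCharExponent {Ω : Type*} [MeasurableSpace Ω] (P : Measure Ω) (L : ℝ≥0 → Ω → ℝ)
    (ψ : ℝ → ℂ) : Prop :=
  ∀ (t : ℝ≥0) (u : ℝ), charFun (P.map (L t)) u = Complex.exp ((t : ℝ) * ψ u)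

/-- `X` solves `dX_t = -b X_t dt + dL_t`, where `L` is a Lévy process. The noise being additive,
the equation is the pathwise identity `X_t = X_0 - b ∫₀ᵗ X_s ds + L_t`. -/
structure IsOUProcess {Ω : Type*} [MeasurableSpace Ω] (P : Measure Ω) (b : ℝ)
    (L X : ℝ≥0 → Ω → ℝ) : Prop where
  levy : IsLevyProcess P L
  measurable : ∀ t, Measurable (X t)
  solves : ∀ᵐ ω ∂P, ∀ t : ℝ≥0,
    IntervalIntegrable (fun s : ℝ => X s.toNNReal ω) volume 0 t ∧
    X t ω = X 0 ω - b * (∫ s in (0 : ℝ)..t, X s.toNNReal ω) + L t ω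

/-- The law of `∫_r^{r+t} exp(-b (r+t-s)) dL_s = X_{r+t} - exp(-b t) X_r`. -/
def stepLaw {Ω : Type*} [MeasurableSpace Ω] (P : Measure Ω) (b : ℝ) (X : ℝ≥0 → Ω → ℝ)
    (r t : ℝ≥0) : Measure ℝ :=
  P.map fun ω => X (r + t) ω - Real.exp (-b * t) * X r ω

/-- `π` is a stationary law of the Ornstein–Uhlenbeck dynamics: if `ξ` has law `π` and is
independent of `L`, then the solution started at `ξ` has law `π` at every time. -/
def IsStationaryLaw {Ω : Type*} [MeasurableSpace Ω] (P : Measure Ω) (b : ℝ) (X : ℝ≥0 → Ω → ℝ)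
    (π : Measure ℝ) : Prop :=
  IsProbabilityMeasure π ∧
    ∀ t : ℝ≥0, (π.map fun x => Real.exp (-b * t) * x) ∗ stepLaw P b X 0 t = π

/-! ### Activity and variation -/

/-- `ρ` is infinitely divisible with characteristic triplet `(0, ν, γ)` for some `γ`. -/
def HasLevyMeasure (ρ ν : Measure ℝ) : Prop :=
  ν {0} = 0 ∧ ∫⁻ x, ENNReal.ofReal (min 1 (x ^ 2)) ∂ν < ⊤ ∧
    ∃ γ : ℝ, ∀ u : ℝ, charFun ρ u = Complex.exp (Complex.I * u * γ +
      ∫ x : ℝ, (Complex.exp (Complex.I * u * x) - 1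
        - if |x| ≤ 1 then Complex.I * u * x else 0) ∂ν)

/-- Finite activity. -/
def FiniteActivity (ρ : Measure ℝ) : Prop :=
  ∃ ν, HasLevyMeasure ρ ν ∧ ν Set.univ < ⊤

/-- Infinite activity and finite variation. -/
def InfiniteActivityFiniteVariation (ρ : Measure ℝ) : Prop :=
  ∃ ν, HasLevyMeasure ρ ν ∧ ν Set.univ = ⊤ ∧
    ∫⁻ x in Set.Icc (-1 : ℝ) 1, ENNReal.ofReal |x| ∂ν < ⊤

/-- Infinite activity and infinite variation. -/
def InfiniteActivityInfiniteVariation (ρ : Measure ℝ) : Prop :=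
  ∃ ν, HasLevyMeasure ρ ν ∧ ν Set.univ = ⊤ ∧
    ∫⁻ x in Set.Icc (-1 : ℝ) 1, ENNReal.ofReal |x| ∂ν = ⊤

/-! ### Tempered stable parameters -/

/-- Parameters of a (generalised, bilateral) tempered stable law; `c = 0` switches a side off. -/
structure TSParams where
  αp : ℝ
  αn : ℝ
  βp : ℝ
  βn : ℝ
  cp : ℝ
  cn : ℝ
  γc : ℝ
  αp_lt : αp < 2
  αn_lt : αn < 2
  βp_pos : 0 < βp
  βn_pos : 0 < βn
  cp_nonneg : 0 ≤ cp
  cn_nonneg : 0 ≤ cn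
  nondegenerate : 0 < cp ∨ 0 < cn

/-- Contribution to the characteristic exponent of the side with Lévy density
`exp(-β x) / x^(1+α)`, at `w = i u` (positive side) or `w = -i u` (negative side). -/
def tsSide (α β : ℝ) (w : ℂ) : ℂ :=
  if α = 0 then -(w / β + Complex.log (1 - w / β))
  else if α = 1 then w + (β - w) * Complex.log (1 - w / β)
  else (Real.Gamma (-α) * β ^ α : ℝ) * ((1 - w / β) ^ (α : ℂ) - 1 + w * (α / β))

namespace TSParams

/-- The characteristic exponent of the tempered stable process. -/
def exponent (p : TSParams) (u : ℝ) : ℂ :=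
  Complex.I * u * p.γc + p.cp * tsSide p.αp p.βp (Complex.I * u)
    + p.cn * tsSide p.αn p.βn (-(Complex.I * u))

/-- `max {αp, αn}`, taken over the sides that are present. -/
def index (p : TSParams) : ℝ :=
  if p.cn = 0 then p.αp else if p.cp = 0 then p.αn else max p.αp p.αn

/-- The stability parameters of the sides that are present are non-negative. -/
def NonnegStability (p : TSParams) : Prop :=
  (0 < p.cp → 0 ≤ p.αp) ∧ (0 < p.cn → 0 ≤ p.αn)

/-- The analyticity strip `(-βp, βn)`, unbounded in the direction of a side that is absent. -/
def strip (p : TSParams) : Set ℝ :=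
  {a | (0 < p.cp → -p.βp < a) ∧ (0 < p.cn → a < p.βn)}

/-- Jump intensity of the driver when its activity is finite. -/
def intensity (p : TSParams) : ℝ :=
  p.cp * Real.Gamma (-p.αp) * p.βp ^ p.αp + p.cn * Real.Gamma (-p.αn) * p.βn ^ p.αn

/-- Drift that remains when the jumps are not compensated. -/
def drift (p : TSParams) : ℝ :=
  p.γc - p.cp * Real.Gamma (1 - p.αp) * p.βp ^ (p.αp - 1)
    + p.cn * Real.Gamma (1 - p.αn) * p.βn ^ (p.αn - 1)

/-- The mass `c` of the sides of Gamma type, i.e. with stability parameter `0`. -/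
def gammaMass (p : TSParams) : ℝ :=
  (if p.αp = 0 then p.cp else 0) + (if p.αn = 0 then p.cn else 0)

end TSParams

/-! ### Normal tempered stable parameters -/

/-- Parameters of a (generalised) normal tempered stable law. -/
structure NTSParams where
  α : ℝ
  κ : ℝ
  σ : ℝ
  θ : ℝ
  α_lt : α < 1
  κ_pos : 0 < κ
  σ_pos : 0 < σ

namespace NTSParams

/-- The characteristic exponent of the normal tempered stable process; `α = 0` is the variance
gamma process. -/
def exponent (p : NTSParams) (u : ℝ) : ℂ :=
  if p.α = 0 then
    -(1 / p.κ) * Complex.log (p.σ ^ 2 * u ^ 2 * p.κ / 2 - Complex.I * p.θ * p.κ * u + 1)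
  else
    (1 - p.α) / (p.κ * p.α) * (1 - (1 - Complex.I * p.κ / (1 - p.α) *
      (p.θ * u + Complex.I * (u ^ 2 * p.σ ^ 2 / 2))) ^ (p.α : ℂ))

/-- The analyticity strip `((θ - A) / σ², (θ + A) / σ²)`, `A = √(θ² + 2 σ² (1 - α) / κ)`. -/
def strip (p : NTSParams) : Set ℝ :=
  Set.Ioo ((p.θ - √(p.θ ^ 2 + 2 * p.σ ^ 2 * (1 - p.α) / p.κ)) / p.σ ^ 2)
    ((p.θ + √(p.θ ^ 2 + 2 * p.σ ^ 2 * (1 - p.α) / p.κ)) / p.σ ^ 2)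

end NTSParams

/-! ### The numerical inversion of the characteristic function -/

/-- The characteristic function at a complex argument, `φ(z) = E[exp(i z Y)]`, `Y ~ ρ`. -/
def cf (ρ : Measure ℝ) (z : ℂ) : ℂ := ∫ y : ℝ, Complex.exp (Complex.I * z * y) ∂ρ

/-- The approximation of the distribution function of `ρ` computed by FFT, with shift `a`, step `h`
in Fourier space and `N` grid points. -/
def fftCDF (ρ : Measure ℝ) (a h : ℝ) (N : ℕ) (x : ℝ) : ℝ :=
  (if 0 < a then 0 else 1) - h * Real.exp (a * x) / Real.pi *
    (∑ n ∈ Finset.range N,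
      cf ρ (((n + 1 / 2) * h : ℝ) + Complex.I * a) / (Complex.I * ((n + 1 / 2) * h : ℝ) - a)
        * Complex.exp (-(Complex.I * x * ((n + 1 / 2) * h : ℝ)))).re

/-- The numerical error `𝓔(x) = |P(x) - P̂(x)|`. -/
def cdfError (ρ : Measure ℝ) (a h : ℝ) (N : ℕ) (x : ℝ) : ℝ :=
  |cdf ρ x - fftCDF ρ a h N x|

/-- The bound for the discretisation error. -/
def discretisationBound (ρ : Measure ℝ) (a h x : ℝ) : ℝ :=
  1 / (Real.exp (2 * Real.pi * |a| / h) - Real.exp (-(2 * Real.pi * |a| / h))) *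
    (1 + Real.exp (2 * a * x) * (cf ρ (2 * Complex.I * a)).re)

/-- Exponential decay with exponent `ω`, for all shifts `a ≠ 0` in half the strip `S`: the error is
the sum of a truncation error that is exponentially small in `(N h)^ω` and of the discretisation
error, and with the balanced step `h(N)` it is exponentially small in `N ^ (ω / (1 + ω))`. -/
def ExponentialErrorDecay (ρ : Measure ℝ) (S : Set ℝ) (ω : ℝ) : Prop :=
  ∃ ℓ : ℝ, 0 < ℓ ∧ ∀ a : ℝ, a ≠ 0 → 2 * a ∈ S →
    Integrable (fun y => Real.exp (-(2 * a * y))) ρ ∧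
    (∃ B : ℝ, 0 < B ∧ ∀ (x h : ℝ) (N : ℕ), 0 < h → 1 ≤ N →
      cdfError ρ a h N x ≤
        B * Real.exp (a * x) / (Real.pi * ω) *
            (Real.exp (-(ℓ * (N * h) ^ ω)) / (ℓ * (N * h) ^ ω))
          + discretisationBound ρ a h x) ∧
    ∀ x : ℝ,
      (fun N : ℕ =>
        cdfError ρ a ((2 * Real.pi * |a| / (ℓ * (N : ℝ) ^ ω)) ^ (1 / (ω + 1))) N x)
      =O[atTop] fun N : ℕ =>
        Real.exp (-(ℓ ^ (1 / (ω + 1)) * (2 * Real.pi * |a|) ^ (ω / (ω + 1))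
          * (N : ℝ) ^ (ω / (ω + 1))))

/-- Power-law decay with exponent `ω`, for all shifts `a ≠ 0` in half the strip `S`: the error is
the sum of a truncation error of order `(N h)^(-ω)` and of the discretisation error; with a fixed
step `h` it is of order `N^(-ω)` up to a discretisation error as small as desired, and with a
logarithmically small step it is of order `(log N / N)^ω`. -/
def PowerLawErrorDecay (ρ : Measure ℝ) (S : Set ℝ) (ω : ℝ) : Prop :=
  ∀ a : ℝ, a ≠ 0 → 2 * a ∈ S →
    Integrable (fun y => Real.exp (-(2 * a * y))) ρ ∧
    (∃ B : ℝ, 0 < B ∧ ∀ (x h : ℝ) (N : ℕ), 0 < h → 1 ≤ N →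
      cdfError ρ a h N x ≤
        B * Real.exp (a * x) / (Real.pi * ω) * (N * h) ^ (-ω)
          + discretisationBound ρ a h x) ∧
    (∀ x ε : ℝ, 0 < ε → ∃ h : ℝ, 0 < h ∧ ∃ C : ℝ, ∀ N : ℕ, 1 ≤ N →
      cdfError ρ a h N x ≤ C * (N : ℝ) ^ (-ω) + ε) ∧
    ∀ x : ℝ,
      (fun N : ℕ => cdfError ρ a (2 * Real.pi * |a| / (ω * Real.log N)) N x)
      =O[atTop] fun N : ℕ => (Real.log N / N) ^ ω

/-- `ρ` is the law of `μ` plus a sum of a Poisson(`Λ`) number of i.i.d. jumps with an absolutely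
continuous law `J`, and `V` is the law of the sum of the jumps given that there is at least one:
a draw from `ρ` is `μ + V` with probability `1 - exp(-Λ)` and `μ` otherwise. -/
def BernoulliDecomposition (ρ V : Measure ℝ) (Λ μ : ℝ) : Prop :=
  0 < Λ ∧ IsProbabilityMeasure V ∧
    (∃ J : Measure ℝ, IsProbabilityMeasure J ∧ J ≪ volume ∧
      ∀ u : ℝ, charFun V u = (Complex.exp (Λ * charFun J u) - 1) / (Complex.exp Λ - 1)) ∧
    ρ = ENNReal.ofReal (Real.exp (-Λ)) • Measure.dirac μ
      + ENNReal.ofReal (1 - Real.exp (-Λ)) • V.map fun v => μ + v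

end LevyOU

end

/-! All four families reduce to one question about a Lévy measure. Weighted sums of increments of
the driver converge pathwise to the Ornstein–Uhlenbeck increment, and independence turns their
characteristic functions into products. Hence `Z` has exponent `∫₀ᵗ ψ(e^{-bs} u) ds`, where `ψ` is
the exponent of the driver (`charFun_stepLaw`). If a stationary law `e^ψ` is prescribed instead, the
convolution equation gives `ψ(u) - ψ(e^{-bt} u)`, which is the same integral for the exponent `χ(u)
= b u ψ'(u)` (`sub_eq_integral_of_hasDerivAt`). In both cases `Z` has the Lévy measure `ouMeasure b
t ν`, where `ν` belongs to `ψ` or to `χ`.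

The numerical error has two sources. Poisson summation for the damped distribution function `e^{-av}
P(v)`, modulated so that the dual lattice falls on midpoints, shows that the full midpoint series
gives `P(x)` up to aliasing terms, which alternate in sign and are geometrically small. They make up
the discretisation bound (`abs_cdf_add_tsum_le`). Stopping after `N` terms costs an integral tail of
`|φ(u + ia)| / u` (`cdfError_le`). So the rate is read off from the decay of `φ` on horizontal
lines. Approximation by compound Poisson laws without small jumps yields `|φ(u + ia)| ≤ K exp(-∫ (1
- cos(ux)) e^{-ax} ν(dx))` (`norm_cf_le_of_isCenteredExponent`).

There are three regimes. If `∫_{|x| ≤ y} x² dν ≥ C y^{2-ω}` with `ω > 0` (`SmallJumpBound`), the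
integral grows at least like `u^ω` and the error decays exponentially; the same bound forces
infinite activity, and infinite variation when `ω ≥ 1`. If the density of the driver is like `c / x`
at zero, the integral grows like `c t log u` and the decay is a power. If `ν` is finite, the law is
conditioned on having a jump, and the conditional transform decays as fast as that of `ν`.

It remains to find the measures. Tempered stable exponents come from the Gamma integral. For a
tempered stable stationary law the identity `w g_α' = α g_α + β g_{α-1}` (`mul_tsSideDeriv`) shows a
driver that is again tempered stable. Normal tempered stable laws are subordinated Brownian motions,
which doubles the index. For a normal tempered stable stationary law the power in `ψ'` is a
Stieltjes mixture of resolvents, whose quadratic denominators split into exponential jump laws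
(`tsSide_mixRate_add`). Variance gamma is treated as a bilateral Gamma law. -/

noncomputable section

namespace LevyOU

/-! ### Discretisation error of the inversion formula -/

/-- A finite measure whose characteristic function vanishes at infinity has no atoms. -/
theorem measure_singleton_zero_of_tendsto_charFun {m : Measure ℝ} [IsFiniteMeasure m]
    (h : Tendsto (charFun m) (cocompact ℝ) (𝓝 0)) : m {0} = 0 := by
  -- Averaging the characteristic function over `[-(n+1), n+1]` integrates `sinc((n+1)x)` against
  -- `m`. These kernels are bounded by `1` and converge to the indicator of `{0}`.
  have h1 : Tendsto (fun n : ℕ => ∫ x, Real.sinc ((n + 1 : ℝ) * x) ∂m) atTop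
      (𝓝 (∫ x, ({0} : Set ℝ).indicator (fun _ => (1 : ℝ)) x ∂m)) := by
    refine tendsto_integral_of_dominated_convergence (fun _ => (1 : ℝ)) (fun n => ?_)
      (integrable_const _) (fun n => ae_of_all _ fun x => ?_) (ae_of_all _ fun x => ?_)
    · exact (Real.continuous_sinc.comp (continuous_const.mul continuous_id)).aestronglyMeasurable
    · exact Real.abs_sinc_le_one _
    · by_cases hx : x = 0
      · subst hx
        simp [Real.sinc_zero]
      · rw [Set.indicator_of_notMem (by simpa using hx)]
        have hbd : ∀ n : ℕ, ‖Real.sinc ((n + 1 : ℝ) * x)‖ ≤ 1 / ((n : ℝ) + 1) * |x|⁻¹ := by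
          intro n
          have hn : (0 : ℝ) < n + 1 := by positivity
          rw [Real.sinc_of_ne_zero (mul_ne_zero hn.ne' hx), norm_div, Real.norm_eq_abs,
            Real.norm_eq_abs, abs_mul, abs_of_pos hn]
          have := Real.abs_sin_le_one ((n + 1 : ℝ) * x)
          have hx' : 0 < |x| := abs_pos.2 hx
          rw [div_le_iff₀ (by positivity)]
          field_simp
          linarith
        refine squeeze_zero_norm hbd ?_
        simpa using (tendsto_one_div_add_atTop_nhds_zero_nat (𝕜 := ℝ)).mul_const |x|⁻¹
  have h2 : Tendsto (fun n : ℕ => ((∫ x, Real.sinc ((n + 1 : ℝ) * x) ∂m : ℝ) : ℂ)) atTop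
      (𝓝 0) := by
    have h3 : ∀ n : ℕ, ((∫ x, Real.sinc ((n + 1 : ℝ) * x) ∂m : ℝ) : ℂ)
        = 1 / 2 * ∫ v in (-1 : ℝ)..1, charFun m ((n + 1 : ℝ) * v) := by
      intro n
      have hn : (0 : ℝ) < n + 1 := by positivity
      have e := integral_charFun_Icc (μ := m) hn
      have hnC : ((n : ℂ) + 1) ≠ 0 := by exact_mod_cast hn.ne'
      rw [intervalIntegral.integral_comp_mul_left _ hn.ne', mul_neg, mul_one, e]
      push_cast
      rw [Complex.real_smul]
      push_cast
      field_simp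
    simp_rw [h3]
    have h4 : Tendsto (fun n : ℕ => ∫ v in (-1 : ℝ)..1, charFun m ((n + 1 : ℝ) * v)) atTop
        (𝓝 (∫ _v in (-1 : ℝ)..1, (0 : ℂ))) := by
      refine intervalIntegral.tendsto_integral_filter_of_dominated_convergence
        (fun _ => m.real Set.univ) (Eventually.of_forall fun n => ?_)
        (Eventually.of_forall fun n => ae_of_all _ fun v _ => norm_charFun_le _)
        intervalIntegrable_const ?_
      · exact (measurable_charFun.comp (measurable_const.mul measurable_id)).aestronglyMeasurable
      · have : ∀ᵐ v : ℝ, v ≠ 0 := by simp [ae_iff]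
        filter_upwards [this] with v hv _
        refine h.comp ?_
        rw [← Metric.cobounded_eq_cocompact, ← tendsto_norm_atTop_iff_cobounded]
        simp only [norm_mul]
        refine Tendsto.atTop_mul_const (norm_pos_iff.2 hv) ?_
        have : Tendsto (fun n : ℕ => (n : ℝ) + 1) atTop atTop :=
          tendsto_atTop_add_const_right _ _ tendsto_natCast_atTop_atTop
        refine this.congr fun n => ?_
        rw [Real.norm_of_nonneg (by positivity)]
    simpa using h4.const_mul (1 / 2 : ℂ)
  have h6 : Tendsto (fun n : ℕ => ∫ x, Real.sinc ((n + 1 : ℝ) * x) ∂m) atTop (𝓝 0) := by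
    simpa only [Function.comp_def, Complex.ofReal_re, Complex.zero_re] using
      (Complex.continuous_re.tendsto _).comp h2
  have h5 := tendsto_nhds_unique h1 h6
  rw [integral_indicator_const _ (measurableSet_singleton _)] at h5
  simpa [Measure.real, ENNReal.toReal_eq_zero_iff] using h5

/-- The distribution function of a law without atoms is continuous. -/
theorem continuous_cdf {ρ : Measure ℝ} [IsProbabilityMeasure ρ] (h : ∀ x, ρ {x} = 0) :
    Continuous (cdf ρ) := by
  refine continuous_iff_continuousAt.2 fun x => ?_
  have e := StieltjesFunction.measure_singleton (cdf ρ) x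
  rw [measure_cdf, h x] at e
  have e2 : cdf ρ x ≤ Function.leftLim (cdf ρ) x := by
    have := ENNReal.ofReal_eq_zero.1 e.symm
    linarith
  have e3 := (cdf ρ).mono.leftLim_le (le_refl x)
  exact (cdf ρ).mono.continuousAt_iff_leftLim_eq_rightLim.2 (by
    rw [StieltjesFunction.rightLim_eq]; exact le_antisymm e3 e2)

/-- An alternating sum with geometrically bounded terms. -/
theorem abs_tsum_alternating_le {s : ℕ → ℝ} {C r : ℝ} (hr : 0 < r) (hr1 : r < 1)
    (h0 : ∀ k, 0 ≤ s k) (hs : ∀ k, s k ≤ C * r ^ (k + 1)) :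
    |∑' k : ℕ, (-1) ^ (k + 1) * s k| ≤ C * (r / (1 - r ^ 2)) := by
  have hC : 0 ≤ C := by
    have := (h0 0).trans (hs 0)
    exact nonneg_of_mul_nonneg_left this (by positivity)
  have hr2 : r ^ 2 < 1 := by nlinarith
  have g := hasSum_geometric_of_lt_one (sq_nonneg r) hr2
  -- Even and odd indices enter with opposite signs, so the modulus is at most the larger of the two
  -- sums, and `C (r + r³ + ...)` bounds both. The triangle inequality over all terms would give
  -- only `C r / (1 - r)`.
  have gE : HasSum (fun j : ℕ => C * r * (r ^ 2) ^ j) (C * r * (1 - r ^ 2)⁻¹) := g.mul_left _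
  have gO : HasSum (fun j : ℕ => C * r ^ 2 * (r ^ 2) ^ j) (C * r ^ 2 * (1 - r ^ 2)⁻¹) :=
    g.mul_left _
  have bE : ∀ j, s (2 * j) ≤ C * r * (r ^ 2) ^ j := fun j => (hs _).trans_eq (by ring)
  have bO : ∀ j, s (2 * j + 1) ≤ C * r ^ 2 * (r ^ 2) ^ j := fun j => (hs _).trans_eq (by ring)
  have sE : Summable fun j => s (2 * j) := .of_nonneg_of_le (fun j => h0 _) bE gE.summable
  have sO : Summable fun j => s (2 * j + 1) := .of_nonneg_of_le (fun j => h0 _) bO gO.summable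
  have tE : ∑' j, s (2 * j) ≤ C * r * (1 - r ^ 2)⁻¹ := by
    rw [← gE.tsum_eq]; exact sE.tsum_le_tsum bE gE.summable
  have tO : ∑' j, s (2 * j + 1) ≤ C * r ^ 2 * (1 - r ^ 2)⁻¹ := by
    rw [← gO.tsum_eq]; exact sO.tsum_le_tsum bO gO.summable
  have e := tsum_even_add_odd (f := fun k => (-1 : ℝ) ^ (k + 1) * s k)
    (by simpa [pow_add, pow_mul] using sE.neg) (by simpa [pow_add, pow_mul] using sO)
  simp only [pow_add, pow_mul] at e
  rw [show (fun k => (-1 : ℝ) ^ (k + 1) * s k) = fun k => (-1 : ℝ) ^ k * (-1) ^ 1 * s k by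
    funext k; ring]
  rw [← e]
  have pE : 0 ≤ ∑' j, s (2 * j) := tsum_nonneg fun j => h0 _
  have pO : 0 ≤ ∑' j, s (2 * j + 1) := tsum_nonneg fun j => h0 _
  have hi : 0 ≤ (1 - r ^ 2)⁻¹ := inv_nonneg.2 (by linarith)
  have hle : C * r ^ 2 * (1 - r ^ 2)⁻¹ ≤ C * r * (1 - r ^ 2)⁻¹ := by
    gcongr
    nlinarith
  simp only [even_two, Even.neg_pow, one_pow, one_mul, pow_one, neg_mul, tsum_neg, mul_neg,
    mul_one, neg_neg]
  rw [div_eq_mul_inv, ← mul_assoc]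
  rw [abs_le]
  constructor <;> linarith

theorem integrable_exp_neg_of_two_mul {ρ : Measure ℝ} [IsFiniteMeasure ρ] {a : ℝ}
    (h : Integrable (fun y => Real.exp (-(2 * a * y))) ρ) :
    Integrable (fun y => Real.exp (-(a * y))) ρ := by
  refine ((integrable_const (1 : ℝ)).add h).mono'
    (by fun_prop) (ae_of_all _ fun y => ?_)
  rw [Real.norm_of_nonneg (Real.exp_pos _).le]
  have : Real.exp (-(2 * a * y)) = Real.exp (-(a * y)) ^ 2 := by
    rw [← Real.exp_nat_mul]; congr 1; push_cast; ring
  simp only [Pi.add_apply, this]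
  nlinarith [sq_nonneg (Real.exp (-(a * y)) - 1), Real.exp_pos (-(a * y))]

theorem cf_conj {ρ : Measure ℝ} (a u : ℝ) :
    cf ρ (((-u : ℝ) : ℂ) + Complex.I * a)
      = (starRingEnd ℂ) (cf ρ ((u : ℂ) + Complex.I * a)) := by
  rw [cf, cf, ← integral_conj]
  congr 1
  funext y
  rw [← Complex.exp_conj]
  congr 1
  simp only [map_mul, map_add, Complex.conj_I, Complex.conj_ofReal]
  push_cast
  ring

/-- Fourier transform of the exponentially damped distribution function. -/
theorem integral_exp_mul_cdf {ρ : Measure ℝ} [IsProbabilityMeasure ρ] {a : ℝ} (ha : 0 < a)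
    (h : Integrable (fun y => Real.exp (-(a * y))) ρ) (u : ℝ) :
    ∫ v : ℝ, Complex.exp (Complex.I * ((u : ℂ) + Complex.I * a) * v) * (cdf ρ v : ℂ)
      = -(cf ρ ((u : ℂ) + Complex.I * a) / (Complex.I * u - a)) := by
  set w : ℂ := Complex.I * ((u : ℂ) + Complex.I * a) with hw
  have hw' : w = Complex.I * u - a := by
    rw [hw]; ring_nf; rw [Complex.I_sq]; ring
  have hwre : w.re = -a := by rw [hw']; simp
  have hneg : w.re < 0 := by rw [hwre]; linarith
  -- The exponential is integrated over `y < v`. One order of integration produces the transform of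
  -- `ρ`, the other that of its distribution function.
  let F : ℝ → ℝ → ℂ := fun v y => (Set.Ioi y).indicator (fun v : ℝ => Complex.exp (w * v)) v
  have hS : MeasurableSet {p : ℝ × ℝ | p.2 < p.1} := measurableSet_lt measurable_snd measurable_fst
  have hF : Function.uncurry F
      = {p : ℝ × ℝ | p.2 < p.1}.indicator fun p => Complex.exp (w * p.1) := by
    funext p
    simp only [Function.uncurry, F, Set.indicator, Set.mem_Ioi, Set.mem_ofPred_eq]
  have hmeas : AEStronglyMeasurable (Function.uncurry F) (volume.prod ρ) := by
    rw [hF]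
    exact (Measurable.indicator (by fun_prop) hS).aestronglyMeasurable
  have hInt : Integrable (Function.uncurry F) (volume.prod ρ) := by
    rw [integrable_prod_iff' hmeas]
    refine ⟨ae_of_all _ fun y => ?_, ?_⟩
    · simp only [Function.uncurry, F]
      exact (integrable_indicator_iff measurableSet_Ioi).2 (integrableOn_exp_mul_complex_Ioi hneg y)
    · have : ∀ y : ℝ, ∫ v : ℝ, ‖Function.uncurry F (v, y)‖ = Real.exp (-(a * y)) / a := by
        intro y
        simp only [Function.uncurry, F, norm_indicator_eq_indicator_norm]
        rw [integral_indicator measurableSet_Ioi]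
        have : ∀ v : ℝ, ‖Complex.exp (w * v)‖ = Real.exp (-a * v) := by
          intro v; rw [Complex.norm_exp]; simp [hwre]
        simp_rw [this]
        rw [integral_exp_mul_Ioi (by linarith)]
        simp [neg_div_neg_eq]
      simp_rw [this]
      exact h.div_const _
  have e := integral_integral_swap hInt
  have e1 : ∀ v : ℝ, ∫ y, F v y ∂ρ = Complex.exp (w * v) * (ρ.real (Set.Iio v) : ℂ) := by
    intro v
    have : ∀ y, F v y = (Set.Iio v).indicator (fun _ => Complex.exp (w * v)) y := by
      intro y; simp only [F, Set.indicator, Set.mem_Ioi, Set.mem_Iio]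
    simp_rw [this]
    rw [integral_indicator_const _ measurableSet_Iio, Complex.real_smul, mul_comm]
  have e2 : ∀ y : ℝ, ∫ v, F v y = -Complex.exp (w * y) / w := by
    intro y
    simp only [F]
    rw [integral_indicator measurableSet_Ioi, integral_exp_mul_complex_Ioi hneg]
  simp_rw [e1, e2] at e
  -- Fubini gives the left-continuous version `ρ (Iio v)`, which differs from the distribution
  -- function only at the countably many atoms.
  have hae : ∀ᵐ v : ℝ, Complex.exp (w * v) * (cdf ρ v : ℂ)
      = Complex.exp (w * v) * (ρ.real (Set.Iio v) : ℂ) := by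
    have hc : (Set.Countable {v : ℝ | 0 < ρ {v}}) :=
      Measure.countable_meas_pos_of_disjoint_iUnion (μ := ρ) (As := fun v : ℝ => {v})
        (fun v => measurableSet_singleton v) (fun v w hvw => by simpa using hvw)
    have hz : volume {v : ℝ | 0 < ρ {v}} = 0 := hc.measure_zero _
    have : ∀ᵐ v : ℝ, ¬ 0 < ρ {v} := by
      rw [ae_iff]; simpa only [not_not] using hz
    filter_upwards [this] with v hv
    congr 2
    rw [cdf_eq_real, ← Set.Iio_union_right, measureReal_union (by simp) (measurableSet_singleton v)]
    have : ρ {v} = 0 := by simpa using hv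
    simp [Measure.real, this]
  rw [integral_congr_ae hae, e, cf, ← hw, ← hw', ← integral_div, ← integral_neg]
  congr 1
  funext y
  ring

theorem re_cf_two_I_mul {ρ : Measure ℝ} (a : ℝ) :
    (cf ρ (2 * Complex.I * a)).re = ∫ y, Real.exp (-(2 * a * y)) ∂ρ := by
  have : ∀ y : ℝ, Complex.exp (Complex.I * (2 * Complex.I * a) * y)
      = ((Real.exp (-(2 * a * y)) : ℝ) : ℂ) := by
    intro y
    push_cast
    congr 1
    linear_combination (2 * (a : ℂ) * y) * Complex.I_sq
  rw [cf]
  simp_rw [this]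
  rw [integral_complex_ofReal, Complex.ofReal_re]

/-- Markov's inequality for the left tail. -/
theorem cdf_le_exp_mul {ρ : Measure ℝ} [IsProbabilityMeasure ρ] {c : ℝ} (hc : 0 ≤ c)
    (h : Integrable (fun y => Real.exp (-(c * y))) ρ) (v : ℝ) :
    cdf ρ v ≤ Real.exp (c * v) * ∫ y, Real.exp (-(c * y)) ∂ρ := by
  rw [cdf_eq_real, ← integral_const_mul]
  calc ρ.real (Set.Iic v) = ∫ y, (Set.Iic v).indicator (fun _ => (1 : ℝ)) y ∂ρ := by
        rw [integral_indicator_const _ measurableSet_Iic]; simp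
    _ ≤ _ := by
        refine integral_mono ((integrable_const _).indicator measurableSet_Iic)
          (h.const_mul _) fun y => ?_
        simp only [Set.indicator, Set.mem_Iic]
        split_ifs with hy
        · rw [← Real.exp_add]
          exact Real.one_le_exp (by nlinarith)
        · positivity

/-- The exponentially damped distribution function. -/
def dampedCDF (ρ : Measure ℝ) (a v : ℝ) : ℝ := Real.exp (-(a * v)) * cdf ρ v

theorem dampedCDF_nonneg {ρ : Measure ℝ} (a v : ℝ) : 0 ≤ dampedCDF ρ a v :=
  mul_nonneg (Real.exp_pos _).le (cdf_nonneg _ _)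

theorem dampedCDF_le_left {ρ : Measure ℝ} (a v : ℝ) : dampedCDF ρ a v ≤ Real.exp (-(a * v)) :=
  mul_le_of_le_one_right (Real.exp_pos _).le (cdf_le_one _ _)

/-- Markov's inequality with exponent `2a` leaves the factor `e^{av}` after damping by `e^{-av}`.
Together with the trivial bound this gives exponential decay at both ends, and it is the reason why
`2a`, not just `a`, has to lie in the strip. -/
theorem dampedCDF_le_right {ρ : Measure ℝ} [IsProbabilityMeasure ρ] {a : ℝ} (ha : 0 < a)
    (h : Integrable (fun y => Real.exp (-(2 * a * y))) ρ) (v : ℝ) :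
    dampedCDF ρ a v ≤ Real.exp (a * v) * ∫ y, Real.exp (-(2 * a * y)) ∂ρ := by
  rw [dampedCDF]
  refine (mul_le_mul_of_nonneg_left (cdf_le_exp_mul (by positivity) h v)
    (Real.exp_pos _).le).trans_eq ?_
  rw [← mul_assoc, ← Real.exp_add]
  congr 2
  ring

/-- The decay is exponential on both sides. The weaker rate `|y|^{-2}` is the form in which Poisson
summation uses it. -/
theorem dampedCDF_isBigO {ρ : Measure ℝ} [IsProbabilityMeasure ρ] {a : ℝ} (ha : 0 < a)
    (h : Integrable (fun y => Real.exp (-(2 * a * y))) ρ) {T : ℝ} (hT : 0 < T) (x : ℝ) :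
    (fun y : ℝ => (dampedCDF ρ a (x + T * y) : ℝ)) =O[cocompact ℝ]
      fun y : ℝ => |y| ^ (-2 : ℝ) := by
  set M := ∫ y, Real.exp (-(2 * a * y)) ∂ρ
  have hM : 0 ≤ M := integral_nonneg fun y => (Real.exp_pos _).le
  have h1 : (fun y : ℝ => (dampedCDF ρ a (x + T * y) : ℝ)) =O[cocompact ℝ]
      fun y : ℝ => Real.exp (-(a * T) * |y|) := by
    refine IsBigO.of_bound (Real.exp (-(a * x)) + Real.exp (a * x) * M)
      (Eventually.of_forall fun y => ?_)
    rw [Real.norm_of_nonneg (dampedCDF_nonneg _ _), Real.norm_of_nonneg (Real.exp_pos _).le]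
    rcases le_total 0 y with hy | hy
    · refine (dampedCDF_le_left _ _).trans ?_
      rw [abs_of_nonneg hy, show -(a * (x + T * y)) = -(a * x) + -(a * T) * y by ring,
        Real.exp_add]
      gcongr
      have : 0 ≤ Real.exp (a * x) * M := by positivity
      linarith
    · refine (dampedCDF_le_right ha h _).trans ?_
      rw [abs_of_nonpos hy, show a * (x + T * y) = a * x + -(a * T) * -y by ring,
        Real.exp_add]
      have : 0 ≤ Real.exp (-(a * x)) * Real.exp (-(a * T) * -y) := by positivity
      nlinarith
  refine h1.trans ?_
  have h2 : (fun t : ℝ => Real.exp (-(a * T) * t)) =o[atTop] fun t : ℝ => t ^ (-2 : ℝ) :=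
    isLittleO_exp_neg_mul_rpow_atTop (by positivity) _
  have h3 : Tendsto (fun y : ℝ => |y|) (cocompact ℝ) atTop := tendsto_norm_cocompact_atTop
  exact (h2.comp_tendsto h3).isBigO

/-- Multiplication by `e^{-iπy}` shifts the frequencies by one half, so that the dual lattice of
step `h` meets the points `(n + 1/2) h` of the midpoint grid. The period in space is then `2π / h`.
-/
theorem fourier_dampedCDF {ρ : Measure ℝ} [IsProbabilityMeasure ρ] {a : ℝ} (ha : 0 < a)
    (hi : Integrable (fun y => Real.exp (-(a * y))) ρ) {h : ℝ} (hh : 0 < h) (x : ℝ) (n : ℤ) :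
    FourierTransform.fourier (fun y : ℝ => Complex.exp (-(Complex.I * Real.pi * y))
        * (dampedCDF ρ a (x + 2 * Real.pi / h * y) : ℂ)) (n : ℝ)
      = (h / (2 * Real.pi) : ℝ) * (Complex.exp (Complex.I * x * ((n + 1 / 2) * h : ℝ))
        * -(cf ρ ((-((n + 1 / 2) * h) : ℝ) + Complex.I * a)
          / (Complex.I * (-((n + 1 / 2) * h) : ℝ) - a))) := by
  rw [Real.fourier_real_eq_integral_exp_smul]
  set u : ℝ := (n + 1 / 2) * h with hu
  set T : ℝ := 2 * Real.pi / h with hT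
  have hT0 : 0 < T := by positivity
  rw [← integral_exp_mul_cdf ha hi, ← integral_const_mul]
  let g : ℝ → ℂ := fun v => Complex.exp (Complex.I * x * (u : ℂ)) *
    (Complex.exp (Complex.I * (((-u : ℝ) : ℂ) + Complex.I * a) * v) * (cdf ρ v : ℂ))
  have e : ∀ v : ℝ, Complex.exp (((-2 * Real.pi * v * n : ℝ) : ℂ) * Complex.I) •
      (Complex.exp (-(Complex.I * Real.pi * v)) * (dampedCDF ρ a (x + T * v) : ℂ))
      = g (x + T * v) := by
    intro v
    simp only [g, dampedCDF, smul_eq_mul]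
    push_cast
    simp only [← mul_assoc, ← Complex.exp_add]
    congr 2
    have hTu : T * u = 2 * Real.pi * (n + 1 / 2) := by
      rw [hT, hu]; field_simp
    have hTu' : (T : ℂ) * u = 2 * Real.pi * (n + 1 / 2) := by
      rw [← Complex.ofReal_mul, hTu]; push_cast; ring
    linear_combination (Complex.I * v) * hTu' - (a * (x + T * v) : ℂ) * Complex.I_sq
  simp_rw [e]
  rw [Measure.integral_comp_mul_left (fun z => g (x + z)) T, integral_add_left_eq_self,
    Complex.real_smul, abs_of_pos (by positivity)]
  congr 2
  rw [hT, inv_div]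

/-- The `n`-th term of the midpoint rule for the inversion integral. -/
def inversionTerm (ρ : Measure ℝ) (a h x : ℝ) (n : ℕ) : ℂ :=
  cf ρ (((n + 1 / 2) * h : ℝ) + Complex.I * a) / (Complex.I * ((n + 1 / 2) * h : ℝ) - a)
    * Complex.exp (-(Complex.I * x * ((n + 1 / 2) * h : ℝ)))

theorem norm_inversionTerm (ρ : Measure ℝ) (a h x : ℝ) (n : ℕ) :
    ‖inversionTerm ρ a h x n‖ = ‖cf ρ (((n + 1 / 2) * h : ℝ) + Complex.I * a)
      / (Complex.I * ((n + 1 / 2) * h : ℝ) - a)‖ := by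
  rw [inversionTerm, norm_mul, Complex.norm_exp (-_)]
  simp

/-- The half-integers `n + 1/2` and `-(n + 1) + 1/2` are opposite, hence their terms are conjugate
and a pair contributes twice a real part. -/
theorem hasSum_int_of_conj {g : ℤ → ℂ} {t : ℕ → ℂ} {c : ℝ} (hs : Summable t)
    (hpos : ∀ n : ℕ, g n = c * -(starRingEnd ℂ) (t n)) (hneg : ∀ n : ℕ, g (-(n + 1)) = c * -t n) :
    HasSum g ((-(2 * c) * (∑' n, t n).re : ℝ) : ℂ) := by
  have h1 : HasSum (fun n : ℕ => g n) (c * -(starRingEnd ℂ) (∑' n, t n)) := by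
    simp_rw [hpos]
    exact ((Complex.hasSum_conj'.2 hs.hasSum).neg).mul_left _
  have h2 : HasSum (fun n : ℕ => g (-(n + 1))) (c * -(∑' n, t n)) := by
    simp_rw [hneg]
    exact hs.hasSum.neg.mul_left _
  have h3 := HasSum.of_nat_of_neg_add_one h1 h2
  convert! h3 using 1
  have := Complex.add_conj (∑' n, t n)
  push_cast at this ⊢
  linear_combination (c : ℂ) * this

theorem tsum_int_alternating {φ : ℝ → ℝ}
    (s1 : Summable fun k : ℕ => (-1 : ℝ) ^ (k + 1) * φ ((k : ℝ) + 1))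
    (s2 : Summable fun k : ℕ => (-1 : ℝ) ^ (k + 1) * φ (-((k : ℝ) + 1))) :
    ∑' k : ℤ, (-1 : ℝ) ^ k * φ k
      = φ 0 + ∑' k : ℕ, (-1 : ℝ) ^ (k + 1) * (φ ((k : ℝ) + 1) + φ (-((k : ℝ) + 1))) := by
  have e1 : (fun n : ℕ => (-1 : ℝ) ^ (n : ℤ) * φ ((n : ℤ) : ℝ))
      = fun n : ℕ => (-1 : ℝ) ^ n * φ n := by
    funext n
    rw [zpow_natCast, Int.cast_natCast]
  have e2 : (fun n : ℕ => (-1 : ℝ) ^ (-((n : ℤ) + 1)) * φ ((-((n : ℤ) + 1) : ℤ) : ℝ))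
      = fun n : ℕ => (-1 : ℝ) ^ (n + 1) * φ (-((n : ℝ) + 1)) := by
    funext n
    rw [zpow_neg, ← inv_zpow, ← Nat.cast_succ, zpow_natCast]
    norm_num
  have s0 : Summable fun n : ℕ => (-1 : ℝ) ^ n * φ n :=
    (summable_nat_add_iff 1).1 (by simpa using s1)
  rw [tsum_of_nat_of_neg_add_one (f := fun k : ℤ => (-1 : ℝ) ^ k * φ k) (by rw [e1]; exact s0)
    (by rw [e2]; exact s2), e1, e2, s0.tsum_eq_zero_add]
  simp only [mul_add, pow_zero, one_mul, Nat.cast_zero, Nat.cast_add, Nat.cast_one]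
  rw [s1.tsum_add s2, add_assoc]

theorem tsum_fourier_dampedCDF {ρ : Measure ℝ} [IsProbabilityMeasure ρ]
    {a : ℝ} (ha : 0 < a) (hi : Integrable (fun y => Real.exp (-(a * y))) ρ)
    {h : ℝ} (hh : 0 < h) (x : ℝ) (hs : Summable (inversionTerm ρ a h x)) :
    HasSum (fun n : ℤ => FourierTransform.fourier
        (fun y : ℝ => Complex.exp (-(Complex.I * Real.pi * y))
        * (dampedCDF ρ a (x + 2 * Real.pi / h * y) : ℂ)) (n : ℝ))
      ((-(h / Real.pi * (∑' n, inversionTerm ρ a h x n).re) : ℝ) : ℂ) := by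
  have hneg : ∀ n : ℕ, FourierTransform.fourier
      (fun y : ℝ => Complex.exp (-(Complex.I * Real.pi * y))
        * (dampedCDF ρ a (x + 2 * Real.pi / h * y) : ℂ)) (((-((n : ℤ) + 1) : ℤ)) : ℝ)
      = (h / (2 * Real.pi) : ℝ) * -inversionTerm ρ a h x n := by
    intro n
    rw [fourier_dampedCDF ha hi hh, inversionTerm]
    have : ((-((n : ℤ) + 1) : ℤ) : ℝ) + 1 / 2 = -(n + 1 / 2) := by push_cast; ring
    rw [this]
    simp only [neg_mul, neg_neg]
    congr 1
    rw [mul_neg, mul_comm (Complex.exp _)]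
    congr 3
    push_cast
    ring
  have hpos : ∀ n : ℕ, FourierTransform.fourier
      (fun y : ℝ => Complex.exp (-(Complex.I * Real.pi * y))
        * (dampedCDF ρ a (x + 2 * Real.pi / h * y) : ℂ)) (((n : ℤ)) : ℝ)
      = (h / (2 * Real.pi) : ℝ) * -(starRingEnd ℂ) (inversionTerm ρ a h x n) := by
    intro n
    rw [fourier_dampedCDF ha hi hh, inversionTerm]
    simp only [Int.cast_natCast]
    rw [cf_conj]
    simp only [map_mul, map_div₀, ← Complex.exp_conj, map_neg, map_sub, Complex.conj_I,
      Complex.conj_ofReal]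
    congr 1
    rw [mul_neg, mul_comm (Complex.exp _)]
    congr 3
    · push_cast
      ring
    · ring
  have := hasSum_int_of_conj (c := h / (2 * Real.pi)) (g := fun n : ℤ =>
    FourierTransform.fourier (fun y : ℝ => Complex.exp (-(Complex.I * Real.pi * y))
        * (dampedCDF ρ a (x + 2 * Real.pi / h * y) : ℂ)) (n : ℝ)) hs hpos hneg
  rwa [show -(2 * (h / (2 * Real.pi))) * (∑' n, inversionTerm ρ a h x n).re
    = -(h / Real.pi * (∑' n, inversionTerm ρ a h x n).re) by field_simp] at this

/-- Poisson summation. The modulation that produces midpoints on the Fourier side becomes the sign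
`(-1)^k` on the spatial side. Absence of atoms supplies the continuity of the summed function. -/
theorem tsum_dampedCDF_eq {ρ : Measure ℝ} [IsProbabilityMeasure ρ] (hρ : ∀ x, ρ {x} = 0)
    {a : ℝ} (ha : 0 < a) (hi : Integrable (fun y => Real.exp (-(2 * a * y))) ρ)
    {h : ℝ} (hh : 0 < h) (x : ℝ) (hs : Summable (inversionTerm ρ a h x)) :
    ∑' k : ℤ, (-1 : ℝ) ^ k * dampedCDF ρ a (x + 2 * Real.pi / h * k)
      = -(h / Real.pi * (∑' n, inversionTerm ρ a h x n).re) := by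
  have hT0 : 0 < 2 * Real.pi / h := by positivity
  have hH := tsum_fourier_dampedCDF ha (integrable_exp_neg_of_two_mul hi) hh x hs
  set f : ℝ → ℂ := fun y => Complex.exp (-(Complex.I * Real.pi * y))
    * (dampedCDF ρ a (x + 2 * Real.pi / h * y) : ℂ) with hf
  have hGc : Continuous (dampedCDF ρ a) := by
    have := continuous_cdf hρ
    unfold dampedCDF
    fun_prop
  have hfc : Continuous f := by
    simp only [hf]
    fun_prop
  have hfO : f =O[cocompact ℝ] fun y : ℝ => |y| ^ (-2 : ℝ) := by
    refine IsBigO.trans (IsBigO.of_bound 1 (Eventually.of_forall fun y => ?_))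
      (dampedCDF_isBigO ha hi hT0 x)
    simp only [hf, norm_mul]
    rw [Complex.norm_exp]
    simp
  have hP := Real.tsum_eq_tsum_fourier_of_rpow_decay_of_summable hfc one_lt_two hfO
    hH.summable 0
  have hR : ∀ n : ℤ, FourierTransform.fourier f n * fourier n ((0 : ℝ) : UnitAddCircle)
      = FourierTransform.fourier f n := fun n => by simp
  simp_rw [hR] at hP
  rw [hH.tsum_eq] at hP
  have hLk : ∀ k : ℤ, f (0 + (k : ℝ))
      = (((-1 : ℝ) ^ k * dampedCDF ρ a (x + 2 * Real.pi / h * k) : ℝ) : ℂ) := by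
    intro k
    simp only [hf, zero_add]
    have : Complex.exp (-(Complex.I * Real.pi * ((k : ℝ) : ℂ))) = (-1 : ℂ) ^ k := by
      rw [show -(Complex.I * Real.pi * ((k : ℝ) : ℂ)) = (k : ℂ) * -(Real.pi * Complex.I) by
        push_cast; ring, Complex.exp_int_mul, Complex.exp_neg, Complex.exp_pi_mul_I]
      norm_num
    rw [this]
    push_cast
    rfl
  simp_rw [hLk] at hP
  rw [← Complex.ofReal_tsum] at hP
  exact_mod_cast hP

/-- The midpoint rule for the inversion integral reproduces the distribution function up to the
discretisation bound. -/
theorem abs_cdf_add_tsum_le {ρ : Measure ℝ} [IsProbabilityMeasure ρ] (hρ : ∀ x, ρ {x} = 0)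
    {a : ℝ} (ha : 0 < a) (hi : Integrable (fun y => Real.exp (-(2 * a * y))) ρ)
    {h : ℝ} (hh : 0 < h) (x : ℝ) (hs : Summable (inversionTerm ρ a h x)) :
    |cdf ρ x + h * Real.exp (a * x) / Real.pi * (∑' n, inversionTerm ρ a h x n).re|
      ≤ discretisationBound ρ a h x := by
  have hE := tsum_dampedCDF_eq hρ ha hi hh x hs
  set M := ∫ y, Real.exp (-(2 * a * y)) ∂ρ with hM
  have hM0 : 0 ≤ M := integral_nonneg fun y => (Real.exp_pos _).le
  set T := 2 * Real.pi / h with hT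
  have hT0 : 0 < T := by positivity
  set r := Real.exp (-(a * T)) with hr
  have hr0 : 0 < r := Real.exp_pos _
  have hr1 : r < 1 := Real.exp_lt_one_iff.2 (by nlinarith)
  have hrk : ∀ k : ℕ, Real.exp (-(a * T * ((k : ℝ) + 1))) = r ^ (k + 1) := by
    intro k
    rw [hr, ← Real.exp_nat_mul]
    congr 1
    push_cast
    ring
  have b1 : ∀ k : ℕ, Real.exp (a * x) * dampedCDF ρ a (x + T * ((k : ℝ) + 1)) ≤ r ^ (k + 1) := by
    intro k
    rw [← hrk]
    refine (mul_le_mul_of_nonneg_left (dampedCDF_le_left _ _) (Real.exp_pos _).le).trans_eq ?_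
    rw [← Real.exp_add]
    congr 1
    ring
  have b2 : ∀ k : ℕ, Real.exp (a * x) * dampedCDF ρ a (x + T * (-((k : ℝ) + 1)))
      ≤ Real.exp (2 * a * x) * M * r ^ (k + 1) := by
    intro k
    rw [← hrk]
    refine (mul_le_mul_of_nonneg_left (dampedCDF_le_right ha hi _)
      (Real.exp_pos _).le).trans_eq ?_
    rw [← hM, ← mul_assoc, ← Real.exp_add, mul_right_comm, ← Real.exp_add]
    congr 2
    ring
  have hgeo : Summable fun k : ℕ => r ^ (k + 1) :=
    (summable_nat_add_iff 1).2 (summable_geometric_of_lt_one hr0.le hr1)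
  have s1 : Summable fun k : ℕ => (-1 : ℝ) ^ (k + 1)
      * (Real.exp (a * x) * dampedCDF ρ a (x + T * ((k : ℝ) + 1))) := by
    refine Summable.of_norm_bounded hgeo fun k => ?_
    rw [norm_mul, norm_pow, norm_neg, norm_one, one_pow, one_mul, Real.norm_of_nonneg
      (mul_nonneg (Real.exp_pos _).le (dampedCDF_nonneg _ _))]
    exact b1 k
  have s2 : Summable fun k : ℕ => (-1 : ℝ) ^ (k + 1)
      * (Real.exp (a * x) * dampedCDF ρ a (x + T * (-((k : ℝ) + 1)))) := by
    refine Summable.of_norm_bounded (hgeo.mul_left (Real.exp (2 * a * x) * M)) fun k => ?_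
    rw [norm_mul, norm_pow, norm_neg, norm_one, one_pow, one_mul, Real.norm_of_nonneg
      (mul_nonneg (Real.exp_pos _).le (dampedCDF_nonneg _ _))]
    exact b2 k
  -- The term `k = 0` is the distribution function at `x`; all the others are aliasing errors.
  have key := tsum_int_alternating (φ := fun y => Real.exp (a * x) * dampedCDF ρ a (x + T * y))
    s1 s2
  have z0 : Real.exp (a * x) * dampedCDF ρ a (x + T * 0) = cdf ρ x := by
    rw [dampedCDF, mul_zero, add_zero, ← mul_assoc, ← Real.exp_add]
    simp
  have z1 : ∀ k : ℤ, (-1 : ℝ) ^ k * (Real.exp (a * x) * dampedCDF ρ a (x + T * k))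
      = Real.exp (a * x) * ((-1 : ℝ) ^ k * dampedCDF ρ a (x + T * k)) := fun k => by ring
  simp_rw [z1] at key
  rw [tsum_mul_left, hE, z0] at key
  -- Aliases to the right are bounded by `P ≤ 1`, those to the left by Markov's inequality. The two
  -- constants add up to the numerator `1 + e^{2ax} φ(2ia)`.
  have hb := abs_tsum_alternating_le (C := 1 + Real.exp (2 * a * x) * M) hr0 hr1
    (s := fun k : ℕ => Real.exp (a * x) * dampedCDF ρ a (x + T * ((k : ℝ) + 1))
      + Real.exp (a * x) * dampedCDF ρ a (x + T * (-((k : ℝ) + 1))))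
    (fun k => add_nonneg (mul_nonneg (Real.exp_pos _).le (dampedCDF_nonneg _ _))
      (mul_nonneg (Real.exp_pos _).le (dampedCDF_nonneg _ _)))
    (fun k => by linarith [b1 k, b2 k])
  rw [show cdf ρ x + h * Real.exp (a * x) / Real.pi * (∑' n, inversionTerm ρ a h x n).re
    = -∑' k : ℕ, (-1 : ℝ) ^ (k + 1) * (Real.exp (a * x) * dampedCDF ρ a (x + T * ((k : ℝ) + 1))
      + Real.exp (a * x) * dampedCDF ρ a (x + T * (-((k : ℝ) + 1)))) by
      linear_combination -key, abs_neg]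
  refine hb.trans_eq ?_
  rw [discretisationBound, re_cf_two_I_mul, ← hM, abs_of_pos ha,
    show 2 * Real.pi * a / h = a * T by rw [hT]; ring, ← hr, mul_comm]
  congr 1
  rw [show Real.exp (a * T) = r⁻¹ by rw [hr, Real.exp_neg, inv_inv]]
  have : r⁻¹ - r ≠ 0 := by
    have : 1 < r⁻¹ := (one_lt_inv₀ hr0).2 hr1
    linarith
  have h1r : 1 - r ^ 2 ≠ 0 := by nlinarith
  field_simp

/-! ### Truncation error -/

/-- Tilting `ρ` by `e^{-ay}` gives a finite measure with the same null sets, whose characteristic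
function is `φ` on the line with imaginary part `a`. Conjugation gives the limit at `-∞`, and a
translation moves the point `x` to `0` at the cost of a unimodular factor. -/
theorem measure_singleton_of_tendsto_cf {ρ : Measure ℝ} [IsFiniteMeasure ρ] {a : ℝ}
    (hi : Integrable (fun y => Real.exp (-(a * y))) ρ)
    (h0 : Tendsto (fun u : ℝ => cf ρ ((u : ℂ) + Complex.I * a)) atTop (𝓝 0)) (x : ℝ) :
    ρ {x} = 0 := by
  set m : Measure ℝ := ρ.withDensity fun y => ENNReal.ofReal (Real.exp (-(a * y))) with hm
  have hfin : IsFiniteMeasure m := isFiniteMeasure_withDensity_ofReal hi.2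
  have hcf : ∀ u : ℝ, charFun m u = cf ρ ((u : ℂ) + Complex.I * a) := by
    intro u
    rw [charFun_apply_real, hm, integral_withDensity_eq_integral_toReal_smul
      (by fun_prop) (by simp), cf]
    congr 1
    funext y
    rw [ENNReal.toReal_ofReal (Real.exp_pos _).le, Complex.real_smul, Complex.ofReal_exp,
      ← Complex.exp_add]
    congr 1
    push_cast
    linear_combination (-(a : ℂ) * y) * Complex.I_sq
  have ht : Tendsto (charFun m) (cocompact ℝ) (𝓝 0) := by
    rw [cocompact_eq_atBot_atTop, tendsto_sup]
    constructor
    · have : (fun u : ℝ => charFun m u) = fun u => (starRingEnd ℂ) (cf ρ (((-u : ℝ) : ℂ)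
          + Complex.I * a)) := by
        funext u
        rw [hcf, ← cf_conj, neg_neg]
      change Tendsto (fun u : ℝ => charFun m u) atBot (𝓝 0)
      rw [this]
      have h1 := (Complex.continuous_conj.tendsto 0).comp (h0.comp tendsto_neg_atBot_atTop)
      simpa [Function.comp_def] using h1
    · exact h0.congr fun u => (hcf u).symm
  have ht' : Tendsto (charFun (m.map fun y => y + -x)) (cocompact ℝ) (𝓝 0) := by
    rw [tendsto_zero_iff_norm_tendsto_zero] at ht ⊢
    refine ht.congr fun u => ?_
    rw [charFun_map_add_const, norm_mul, Complex.norm_exp_ofReal_mul_I, mul_one]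
  have h1 := measure_singleton_zero_of_tendsto_charFun ht'
  rw [Measure.map_apply (by fun_prop) (measurableSet_singleton _)] at h1
  have h2 : m {x} = 0 := by
    convert h1 using 2
    ext y
    simp
  rw [hm, withDensity_apply _ (measurableSet_singleton _), lintegral_singleton] at h2
  rcases mul_eq_zero.1 h2 with h3 | h3
  · exact absurd (ENNReal.ofReal_eq_zero.1 h3) (not_le.2 (Real.exp_pos _))
  · exact h3

theorem cf_map_neg (ρ : Measure ℝ) (z : ℂ) : cf (ρ.map fun y => -y) z = cf ρ (-z) := by
  rw [cf, cf, integral_map (by fun_prop) (by fun_prop)]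
  congr 1
  funext y
  push_cast
  ring_nf

theorem cdf_map_neg {ρ : Measure ℝ} [IsProbabilityMeasure ρ] (hρ : ∀ x, ρ {x} = 0) (x : ℝ) :
    cdf (ρ.map fun y => -y) (-x) = 1 - cdf ρ x := by
  have : IsProbabilityMeasure (ρ.map fun y => -y) := Measure.isProbabilityMeasure_map (by fun_prop)
  rw [cdf_eq_real, cdf_eq_real, map_measureReal_apply (by fun_prop) measurableSet_Iic]
  have h1 : (fun y : ℝ => -y) ⁻¹' Set.Iic (-x) = Set.Ici x := by ext y; simp
  have h2 : ρ.real (Set.Ici x) = ρ.real (Set.Ioi x) := by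
    rw [← Set.Ioi_union_left, measureReal_union (by simp) (measurableSet_singleton x)]
    simp [Measure.real, hρ x]
  rw [h1, h2, ← Set.compl_Iic, probReal_compl_eq_one_sub measurableSet_Iic]

theorem fftCDF_eq (ρ : Measure ℝ) (a h : ℝ) (N : ℕ) (x : ℝ) :
    fftCDF ρ a h N x = (if 0 < a then 0 else 1) - h * Real.exp (a * x) / Real.pi *
      (∑ n ∈ Finset.range N, inversionTerm ρ a h x n).re := rfl

theorem inversionTerm_map_neg (ρ : Measure ℝ) (a h x : ℝ) (n : ℕ) :
    inversionTerm (ρ.map fun y => -y) (-a) h (-x) n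
      = -(starRingEnd ℂ) (inversionTerm ρ a h x n) := by
  rw [inversionTerm, inversionTerm, cf_map_neg]
  set u : ℝ := (n + 1 / 2) * h
  rw [show -((u : ℂ) + Complex.I * ((-a : ℝ) : ℂ)) = ((-u : ℝ) : ℂ) + Complex.I * a by
    push_cast; ring, cf_conj]
  simp only [map_mul, map_div₀, ← Complex.exp_conj, map_neg, map_sub, Complex.conj_I,
      Complex.conj_ofReal]
  rw [show Complex.I * (u : ℂ) - ((-a : ℝ) : ℂ) = -(-Complex.I * u - a) by push_cast; ring,
    div_neg, neg_mul]
  congr 4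
  push_cast
  ring

/-- Reflection exchanges `P` with `1 - P`, which the constant `1` present for `a < 0` compensates
exactly. So only positive shifts have to be analysed. -/
theorem cdfError_map_neg {ρ : Measure ℝ} [IsProbabilityMeasure ρ] (hρ : ∀ x, ρ {x} = 0)
    {a : ℝ} (ha : a < 0) (h : ℝ) (N : ℕ) (x : ℝ) :
    cdfError (ρ.map fun y => -y) (-a) h N (-x) = cdfError ρ a h N x := by
  rw [cdfError, cdfError, cdf_map_neg hρ, fftCDF_eq, fftCDF_eq, if_pos (by linarith),
    if_neg (by linarith)]
  simp_rw [inversionTerm_map_neg]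
  rw [Finset.sum_neg_distrib, ← map_sum, Complex.neg_re, Complex.conj_re, neg_mul_neg, ← abs_neg]
  congr 1
  ring

theorem discretisationBound_map_neg (ρ : Measure ℝ) (a h x : ℝ) :
    discretisationBound (ρ.map fun y => -y) (-a) h (-x) = discretisationBound ρ a h x := by
  rw [discretisationBound, discretisationBound, cf_map_neg, abs_neg,
    show 2 * -a * -x = 2 * a * x by ring,
    show -(2 * Complex.I * ((-a : ℝ) : ℂ)) = 2 * Complex.I * a by push_cast; ring]

/-- A sum over a midpoint grid is controlled by the integral. -/
theorem tsum_midpoint_le {f F F' : ℝ → ℝ} (hf0 : ∀ x, 0 < x → 0 ≤ f x)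
    (hf : AntitoneOn f (Set.Ioi 0)) (hF0 : ∀ x, 0 < x → 0 ≤ F x)
    (hF : ∀ x, 0 < x → HasDerivAt F (F' x) x) (hfF : ∀ x, 0 < x → f x ≤ -F' x)
    {h : ℝ} (hh : 0 < h) {N : ℕ} (hN : 1 ≤ N) :
    Summable (fun n : ℕ => h * f (((n + N : ℕ) + 1 / 2) * h)) ∧
      ∑' n : ℕ, h * f (((n + N : ℕ) + 1 / 2) * h) ≤ F (N * h / 2) := by
  -- `-F'` majorises `f`, so the mean value theorem plays the role of the comparison of a sum with
  -- an integral.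
  have hmvt : ∀ x y, 0 < x → x < y → (y - x) * f y ≤ F x - F y := by
    intro x y hx hxy
    obtain ⟨c, hc, hc'⟩ := exists_hasDerivAt_eq_slope F F' hxy
      (fun z hz => (hF z (hx.trans_le hz.1)).continuousAt.continuousWithinAt)
      (fun z hz => hF z (hx.trans hz.1))
    have h1 : f y ≤ f c := hf (hx.trans hc.1) (hx.trans hxy) hc.2.le
    have h2 := hfF c (hx.trans hc.1)
    rw [hc', ← neg_div, le_div_iff₀ (by linarith)] at h2
    nlinarith
  have hN' : (1 : ℝ) ≤ N := by exact_mod_cast hN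
  -- The first cell starts at `(N - 1/2) h`, which is at least `N h / 2` because `N ≥ 1`. The cruder
  -- point makes the bound a function of `N h` alone.
  have hanti : F ((N - 1 / 2) * h) ≤ F (N * h / 2) := by
    rcases eq_or_lt_of_le hN' with h1 | h1
    · rw [← h1]; apply le_of_eq; congr 1; ring
    · have := hmvt (N * h / 2) ((N - 1 / 2) * h) (by positivity) (by nlinarith)
      have h3 : 0 ≤ ((N - 1 / 2) * h - N * h / 2) * f ((N - 1 / 2) * h) :=
        mul_nonneg (by nlinarith) (hf0 _ (by nlinarith))
      linarith
  have hterm : ∀ n : ℕ, h * f (((n + N : ℕ) + 1 / 2) * h)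
      ≤ F ((n + N - 1 / 2 : ℝ) * h) - F (((n + 1 : ℕ) + N - 1 / 2 : ℝ) * h) := by
    intro n
    have hn : (0 : ℝ) ≤ n := n.cast_nonneg
    have := hmvt ((n + N - 1 / 2 : ℝ) * h) (((n + N : ℕ) + 1 / 2) * h) (by nlinarith)
      (by push_cast; nlinarith)
    push_cast at this ⊢
    rw [show ((n : ℝ) + 1 + N - 1 / 2) * h = (n + N + 1 / 2) * h by ring]
    rwa [show ((n : ℝ) + N + 1 / 2) * h - (n + N - 1 / 2) * h = h by ring] at this
  have h0 : ∀ n : ℕ, 0 ≤ h * f (((n + N : ℕ) + 1 / 2) * h) := fun n =>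
    mul_nonneg hh.le (hf0 _ (by positivity))
  have hpart : ∀ k : ℕ, ∑ n ∈ Finset.range k, h * f (((n + N : ℕ) + 1 / 2) * h)
      ≤ F (N * h / 2) := by
    intro k
    refine (Finset.sum_le_sum fun n _ => hterm n).trans ?_
    rw [Finset.sum_range_sub' (fun n : ℕ => F ((n + N - 1 / 2 : ℝ) * h))]
    have hk : (0 : ℝ) ≤ k := k.cast_nonneg
    have := hF0 ((k + N - 1 / 2 : ℝ) * h) (by nlinarith)
    simp only [Nat.cast_zero, zero_add]
    linarith
  exact ⟨summable_of_sum_range_le h0 hpart, Real.tsum_le_of_sum_range_le h0 hpart⟩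

/-- The part of the series beyond `N` is added to the discretisation error. The bound on `φ` is
written as `K u f(u)` because the denominator satisfies `|iu - a| ≥ u`, so that `f` bounds the
quotient. -/
theorem cdfError_le_of_pos {ρ : Measure ℝ} [IsProbabilityMeasure ρ] (hρ : ∀ x, ρ {x} = 0)
    {a : ℝ} (ha : 0 < a) (hi : Integrable (fun y => Real.exp (-(2 * a * y))) ρ)
    {f F F' : ℝ → ℝ} {K : ℝ} (hK : 0 ≤ K) (hf0 : ∀ x, 0 < x → 0 ≤ f x)
    (hf : AntitoneOn f (Set.Ioi 0)) (hF0 : ∀ x, 0 < x → 0 ≤ F x)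
    (hF : ∀ x, 0 < x → HasDerivAt F (F' x) x) (hfF : ∀ x, 0 < x → f x ≤ -F' x)
    (hφ : ∀ u : ℝ, 0 < u → ‖cf ρ ((u : ℂ) + Complex.I * a)‖ ≤ K * (u * f u))
    {x h : ℝ} {N : ℕ} (hh : 0 < h) (hN : 1 ≤ N) :
    cdfError ρ a h N x ≤ K * Real.exp (a * x) / Real.pi * F (N * h / 2)
      + discretisationBound ρ a h x := by
  obtain ⟨hsum, hle⟩ := tsum_midpoint_le hf0 hf hF0 hF hfF hh hN
  have hterm : ∀ n : ℕ, h * ‖inversionTerm ρ a h x n‖ ≤ K * (h * f ((n + 1 / 2) * h)) := by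
    intro n
    rw [norm_inversionTerm, norm_div]
    have hu : (0 : ℝ) < (n + 1 / 2) * h := by positivity
    set u : ℝ := (n + 1 / 2) * h
    have h1 : u ≤ ‖Complex.I * (u : ℂ) - a‖ := by
      have := Complex.abs_im_le_norm (Complex.I * (u : ℂ) - a)
      simp only [Complex.sub_im, Complex.mul_im, Complex.I_re, Complex.I_im, Complex.ofReal_im,
        Complex.ofReal_re, zero_mul, one_mul, zero_add, sub_zero] at this
      exact (le_abs_self u).trans this
    have h2 : ‖cf ρ ((u : ℂ) + Complex.I * a)‖ / ‖Complex.I * (u : ℂ) - a‖ ≤ K * f u := by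
      rw [div_le_iff₀ (hu.trans_le h1)]
      refine (hφ u hu).trans ?_
      rw [show K * (u * f u) = K * f u * u by ring]
      exact mul_le_mul_of_nonneg_left h1 (mul_nonneg hK (hf0 u hu))
    calc _ ≤ h * (K * f u) := by gcongr
      _ = _ := by ring
  have hsumN : Summable fun n : ℕ => h * ‖inversionTerm ρ a h x (n + N)‖ :=
    Summable.of_nonneg_of_le (fun n => by positivity) (fun n => hterm (n + N)) (hsum.mul_left K)
  have hs : Summable (inversionTerm ρ a h x) := by
    refine Summable.of_norm ?_
    have h1 := (summable_nat_add_iff (f := fun n => h * ‖inversionTerm ρ a h x n‖) N).1 hsumN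
    exact (summable_mul_left_iff hh.ne').1 h1
  have hmain := abs_cdf_add_tsum_le hρ ha hi hh x hs
  have hsplit := hs.sum_add_tsum_nat_add N
  have htail : h * ‖∑' n, inversionTerm ρ a h x (n + N)‖ ≤ K * F (N * h / 2) := by
    have hn : Summable fun n : ℕ => ‖inversionTerm ρ a h x (n + N)‖ :=
      (summable_mul_left_iff hh.ne').1 hsumN
    calc h * ‖∑' n, inversionTerm ρ a h x (n + N)‖
        ≤ h * ∑' n, ‖inversionTerm ρ a h x (n + N)‖ := by
          gcongr; exact norm_tsum_le_tsum_norm hn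
      _ = ∑' n, h * ‖inversionTerm ρ a h x (n + N)‖ := tsum_mul_left.symm
      _ ≤ ∑' n : ℕ, K * (h * f (((n + N : ℕ) + 1 / 2) * h)) :=
          hsumN.tsum_le_tsum (fun n => hterm (n + N)) (hsum.mul_left K)
      _ = K * ∑' n : ℕ, (h * f (((n + N : ℕ) + 1 / 2) * h)) := tsum_mul_left
      _ ≤ _ := by gcongr
  rw [cdfError, fftCDF_eq, if_pos ha]
  set S := ∑ n ∈ Finset.range N, inversionTerm ρ a h x n
  set R := ∑' n, inversionTerm ρ a h x (n + N)
  rw [← hsplit, Complex.add_re] at hmain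
  have hc : 0 ≤ Real.exp (a * x) / Real.pi := by positivity
  have hR : |h * Real.exp (a * x) / Real.pi * R.re|
      ≤ K * Real.exp (a * x) / Real.pi * F (N * h / 2) := by
    rw [show h * Real.exp (a * x) / Real.pi * R.re = Real.exp (a * x) / Real.pi * (h * R.re) by
      ring, abs_mul, abs_of_nonneg hc, abs_mul, abs_of_pos hh]
    calc _ ≤ Real.exp (a * x) / Real.pi * (K * F (N * h / 2)) := by
          refine mul_le_mul_of_nonneg_left (le_trans ?_ htail) hc
          gcongr
          exact Complex.abs_re_le_norm R
      _ = _ := by ring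
  have := abs_sub (cdf ρ x + h * Real.exp (a * x) / Real.pi * (S.re + R.re))
    (h * Real.exp (a * x) / Real.pi * R.re)
  calc _ = |cdf ρ x + h * Real.exp (a * x) / Real.pi * (S.re + R.re)
      - h * Real.exp (a * x) / Real.pi * R.re| := by congr 1; ring
    _ ≤ _ := by linarith

/-- The error of the inversion is the sum of a truncation error, controlled by an integral bound of
the characteristic function, and of the discretisation error. -/
theorem cdfError_le {ρ : Measure ℝ} [IsProbabilityMeasure ρ]
    {a : ℝ} (ha : a ≠ 0) (hi : Integrable (fun y => Real.exp (-(2 * a * y))) ρ)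
    {f F F' : ℝ → ℝ} {K : ℝ} (hK : 0 ≤ K) (hf0 : ∀ x, 0 < x → 0 ≤ f x)
    (hf : AntitoneOn f (Set.Ioi 0)) (hF0 : ∀ x, 0 < x → 0 ≤ F x)
    (hF : ∀ x, 0 < x → HasDerivAt F (F' x) x) (hfF : ∀ x, 0 < x → f x ≤ -F' x)
    (hlim : Tendsto (fun u => u * f u) atTop (𝓝 0))
    (hφ : ∀ u : ℝ, 0 < u → ‖cf ρ ((u : ℂ) + Complex.I * a)‖ ≤ K * (u * f u))
    {x h : ℝ} {N : ℕ} (hh : 0 < h) (hN : 1 ≤ N) :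
    cdfError ρ a h N x ≤ K * Real.exp (a * x) / Real.pi * F (N * h / 2)
      + discretisationBound ρ a h x := by
  -- The decay on the line already excludes atoms.
  have hρ : ∀ x, ρ {x} = 0 := by
    refine measure_singleton_of_tendsto_cf (integrable_exp_neg_of_two_mul hi) ?_
    refine squeeze_zero_norm' ((eventually_gt_atTop 0).mono hφ) ?_
    simpa using hlim.const_mul K
  rcases lt_or_gt_of_ne ha with ha' | ha'
  · have : IsProbabilityMeasure (ρ.map fun y => -y) :=
      Measure.isProbabilityMeasure_map (by fun_prop)
    rw [← cdfError_map_neg hρ ha', ← discretisationBound_map_neg, show a * x = -a * -x by ring]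
    refine cdfError_le_of_pos (fun x => ?_) (by linarith) ?_ hK hf0 hf hF0 hF hfF (fun u hu => ?_)
      hh hN
    · rw [Measure.map_apply (by fun_prop) (measurableSet_singleton _)]
      convert hρ (-x) using 2
      ext y
      simp
    · rw [integrable_map_measure (by fun_prop) (by fun_prop)]
      refine hi.congr (ae_of_all _ fun y => ?_)
      simp only [Function.comp]
      congr 1
      ring
    · rw [cf_map_neg, show -((u : ℂ) + Complex.I * ((-a : ℝ) : ℂ))
        = ((-u : ℝ) : ℂ) + Complex.I * a by push_cast; ring, cf_conj, RCLike.norm_conj]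
      exact hφ u hu
  · exact cdfError_le_of_pos hρ ha' hi hK hf0 hf hF0 hF hfF hφ hh hN

theorem cdfError_nonneg (ρ : Measure ℝ) (a h : ℝ) (N : ℕ) (x : ℝ) : 0 ≤ cdfError ρ a h N x :=
  abs_nonneg _

theorem discretisationBound_le (ρ : Measure ℝ) {a h : ℝ} (x : ℝ)
    (hq : 1 ≤ 2 * Real.pi * |a| / h) :
    discretisationBound ρ a h x ≤ 2 * (1 + Real.exp (2 * a * x)
      * ∫ y, Real.exp (-(2 * a * y)) ∂ρ) * Real.exp (-(2 * Real.pi * |a| / h)) := by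
  set q := 2 * Real.pi * |a| / h
  rw [discretisationBound, re_cf_two_I_mul]
  have hM : 0 ≤ ∫ y, Real.exp (-(2 * a * y)) ∂ρ := integral_nonneg fun y => (Real.exp_pos _).le
  have h1 : 1 / (Real.exp q - Real.exp (-q)) ≤ 2 * Real.exp (-q) := by
    have e1 : 2 ≤ Real.exp q := by linarith [Real.add_one_le_exp q]
    have e2 : Real.exp (-q) ≤ 1 := Real.exp_le_one_iff.2 (by linarith)
    have e3 : Real.exp q * Real.exp (-q) = 1 := by rw [← Real.exp_add]; simp
    rw [div_le_iff₀ (by linarith)]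
    nlinarith [Real.exp_pos (-q)]
  calc _ ≤ 2 * Real.exp (-q) * (1 + Real.exp (2 * a * x) * ∫ y, Real.exp (-(2 * a * y)) ∂ρ) := by
        gcongr
    _ = _ := by ring

theorem discretisationBound_const_nonneg (ρ : Measure ℝ) (a x : ℝ) :
    0 ≤ 2 * (1 + Real.exp (2 * a * x) * ∫ y, Real.exp (-(2 * a * y)) ∂ρ) := by
  have hM : 0 ≤ ∫ y, Real.exp (-(2 * a * y)) ∂ρ := integral_nonneg fun y => (Real.exp_pos _).le
  positivity

/-- The step solves `ℓ (n h)^ω = A / h`: with `A = 2π|a|` the truncation and the discretisation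
error then have the same exponential order. -/
theorem balanced_step {A ℓ n ω : ℝ} (hA : 0 < A) (hℓ : 0 < ℓ) (hn : 0 < n) (hω : 0 < ω) :
    let h := (A / (ℓ * n ^ ω)) ^ (1 / (ω + 1))
    0 < h ∧ A / h = ℓ ^ (1 / (ω + 1)) * A ^ (ω / (ω + 1)) * n ^ (ω / (ω + 1)) ∧
      ℓ * (n * h) ^ ω = A / h := by
  intro h
  have hnω : 0 < n ^ ω := Real.rpow_pos_of_pos hn _
  have hh : 0 < h := Real.rpow_pos_of_pos (by positivity) _
  have hω1 : ω + 1 ≠ 0 := by positivity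
  refine ⟨hh, ?_, ?_⟩
  · rw [div_eq_iff hh.ne']
    simp only [h]
    rw [Real.div_rpow hA.le (by positivity), Real.mul_rpow hℓ.le hnω.le, ← Real.rpow_mul hn.le,
      mul_one_div]
    have e : A ^ (ω / (ω + 1)) * A ^ (1 / (ω + 1)) = A := by
      rw [← Real.rpow_add hA, ← add_div, div_self hω1, Real.rpow_one]
    have p1 : 0 < ℓ ^ (1 / (ω + 1)) := Real.rpow_pos_of_pos hℓ _
    have p2 : 0 < n ^ (ω / (ω + 1)) := Real.rpow_pos_of_pos hn _
    field_simp
    exact e.symm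
  · have e : h ^ ω * h = A / (ℓ * n ^ ω) := by
      rw [← Real.rpow_add_one hh.ne']
      simp only [h]
      rw [← Real.rpow_mul (by positivity), one_div, inv_mul_cancel₀ hω1, Real.rpow_one]
    rw [Real.mul_rpow hn.le hh.le, eq_div_iff hh.ne']
    calc ℓ * (n ^ ω * h ^ ω) * h = ℓ * n ^ ω * (h ^ ω * h) := by ring
      _ = A := by rw [e]; field_simp

/-- An exponentially decaying characteristic function makes the error decay exponentially. -/
theorem exponentialErrorDecay_of_norm_cf_le {ρ : Measure ℝ} [IsProbabilityMeasure ρ] {S : Set ℝ}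
    {ω k : ℝ} (hω : 0 < ω) (hk : 0 < k)
    (H : ∀ a : ℝ, a ≠ 0 → 2 * a ∈ S → Integrable (fun y => Real.exp (-(2 * a * y))) ρ ∧
      ∃ K : ℝ, ∀ u : ℝ, 0 < u → ‖cf ρ ((u : ℂ) + Complex.I * a)‖ ≤ K * Real.exp (-(k * u ^ ω))) :
    ExponentialErrorDecay ρ S ω := by
  -- The factor `2^{-ω}` appears because the tail is evaluated at `N h / 2`. The constant `k`, hence
  -- `ℓ`, does not depend on `a`.
  set ℓ := k * (2⁻¹ : ℝ) ^ ω with hℓ'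
  have hℓ : 0 < ℓ := by positivity
  refine ⟨ℓ, hℓ, fun a ha haS => ?_⟩
  obtain ⟨hi, K, hK⟩ := H a ha haS
  have hbound : ∀ (x h : ℝ) (N : ℕ), 0 < h → 1 ≤ N → cdfError ρ a h N x ≤
        (|K| + 1) * Real.exp (a * x) / (Real.pi * ω) *
            (Real.exp (-(ℓ * (N * h) ^ ω)) / (ℓ * (N * h) ^ ω))
          + discretisationBound ρ a h x := by
    intro x h N hh hN
    have hN' : (0 : ℝ) < N := by exact_mod_cast hN
    -- `F` is the usual majorant of an incomplete Gamma function: `-F' = f (1 + 1/(k u^ω)) ≥ f`.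
    refine (cdfError_le (K := |K| + 1) (f := fun u => Real.exp (-(k * u ^ ω)) / u)
      (F := fun u => Real.exp (-(k * u ^ ω)) / (ω * (k * u ^ ω)))
      (F' := fun u => -(Real.exp (-(k * u ^ ω)) / u * (1 + 1 / (k * u ^ ω))))
      ha hi (by positivity) (fun x hx => by positivity) ?_ (fun x hx => by positivity) ?_ ?_ ?_ ?_
      hh hN).trans_eq ?_
    · intro x hx y hy hxy
      have hx : 0 < x := hx
      dsimp only
      gcongr
    · intro x hx
      have hxω : 0 < x ^ ω := Real.rpow_pos_of_pos hx _
      have h1 : HasDerivAt (fun u : ℝ => k * u ^ ω) (k * (ω * x ^ (ω - 1))) x :=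
        (Real.hasDerivAt_rpow_const (Or.inl hx.ne')).const_mul k
      have h2 := (h1.neg.exp).div (h1.const_mul ω) (by positivity)
      refine h2.congr_deriv ?_
      rw [Real.rpow_sub_one hx.ne']
      simp only [Pi.neg_apply]
      field_simp
      ring
    · intro x hx
      have hxω : 0 < x ^ ω := Real.rpow_pos_of_pos hx _
      rw [neg_neg]
      refine le_mul_of_one_le_right (by positivity) ?_
      have : 0 ≤ 1 / (k * x ^ ω) := by positivity
      linarith
    · have h1 : Tendsto (fun u : ℝ => Real.exp (-(k * u ^ ω))) atTop (𝓝 0) :=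
        Real.tendsto_exp_neg_atTop_nhds_zero.comp
          ((tendsto_rpow_atTop hω).const_mul_atTop hk)
      refine h1.congr' ?_
      filter_upwards [eventually_gt_atTop 0] with u hu
      field_simp
    · intro u hu
      refine (hK u hu).trans ?_
      rw [mul_div_cancel₀ _ hu.ne']
      gcongr
      linarith [le_abs_self K]
    · have e : k * (N * h / 2) ^ ω = ℓ * (N * h) ^ ω := by
        rw [hℓ', div_eq_mul_inv, Real.mul_rpow (by positivity) (by norm_num)]
        ring
      simp only [e]
      congr 1
      have : 0 < ((N : ℝ) * h) ^ ω := by positivity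
      field_simp
  refine ⟨hi, ⟨|K| + 1, by positivity, hbound⟩, fun x => ?_⟩
  have hA : 0 < 2 * Real.pi * |a| := by positivity
  set c := ℓ ^ (1 / (ω + 1)) * (2 * Real.pi * |a|) ^ (ω / (ω + 1))
  have hc : 0 < c := by positivity
  have hlim : Tendsto (fun N : ℕ => c * (N : ℝ) ^ (ω / (ω + 1))) atTop atTop :=
    ((tendsto_rpow_atTop (by positivity)).comp tendsto_natCast_atTop_atTop).const_mul_atTop hc
  refine IsBigO.of_bound ((|K| + 1) * Real.exp (a * x) / (Real.pi * ω)
    + 2 * (1 + Real.exp (2 * a * x) * ∫ y, Real.exp (-(2 * a * y)) ∂ρ)) ?_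
  filter_upwards [hlim.eventually_ge_atTop 1, eventually_ge_atTop 1] with N hq hN
  have hN' : (0 : ℝ) < N := by exact_mod_cast hN
  obtain ⟨hh, e1, e2⟩ := balanced_step hA hℓ hN' hω
  set h := (2 * Real.pi * |a| / (ℓ * (N : ℝ) ^ ω)) ^ (1 / (ω + 1))
  rw [Real.norm_of_nonneg (cdfError_nonneg _ _ _ _ _), Real.norm_of_nonneg (Real.exp_pos _).le]
  change 1 ≤ ℓ ^ (1 / (ω + 1)) * (2 * Real.pi * |a|) ^ (ω / (ω + 1)) * _ at hq
  change _ ≤ _ * Real.exp (-(ℓ ^ (1 / (ω + 1)) * (2 * Real.pi * |a|) ^ (ω / (ω + 1)) * _))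
  rw [← e1] at hq ⊢
  refine (hbound x h N hh hN).trans ?_
  rw [e2, add_mul (_ / (Real.pi * ω))]
  refine add_le_add ?_ (discretisationBound_le ρ x hq)
  gcongr
  exact div_le_self (Real.exp_pos _).le hq

/-- A characteristic function that decays as a power makes the error decay as that power. -/
theorem powerLawErrorDecay_of_norm_cf_le {ρ : Measure ℝ} [IsProbabilityMeasure ρ] {S : Set ℝ}
    {ω : ℝ} (hω : 0 < ω)
    (H : ∀ a : ℝ, a ≠ 0 → 2 * a ∈ S → Integrable (fun y => Real.exp (-(2 * a * y))) ρ ∧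
      ∃ K : ℝ, ∀ u : ℝ, 0 < u → ‖cf ρ ((u : ℂ) + Complex.I * a)‖ ≤ K * u ^ (-ω)) :
    PowerLawErrorDecay ρ S ω := by
  intro a ha haS
  obtain ⟨hi, K, hK⟩ := H a ha haS
  -- The factor `2^ω` again pays for the evaluation of the tail at `N h / 2`.
  set B := (|K| + 1) * (2⁻¹ : ℝ) ^ (-ω) with hB'
  have hB : 0 < B := by positivity
  have hbound : ∀ (x h : ℝ) (N : ℕ), 0 < h → 1 ≤ N → cdfError ρ a h N x ≤
        B * Real.exp (a * x) / (Real.pi * ω) * (N * h) ^ (-ω) + discretisationBound ρ a h x := by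
    intro x h N hh hN
    have hN' : (0 : ℝ) < N := by exact_mod_cast hN
    refine (cdfError_le (K := |K| + 1) (f := fun u => u ^ (-ω - 1))
      (F := fun u => u ^ (-ω) / ω) (F' := fun u => -(u ^ (-ω - 1)))
      ha hi (by positivity) (fun x hx => by positivity) ?_ (fun x hx => by positivity) ?_ ?_ ?_ ?_
      hh hN).trans_eq ?_
    · intro x hx y hy hxy
      exact Real.rpow_le_rpow_of_nonpos hx hxy (by linarith)
    · intro x hx
      refine ((Real.hasDerivAt_rpow_const (p := -ω) (Or.inl hx.ne')).div_const ω).congr_deriv ?_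
      field_simp
    · intro x hx
      rw [neg_neg]
    · refine (tendsto_rpow_neg_atTop hω).congr' ?_
      filter_upwards [eventually_gt_atTop 0] with u hu
      rw [Real.rpow_sub_one hu.ne']
      field_simp
    · intro u hu
      refine (hK u hu).trans ?_
      rw [Real.rpow_sub_one hu.ne', mul_div_cancel₀ _ hu.ne']
      gcongr
      linarith [le_abs_self K]
    · congr 1
      rw [hB', div_eq_mul_inv (N * h : ℝ), Real.mul_rpow (by positivity) (by norm_num)]
      field_simp
  refine ⟨hi, ⟨B, hB, hbound⟩, fun x ε hε => ?_, fun x => ?_⟩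
  · set D := 2 * (1 + Real.exp (2 * a * x) * ∫ y, Real.exp (-(2 * a * y)) ∂ρ) with hD
    have hD0 : 0 ≤ D := discretisationBound_const_nonneg ρ a x
    have hlim : Tendsto (fun q : ℝ => D * Real.exp (-q)) atTop (𝓝 0) := by
      simpa using Real.tendsto_exp_neg_atTop_nhds_zero.const_mul D
    -- `q` stands for `2π|a| / h`: it is taken so large that the discretisation bound `D e^{-q}`
    -- falls below `ε`.
    obtain ⟨q, hq1, hq2⟩ := ((eventually_ge_atTop 1).and
      (hlim.eventually_le_const hε)).exists
    have hA : 0 < 2 * Real.pi * |a| := by positivity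
    have hq0 : 0 < q := by linarith
    have e : 2 * Real.pi * |a| / (2 * Real.pi * |a| / q) = q := by field_simp
    refine ⟨2 * Real.pi * |a| / q, by positivity, B * Real.exp (a * x) / (Real.pi * ω)
      * (2 * Real.pi * |a| / q) ^ (-ω), fun N hN => ?_⟩
    refine (hbound x _ N (by positivity) hN).trans (add_le_add ?_ ?_)
    · rw [Real.mul_rpow (by positivity) (by positivity)]
      apply le_of_eq
      ring
    · refine (discretisationBound_le ρ x (by rw [e]; exact hq1)).trans ?_
      rw [e]
      exact hq2
  · have hlim : Tendsto (fun N : ℕ => Real.log (N : ℝ)) atTop atTop :=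
      Real.tendsto_log_atTop.comp tendsto_natCast_atTop_atTop
    have hA : 0 < 2 * Real.pi * |a| := by positivity
    refine IsBigO.of_bound (B * Real.exp (a * x) / (Real.pi * ω)
      * (2 * Real.pi * |a| / ω) ^ (-ω)
      + 2 * (1 + Real.exp (2 * a * x) * ∫ y, Real.exp (-(2 * a * y)) ∂ρ)) ?_
    filter_upwards [hlim.eventually_ge_atTop 1, (hlim.const_mul_atTop hω).eventually_ge_atTop 1,
      eventually_ge_atTop 1] with N hlog hq hN
    have hN' : (0 : ℝ) < N := by exact_mod_cast hN
    have hl0 : 0 < Real.log N := by linarith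
    have e : 2 * Real.pi * |a| / (2 * Real.pi * |a| / (ω * Real.log N)) = ω * Real.log N := by
      field_simp
    have hp : 0 < (Real.log N / N) ^ ω := by positivity
    rw [Real.norm_of_nonneg (cdfError_nonneg _ _ _ _ _), Real.norm_of_nonneg hp.le]
    refine (hbound x _ N (by positivity) hN).trans ?_
    have e3 : ((N : ℝ) * (2 * Real.pi * |a| / (ω * Real.log N))) ^ (-ω)
        = (2 * Real.pi * |a| / ω) ^ (-ω) * (Real.log N / N) ^ ω := by
      rw [show (N : ℝ) * (2 * Real.pi * |a| / (ω * Real.log N))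
        = 2 * Real.pi * |a| / ω * (Real.log N / N)⁻¹ by field_simp,
        Real.mul_rpow (by positivity) (by positivity), Real.inv_rpow (by positivity),
        Real.rpow_neg (x := Real.log N / N) (by positivity), inv_inv]
    rw [add_mul (_ * _ ^ (-ω)), e3]
    refine add_le_add (le_of_eq (by ring)) ?_
    refine (discretisationBound_le ρ x (by rw [e]; exact hq)).trans ?_
    rw [e]
    refine mul_le_mul_of_nonneg_left ?_ (discretisationBound_const_nonneg ρ a x)
    -- With the logarithmic step the discretisation error is of order `N^{-ω}`, which `log N ≥ 1`
    -- places below `(log N / N)^ω`.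
    rw [show -(ω * Real.log N) = Real.log N * -ω by ring, ← Real.rpow_def_of_pos hN',
      Real.rpow_neg hN'.le, ← Real.inv_rpow hN'.le]
    gcongr
    rw [inv_eq_one_div]
    gcongr

/-! ### Compound Poisson laws -/

/-- Convolution powers of a measure. -/
def convPow (m : Measure ℝ) : ℕ → Measure ℝ
  | 0 => Measure.dirac 0
  | k + 1 => convPow m k ∗ m

instance isFiniteMeasure_convPow (m : Measure ℝ) [IsFiniteMeasure m] (k : ℕ) :
    IsFiniteMeasure (convPow m k) := by
  induction k with
  | zero => rw [convPow]; infer_instance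
  | succ k ih => rw [convPow]; infer_instance

/-- The unnormalised law `∑_{k ≥ 1} m^{*k} / k!` of a compound Poisson sum with at least one
jump. -/
def jumpSeries (m : Measure ℝ) : Measure ℝ :=
  Measure.sum fun k : ℕ => ENNReal.ofReal ((Nat.factorial (k + 1) : ℝ)⁻¹) • convPow m (k + 1)

theorem exp_I_mul_add (z : ℂ) (x y : ℝ) : Complex.exp (Complex.I * z * ((x + y : ℝ) : ℂ))
    = Complex.exp (Complex.I * z * x) * Complex.exp (Complex.I * z * y) := by
  rw [← Complex.exp_add]
  congr 1
  push_cast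
  ring

theorem norm_exp_I_mul (z : ℂ) (x : ℝ) :
    ‖Complex.exp (Complex.I * z * (x : ℂ))‖ = Real.exp (-(z.im * x)) := by
  rw [Complex.norm_exp]
  simp

theorem integrable_conv {μ ν : Measure ℝ} [SFinite μ] [SFinite ν] {z : ℂ}
    (hμ : Integrable (fun x : ℝ => Complex.exp (Complex.I * z * x)) μ)
    (hν : Integrable (fun x : ℝ => Complex.exp (Complex.I * z * x)) ν) :
    Integrable (fun x : ℝ => Complex.exp (Complex.I * z * x)) (μ ∗ ν) ∧
      cf (μ ∗ ν) z = cf μ z * cf ν z := by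
  have h := hμ.mul_prod hν
  rw [Measure.conv, cf, cf, cf, integrable_map_measure (by fun_prop) (by fun_prop),
    integral_map (by fun_prop) (by fun_prop)]
  simp_rw [exp_I_mul_add]
  refine ⟨h.congr (ae_of_all _ fun p => ?_), integral_prod_mul
    (fun x : ℝ => Complex.exp (Complex.I * z * x)) (fun x : ℝ => Complex.exp (Complex.I * z * x))⟩
  simp only [Function.comp, exp_I_mul_add]

theorem integrable_convPow {m : Measure ℝ} [IsFiniteMeasure m] {z : ℂ}
    (hm : Integrable (fun x : ℝ => Complex.exp (Complex.I * z * x)) m) (k : ℕ) :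
    Integrable (fun x : ℝ => Complex.exp (Complex.I * z * x)) (convPow m k) ∧
      cf (convPow m k) z = cf m z ^ k := by
  induction k with
  | zero =>
    rw [convPow]
    refine ⟨integrable_dirac (by simp), ?_⟩
    rw [cf, integral_dirac]
    simp
  | succ k ih =>
    rw [convPow, pow_succ, ← ih.2]
    exact integrable_conv ih.1 hm

theorem cf_I_mul_im (m : Measure ℝ) (a : ℝ) :
    cf m (Complex.I * a) = ((∫ x, Real.exp (-(a * x)) ∂m : ℝ) : ℂ) := by
  rw [cf, ← integral_complex_ofReal]
  congr 1
  funext x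
  push_cast
  congr 1
  linear_combination ((a : ℂ) * x) * Complex.I_sq

theorem integrable_exp_I_mul_iff {m : Measure ℝ} {z : ℂ} :
    Integrable (fun x : ℝ => Complex.exp (Complex.I * z * x)) m ↔
      Integrable (fun x : ℝ => Real.exp (-(z.im * x))) m := by
  rw [← integrable_norm_iff (by fun_prop)]
  simp_rw [norm_exp_I_mul]

/-- The exponential moment of the `k`-th convolution power is the `k`-th power of that of `m`, so
the series of moments is part of an exponential series. -/
theorem integrable_jumpSeries {m : Measure ℝ} [IsFiniteMeasure m] {z : ℂ}
    (hm : Integrable (fun x : ℝ => Complex.exp (Complex.I * z * x)) m) :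
    Integrable (fun x : ℝ => Complex.exp (Complex.I * z * x)) (jumpSeries m) := by
  set a := z.im with ha
  set A := ∫ x, Real.exp (-(a * x)) ∂m with hA
  have hA0 : 0 ≤ A := integral_nonneg fun x => (Real.exp_pos _).le
  have hm' : Integrable (fun x : ℝ => Real.exp (-(a * x))) m := integrable_exp_I_mul_iff.1 hm
  have hz : Integrable (fun x : ℝ => Complex.exp (Complex.I * (Complex.I * a) * x)) m := by
    rw [integrable_exp_I_mul_iff]
    simpa using hm'
  have hk : ∀ k, ∫⁻ x, ENNReal.ofReal (Real.exp (-(a * x))) ∂convPow m k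
      = ENNReal.ofReal (A ^ k) := by
    intro k
    obtain ⟨h1, h2⟩ := integrable_convPow hz k
    rw [integrable_exp_I_mul_iff] at h1
    rw [← ofReal_integral_eq_lintegral_ofReal (by simpa using h1)
      (ae_of_all _ fun x => (Real.exp_pos _).le)]
    congr 1
    rw [cf_I_mul_im, cf_I_mul_im] at h2
    exact_mod_cast h2
  refine ⟨by fun_prop, ?_⟩
  rw [hasFiniteIntegral_iff_norm]
  simp_rw [norm_exp_I_mul]
  rw [jumpSeries, lintegral_sum_measure]
  simp_rw [lintegral_smul_measure, ← ha, hk, smul_eq_mul]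
  have hs : Summable fun k : ℕ => (Nat.factorial (k + 1) : ℝ)⁻¹ * A ^ (k + 1) := by
    have := (summable_nat_add_iff 1).2 (Real.summable_pow_div_factorial A)
    refine this.congr fun k => ?_
    rw [div_eq_inv_mul]
  have : ∀ k : ℕ, ENNReal.ofReal ((Nat.factorial (k + 1) : ℝ)⁻¹) * ENNReal.ofReal (A ^ (k + 1))
      = ENNReal.ofReal ((Nat.factorial (k + 1) : ℝ)⁻¹ * A ^ (k + 1)) := by
    intro k
    rw [ENNReal.ofReal_mul (by positivity)]
  simp_rw [this]
  rw [← ENNReal.ofReal_tsum_of_nonneg (fun k => by positivity) hs]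
  exact ENNReal.ofReal_lt_top

theorem cf_jumpSeries {m : Measure ℝ} [IsFiniteMeasure m] {z : ℂ}
    (hm : Integrable (fun x : ℝ => Complex.exp (Complex.I * z * x)) m) :
    cf (jumpSeries m) z = Complex.exp (cf m z) - 1 := by
  have h1 := integrable_jumpSeries hm
  have h2 := hasSum_integral_measure h1
  have h3 : ∀ k : ℕ, ∫ x, Complex.exp (Complex.I * z * x)
      ∂(ENNReal.ofReal ((Nat.factorial (k + 1) : ℝ)⁻¹) • convPow m (k + 1))
      = cf m z ^ (k + 1) / (Nat.factorial (k + 1) : ℂ) := by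
    intro k
    rw [integral_smul_measure, ENNReal.toReal_ofReal (by positivity), ← cf,
      (integrable_convPow hm (k + 1)).2, Complex.real_smul, div_eq_inv_mul]
    push_cast
    rfl
  simp_rw [h3] at h2
  have h4 := NormedSpace.expSeries_div_hasSum_exp (cf m z)
  rw [← Complex.exp_eq_exp_ℂ] at h4
  have h5 := (hasSum_nat_add_iff' 1).2 h4
  simp only [Finset.range_one, Finset.sum_singleton, pow_zero, Nat.factorial_zero, Nat.cast_one,
    div_one] at h5
  exact h2.unique h5

theorem cf_zero (m : Measure ℝ) : cf m 0 = m.real Set.univ := by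
  simp [cf]

theorem charFun_eq_cf (m : Measure ℝ) (u : ℝ) : charFun m u = cf m u := by
  rw [charFun_apply_real, cf]
  congr 1
  funext x
  ring_nf

theorem integrable_exp_I_mul_ofReal (m : Measure ℝ) [IsFiniteMeasure m] (u : ℝ) :
    Integrable (fun x : ℝ => Complex.exp (Complex.I * (u : ℂ) * x)) m := by
  rw [integrable_exp_I_mul_iff]
  simp

instance isFiniteMeasure_jumpSeries (m : Measure ℝ) [IsFiniteMeasure m] :
    IsFiniteMeasure (jumpSeries m) := by
  have := integrable_jumpSeries (integrable_exp_I_mul_ofReal m 0)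
  rw [integrable_exp_I_mul_iff] at this
  simp only [Complex.ofReal_zero, Complex.zero_im, zero_mul, neg_zero, Real.exp_zero] at this
  exact (integrable_const_iff_isFiniteMeasure one_ne_zero).1 this

theorem real_univ_jumpSeries (m : Measure ℝ) [IsFiniteMeasure m] :
    (jumpSeries m).real Set.univ = Real.exp (m.real Set.univ) - 1 := by
  have := cf_jumpSeries (integrable_exp_I_mul_ofReal m 0)
  rw [Complex.ofReal_zero, cf_zero, cf_zero] at this
  exact_mod_cast this

theorem charFun_jumpSeries (m : Measure ℝ) [IsFiniteMeasure m] (u : ℝ) :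
    charFun (jumpSeries m) u = Complex.exp (charFun m u) - 1 := by
  rw [charFun_eq_cf, charFun_eq_cf, cf_jumpSeries (integrable_exp_I_mul_ofReal m u)]

/-- The law of a compound Poisson sum with jump measure `m`, shifted by `γ`. -/
def compoundPoisson (m : Measure ℝ) (γ : ℝ) : Measure ℝ :=
  ENNReal.ofReal (Real.exp (-m.real Set.univ)) •
    (Measure.dirac 0 + jumpSeries m).map fun x => γ + x

theorem integrable_compoundPoisson {m : Measure ℝ} [IsFiniteMeasure m] (γ : ℝ) {z : ℂ}
    (hm : Integrable (fun x : ℝ => Complex.exp (Complex.I * z * x)) m) :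
    Integrable (fun x : ℝ => Complex.exp (Complex.I * z * x)) (compoundPoisson m γ) ∧
      cf (compoundPoisson m γ) z
        = Complex.exp (Complex.I * z * γ + (cf m z - m.real Set.univ)) := by
  have h1 := integrable_jumpSeries hm
  have h0 : Integrable (fun x : ℝ => Complex.exp (Complex.I * z * x)) (Measure.dirac (0 : ℝ)) :=
    integrable_dirac (by simp)
  have h2 := (h0.add_measure h1).const_mul (Complex.exp (Complex.I * z * γ))
  constructor
  · rw [compoundPoisson]
    refine Integrable.smul_measure ?_ ENNReal.ofReal_ne_top
    rw [integrable_map_measure (by fun_prop) (by fun_prop)]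
    refine h2.congr (ae_of_all _ fun x => ?_)
    simp only [Function.comp, exp_I_mul_add]
  · rw [compoundPoisson, cf, integral_smul_measure, integral_map (by fun_prop) (by fun_prop)]
    simp_rw [exp_I_mul_add]
    rw [integral_const_mul, integral_add_measure h0 h1, integral_dirac, ← cf, cf_jumpSeries hm,
      ENNReal.toReal_ofReal (Real.exp_pos _).le, Complex.real_smul, Complex.exp_add,
      Complex.exp_sub, Real.exp_neg]
    push_cast
    simp only [mul_zero, Complex.exp_zero]
    rw [div_eq_mul_inv]
    ring

instance isFiniteMeasure_compoundPoisson (m : Measure ℝ) [IsFiniteMeasure m] (γ : ℝ) :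
    IsFiniteMeasure (compoundPoisson m γ) := by
  rw [compoundPoisson]
  exact Measure.smul_finite _ ENNReal.ofReal_ne_top

instance isProbabilityMeasure_compoundPoisson (m : Measure ℝ) [IsFiniteMeasure m] (γ : ℝ) :
    IsProbabilityMeasure (compoundPoisson m γ) := by
  have := (integrable_compoundPoisson γ (integrable_exp_I_mul_ofReal m 0)).2
  rw [Complex.ofReal_zero, cf_zero, cf_zero] at this
  simp only [mul_zero, zero_mul, sub_self, add_zero, Complex.exp_zero] at this
  have h1 : (compoundPoisson m γ).real Set.univ = 1 := by exact_mod_cast this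
  refine ⟨?_⟩
  rw [Measure.real, ENNReal.toReal_eq_one_iff] at h1
  exact h1

/-! ### Exponential moments and tilting of infinitely divisible laws -/

/-- Taylor's formula for the exponential, with integral remainder. -/
theorem integral_exp_remainder (k : ℂ) :
    ∫ τ in (0 : ℝ)..1, (1 - (τ : ℂ)) * (k ^ 2 * Complex.exp (τ * k)) = Complex.exp k - 1 - k := by
  have hd : ∀ τ : ℝ, HasDerivAt (fun τ : ℝ => (1 - (τ : ℂ)) * (k * Complex.exp (τ * k))
      + Complex.exp (τ * k)) ((1 - (τ : ℂ)) * (k ^ 2 * Complex.exp (τ * k))) τ := by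
    intro τ
    have h0 : HasDerivAt (fun τ : ℝ => (τ : ℂ)) 1 τ := Complex.ofRealCLM.hasDerivAt
    have h1 : HasDerivAt (fun τ : ℝ => Complex.exp (τ * k)) (Complex.exp (τ * k) * (1 * k)) τ :=
      (h0.mul_const k).cexp
    refine (((h0.const_sub 1).mul (h1.const_mul k)).add h1).congr_deriv ?_
    ring
  rw [intervalIntegral.integral_eq_sub_of_hasDerivAt (fun τ _ => hd τ)
    (Continuous.intervalIntegrable (by fun_prop) _ _)]
  simp
  ring

theorem norm_exp_sub_one_sub_le (k : ℂ) :
    ‖Complex.exp k - 1 - k‖ ≤ ‖k‖ ^ 2 * (1 + Real.exp k.re) := by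
  rw [← integral_exp_remainder]
  refine (intervalIntegral.norm_integral_le_of_norm_le_const (C := ‖k‖ ^ 2 * (1 + Real.exp k.re))
    fun τ hτ => ?_).trans_eq (by simp)
  rw [Set.uIoc_of_le zero_le_one] at hτ
  have h1 : ‖(1 : ℂ) - τ‖ ≤ 1 := by
    rw [← Complex.ofReal_one, ← Complex.ofReal_sub, Complex.norm_real, Real.norm_eq_abs, abs_le]
    constructor <;> linarith [hτ.1, hτ.2]
  have h2 : Real.exp (τ * k.re) ≤ 1 + Real.exp k.re := by
    rcases le_total 0 k.re with h | h
    · have : Real.exp (τ * k.re) ≤ Real.exp k.re := Real.exp_le_exp.2 (by nlinarith [hτ.2])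
      linarith
    · have : Real.exp (τ * k.re) ≤ 1 := Real.exp_le_one_iff.2 (by nlinarith [hτ.1])
      linarith [Real.exp_pos k.re]
  rw [norm_mul, norm_mul, norm_pow, Complex.norm_exp, Complex.re_ofReal_mul]
  calc _ ≤ 1 * (‖k‖ ^ 2 * (1 + Real.exp k.re)) := by gcongr
    _ = _ := one_mul _

/-- Even if `ν` is infinite near zero, the centred integrand needs only the moments `x²` and `x²
e^{-x Im z}`. This is why the exponential moments of `ν` are always stated with the factor `x²`. -/
theorem norm_centered_le (z : ℂ) (x : ℝ) :
    ‖Complex.exp (Complex.I * z * x) - 1 - Complex.I * z * x‖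
      ≤ ‖z‖ ^ 2 * (x ^ 2 + x ^ 2 * Real.exp (-(z.im * x))) := by
  refine (norm_exp_sub_one_sub_le _).trans_eq ?_
  have : (Complex.I * z * (x : ℂ)).re = -(z.im * x) := by simp
  rw [this, norm_mul, norm_mul, Complex.norm_I, Complex.norm_real, one_mul, mul_pow,
    Real.norm_eq_abs, sq_abs]
  ring

theorem integrable_centered {ν : Measure ℝ} {z : ℂ} (h2 : Integrable (fun x => x ^ 2) ν)
    (hc : Integrable (fun x => x ^ 2 * Real.exp (-(z.im * x))) ν) :
    Integrable (fun x : ℝ => Complex.exp (Complex.I * z * x) - 1 - Complex.I * z * x) ν :=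
  ((h2.add hc).const_mul (‖z‖ ^ 2)).mono' (by fun_prop)
    (ae_of_all _ fun x => norm_centered_le z x)

theorem integrable_centered_ofReal {ν : Measure ℝ} (h2 : Integrable (fun x => x ^ 2) ν) (u : ℝ) :
    Integrable (fun x : ℝ => Complex.exp (Complex.I * u * x) - 1 - Complex.I * u * x) ν :=
  integrable_centered h2 (by simpa using h2)

/-- `ψ` is the exponent with Lévy measure `ν`, no Gaussian part and mean `γ`. -/
def IsCenteredExponent (ν : Measure ℝ) (γ : ℝ) (ψ : ℝ → ℂ) : Prop :=
  ∀ u : ℝ, ψ u = Complex.I * u * γ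
    + ∫ x : ℝ, (Complex.exp (Complex.I * u * x) - 1 - Complex.I * u * x) ∂ν

/-- The jumps of size at least `1 / (n + 1)`. -/
def largeJumps (n : ℕ) : Set ℝ := {x | 1 / ((n : ℝ) + 1) ≤ |x|}

theorem measurableSet_largeJumps (n : ℕ) : MeasurableSet (largeJumps n) :=
  measurableSet_le measurable_const (by fun_prop)

theorem monotone_largeJumps : Monotone largeJumps := by
  intro m n hmn x hx
  simp only [largeJumps, Set.mem_ofPred_eq] at hx ⊢
  refine le_trans ?_ hx
  gcongr

theorem iUnion_largeJumps : ⋃ n, largeJumps n = {0}ᶜ := by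
  ext x
  simp only [largeJumps, Set.mem_iUnion, Set.mem_ofPred_eq, Set.mem_compl_iff,
    Set.mem_singleton_iff]
  constructor
  · rintro ⟨n, hn⟩ rfl
    have : (0 : ℝ) < 1 / ((n : ℝ) + 1) := by positivity
    simp at hn
    linarith [show (0 : ℝ) < (n : ℝ) + 1 by positivity]
  · intro hx
    obtain ⟨n, hn⟩ := exists_nat_one_div_lt (abs_pos.2 hx)
    exact ⟨n, hn.le⟩

theorem tendsto_setIntegral_largeJumps {E : Type*} [NormedAddCommGroup E] [NormedSpace ℝ E]
    {ν : Measure ℝ} {g : ℝ → E} (hg : Integrable g ν) (h0 : g 0 = 0) :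
    Tendsto (fun n => ∫ x in largeJumps n, g x ∂ν) atTop (𝓝 (∫ x, g x ∂ν)) := by
  have := tendsto_setIntegral_of_monotone measurableSet_largeJumps monotone_largeJumps
    (f := g) (μ := ν) hg.integrableOn
  rwa [iUnion_largeJumps, setIntegral_eq_integral_of_forall_compl_eq_zero] at this
  intro x hx
  simp only [Set.mem_compl_iff, Set.mem_singleton_iff, not_not] at hx
  rw [hx, h0]

theorem integrableOn_largeJumps {ν : Measure ℝ} {g : ℝ → ℝ} (hgm : AEStronglyMeasurable g ν)
    (hg : Integrable (fun x => x ^ 2 * g x) ν) (n : ℕ) : IntegrableOn g (largeJumps n) ν := by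
  refine ((hg.norm.integrableOn (s := largeJumps n)).const_mul (((n : ℝ) + 1) ^ 2)).mono'
    hgm.restrict ?_
  filter_upwards [ae_restrict_mem (measurableSet_largeJumps n)] with x hx
  simp only [largeJumps, Set.mem_ofPred_eq] at hx
  have hn : (0 : ℝ) < (n : ℝ) + 1 := by positivity
  have h1 : 1 ≤ ((n : ℝ) + 1) * |x| := by
    rw [div_le_iff₀ hn] at hx
    linarith
  have h2 : 1 ≤ ((n : ℝ) + 1) ^ 2 * x ^ 2 := by
    rw [← sq_abs x, ← mul_pow]
    exact one_le_pow₀ h1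
  rw [norm_mul, norm_pow, Real.norm_eq_abs x, sq_abs, ← mul_assoc]
  exact le_mul_of_one_le_left (norm_nonneg _) h2

theorem isFiniteMeasure_largeJumps {ν : Measure ℝ} (h2 : Integrable (fun x => x ^ 2) ν) (n : ℕ) :
    IsFiniteMeasure (ν.restrict (largeJumps n)) := by
  have := integrableOn_largeJumps (ν := ν) (g := fun _ => (1 : ℝ)) (by fun_prop) (by simpa using h2) n
  exact (integrable_const_iff_isFiniteMeasure one_ne_zero).1 this

/-- The compound Poisson law that keeps only the jumps of size at least `1 / (n + 1)`. -/
def truncatedLaw (ν : Measure ℝ) (γ : ℝ) (n : ℕ) : Measure ℝ :=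
  compoundPoisson (ν.restrict (largeJumps n)) (γ - ∫ x in largeJumps n, x ∂ν)

theorem isProbabilityMeasure_truncatedLaw {ν : Measure ℝ} (h2 : Integrable (fun x => x ^ 2) ν)
    (γ : ℝ) (n : ℕ) : IsProbabilityMeasure (truncatedLaw ν γ n) := by
  have := isFiniteMeasure_largeJumps h2 n
  rw [truncatedLaw]
  infer_instance

theorem cf_truncatedLaw {ν : Measure ℝ} (h2 : Integrable (fun x => x ^ 2) ν) (γ : ℝ) (n : ℕ)
    {z : ℂ} (hz : Integrable (fun x => x ^ 2 * Real.exp (-(z.im * x))) ν) :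
    Integrable (fun x : ℝ => Complex.exp (Complex.I * z * x)) (truncatedLaw ν γ n) ∧
      cf (truncatedLaw ν γ n) z = Complex.exp (Complex.I * z * γ + ∫ x in largeJumps n,
        (Complex.exp (Complex.I * z * x) - 1 - Complex.I * z * x) ∂ν) := by
  have := isFiniteMeasure_largeJumps h2 n
  have hi : Integrable (fun x : ℝ => Complex.exp (Complex.I * z * x))
      (ν.restrict (largeJumps n)) :=
    integrable_exp_I_mul_iff.2 (integrableOn_largeJumps (by fun_prop) hz n)
  have hx : Integrable (fun x : ℝ => x) (ν.restrict (largeJumps n)) := by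
    have h1 : Integrable (fun x : ℝ => x ^ 2) (ν.restrict (largeJumps n)) := h2.restrict
    refine ((integrable_const (1 : ℝ)).add h1).mono' (by fun_prop) (ae_of_all _ fun x => ?_)
    simp only [Pi.add_apply, Real.norm_eq_abs]
    nlinarith [sq_nonneg (|x| - 1), sq_abs x, abs_nonneg x]
  obtain ⟨h3, h4⟩ := integrable_compoundPoisson (γ - ∫ x in largeJumps n, x ∂ν) hi
  refine ⟨h3, ?_⟩
  rw [truncatedLaw, h4]
  congr 1
  have hx' : Integrable (fun x : ℝ => Complex.I * z * (x : ℂ)) (ν.restrict (largeJumps n)) :=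
    hx.ofReal.const_mul _
  have h1' : Integrable (fun x : ℝ => Complex.exp (Complex.I * z * x) - 1)
      (ν.restrict (largeJumps n)) := hi.sub (integrable_const _)
  rw [integral_sub h1' hx', integral_sub hi (integrable_const _), integral_const_mul,
    integral_complex_ofReal, cf, integral_const, Complex.real_smul]
  push_cast
  ring

/-- Lévy's continuity theorem: the retained sets of jumps exhaust the complement of `0`, and the
centred integrand vanishes at `0`, so the exponents converge. -/
theorem tendsto_truncatedLaw {ρ ν : Measure ℝ} [IsProbabilityMeasure ρ] {γ : ℝ}
    (h2 : Integrable (fun x => x ^ 2) ν) {ψ : ℝ → ℂ} (hψ : IsCenteredExponent ν γ ψ)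
    (hρ : ∀ u, charFun ρ u = Complex.exp (ψ u)) :
    Tendsto (β := ProbabilityMeasure ℝ)
      (fun n => ⟨truncatedLaw ν γ n, isProbabilityMeasure_truncatedLaw h2 γ n⟩) atTop
      (@nhds (ProbabilityMeasure ℝ) _ ⟨ρ, inferInstance⟩) := by
  refine ProbabilityMeasure.tendsto_of_tendsto_charFun fun u => ?_
  simp only [ProbabilityMeasure.coe_mk]
  rw [hρ, hψ]
  have : ∀ n, charFun (truncatedLaw ν γ n) u = Complex.exp (Complex.I * u * γ
      + ∫ x in largeJumps n, (Complex.exp (Complex.I * u * x) - 1 - Complex.I * u * x) ∂ν) := by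
    intro n
    rw [charFun_eq_cf, (cf_truncatedLaw h2 γ n (z := u) (by simpa using h2)).2]
  simp_rw [this]
  refine (Complex.continuous_exp.tendsto _).comp (Tendsto.const_add _ ?_)
  exact tendsto_setIntegral_largeJumps (integrable_centered_ofReal h2 u) (by simp)

theorem exp_sub_one_sub_nonneg (c x : ℝ) : 0 ≤ Real.exp (-(c * x)) - 1 + c * x := by
  linarith [Real.add_one_le_exp (-(c * x))]

theorem integrable_exp_sub_one_sub {ν : Measure ℝ} {c : ℝ} (h2 : Integrable (fun x => x ^ 2) ν)
    (hc : Integrable (fun x => x ^ 2 * Real.exp (-(c * x))) ν) :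
    Integrable (fun x => Real.exp (-(c * x)) - 1 + c * x) ν := by
  have := integrable_centered (z := Complex.I * c) h2 (by simpa using hc)
  refine this.re.congr (ae_of_all _ fun x => ?_)
  simp only [RCLike.re_to_complex, Complex.sub_re]
  rw [show Complex.I * (Complex.I * (c : ℂ)) * (x : ℂ) = ((-(c * x) : ℝ) : ℂ) by
    push_cast; linear_combination ((c : ℂ) * x) * Complex.I_sq, ← Complex.ofReal_exp,
    Complex.ofReal_re, Complex.ofReal_re, Complex.one_re]
  ring

/-- Bound for the exponential moment of an infinitely divisible law. -/
def expMomentBound (ν : Measure ℝ) (γ c : ℝ) : ℝ :=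
  Real.exp (-(c * γ) + ∫ x, (Real.exp (-(c * x)) - 1 + c * x) ∂ν)

/-- The integrand `e^{-cx} - 1 + cx` is non-negative, so restoring the small jumps only increases
the exponent. The bound is therefore uniform in `n`. -/
theorem integral_exp_truncatedLaw_le {ν : Measure ℝ} (h2 : Integrable (fun x => x ^ 2) ν) (γ : ℝ)
    (n : ℕ) {c : ℝ} (hc : Integrable (fun x => x ^ 2 * Real.exp (-(c * x))) ν) :
    Integrable (fun x : ℝ => Real.exp (-(c * x))) (truncatedLaw ν γ n) ∧
      ∫ x, Real.exp (-(c * x)) ∂truncatedLaw ν γ n ≤ expMomentBound ν γ c := by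
  obtain ⟨h3, h4⟩ := cf_truncatedLaw h2 γ n (z := Complex.I * c) (by simpa using hc)
  rw [integrable_exp_I_mul_iff] at h3
  refine ⟨by simpa using h3, ?_⟩
  rw [cf_I_mul_im] at h4
  have e : ∀ x : ℝ, Complex.exp (Complex.I * (Complex.I * c) * x) - 1
      - Complex.I * (Complex.I * c) * x = ((Real.exp (-(c * x)) - 1 + c * x : ℝ) : ℂ) := by
    intro x
    rw [show Complex.I * (Complex.I * (c : ℂ)) * (x : ℂ) = ((-(c * x) : ℝ) : ℂ) by
      push_cast; linear_combination ((c : ℂ) * x) * Complex.I_sq]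
    push_cast
    ring
  simp_rw [e] at h4
  rw [integral_complex_ofReal, show Complex.I * (Complex.I * (c : ℂ)) * (γ : ℂ)
    = ((-(c * γ) : ℝ) : ℂ) by push_cast; linear_combination ((c : ℂ) * γ) * Complex.I_sq] at h4
  have h5 : ∫ x, Real.exp (-(c * x)) ∂truncatedLaw ν γ n = Real.exp (-(c * γ)
      + ∫ x in largeJumps n, (Real.exp (-(c * x)) - 1 + c * x) ∂ν) := by exact_mod_cast h4
  rw [h5, expMomentBound]
  gcongr
  · exact ae_of_all _ fun x => exp_sub_one_sub_nonneg c x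
  · exact integrable_exp_sub_one_sub h2 hc
  · exact Measure.restrict_le_self

/-- Exponential moments of an infinitely divisible law. -/
theorem integrable_exp_of_isCenteredExponent {ρ ν : Measure ℝ} [IsProbabilityMeasure ρ] {γ : ℝ}
    (h2 : Integrable (fun x => x ^ 2) ν) {ψ : ℝ → ℂ} (hψ : IsCenteredExponent ν γ ψ)
    (hρ : ∀ u, charFun ρ u = Complex.exp (ψ u)) {c : ℝ}
    (hc : Integrable (fun x => x ^ 2 * Real.exp (-(c * x))) ν) :
    Integrable (fun x => Real.exp (-(c * x))) ρ ∧
      ∫ x, Real.exp (-(c * x)) ∂ρ ≤ expMomentBound ν γ c := by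
  have hw := tendsto_truncatedLaw h2 hψ hρ
  -- Exponential moments are lower semicontinuous under weak convergence, by Fatou's lemma over open
  -- sets, and the uniform bound passes to the limit.
  have hopen : ∀ G, IsOpen G → ρ G ≤ atTop.liminf fun n => truncatedLaw ν γ n G := fun G hG =>
    ProbabilityMeasure.le_liminf_measure_open_of_tendsto hw hG
  have hF := lintegral_le_liminf_lintegral_of_forall_isOpen_measure_le_liminf_measure
    (f := fun x : ℝ => Real.exp (-(c * x))) (by fun_prop) (fun x => (Real.exp_pos _).le) hopen
  have hle : ∀ n, ∫⁻ x, ENNReal.ofReal (Real.exp (-(c * x))) ∂truncatedLaw ν γ n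
      ≤ ENNReal.ofReal (expMomentBound ν γ c) := by
    intro n
    obtain ⟨h3, h4⟩ := integral_exp_truncatedLaw_le h2 γ n hc
    rw [← ofReal_integral_eq_lintegral_ofReal h3 (ae_of_all _ fun x => (Real.exp_pos _).le)]
    exact ENNReal.ofReal_le_ofReal h4
  have hfin : ∫⁻ x, ENNReal.ofReal (Real.exp (-(c * x))) ∂ρ
      ≤ ENNReal.ofReal (expMomentBound ν γ c) := by
    refine hF.trans ?_
    refine (liminf_le_liminf (Eventually.of_forall hle)).trans_eq ?_
    simp
  have hint : Integrable (fun x => Real.exp (-(c * x))) ρ := by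
    refine ⟨by fun_prop, ?_⟩
    rw [hasFiniteIntegral_iff_ofReal (ae_of_all _ fun x => (Real.exp_pos _).le)]
    exact hfin.trans_lt ENNReal.ofReal_lt_top
  refine ⟨hint, ?_⟩
  rw [← ofReal_integral_eq_lintegral_ofReal hint (ae_of_all _ fun x => (Real.exp_pos _).le)] at hfin
  exact (ENNReal.ofReal_le_ofReal_iff (Real.exp_pos _).le).1 hfin

/-- The characteristic function on a horizontal line, through the tilted Lévy measure. -/
theorem norm_cf_le_of_isCenteredExponent {ρ ν : Measure ℝ} [IsProbabilityMeasure ρ] {γ : ℝ}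
    (h2 : Integrable (fun x => x ^ 2) ν) {ψ : ℝ → ℂ} (hψ : IsCenteredExponent ν γ ψ)
    (hρ : ∀ u, charFun ρ u = Complex.exp (ψ u)) {a : ℝ}
    (hc : Integrable (fun x => x ^ 2 * Real.exp (-(2 * a * x))) ν)
    (ha : Integrable (fun x => x ^ 2 * Real.exp (-(a * x))) ν) (u : ℝ) :
    ‖cf ρ ((u : ℂ) + Complex.I * a)‖ ≤ expMomentBound ν γ a
      * Real.exp (-∫ x, (1 - Real.cos (u * x)) * Real.exp (-(a * x)) ∂ν) := by
  have hw := tendsto_truncatedLaw h2 hψ hρ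
  obtain ⟨hi2, hM2⟩ := integrable_exp_of_isCenteredExponent h2 hψ hρ hc
  have hi1 := integrable_exp_neg_of_two_mul hi2
  set z : ℂ := (u : ℂ) + Complex.I * a with hz
  have hzim : z.im = a := by simp [hz]
  set M := expMomentBound ν γ (2 * a)
  have hK := integrable_centered (z := z) h2 (by rw [hzim]; exact ha)
  have hre : ∀ x : ℝ, (Complex.exp (Complex.I * z * x) - 1 - Complex.I * z * x).re
      = (Real.exp (-(a * x)) - 1 + a * x) - (1 - Real.cos (u * x)) * Real.exp (-(a * x)) := by
    intro x
    have : Complex.I * z * x = ((-(a * x) : ℝ) : ℂ) + ((u * x : ℝ) : ℂ) * Complex.I := by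
      rw [hz]; push_cast; linear_combination ((a : ℂ) * x) * Complex.I_sq
    rw [this]
    simp only [Complex.sub_re, Complex.exp_re, Complex.add_re, Complex.ofReal_re, Complex.add_im,
      Complex.ofReal_im, Complex.re_ofReal_mul, Complex.im_ofReal_mul, Complex.I_re, Complex.I_im,
      Complex.one_re]
    ring_nf
  have hcos : Integrable (fun x => (1 - Real.cos (u * x)) * Real.exp (-(a * x))) ν := by
    refine ((integrable_exp_sub_one_sub h2 ha).sub hK.re).congr (ae_of_all _ fun x => ?_)
    simp only [Pi.sub_apply, RCLike.re_to_complex, hre]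
    ring
  -- the limit of the norms of the approximating transforms
  have hlim : Tendsto (fun n => ‖cf (truncatedLaw ν γ n) z‖) atTop
      (𝓝 (expMomentBound ν γ a
        * Real.exp (-∫ x, (1 - Real.cos (u * x)) * Real.exp (-(a * x)) ∂ν))) := by
    have h1 : ∀ n, cf (truncatedLaw ν γ n) z = Complex.exp (Complex.I * z * γ
        + ∫ x in largeJumps n, (Complex.exp (Complex.I * z * x) - 1 - Complex.I * z * x) ∂ν) :=
      fun n => (cf_truncatedLaw h2 γ n (by rw [hzim]; exact ha)).2
    simp_rw [h1]
    have h3 := ((Complex.continuous_exp.tendsto _).comp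
      ((tendsto_setIntegral_largeJumps hK (by simp)).const_add (Complex.I * z * γ))).norm
    convert! h3 using 2
    rw [Complex.norm_exp, Complex.add_re, expMomentBound, ← Real.exp_add]
    congr 1
    have h4 : (∫ x, (Complex.exp (Complex.I * z * x) - 1 - Complex.I * z * x) ∂ν).re
        = ∫ x, (Complex.exp (Complex.I * z * x) - 1 - Complex.I * z * x).re ∂ν :=
      (integral_re hK).symm
    rw [h4]
    simp_rw [hre]
    rw [integral_sub (integrable_exp_sub_one_sub h2 ha) hcos]
    simp [hz]
    ring
  -- cutting off the exponential growth
  have hcut : ∀ k : ℝ, 0 < k → ∀ μ : Measure ℝ, IsProbabilityMeasure μ →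
      Integrable (fun x => Real.exp (-(2 * a * x))) μ → ∫ x, Real.exp (-(2 * a * x)) ∂μ ≤ M →
      ‖cf μ z - ∫ x : ℝ, Complex.exp (Complex.I * z * x)
        * ((1 + k * Real.exp (-(a * x)))⁻¹ : ℝ) ∂μ‖ ≤ k * M := by
    intro k hk μ hμ hμi hμM
    have hb : ∀ x : ℝ, 0 < 1 + k * Real.exp (-(a * x)) := fun x => by positivity
    have hμ1 : Integrable (fun x : ℝ => Complex.exp (Complex.I * z * x)) μ := by
      rw [integrable_exp_I_mul_iff, hzim]
      exact integrable_exp_neg_of_two_mul hμi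
    have hcont : Continuous fun x : ℝ => (1 + k * Real.exp (-(a * x)))⁻¹ :=
      Continuous.inv₀ (by fun_prop) fun x => (hb x).ne'
    have hle1 : ∀ x : ℝ, (1 + k * Real.exp (-(a * x)))⁻¹ ≤ 1 := fun x =>
      inv_le_one_of_one_le₀ (by have := Real.exp_pos (-(a * x)); nlinarith)
    have hμ2 : Integrable (fun x : ℝ => Complex.exp (Complex.I * z * x)
        * ((1 + k * Real.exp (-(a * x)))⁻¹ : ℝ)) μ := by
      refine hμ1.norm.mono' (by fun_prop) (ae_of_all _ fun x => ?_)
      rw [norm_mul, Complex.norm_real, Real.norm_of_nonneg (inv_nonneg.2 (hb x).le)]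
      exact mul_le_of_le_one_right (norm_nonneg _) (hle1 x)
    rw [cf, ← integral_sub hμ1 hμ2]
    refine (norm_integral_le_of_norm_le (hμi.const_mul k) (ae_of_all _ fun x => ?_)).trans ?_
    · rw [← mul_one_sub, norm_mul, norm_exp_I_mul, hzim, ← Complex.ofReal_one,
        ← Complex.ofReal_sub, Complex.norm_real, Real.norm_of_nonneg (by linarith [hle1 x])]
      have e2 : Real.exp (-(2 * a * x)) = Real.exp (-(a * x)) * Real.exp (-(a * x)) := by
        rw [← Real.exp_add]; ring_nf
      -- With `s = k e^{-ax}`, the inequality `1 - 1/(1+s) ≤ s` creates a second factor `e^{-ax}`.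
      -- The error of the cut-off is thus `k` times a moment of order `2a`, uniformly over the laws
      -- considered.
      have e3 : 1 - (1 + k * Real.exp (-(a * x)))⁻¹ ≤ k * Real.exp (-(a * x)) := by
        have h1 : 1 - k * Real.exp (-(a * x)) ≤ (1 + k * Real.exp (-(a * x)))⁻¹ := by
          rw [← one_div, le_div_iff₀ (hb x)]
          nlinarith [sq_nonneg (k * Real.exp (-(a * x)))]
        linarith
      rw [e2]
      nlinarith [Real.exp_pos (-(a * x))]
    · rw [integral_const_mul]
      gcongr
  -- The cut-off integrand has modulus `e^{-ax}/(1 + k e^{-ax}) ≤ 1/k`, so weak convergence applies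
  -- to it. Cutting costs `k M` once for `ρ` and once for the approximations, and `k` is arbitrary.
  have hfinal : ∀ k : ℝ, 0 < k → ‖cf ρ z‖ ≤ expMomentBound ν γ a
      * Real.exp (-∫ x, (1 - Real.cos (u * x)) * Real.exp (-(a * x)) ∂ν) + 2 * (k * M) := by
    intro k hk
    have hb : ∀ x : ℝ, 0 < 1 + k * Real.exp (-(a * x)) := fun x => by positivity
    have hcont : Continuous fun x : ℝ => (1 + k * Real.exp (-(a * x)))⁻¹ :=
      Continuous.inv₀ (by fun_prop) fun x => (hb x).ne'
    let g : BoundedContinuousFunction ℝ ℂ := BoundedContinuousFunction.ofNormedAddCommGroup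
      (fun x : ℝ => Complex.exp (Complex.I * z * x) * ((1 + k * Real.exp (-(a * x)))⁻¹ : ℝ))
      (by fun_prop) k⁻¹ (fun x => by
        rw [norm_mul, norm_exp_I_mul, hzim, Complex.norm_real,
          Real.norm_of_nonneg (inv_nonneg.2 (hb x).le), ← div_eq_mul_inv, div_le_iff₀ (hb x),
          mul_add, inv_mul_cancel_left₀ hk.ne']
        have : 0 < k⁻¹ := inv_pos.2 hk
        linarith)
    have hg := ((ProbabilityMeasure.tendsto_iff_forall_integral_rclike_tendsto ℂ).1 hw g).norm
    have h3 := norm_sub_norm_le (cf ρ z) (∫ x, g x ∂ρ)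
    have h4 := hcut k hk ρ inferInstance hi2 hM2
    have h5 : ‖∫ x, g x ∂ρ‖ ≤ expMomentBound ν γ a
      * Real.exp (-∫ x, (1 - Real.cos (u * x)) * Real.exp (-(a * x)) ∂ν) + k * M := by
      refine le_of_tendsto_of_tendsto' hg (hlim.add_const (k * M)) fun n => ?_
      obtain ⟨h6, h7⟩ := integral_exp_truncatedLaw_le h2 γ n hc
      have h8 := hcut k hk _ (isProbabilityMeasure_truncatedLaw h2 γ n) h6 h7
      have h9 := norm_sub_norm_le (∫ x, g x ∂truncatedLaw ν γ n) (cf (truncatedLaw ν γ n) z)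
      rw [norm_sub_rev] at h9
      have h10 := h9.trans h8
      simp only [ProbabilityMeasure.coe_mk]
      linarith
    have h11 := h3.trans h4
    linarith
  refine le_of_forall_pos_le_add fun ε hε => ?_
  have hM0 : 0 < M := Real.exp_pos _
  refine (hfinal (ε / (2 * M)) (by positivity)).trans_eq ?_
  congr 1
  field_simp

/-! ### The law of the Ornstein–Uhlenbeck increment -/

/-- The points of the uniform grid with `n + 1` cells on `[0, t]`. -/
def grid (t : ℝ) (n k : ℕ) : ℝ := t * k / (n + 1)

/-- The index of the grid cell that contains a point. -/
def cell (t : ℝ) (n : ℕ) (s : ℝ) : ℕ := ⌈(n + 1) * s / t⌉₊ - 1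

theorem grid_zero (t : ℝ) (n : ℕ) : grid t n 0 = 0 := by simp [grid]

theorem grid_last (t : ℝ) (n : ℕ) : grid t n (n + 1) = t := by
  have : (n : ℝ) + 1 ≠ 0 := by positivity
  simp only [grid, Nat.cast_add, Nat.cast_one]
  field_simp

theorem grid_succ_sub (t : ℝ) (n k : ℕ) : grid t n (k + 1) - grid t n k = t / (n + 1) := by
  simp only [grid, Nat.cast_add, Nat.cast_one]
  ring

theorem grid_nonneg {t : ℝ} (ht : 0 < t) (n k : ℕ) : 0 ≤ grid t n k := by
  rw [grid]; positivity

theorem grid_mono {t : ℝ} (ht : 0 < t) (n : ℕ) : Monotone (grid t n) := by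
  intro j k h
  have : (j : ℝ) ≤ k := by exact_mod_cast h
  simp only [grid]
  gcongr

theorem grid_le {t : ℝ} (ht : 0 < t) {n k : ℕ} (hk : k ≤ n + 1) : grid t n k ≤ t :=
  (grid_mono ht n hk).trans_eq (grid_last t n)

theorem cell_eq {t : ℝ} (ht : 0 < t) {n k : ℕ} {s : ℝ}
    (hs : s ∈ Set.Ioc (grid t n k) (grid t n (k + 1))) : cell t n s = k := by
  have hn : (0 : ℝ) < (n : ℝ) + 1 := by positivity
  obtain ⟨h1, h2⟩ := hs
  rw [grid, div_lt_iff₀ hn] at h1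
  rw [grid, le_div_iff₀ hn] at h2
  have : ⌈(n + 1) * s / t⌉₊ = k + 1 := by
    rw [Nat.ceil_eq_iff (by simp)]
    constructor
    · rw [lt_div_iff₀ ht]; push_cast; linarith
    · rw [div_le_iff₀ ht]; linarith
  rw [cell, this]
  simp

theorem mem_cell {t : ℝ} (ht : 0 < t) {n : ℕ} {s : ℝ} (hs : s ∈ Set.Ioc 0 t) :
    s ∈ Set.Ioc (grid t n (cell t n s)) (grid t n (cell t n s + 1)) ∧ cell t n s < n + 1 := by
  have hn : (0 : ℝ) < (n : ℝ) + 1 := by positivity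
  have hq : 0 < (n + 1) * s / t := by have := hs.1; positivity
  have hc : 1 ≤ ⌈(n + 1) * s / t⌉₊ := Nat.one_le_iff_ne_zero.2 (Nat.ceil_pos.2 hq).ne'
  have hc' : cell t n s + 1 = ⌈(n + 1) * s / t⌉₊ := by rw [cell]; omega
  have h1 : (n + 1) * s / t ≤ cell t n s + 1 := by
    have := Nat.le_ceil ((n + 1) * s / t)
    rw [← hc'] at this
    exact_mod_cast this
  have h2 : (cell t n s : ℝ) < (n + 1) * s / t := by
    have := Nat.ceil_lt_add_one hq.le
    rw [← hc'] at this
    push_cast at this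
    linarith
  have h3 : cell t n s + 1 ≤ n + 1 := by
    rw [hc', Nat.ceil_le, div_le_iff₀ ht]
    push_cast
    have := hs.2
    gcongr
  rw [lt_div_iff₀ ht] at h2
  rw [div_le_iff₀ ht] at h1
  refine ⟨⟨?_, ?_⟩, by omega⟩
  · rw [grid, div_lt_iff₀ hn]; linarith
  · rw [grid, le_div_iff₀ hn]; push_cast; linarith

/-- The right end point of the cell is approached from the right, as the right-continuity of the
paths requires. -/
theorem tendsto_grid_cell {t : ℝ} (ht : 0 < t) {s : ℝ} (hs : s ∈ Set.Ioc 0 t) :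
    Tendsto (fun n => grid t n (cell t n s)) atTop (𝓝 s) ∧
      Tendsto (fun n => grid t n (cell t n s + 1)) atTop (𝓝[≥] s) := by
  have h0 : Tendsto (fun n : ℕ => t / ((n : ℝ) + 1)) atTop (𝓝 0) := by
    have := (tendsto_one_div_add_atTop_nhds_zero_nat (𝕜 := ℝ)).const_mul t
    simpa [div_eq_mul_inv] using this
  constructor
  · refine tendsto_of_tendsto_of_tendsto_of_le_of_le (g := fun n : ℕ => s - t / ((n : ℝ) + 1))
      (h := fun _ => s) (by simpa using h0.const_sub s) tendsto_const_nhds (fun n => ?_)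
      (fun n => (mem_cell ht hs).1.1.le)
    have := (mem_cell ht (n := n) hs).1.2
    have h2 := grid_succ_sub t n (cell t n s)
    simp only
    linarith
  · refine tendsto_nhdsWithin_iff.2 ⟨?_, Eventually.of_forall fun n => (mem_cell ht hs).1.2⟩
    refine tendsto_of_tendsto_of_tendsto_of_le_of_le (g := fun _ => s)
      (h := fun n : ℕ => s + t / ((n : ℝ) + 1)) tendsto_const_nhds (by simpa using h0.const_add s)
      (fun n => (mem_cell ht hs).1.2) (fun n => ?_)
    have := (mem_cell ht (n := n) hs).1.1
    have h2 := grid_succ_sub t n (cell t n s)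
    simp only
    linarith

/-- Sums of integrals over the grid cells, with integrands that depend on the cell, converge. -/
theorem tendsto_sum_integral_grid {E : Type*} [NormedAddCommGroup E] [NormedSpace ℝ E]
    {t : ℝ} (ht : 0 < t) {H : ℕ → ℝ → ℕ → E} {h : ℝ → E} {C : ℝ}
    (hi : ∀ n k, k < n + 1 →
      IntervalIntegrable (fun s => H n s k) volume (grid t n k) (grid t n (k + 1)))
    (hC : ∀ n s k, k < n + 1 → s ∈ Set.Ioc (grid t n k) (grid t n (k + 1)) → ‖H n s k‖ ≤ C)
    (hlim : ∀ s ∈ Set.Ioo 0 t, Tendsto (fun n => H n s (cell t n s)) atTop (𝓝 (h s))) :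
    Tendsto (fun n => ∑ k ∈ Finset.range (n + 1), ∫ s in grid t n k..grid t n (k + 1), H n s k)
      atTop (𝓝 (∫ s in (0 : ℝ)..t, h s)) := by
  have hcongr : ∀ n k, Set.EqOn (fun s => H n s k) (fun s => H n s (cell t n s))
      (Set.uIoc (grid t n k) (grid t n (k + 1))) := by
    intro n k s hs
    rw [Set.uIoc_of_le (grid_mono ht n (Nat.le_succ k))] at hs
    simp only [cell_eq ht hs]
  have hi' : ∀ n k, k < n + 1 → IntervalIntegrable (fun s => H n s (cell t n s)) volume
      (grid t n k) (grid t n (k + 1)) := fun n k hk => (hi n k hk).congr (hcongr n k)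
  -- On each cell the index `k` equals `cell t n s`, so the sum is a single integral over `[0, t]`
  -- and dominated convergence applies.
  have hsum : ∀ n, ∑ k ∈ Finset.range (n + 1), ∫ s in grid t n k..grid t n (k + 1), H n s k
      = ∫ s in (0 : ℝ)..t, H n s (cell t n s) := by
    intro n
    have e := intervalIntegral.sum_integral_adjacent_intervals (hi' n)
    rw [grid_zero, grid_last] at e
    rw [← e]
    refine Finset.sum_congr rfl fun k _ => ?_
    exact intervalIntegral.integral_congr_ae (ae_of_all _ fun s hs => hcongr n k hs)
  simp_rw [hsum]
  refine intervalIntegral.tendsto_integral_filter_of_dominated_convergence (fun _ => C)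
    (Eventually.of_forall fun n => ?_) (Eventually.of_forall fun n => ae_of_all _ fun s hs => ?_)
    intervalIntegrable_const ?_
  · have h1 := IntervalIntegrable.trans_iterate (hi' n)
    rw [grid_zero, grid_last] at h1
    rw [Set.uIoc_of_le ht.le]
    exact h1.1.aestronglyMeasurable
  · rw [Set.uIoc_of_le ht.le] at hs
    exact hC n s _ (mem_cell ht hs).2 (mem_cell ht hs).1
  · have : ∀ᵐ s : ℝ, s ≠ t := by simp [ae_iff]
    filter_upwards [this] with s hst hs
    rw [Set.uIoc_of_le ht.le] at hs
    exact hlim s ⟨hs.1, lt_of_le_of_ne hs.2 hst⟩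

theorem tendsto_riemann_sum {t : ℝ} (ht : 0 < t) {G : ℝ → ℂ} (hG : Continuous G) :
    Tendsto (fun n : ℕ => ∑ k ∈ Finset.range (n + 1), ((t / (n + 1) : ℝ) : ℂ) * G (grid t n k))
      atTop (𝓝 (∫ s in (0 : ℝ)..t, G s)) := by
  obtain ⟨C, hC⟩ := isCompact_Icc.exists_bound_of_continuousOn (s := Set.Icc 0 t) hG.continuousOn
  have := tendsto_sum_integral_grid ht (H := fun n _ k => G (grid t n k)) (h := G) (C := C)
    (fun n k _ => intervalIntegrable_const)
    (fun n s k hk _ => hC _ ⟨grid_nonneg ht n k, grid_le ht hk.le⟩)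
    (fun s hs => (hG.tendsto s).comp (tendsto_grid_cell ht ⟨hs.1, hs.2.le⟩).1)
  simpa [grid_succ_sub, intervalIntegral.integral_const, Complex.real_smul] using this

/-- Pathwise approximation of the Ornstein–Uhlenbeck increment by weighted sums of increments of
the driving path. -/
theorem tendsto_weighted_increments {b t : ℝ} (hb : 0 < b) (ht : 0 < t) {y l : ℝ → ℝ}
    (hi : IntervalIntegrable y volume 0 t)
    (hy : ∀ s ∈ Set.Icc 0 t, y s = y 0 - b * (∫ v in (0 : ℝ)..s, y v) + l s)
    {C : ℝ} (hC : ∀ s ∈ Set.Icc 0 t, |y s| ≤ C)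
    (hr : ∀ s ∈ Set.Ico 0 t, ContinuousWithinAt y (Set.Ici s) s) :
    Tendsto (fun n => ∑ k ∈ Finset.range (n + 1), Real.exp (-b * (t - grid t n k))
        * (l (grid t n (k + 1)) - l (grid t n k))) atTop (𝓝 (y t - Real.exp (-b * t) * y 0)) := by
  set f : ℝ → ℝ := fun s => Real.exp (-b * (t - s)) with hf
  have hfc : Continuous f := by fun_prop
  have hC0 : 0 ≤ C := (abs_nonneg _).trans (hC 0 ⟨le_rfl, ht.le⟩)
  have hf1 : ∀ s ≤ t, |f s| ≤ 1 := by
    intro s hs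
    rw [abs_of_pos (Real.exp_pos _)]
    exact Real.exp_le_one_iff.2 (by nlinarith)
  have hgi : ∀ n k, k < n + 1 → IntervalIntegrable y volume (grid t n k) (grid t n (k + 1)) := by
    intro n k hk
    refine hi.mono_set ?_
    rw [Set.uIcc_of_le (grid_mono ht n (Nat.le_succ k)), Set.uIcc_of_le ht.le]
    exact Set.Icc_subset_Icc (grid_nonneg ht n k) (grid_le ht hk)
  have hfd : ∀ p q, b * ∫ s in p..q, f s = f q - f p := by
    intro p q
    rw [← intervalIntegral.integral_const_mul]
    refine intervalIntegral.integral_eq_sub_of_hasDerivAt (fun s _ => ?_)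
      (Continuous.intervalIntegrable (by fun_prop) _ _)
    have h1 : HasDerivAt (fun s => -b * (t - s)) (-b * (-1)) s :=
      ((hasDerivAt_id s).const_sub t).const_mul (-b)
    refine h1.exp.congr_deriv ?_
    simp only [hf]
    ring
  -- This is the defect of summation by parts. Its integrand tends to `f(s) y(s) - f(s) y(s) = 0`
  -- because `y` is right-continuous, and it is bounded by `2C` because `|f| ≤ 1` up to time `t`.
  have herr := tendsto_sum_integral_grid ht
    (H := fun n s k => f (grid t n k) * y s - f s * y (grid t n (k + 1))) (h := fun _ => 0)
    (C := 2 * C)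
    (fun n k hk => ((hgi n k hk).const_mul _).sub
      ((hfc.intervalIntegrable _ _).mul_const _))
    (fun n s k hk hs => by
      have hsm : s ∈ Set.Icc 0 t :=
        ⟨(grid_nonneg ht n k).trans hs.1.le, hs.2.trans (grid_le ht hk)⟩
      have e1 := hC s hsm
      have e2 := hC (grid t n (k + 1)) ⟨grid_nonneg ht _ _, grid_le ht hk⟩
      have e3 := hf1 _ (grid_le ht hk.le : grid t n k ≤ t)
      have e4 := hf1 s hsm.2
      refine (norm_sub_le _ _).trans ?_
      rw [norm_mul, norm_mul]
      simp only [Real.norm_eq_abs]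
      have p1 : |f (grid t n k)| * |y s| ≤ 1 * C :=
        mul_le_mul e3 e1 (abs_nonneg _) zero_le_one
      have p2 : |f s| * |y (grid t n (k + 1))| ≤ 1 * C :=
        mul_le_mul e4 e2 (abs_nonneg _) zero_le_one
      linarith)
    (fun s hs => by
      obtain ⟨g1, g2⟩ := tendsto_grid_cell ht ⟨hs.1, hs.2.le⟩
      have l1 := ((hfc.tendsto s).comp g1).mul_const (y s)
      have l2 := (Tendsto.comp (hr s ⟨hs.1.le, hs.2⟩) g2).const_mul (f s)
      simpa using l1.sub l2)
  -- Since `f' = b f` and the increments of `l` are those of `y` plus `b ∫ y`, each weighted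
  -- increment is the increment of `f y` up to `b` times the defect. The increments of `f y`
  -- telescope.
  have hid : ∀ n, ∑ k ∈ Finset.range (n + 1), f (grid t n k)
        * (l (grid t n (k + 1)) - l (grid t n k))
      = (y t - Real.exp (-b * t) * y 0) + b * ∑ k ∈ Finset.range (n + 1),
        ∫ s in grid t n k..grid t n (k + 1),
          (f (grid t n k) * y s - f s * y (grid t n (k + 1))) := by
    intro n
    have hterm : ∀ k ∈ Finset.range (n + 1), f (grid t n k)
        * (l (grid t n (k + 1)) - l (grid t n k))
        = (f (grid t n (k + 1)) * y (grid t n (k + 1)) - f (grid t n k) * y (grid t n k))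
          + b * ∫ s in grid t n k..grid t n (k + 1),
            (f (grid t n k) * y s - f s * y (grid t n (k + 1))) := by
      intro k hk
      have hk := Finset.mem_range.1 hk
      rw [intervalIntegral.integral_sub ((hgi n k hk).const_mul _)
        ((hfc.intervalIntegrable _ _).mul_const _), intervalIntegral.integral_const_mul,
        intervalIntegral.integral_mul_const]
      have e1 := hy (grid t n k) ⟨grid_nonneg ht _ _, grid_le ht hk.le⟩
      have e2 := hy (grid t n (k + 1)) ⟨grid_nonneg ht _ _, grid_le ht hk⟩
      have e3 := hfd (grid t n k) (grid t n (k + 1))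
      have e4 : (∫ v in (0 : ℝ)..grid t n k, y v) + ∫ v in grid t n k..grid t n (k + 1), y v
          = ∫ v in (0 : ℝ)..grid t n (k + 1), y v := by
        refine intervalIntegral.integral_add_adjacent_intervals ?_ (hgi n k hk)
        refine hi.mono_set ?_
        rw [Set.uIcc_of_le (grid_nonneg ht n k), Set.uIcc_of_le ht.le]
        exact Set.Icc_subset_Icc le_rfl (grid_le ht hk.le)
      linear_combination (f (grid t n k)) * (e1 - e2) + y (grid t n (k + 1)) * e3
        - b * f (grid t n k) * e4
    rw [Finset.sum_congr rfl hterm, Finset.sum_add_distrib,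
      Finset.sum_range_sub (fun k => f (grid t n k) * y (grid t n k)), ← Finset.mul_sum,
      grid_last, grid_zero]
    congr 1
    simp [hf]
  change Tendsto (fun n => ∑ k ∈ Finset.range (n + 1), f (grid t n k)
        * (l (grid t n (k + 1)) - l (grid t n k))) atTop _
  simp_rw [hid]
  simpa using (herr.const_mul b).const_add (y t - Real.exp (-b * t) * y 0)

/-- The one-sided limits bound the path on a neighbourhood of every point, and compactness of `[0,
T]` does the rest. -/
theorem IsCadlagPath.exists_bound {f : ℝ≥0 → ℝ} (hf : IsCadlagPath f) (T : ℝ≥0) :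
    ∃ C, ∀ s ≤ T, |f s| ≤ C := by
  have : ∃ C, ∀ s ∈ Set.Icc 0 T, |f s| ≤ C := by
    refine isCompact_Icc.induction_on (p := fun S => ∃ C, ∀ s ∈ S, |f s| ≤ C) ⟨0, by simp⟩ ?_ ?_ ?_
    · rintro S S' h ⟨C, hC⟩
      exact ⟨C, fun s hs => hC s (h hs)⟩
    · rintro S S' ⟨C, hC⟩ ⟨C', hC'⟩
      refine ⟨max C C', fun s hs => ?_⟩
      rcases hs with hs | hs
      · exact (hC s hs).trans (le_max_left _ _)
      · exact (hC' s hs).trans (le_max_right _ _)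
    · intro x _
      obtain ⟨h1, l, h2⟩ := hf x
      have e1 : ∀ᶠ s in 𝓝[≥] x, |f s| ≤ max (|f x| + 1) (|l| + 1) :=
        ((h1.abs).eventually_le_const (lt_add_one |f x|)).mono fun s hs => hs.trans (le_max_left _ _)
      have e2 : ∀ᶠ s in 𝓝[<] x, |f s| ≤ max (|f x| + 1) (|l| + 1) :=
        ((h2.abs).eventually_le_const (lt_add_one |l|)).mono fun s hs => hs.trans (le_max_right _ _)
      have e3 : ∀ᶠ s in 𝓝 x, |f s| ≤ max (|f x| + 1) (|l| + 1) := by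
        rw [← nhdsLT_sup_nhdsGE, eventually_sup]
        exact ⟨e2, e1⟩
      exact ⟨_, mem_nhdsWithin_of_mem_nhds e3, _, fun s hs => hs⟩
  obtain ⟨C, hC⟩ := this
  exact ⟨C, fun s hs => hC s ⟨zero_le, hs⟩⟩

theorem toNNReal_coe_add {r : ℝ≥0} {v : ℝ} (hv : 0 ≤ v) :
    ((r : ℝ) + v).toNNReal = r + v.toNNReal := by
  rw [Real.toNNReal_add r.coe_nonneg hv, Real.toNNReal_coe]

/-- The weighted sums of increments of the driver converge to the increment of a path that solves
the Ornstein–Uhlenbeck equation. -/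
theorem tendsto_weighted_increments_path {b : ℝ} (hb : 0 < b) {x l : ℝ≥0 → ℝ}
    (hx : ∀ t : ℝ≥0, IntervalIntegrable (fun s : ℝ => x s.toNNReal) volume 0 t ∧
      x t = x 0 - b * (∫ s in (0 : ℝ)..t, x s.toNNReal) + l t)
    (hl : IsCadlagPath l) (r t : ℝ≥0) (ht : 0 < t) :
    Tendsto (fun n => ∑ k ∈ Finset.range (n + 1), Real.exp (-b * (t - grid t n k))
        * (l (r + (grid t n (k + 1)).toNNReal) - l (r + (grid t n k).toNNReal))) atTop
      (𝓝 (x (r + t) - Real.exp (-b * t) * x r)) := by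
  have ht' : (0 : ℝ) < t := by exact_mod_cast ht
  set y : ℝ → ℝ := fun s => x (r + s.toNNReal) with hy
  set m : ℝ → ℝ := fun s => l (r + s.toNNReal) - l r with hm
  have hsh : ∀ s : ℝ, 0 ≤ s → IntervalIntegrable y volume 0 s ∧
      ∫ v in (0 : ℝ)..s, y v = ∫ v in (r : ℝ)..(r + s), x v.toNNReal := by
    intro s hs
    have hcongr : Set.EqOn (fun v : ℝ => x ((r : ℝ) + v).toNNReal) y (Set.uIoc 0 s) := by
      intro v hv
      rw [Set.uIoc_of_le hs] at hv
      simp only [hy, toNNReal_coe_add hv.1.le]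
    have h1 := (hx (r + s.toNNReal)).1
    rw [NNReal.coe_add, Real.coe_toNNReal s hs] at h1
    have h2 : IntervalIntegrable (fun v : ℝ => x v.toNNReal) volume r (r + s) := by
      refine h1.mono_set ?_
      rw [Set.uIcc_of_le (by linarith), Set.uIcc_of_le (by positivity)]
      exact Set.Icc_subset_Icc r.coe_nonneg le_rfl
    have h3 := h2.comp_add_left (r : ℝ)
    rw [sub_self, add_sub_cancel_left] at h3
    refine ⟨h3.congr hcongr, ?_⟩
    rw [← intervalIntegral.integral_congr_ae (ae_of_all _ fun v hv => hcongr hv),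
      intervalIntegral.integral_comp_add_left (fun v => x v.toNNReal), add_zero]
  -- The equation restarted at time `r`, with the driver measured from its value there.
  have heq : ∀ s, 0 ≤ s → y s = y 0 - b * (∫ v in (0 : ℝ)..s, y v) + m s := by
    intro s hs
    obtain ⟨h1, e1⟩ := hx (r + s.toNNReal)
    obtain ⟨h2, e2⟩ := hx r
    rw [NNReal.coe_add, Real.coe_toNNReal s hs] at h1 e1
    have h3 : IntervalIntegrable (fun v : ℝ => x v.toNNReal) volume r (r + s) := h2.symm.trans h1
    have e3 := intervalIntegral.integral_add_adjacent_intervals h2 h3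
    rw [(hsh s hs).2]
    simp only [hy, hm, Real.toNNReal_zero, add_zero]
    rw [e1, e2]
    linear_combination b * e3
  -- The càdlàg hypothesis concerns the driver. The solution inherits boundedness and
  -- right-continuity from the equation, because the integral term is continuous.
  have hprim : ContinuousOn (fun s => ∫ v in (0 : ℝ)..s, y v) (Set.Icc 0 t) := by
    have := intervalIntegral.continuousOn_primitive_interval' (hsh t ht'.le).1
      (Set.left_mem_uIcc)
    rwa [Set.uIcc_of_le ht'.le] at this
  obtain ⟨C1, hC1⟩ := isCompact_Icc.exists_bound_of_continuousOn hprim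
  obtain ⟨C2, hC2⟩ := hl.exists_bound (r + t)
  have hbound : ∀ s ∈ Set.Icc 0 (t : ℝ), |y s| ≤ |y 0| + b * C1 + (C2 + C2) := by
    intro s hs
    rw [heq s hs.1]
    have e1 := hC1 s hs
    have hst : s.toNNReal ≤ t := by rw [Real.toNNReal_le_iff_le_coe]; exact hs.2
    have e2 : |m s| ≤ C2 + C2 := by
      refine (abs_sub _ _).trans (add_le_add (hC2 _ ?_) (hC2 _ ?_))
      · gcongr
      · exact le_add_of_nonneg_right zero_le
    refine (abs_add_le _ _).trans (add_le_add ((abs_sub _ _).trans (add_le_add le_rfl ?_)) e2)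
    rw [abs_mul, abs_of_pos hb]
    gcongr
    exact e1
  have hright : ∀ s ∈ Set.Ico 0 (t : ℝ), ContinuousWithinAt y (Set.Ici s) s := by
    intro s hs
    have c1 : ContinuousWithinAt (fun s => ∫ v in (0 : ℝ)..s, y v) (Set.Icc s t) s :=
      (hprim s ⟨hs.1, hs.2.le⟩).mono (Set.Icc_subset_Icc hs.1 le_rfl)
    have c2 : ContinuousWithinAt m (Set.Icc s t) s := by
      have h1 := (hl (r + s.toNNReal)).1
      have h2 : ContinuousWithinAt (fun v : ℝ => r + v.toNNReal) (Set.Icc s t) s := by fun_prop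
      have h3 : ContinuousWithinAt (fun v : ℝ => l (r + v.toNNReal)) (Set.Icc s t) s :=
        ContinuousWithinAt.comp (g := l) (f := fun v : ℝ => r + v.toNNReal)
          (t := Set.Ici (r + s.toNNReal)) h1 h2 fun v hv => by
          have := Real.toNNReal_le_toNNReal hv.1
          simp only [Set.mem_Ici]
          gcongr
      exact h3.sub continuousWithinAt_const
    have c3 : ContinuousWithinAt y (Set.Icc s t) s :=
      ((continuousWithinAt_const.sub (c1.const_mul b)).add c2).congr
        (fun v hv => heq v (hs.1.trans hv.1)) (heq s hs.1)
    exact c3.mono_of_mem_nhdsWithin (Icc_mem_nhdsGE hs.2)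
  have := tendsto_weighted_increments hb ht' (hsh t ht'.le).1 (fun s hs => heq s hs.1) hbound hright
  simpa [hy, hm] using this

/-- The characteristic function of the Ornstein–Uhlenbeck increment as a limit of products. -/
theorem tendsto_charFun_stepLaw {Ω : Type*} [MeasurableSpace Ω] {P : Measure Ω}
    [IsProbabilityMeasure P] {b : ℝ} (hb : 0 < b) {L X : ℝ≥0 → Ω → ℝ} (hX : IsOUProcess P b L X)
    (r t : ℝ≥0) (ht : 0 < t) (u : ℝ) :
    Tendsto (fun n : ℕ => ∏ k ∈ Finset.range (n + 1),
        charFun (P.map (L (t / (n + 1)))) (Real.exp (-b * (t - grid t n k)) * u))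
      atTop (𝓝 (charFun (stepLaw P b X r t) u)) := by
  have ht' : (0 : ℝ) < t := by exact_mod_cast ht
  set S : ℕ → Ω → ℝ := fun n ω => ∑ k ∈ Finset.range (n + 1), Real.exp (-b * (t - grid t n k))
    * (L (r + (grid t n (k + 1)).toNNReal) ω - L (r + (grid t n k).toNNReal) ω) with hS
  have hSm : ∀ n, Measurable (S n) := fun n => Finset.measurable_sum _ fun k _ =>
    ((hX.levy.measurable _).sub (hX.levy.measurable _)).const_mul _
  -- Independence of the increments gives the product; stationarity replaces each of them by `L` at
  -- time `t/(n+1)`, so that `r` disappears.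
  have hprod : ∀ n : ℕ, charFun (P.map (S n)) u = ∏ k ∈ Finset.range (n + 1),
      charFun (P.map (L (t / (n + 1)))) (Real.exp (-b * (t - grid t n k)) * u) := by
    intro n
    have hmono : Monotone fun k : ℕ => r + (grid t n k).toNNReal := fun j k hjk =>
      add_le_add le_rfl (Real.toNNReal_le_toNNReal (grid_mono ht' n hjk))
    have hind := (hX.levy.indep.nat hmono).comp
      (fun k x => Real.exp (-b * (t - grid t n k)) * x) (fun k => by fun_prop)
    have h1 := iIndepFun.charFun_map_fun_finsetSum_eq_prod (s := Finset.range (n + 1)) (P := P)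
      (X := fun k ω => Real.exp (-b * (t - grid t n k))
        * (L (r + (grid t n (k + 1)).toNNReal) ω - L (r + (grid t n k).toNNReal) ω))
      (fun k _ => (((hX.levy.measurable _).sub (hX.levy.measurable _)).const_mul _).aemeasurable)
      (hind.precomp (g := fun i : Finset.range (n + 1) => (i : ℕ)) Subtype.val_injective)
    have h2 := congrFun h1 u
    rw [Finset.prod_apply] at h2
    refine h2.trans (Finset.prod_congr rfl fun k _ => ?_)
    have hm : AEMeasurable (fun ω => L (r + (grid t n (k + 1)).toNNReal) ω
        - L (r + (grid t n k).toNNReal) ω) P :=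
      ((hX.levy.measurable _).sub (hX.levy.measurable _)).aemeasurable
    rw [charFun_map_mul_comp hm]
    have hstat := (hX.levy.stationary (r + (grid t n k).toNNReal) (t / (n + 1))).map_eq
    rw [← hstat]
    have e : r + (grid t n (k + 1)).toNNReal = r + (grid t n k).toNNReal + t / (n + 1) := by
      rw [add_assoc]
      congr 1
      have := grid_succ_sub t n k
      rw [← NNReal.coe_inj, NNReal.coe_add, Real.coe_toNNReal _ (grid_nonneg ht' _ _),
        Real.coe_toNNReal _ (grid_nonneg ht' _ _)]
      push_cast
      linarith
    rw [e]
  simp_rw [← hprod]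
  have hlim : ∀ᵐ ω ∂P, Tendsto (fun n => S n ω) atTop
      (𝓝 (X (r + t) ω - Real.exp (-b * t) * X r ω)) := by
    filter_upwards [hX.solves, hX.levy.cadlag] with ω h1 h2
    exact tendsto_weighted_increments_path (x := fun s => X s ω) hb h1 h2 r t ht
  have hZm : Measurable fun ω => X (r + t) ω - Real.exp (-b * t) * X r ω :=
    (hX.measurable _).sub ((hX.measurable _).const_mul _)
  simp_rw [stepLaw, charFun_apply_real]
  rw [integral_map hZm.aemeasurable (by fun_prop)]
  have e : ∀ n, ∫ x, Complex.exp (u * x * Complex.I) ∂(P.map (S n))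
      = ∫ ω, Complex.exp (u * (S n ω : ℝ) * Complex.I) ∂P := fun n => by
    rw [integral_map (hSm n).aemeasurable (by fun_prop)]
  simp_rw [e]
  refine tendsto_integral_of_dominated_convergence (fun _ => (1 : ℝ)) (fun n => ?_)
    (integrable_const _) (fun n => ae_of_all _ fun ω => ?_) ?_
  · have := hSm n
    fun_prop
  · rw [← Complex.ofReal_mul, Complex.norm_exp_ofReal_mul_I]
  · filter_upwards [hlim] with ω hω
    have hc : Continuous fun x : ℝ => Complex.exp (u * x * Complex.I) := by fun_prop
    exact (hc.tendsto _).comp hω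

theorem isProbabilityMeasure_stepLaw {Ω : Type*} [MeasurableSpace Ω] {P : Measure Ω}
    [IsProbabilityMeasure P] {b : ℝ} {L X : ℝ≥0 → Ω → ℝ} (hX : IsOUProcess P b L X) (r t : ℝ≥0) :
    IsProbabilityMeasure (stepLaw P b X r t) :=
  Measure.isProbabilityMeasure_map
    ((hX.measurable _).sub ((hX.measurable _).const_mul _)).aemeasurable

/-- The product of exponentials is the exponential of a Riemann sum for `ψ(e^{-b(t-s)} u)`, and the
substitution `s ↦ t - s` puts the limit in its final form. -/
theorem charFun_stepLaw {Ω : Type*} [MeasurableSpace Ω] {P : Measure Ω}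
    [IsProbabilityMeasure P] {b : ℝ} (hb : 0 < b) {L X : ℝ≥0 → Ω → ℝ} (hX : IsOUProcess P b L X)
    (r t : ℝ≥0) (ht : 0 < t) {ψ : ℝ → ℂ} (hψ : Continuous ψ) (hL : HasCharExponent P L ψ) (u : ℝ) :
    charFun (stepLaw P b X r t) u
      = Complex.exp (∫ s in (0 : ℝ)..t, ψ (Real.exp (-b * s) * u)) := by
  have ht' : (0 : ℝ) < t := by exact_mod_cast ht
  have h1 := tendsto_charFun_stepLaw hb hX r t ht u
  have hG : Continuous fun s : ℝ => ψ (Real.exp (-b * (t - s)) * u) := by fun_prop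
  have h2 := (Complex.continuous_exp.tendsto _).comp (tendsto_riemann_sum ht' hG)
  have e : ∫ s in (0 : ℝ)..t, ψ (Real.exp (-b * (t - s)) * u)
      = ∫ s in (0 : ℝ)..t, ψ (Real.exp (-b * s) * u) := by
    rw [intervalIntegral.integral_comp_sub_left (fun s => ψ (Real.exp (-b * s) * u)) (t : ℝ)]
    simp
  rw [e] at h2
  refine tendsto_nhds_unique h1 (h2.congr fun n => ?_)
  simp only [Function.comp]
  rw [Complex.exp_sum]
  refine Finset.prod_congr rfl fun k _ => ?_
  rw [hL]
  push_cast
  rfl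

/-- The products that converge to the characteristic function do not involve `r`. The definition of
a stationary law refers to `r = 0`, and this carries it to every `r`. -/
theorem stepLaw_eq_zero {Ω : Type*} [MeasurableSpace Ω] {P : Measure Ω}
    [IsProbabilityMeasure P] {b : ℝ} (hb : 0 < b) {L X : ℝ≥0 → Ω → ℝ} (hX : IsOUProcess P b L X)
    (r t : ℝ≥0) (ht : 0 < t) : stepLaw P b X r t = stepLaw P b X 0 t := by
  have := isProbabilityMeasure_stepLaw hX r t
  have := isProbabilityMeasure_stepLaw hX 0 t
  refine Measure.ext_of_charFun (funext fun u => ?_)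
  exact tendsto_nhds_unique (tendsto_charFun_stepLaw hb hX r t ht u)
    (tendsto_charFun_stepLaw hb hX 0 t ht u)

/-- An exponential never vanishes, so the stationarity equation `π̂(e^{-bt}u) · Ẑ(u) = π̂(u)` can be
divided. The exponent of the driver is not needed. -/
theorem charFun_stepLaw_of_isStationaryLaw {Ω : Type*} [MeasurableSpace Ω] {P : Measure Ω}
    [IsProbabilityMeasure P] {b : ℝ} (hb : 0 < b) {L X : ℝ≥0 → Ω → ℝ} (hX : IsOUProcess P b L X)
    (r t : ℝ≥0) (ht : 0 < t) {π : Measure ℝ} (hπ : IsStationaryLaw P b X π) {ψ : ℝ → ℂ}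
    (hψ : ∀ u, charFun π u = Complex.exp (ψ u)) (u : ℝ) :
    charFun (stepLaw P b X r t) u = Complex.exp (ψ u - ψ (Real.exp (-b * t) * u)) := by
  have := isProbabilityMeasure_stepLaw hX 0 t
  have := hπ.1
  have h := congrArg (fun m => charFun m u) (hπ.2 t)
  have : IsProbabilityMeasure (π.map fun x => Real.exp (-b * t) * x) :=
    Measure.isProbabilityMeasure_map (by fun_prop)
  rw [charFun_conv, charFun_map_mul, hψ, hψ] at h
  rw [stepLaw_eq_zero hb hX r t ht, Complex.exp_sub, ← h]
  field_simp

/-! ### Lévy exponents with exponential moments: criteria for activity and for error decay -/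

/-- `ψ` is the exponent with Lévy measure `ν`, no Gaussian part and mean `γ`, and `ν` has
exponential moments on the strip `S`. -/
structure IsLevyExponent (ν : Measure ℝ) (γ : ℝ) (ψ : ℝ → ℂ) (S : Set ℝ) : Prop where
  zero : ν {0} = 0
  sq : Integrable (fun x => x ^ 2) ν
  centered : IsCenteredExponent ν γ ψ
  exp_moment : ∀ c ∈ S, Integrable (fun x => x ^ 2 * Real.exp (-(c * x))) ν

theorem integrable_sq_mul_exp_half {ν : Measure ℝ} (h2 : Integrable (fun x => x ^ 2) ν) {a : ℝ}
    (h : Integrable (fun x => x ^ 2 * Real.exp (-(2 * a * x))) ν) :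
    Integrable (fun x => x ^ 2 * Real.exp (-(a * x))) ν := by
  refine (h2.add h).mono' (by fun_prop) (ae_of_all _ fun x => ?_)
  rw [Real.norm_eq_abs, abs_of_nonneg (by positivity)]
  have h1 : Real.exp (-(a * x)) ≤ 1 + Real.exp (-(2 * a * x)) := by
    have : Real.exp (-(2 * a * x)) = Real.exp (-(a * x)) ^ 2 := by
      rw [← Real.exp_nat_mul]; congr 1; push_cast; ring
    rw [this]
    nlinarith [sq_nonneg (Real.exp (-(a * x)) - 1), Real.exp_pos (-(a * x))]
  simp only [Pi.add_apply]
  nlinarith [mul_le_mul_of_nonneg_left h1 (sq_nonneg x)]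

namespace IsLevyExponent

variable {ν : Measure ℝ} {γ : ℝ} {ψ : ℝ → ℂ} {S : Set ℝ}

theorem integrableOn_large (h : IsLevyExponent ν γ ψ S) :
    IntegrableOn (fun x : ℝ => x) {x | 1 < |x|} ν := by
  refine (h.sq.integrableOn).mono' (by fun_prop) ?_
  filter_upwards [ae_restrict_mem (measurableSet_lt measurable_const (by fun_prop))] with x hx
  rw [Real.norm_eq_abs, ← sq_abs]
  nlinarith

/-- The centred form compensates all jumps, the triplet only those with `|x| ≤ 1`. The second moment
makes the larger jumps integrable, and their mean moves into the drift. -/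
theorem hasLevyMeasure (h : IsLevyExponent ν γ ψ S) {ρ : Measure ℝ}
    (hρ : ∀ u, charFun ρ u = Complex.exp (ψ u)) : HasLevyMeasure ρ ν := by
  refine ⟨h.zero, ?_, γ - ∫ x in {x : ℝ | 1 < |x|}, x ∂ν, fun u => ?_⟩
  · refine lt_of_le_of_lt (lintegral_mono fun x => ?_) h.sq.lintegral_lt_top
    exact ENNReal.ofReal_le_ofReal (min_le_right _ _)
  · have hms : MeasurableSet {x : ℝ | 1 < |x|} := measurableSet_lt measurable_const (by fun_prop)
    have h1 : Integrable (fun x : ℝ => Set.indicator {x : ℝ | 1 < |x|}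
        (fun x : ℝ => Complex.I * u * x) x) ν := by
      rw [integrable_indicator_iff hms]
      exact (h.integrableOn_large.ofReal).const_mul _
    rw [hρ, h.centered u]
    congr 1
    have e : ∀ x : ℝ, (Complex.exp (Complex.I * u * x) - 1
        - if |x| ≤ 1 then Complex.I * u * x else 0)
        = (Complex.exp (Complex.I * u * x) - 1 - Complex.I * u * x)
          + Set.indicator {x : ℝ | 1 < |x|} (fun x : ℝ => Complex.I * u * x) x := by
      intro x
      by_cases hx : |x| ≤ 1
      · simp [hx]
      · simp [hx, not_le.1 hx]
    simp_rw [e]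
    rw [integral_add (integrable_centered_ofReal h.sq u) h1, integral_indicator hms,
      integral_const_mul, integral_complex_ofReal]
    push_cast
    ring

theorem norm_cf_le (h : IsLevyExponent ν γ ψ S) {ρ : Measure ℝ} [IsProbabilityMeasure ρ]
    (hρ : ∀ u, charFun ρ u = Complex.exp (ψ u)) {a : ℝ} (ha : 2 * a ∈ S) (u : ℝ) :
    ‖cf ρ ((u : ℂ) + Complex.I * a)‖ ≤ expMomentBound ν γ a
      * Real.exp (-∫ x, (1 - Real.cos (u * x)) * Real.exp (-(a * x)) ∂ν) :=
  norm_cf_le_of_isCenteredExponent h.sq h.centered hρ (h.exp_moment _ ha)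
    (integrable_sq_mul_exp_half h.sq (h.exp_moment _ ha)) u

theorem integrable_exp (h : IsLevyExponent ν γ ψ S) {ρ : Measure ℝ} [IsProbabilityMeasure ρ]
    (hρ : ∀ u, charFun ρ u = Complex.exp (ψ u)) {c : ℝ} (hc : c ∈ S) :
    Integrable (fun x => Real.exp (-(c * x))) ρ :=
  (integrable_exp_of_isCenteredExponent h.sq h.centered hρ (h.exp_moment _ hc)).1

theorem powerLawErrorDecay (h : IsLevyExponent ν γ ψ S) {ρ : Measure ℝ} [IsProbabilityMeasure ρ]
    (hρ : ∀ u, charFun ρ u = Complex.exp (ψ u)) {ω : ℝ} (hω : 0 < ω)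
    (H : ∀ a, 2 * a ∈ S → ∃ K, ∀ u > 0,
      Real.exp (-∫ x, (1 - Real.cos (u * x)) * Real.exp (-(a * x)) ∂ν) ≤ K * u ^ (-ω)) :
    PowerLawErrorDecay ρ S ω := by
  refine powerLawErrorDecay_of_norm_cf_le hω fun a _ ha => ⟨h.integrable_exp hρ ha, ?_⟩
  obtain ⟨K, hK⟩ := H a ha
  refine ⟨expMomentBound ν γ a * K, fun u hu => (h.norm_cf_le hρ ha u).trans ?_⟩
  rw [mul_assoc]
  exact mul_le_mul_of_nonneg_left (hK u hu) (Real.exp_pos _).le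

end IsLevyExponent

/-- The truncated second moment is bounded from below by that of a stable process of index `ω`. -/
def SmallJumpBound (ν : Measure ℝ) (ω : ℝ) : Prop :=
  ∃ C : ℝ, 0 < C ∧ ∀ y, 0 < y → y ≤ 1 → C * y ^ (2 - ω) ≤ ∫ x in Set.Icc (-y) y, x ^ 2 ∂ν

theorem tendsto_setIntegral_shrinking {ν : Measure ℝ} (h0 : ν {0} = 0) {f : ℝ → ℝ}
    (hf : IntegrableOn f (Set.Icc (-1) 1) ν) :
    Tendsto (fun n : ℕ => ∫ x in Set.Icc (-(1 / ((n : ℝ) + 1))) (1 / ((n : ℝ) + 1)), f x ∂ν) atTop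
      (𝓝 0) := by
  have h1 : Antitone fun n : ℕ => Set.Icc (-(1 / ((n : ℝ) + 1))) (1 / ((n : ℝ) + 1)) := by
    intro m n hmn
    have : 1 / ((n : ℝ) + 1) ≤ 1 / ((m : ℝ) + 1) := by gcongr
    exact Set.Icc_subset_Icc (by linarith) this
  have h2 := tendsto_setIntegral_of_antitone (fun n => measurableSet_Icc) h1
    (f := f) (μ := ν) ⟨0, by simpa using hf⟩
  have h3 : ⋂ n : ℕ, Set.Icc (-(1 / ((n : ℝ) + 1))) (1 / ((n : ℝ) + 1)) = {0} := by
    ext x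
    rw [Set.mem_iInter, Set.mem_singleton_iff]
    constructor
    · intro h
      have := ge_of_tendsto' (tendsto_one_div_add_atTop_nhds_zero_nat (𝕜 := ℝ))
        fun n => abs_le.2 (h n)
      exact abs_eq_zero.1 (le_antisymm this (abs_nonneg x))
    · rintro rfl n
      refine abs_le.1 ?_
      rw [abs_zero]
      positivity
  rwa [h3, Measure.restrict_eq_zero.2 h0, integral_zero_measure] at h2

/-- On `[-y, y]` one has `x² ≤ y^{2-p} |x|^p`, so the integral of `|x|^p` over `[-y, y]` is at least
`C y^{p-ω} ≥ C` for every `y ≤ 1`, whereas integrability would make it tend to zero. The case `p =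
0` gives infinite activity and `p = 1` infinite variation. -/
theorem SmallJumpBound.not_integrableOn {ν : Measure ℝ} {ω p : ℝ} (h : SmallJumpBound ν ω)
    (h0 : ν {0} = 0) (hp : 0 ≤ p) (hp2 : p ≤ 2) (hpω : p ≤ ω) :
    ¬ IntegrableOn (fun x => |x| ^ p) (Set.Icc (-1) 1) ν := by
  intro hi
  obtain ⟨C, hC, hb⟩ := h
  have hle : ∀ n : ℕ, C ≤ ∫ x in Set.Icc (-(1 / ((n : ℝ) + 1))) (1 / ((n : ℝ) + 1)),
      |x| ^ p ∂ν := by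
    intro n
    set y : ℝ := 1 / ((n : ℝ) + 1) with hy
    have hy0 : 0 < y := by positivity
    have hy1 : y ≤ 1 := by
      rw [hy, div_le_one (by positivity)]
      linarith [(Nat.cast_nonneg n : (0 : ℝ) ≤ n)]
    have hsub : Set.Icc (-y) y ⊆ Set.Icc (-1) 1 := Set.Icc_subset_Icc (by linarith) hy1
    have h1 : ∫ x in Set.Icc (-y) y, x ^ 2 ∂ν ≤ y ^ (2 - p) * ∫ x in Set.Icc (-y) y, |x| ^ p ∂ν := by
      rw [← integral_const_mul]
      refine integral_mono_of_nonneg (ae_of_all _ fun x => sq_nonneg x)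
        ((hi.mono_set hsub).const_mul _) ?_
      filter_upwards [ae_restrict_mem measurableSet_Icc] with x hx
      have hx' := abs_le.2 hx
      calc x ^ 2 = |x| ^ (2 - p) * |x| ^ p := by
            rw [← Real.rpow_add_of_nonneg (abs_nonneg x) (by linarith) hp, sub_add_cancel,
              Real.rpow_two, sq_abs]
        _ ≤ y ^ (2 - p) * |x| ^ p := by
            gcongr
    have h2 := (hb y hy0 hy1).trans h1
    have h3 : y ^ (2 - ω) = y ^ (2 - p) * y ^ (p - ω) := by
      rw [← Real.rpow_add hy0]; congr 1; ring
    have h4 : 1 ≤ y ^ (p - ω) :=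
      Real.one_le_rpow_of_pos_of_le_one_of_nonpos hy0 hy1 (by linarith)
    have h5 : 0 < y ^ (2 - p) := Real.rpow_pos_of_pos hy0 _
    refine le_of_mul_le_mul_left ?_ h5
    refine le_trans ?_ h2
    rw [h3]
    nlinarith [mul_pos hC h5]
  exact absurd (ge_of_tendsto' (tendsto_setIntegral_shrinking h0 hi) hle) (not_le.2 hC)

theorem SmallJumpBound.measure_univ {ν : Measure ℝ} {ω : ℝ} (h : SmallJumpBound ν ω)
    (h0 : ν {0} = 0) (hω : 0 ≤ ω) : ν Set.univ = ⊤ := by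
  by_contra hne
  have : IsFiniteMeasure ν := ⟨lt_top_iff_ne_top.2 hne⟩
  exact h.not_integrableOn h0 le_rfl zero_le_two hω (by simp)

theorem SmallJumpBound.lintegral_abs {ν : Measure ℝ} {ω : ℝ} (h : SmallJumpBound ν ω)
    (h0 : ν {0} = 0) (hω : 1 ≤ ω) : ∫⁻ x in Set.Icc (-1 : ℝ) 1, ENNReal.ofReal |x| ∂ν = ⊤ := by
  by_contra hne
  refine h.not_integrableOn h0 zero_le_one one_le_two hω ?_
  simp only [Real.rpow_one]
  refine ⟨by fun_prop, ?_⟩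
  rw [hasFiniteIntegral_iff_ofReal (ae_of_all _ fun x => abs_nonneg x)]
  exact lt_top_iff_ne_top.2 hne

namespace IsLevyExponent

variable {ν : Measure ℝ} {γ : ℝ} {ψ : ℝ → ℂ} {S : Set ℝ}

theorem infiniteActivityFiniteVariation (h : IsLevyExponent ν γ ψ S) {ρ : Measure ℝ}
    (hρ : ∀ u, charFun ρ u = Complex.exp (ψ u)) {ω : ℝ} (hω : 0 ≤ ω) (hb : SmallJumpBound ν ω)
    (hi : Integrable (fun x => x) ν) : InfiniteActivityFiniteVariation ρ := by
  refine ⟨ν, h.hasLevyMeasure hρ, hb.measure_univ h.zero hω, ?_⟩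
  exact (hi.abs.integrableOn).lintegral_lt_top

theorem infiniteActivityInfiniteVariation (h : IsLevyExponent ν γ ψ S) {ρ : Measure ℝ}
    (hρ : ∀ u, charFun ρ u = Complex.exp (ψ u)) {ω : ℝ} (hω : 1 ≤ ω) (hb : SmallJumpBound ν ω) :
    InfiniteActivityInfiniteVariation ρ :=
  ⟨ν, h.hasLevyMeasure hρ, hb.measure_univ h.zero (by linarith), hb.lintegral_abs h.zero hω⟩

theorem integrable_one_sub_cos_mul_exp (h : IsLevyExponent ν γ ψ S) {a : ℝ} (ha : 2 * a ∈ S)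
    (u : ℝ) : Integrable (fun x => (1 - Real.cos (u * x)) * Real.exp (-(a * x))) ν := by
  refine ((integrable_sq_mul_exp_half h.sq (h.exp_moment _ ha)).const_mul (u ^ 2)).mono'
    (by fun_prop) (ae_of_all _ fun x => ?_)
  have h1 := Real.one_sub_sq_div_two_le_cos (x := u * x)
  have h2 := Real.cos_le_one (u * x)
  rw [Real.norm_eq_abs, abs_of_nonneg (mul_nonneg (by linarith) (Real.exp_pos _).le),
    ← mul_assoc]
  gcongr
  nlinarith [mul_pow u x 2, sq_nonneg (u * x)]

/-- For `|x| ≤ 1/u` one has `1 - cos(ux) ≥ (ux)²/5`, so the exponent is at least a multiple of `u²`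
times the second moment truncated at `1/u`, that is, of `u^ω`. -/
theorem exponentialErrorDecay (h : IsLevyExponent ν γ ψ S) {ρ : Measure ℝ} [IsProbabilityMeasure ρ]
    (hρ : ∀ u, charFun ρ u = Complex.exp (ψ u)) {ω : ℝ} (hω : 0 < ω) (hb : SmallJumpBound ν ω) :
    ExponentialErrorDecay ρ S ω := by
  obtain ⟨C, hC, hb⟩ := hb
  -- A single `ℓ` has to serve all shifts. For `u ≥ 1 + |a|` the tilt satisfies `e^{-ax} ≥ e^{-1}`
  -- on `|x| ≤ 1/u`, which keeps `a` out of this constant.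
  have hk : 0 < C / 5 * Real.exp (-1) := by positivity
  refine exponentialErrorDecay_of_norm_cf_le hω hk fun a _ ha => ⟨h.integrable_exp hρ ha, ?_⟩
  have hnn : ∀ u x : ℝ, 0 ≤ (1 - Real.cos (u * x)) * Real.exp (-(a * x)) := fun u x =>
    mul_nonneg (by linarith [Real.cos_le_one (u * x)]) (Real.exp_pos _).le
  have key : ∀ u : ℝ, 1 + |a| ≤ u → C / 5 * Real.exp (-1) * u ^ ω
      ≤ ∫ x, (1 - Real.cos (u * x)) * Real.exp (-(a * x)) ∂ν := by
    intro u hu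
    have hu0 : 0 < u := by linarith [abs_nonneg a]
    have hi := h.integrable_one_sub_cos_mul_exp ha u
    have h1 := hb (1 / u) (by positivity) (by rw [div_le_one hu0]; linarith [abs_nonneg a])
    have h2 : (1 / u) ^ (2 - ω) = u ^ ω / u ^ 2 := by
      rw [one_div, Real.inv_rpow hu0.le, ← Real.rpow_neg hu0.le, neg_sub, Real.rpow_sub hu0,
        Real.rpow_two]
    have h3 : ∫ x in Set.Icc (-(1 / u)) (1 / u), u ^ 2 / 5 * Real.exp (-1) * x ^ 2 ∂ν
        ≤ ∫ x in Set.Icc (-(1 / u)) (1 / u), (1 - Real.cos (u * x)) * Real.exp (-(a * x)) ∂ν := by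
      refine integral_mono_ae (h.sq.integrableOn.const_mul _) hi.integrableOn ?_
      filter_upwards [ae_restrict_mem measurableSet_Icc] with x hx
      have hx' : |x| ≤ 1 / u := abs_le.2 hx
      have hux : |u * x| ≤ 1 := by
        rw [abs_mul, abs_of_pos hu0]
        rw [le_div_iff₀ hu0] at hx'
        linarith
      have hcos : (u * x) ^ 2 / 5 ≤ 1 - Real.cos (u * x) := by
        have hpi : |u * x| ≤ Real.pi := hux.trans (by linarith [Real.pi_gt_three])
        have e1 := Real.cos_le_one_sub_mul_cos_sq hpi
        have e2 : 1 / 5 ≤ 2 / Real.pi ^ 2 := by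
          rw [div_le_div_iff₀ (by norm_num) (by positivity)]
          nlinarith [Real.pi_lt_d2, Real.pi_pos]
        nlinarith [mul_le_mul_of_nonneg_right e2 (sq_nonneg (u * x))]
      have hexp : Real.exp (-1) ≤ Real.exp (-(a * x)) := by
        refine Real.exp_le_exp.2 (neg_le_neg ?_)
        refine (le_abs_self _).trans ?_
        rw [abs_mul]
        calc |a| * |x| ≤ u * (1 / u) := by
              gcongr
              linarith
          _ = 1 := by field_simp
      calc u ^ 2 / 5 * Real.exp (-1) * x ^ 2 = (u * x) ^ 2 / 5 * Real.exp (-1) := by ring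
        _ ≤ _ := by
          gcongr
          linarith [Real.cos_le_one (u * x)]
    have h4 := setIntegral_le_integral (s := Set.Icc (-(1 / u)) (1 / u)) hi
      (ae_of_all _ fun x => hnn u x)
    refine le_trans ?_ (h3.trans h4)
    rw [integral_const_mul]
    rw [h2] at h1
    calc C / 5 * Real.exp (-1) * u ^ ω = u ^ 2 / 5 * Real.exp (-1) * (C * (u ^ ω / u ^ 2)) := by
          field_simp
      _ ≤ _ := by gcongr
  -- The second factor covers `u < 1 + |a|`, where the integral is only known to be non-negative;
  -- here dependence on `a` is allowed.
  refine ⟨expMomentBound ν γ a * Real.exp (C / 5 * Real.exp (-1) * (1 + |a|) ^ ω), fun u hu =>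
    (h.norm_cf_le hρ ha u).trans ?_⟩
  rw [mul_assoc, ← Real.exp_add]
  refine mul_le_mul_of_nonneg_left (Real.exp_le_exp.2 ?_) (Real.exp_pos _).le
  have hA : 0 ≤ C / 5 * Real.exp (-1) * (1 + |a|) ^ ω := by positivity
  rcases le_total (1 + |a|) u with hu1 | hu1
  · linarith [key u hu1]
  · have : 0 ≤ ∫ x, (1 - Real.cos (u * x)) * Real.exp (-(a * x)) ∂ν :=
      integral_nonneg fun x => hnn u x
    have : C / 5 * Real.exp (-1) * u ^ ω ≤ C / 5 * Real.exp (-1) * (1 + |a|) ^ ω := by gcongr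
    linarith

/-- A compound Poisson law with an absolutely continuous jump law. -/
theorem bernoulliDecomposition (h : IsLevyExponent ν γ ψ S) [IsFiniteMeasure ν]
    {ρ : Measure ℝ} [IsProbabilityMeasure ρ]
    (hρ : ∀ u, charFun ρ u = Complex.exp (ψ u)) (hac : ν ≪ volume) (hν : 0 < ν.real Set.univ)
    {ω : ℝ} (hω : 0 < ω)
    (H : ∀ a : ℝ, 2 * a ∈ S → ∃ K : ℝ, ∀ u : ℝ, 0 < u → ‖cf ν ((u : ℂ) + Complex.I * a)‖ ≤ K * u ^ (-ω)) :
    FiniteActivity ρ ∧ ∃ V, BernoulliDecomposition ρ V (ν.real Set.univ) (γ - ∫ x, x ∂ν) ∧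
      PowerLawErrorDecay V S ω := by
  refine ⟨⟨ν, h.hasLevyMeasure hρ, measure_lt_top _ _⟩, ?_⟩
  set Λ := ν.real Set.univ with hΛ
  have hE : 0 < Real.exp Λ - 1 := by linarith [Real.add_one_lt_exp hν.ne']
  have hix : Integrable (fun x : ℝ => x) ν := by
    refine (h.sq.add (integrable_const (1 : ℝ))).mono' (by fun_prop) (ae_of_all _ fun x => ?_)
    simp only [Pi.add_apply, Real.norm_eq_abs]
    nlinarith [sq_abs x, sq_nonneg (|x| - 1), abs_nonneg x]
  -- The series over at least one jump has mass `e^Λ - 1`; normalised, it is the law conditioned on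
  -- a jump.
  set V : Measure ℝ := ENNReal.ofReal (Real.exp Λ - 1)⁻¹ • jumpSeries ν with hV
  have hcfV : ∀ z, cf V z = ((Real.exp Λ - 1 : ℝ) : ℂ)⁻¹ * cf (jumpSeries ν) z := by
    intro z
    rw [hV, cf, integral_smul_measure, ENNReal.toReal_ofReal (by positivity), cf,
      Complex.real_smul, Complex.ofReal_inv]
  have hVfin : IsFiniteMeasure V := by
    rw [hV]; exact Measure.smul_finite _ ENNReal.ofReal_ne_top
  have hVp : IsProbabilityMeasure V := by
    rw [isProbabilityMeasure_iff_real, hV, measureReal_ennreal_smul_apply,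
      ENNReal.toReal_ofReal (by positivity), real_univ_jumpSeries]
    exact inv_mul_cancel₀ hE.ne'
  refine ⟨V, ⟨hν, hVp, ⟨ENNReal.ofReal Λ⁻¹ • ν, ?_, ?_, ?_⟩, ?_⟩, ?_⟩
  · rw [isProbabilityMeasure_iff_real, measureReal_ennreal_smul_apply,
      ENNReal.toReal_ofReal (by positivity)]
    field_simp
    rfl
  · exact hac.smul_left _
  · intro u
    have e : charFun (ENNReal.ofReal Λ⁻¹ • ν) u = (Λ : ℂ)⁻¹ * charFun ν u := by
      rw [charFun_eq_cf, charFun_eq_cf, cf, integral_smul_measure,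
        ENNReal.toReal_ofReal (by positivity), cf, Complex.real_smul, Complex.ofReal_inv]
    have hΛ' : (Λ : ℂ) ≠ 0 := by exact_mod_cast hν.ne'
    rw [e, mul_inv_cancel_left₀ hΛ', charFun_eq_cf V, hcfV, ← charFun_eq_cf, charFun_jumpSeries]
    push_cast
    rw [div_eq_inv_mul]
  · have hm : Measurable fun v : ℝ => γ - ∫ x, x ∂ν + v := by fun_prop
    -- The weights match because `(1 - e^{-Λ}) / (e^Λ - 1) = e^{-Λ}`.
    have e : ENNReal.ofReal (Real.exp (-Λ)) • Measure.dirac (γ - ∫ x, x ∂ν)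
        + ENNReal.ofReal (1 - Real.exp (-Λ)) • V.map (fun v => γ - ∫ x, x ∂ν + v)
        = compoundPoisson ν (γ - ∫ x, x ∂ν) := by
      rw [compoundPoisson, Measure.map_add _ _ hm, smul_add, Measure.map_dirac _, add_zero, hV,
        Measure.map_smul, smul_smul, ← ENNReal.ofReal_mul]
      · congr 3
        rw [← hΛ, Real.exp_neg]
        field_simp
      · rw [sub_nonneg, Real.exp_le_one_iff]; linarith
    rw [e]
    refine Measure.ext_of_charFun (funext fun u => ?_)
    rw [hρ, h.centered, charFun_eq_cf,
      (integrable_compoundPoisson _ (integrable_exp_I_mul_ofReal ν u)).2]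
    congr 1
    have h1 : Integrable (fun x : ℝ => Complex.I * u * x) ν := hix.ofReal.const_mul _
    have h2 := integrable_exp_I_mul_ofReal ν u
    have h3 : Integrable (fun x : ℝ => Complex.exp (Complex.I * u * x) - 1) ν :=
      h2.sub (integrable_const _)
    rw [integral_sub h3 h1, integral_sub h2 (integrable_const _),
      integral_const_mul, integral_complex_ofReal, integral_const, cf]
    push_cast
    simp only [Complex.real_smul, mul_one]
    ring
  · have hexp : ∀ a, 2 * a ∈ S → Integrable (fun x => Real.exp (-(2 * a * x))) ν := by
      intro a ha
      refine ((h.exp_moment _ ha).add (integrable_const (Real.exp |2 * a|))).mono' (by fun_prop)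
        (ae_of_all _ fun x => ?_)
      simp only [Pi.add_apply, Real.norm_eq_abs, Real.abs_exp]
      rcases le_total 1 |x| with hx | hx
      · have : 1 ≤ x ^ 2 := by rw [← sq_abs]; nlinarith
        nlinarith [Real.exp_pos (-(2 * a * x)), Real.exp_pos |2 * a|]
      · have : Real.exp (-(2 * a * x)) ≤ Real.exp |2 * a| := by
          refine Real.exp_le_exp.2 ((neg_le_abs _).trans ?_)
          rw [abs_mul]
          nlinarith [abs_nonneg (2 * a)]
        nlinarith [mul_nonneg (sq_nonneg x) (Real.exp_pos (-(2 * a * x))).le]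
    refine powerLawErrorDecay_of_norm_cf_le hω fun a _ ha => ⟨?_, ?_⟩
    · have h1 : Integrable (fun x : ℝ => Complex.exp (Complex.I * (Complex.I * (2 * a : ℝ)) * x)) ν :=
        integrable_exp_I_mul_iff.2 (by simpa using hexp a ha)
      have h2 := integrable_exp_I_mul_iff.1 (integrable_jumpSeries h1)
      rw [hV]
      exact (by simpa using h2 : Integrable (fun x => Real.exp (-(2 * a * x))) _).smul_measure
        ENNReal.ofReal_ne_top
    · obtain ⟨K, hK⟩ := H a ha
      set A := ∫ x, Real.exp (-(a * x)) ∂ν with hA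
      have hia : Integrable (fun x => Real.exp (-(a * x))) ν := integrable_exp_neg_of_two_mul (hexp a ha)
      have hK0 : 0 ≤ K := by
        have := (norm_nonneg _).trans (hK 1 one_pos)
        simpa using this
      refine ⟨(Real.exp Λ - 1)⁻¹ * (K * Real.exp A), fun u hu => ?_⟩
      have hz : Integrable (fun x : ℝ => Complex.exp (Complex.I * ((u : ℂ) + Complex.I * a) * x)) ν :=
        integrable_exp_I_mul_iff.2 (by simpa using hia)
      rw [hcfV, cf_jumpSeries hz, norm_mul, norm_inv, Complex.norm_real, Real.norm_eq_abs,
        abs_of_pos hE, mul_assoc]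
      refine mul_le_mul_of_nonneg_left ?_ (by positivity)
      have hn : ‖cf ν ((u : ℂ) + Complex.I * a)‖ ≤ A := by
        refine (norm_integral_le_integral_norm _).trans_eq ?_
        rw [hA]
        congr 1
        funext x
        rw [norm_exp_I_mul]
        simp
      -- The transform of `V` is a multiple of `e^w - 1` with `w` the transform of `ν`, so this
      -- inequality transfers the decay from `ν` to `V`.
      have hw : ∀ w : ℂ, ‖Complex.exp w - 1‖ ≤ ‖w‖ * Real.exp ‖w‖ := by
        intro w
        simpa using Complex.norm_exp_sub_sum_le_norm_mul_exp w 1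
      calc _ ≤ _ := hw _
        _ ≤ K * u ^ (-ω) * Real.exp A := by
          have := hK u hu
          gcongr
        _ = _ := by ring

end IsLevyExponent

/-! ### The Lévy measure of the Ornstein–Uhlenbeck increment, and operations on exponents -/

/-- The Lévy measure of `∫₀ᵗ exp(-b s) dL_s`, where `ν` is the Lévy measure of `L`. -/
def ouMeasure (b t : ℝ) (ν : Measure ℝ) : Measure ℝ :=
  ((volume.restrict (Set.Ioc 0 t)).prod ν).map fun q => Real.exp (-b * q.1) * q.2

theorem measurable_ou_map (b : ℝ) : Measurable fun q : ℝ × ℝ => Real.exp (-b * q.1) * q.2 := by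
  fun_prop

theorem ae_fst_mem_Ioc (t : ℝ) (ν : Measure ℝ) [SFinite ν] :
    ∀ᵐ q ∂(volume.restrict (Set.Ioc 0 t)).prod ν, q.1 ∈ Set.Ioc 0 t :=
  Measure.quasiMeasurePreserving_fst.ae (ae_restrict_mem measurableSet_Ioc)

theorem ouMeasure_apply (b t : ℝ) (ν : Measure ℝ) [SFinite ν] {A : Set ℝ} (hA : MeasurableSet A) :
    ouMeasure b t ν A = ∫⁻ s in Set.Ioc 0 t, ν {x | Real.exp (-b * s) * x ∈ A} := by
  rw [ouMeasure, Measure.map_apply (measurable_ou_map b) hA,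
    Measure.prod_apply ((measurable_ou_map b) hA)]
  rfl

theorem ouMeasure_singleton_zero (b t : ℝ) {ν : Measure ℝ} [SFinite ν] (h : ν {0} = 0) :
    ouMeasure b t ν {0} = 0 := by
  rw [ouMeasure_apply b t ν (measurableSet_singleton 0)]
  simp [h]

theorem ouMeasure_absolutelyContinuous (b t : ℝ) {ν : Measure ℝ} [SFinite ν] (h : ν ≪ volume) :
    ouMeasure b t ν ≪ volume := by
  refine Measure.AbsolutelyContinuous.mk fun A hA h0 => ?_
  rw [ouMeasure_apply b t ν hA]
  refine (lintegral_congr fun s => ?_).trans lintegral_zero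
  refine h ?_
  have := Real.volume_preimage_mul_left (Real.exp_pos (-b * s)).ne' A
  rw [h0, mul_zero] at this
  exact this

theorem ouMeasure_univ (b t : ℝ) (ν : Measure ℝ) [SFinite ν] :
    ouMeasure b t ν Set.univ = ENNReal.ofReal t * ν Set.univ := by
  rw [ouMeasure_apply b t ν MeasurableSet.univ]
  simp [mul_comm]

theorem real_univ_ouMeasure (b : ℝ) {t : ℝ} (ht : 0 ≤ t) (ν : Measure ℝ) [SFinite ν] :
    (ouMeasure b t ν).real Set.univ = t * ν.real Set.univ := by
  rw [measureReal_def, ouMeasure_univ, ENNReal.toReal_mul, ENNReal.toReal_ofReal ht,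
    measureReal_def]

instance isFiniteMeasure_ouMeasure (b t : ℝ) (ν : Measure ℝ) [IsFiniteMeasure ν] :
    IsFiniteMeasure (ouMeasure b t ν) :=
  ⟨by rw [ouMeasure_univ]; exact ENNReal.mul_lt_top ENNReal.ofReal_lt_top (measure_lt_top _ _)⟩

theorem integrable_ouMeasure_of_le {E : Type*} [NormedAddCommGroup E] {b t : ℝ} {ν : Measure ℝ}
    [SFinite ν] {f : ℝ → E} (hf : StronglyMeasurable f) {g : ℝ → ℝ}
    (hg : Integrable g ν)
    (h : ∀ s ∈ Set.Ioc 0 t, ∀ x, ‖f (Real.exp (-b * s) * x)‖ ≤ g x) :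
    Integrable f (ouMeasure b t ν) := by
  rw [ouMeasure, integrable_map_measure hf.aestronglyMeasurable (by fun_prop)]
  refine (hg.comp_snd (volume.restrict (Set.Ioc 0 t))).mono'
    (hf.comp_measurable (measurable_ou_map b)).aestronglyMeasurable ?_
  filter_upwards [ae_fst_mem_Ioc t ν] with q hq
  exact h q.1 hq q.2

theorem integral_ouMeasure {E : Type*} [NormedAddCommGroup E] [NormedSpace ℝ E] (b : ℝ)
    {t : ℝ} (ht : 0 ≤ t) {ν : Measure ℝ} [SFinite ν] {f : ℝ → E} (hf : StronglyMeasurable f)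
    (hi : Integrable f (ouMeasure b t ν)) :
    IntervalIntegrable (fun s => ∫ x, f (Real.exp (-b * s) * x) ∂ν) volume 0 t ∧
    ∫ x, f x ∂ouMeasure b t ν = ∫ s in (0 : ℝ)..t, ∫ x, f (Real.exp (-b * s) * x) ∂ν := by
  rw [ouMeasure, integrable_map_measure hf.aestronglyMeasurable (by fun_prop)] at hi
  rw [intervalIntegrable_iff_integrableOn_Ioc_of_le ht, intervalIntegral.integral_of_le ht,
    ouMeasure, integral_map (by fun_prop) hf.aestronglyMeasurable]
  exact ⟨hi.integral_prod_left, integral_prod _ hi⟩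

theorem exp_neg_mul_mem {b t s : ℝ} (hb : 0 < b) (hs : s ∈ Set.Ioc 0 t) :
    Real.exp (-b * t) ≤ Real.exp (-b * s) ∧ Real.exp (-b * s) ≤ 1 := by
  refine ⟨Real.exp_le_exp.2 ?_, Real.exp_le_one_iff.2 ?_⟩ <;> nlinarith [hs.1, hs.2]

theorem integral_exp_neg_mul {b : ℝ} (hb : 0 < b) (t : ℝ) :
    ∫ s in (0 : ℝ)..t, Real.exp (-b * s) = (1 - Real.exp (-b * t)) / b := by
  rw [intervalIntegral.integral_comp_mul_left (fun x => Real.exp x) (neg_ne_zero.2 hb.ne')]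
  simp
  field_simp
  ring

theorem integrable_sq_ouMeasure {b t : ℝ} (hb : 0 < b) {ν : Measure ℝ} [SFinite ν]
    (h : Integrable (fun x => x ^ 2) ν) : Integrable (fun x => x ^ 2) (ouMeasure b t ν) := by
  refine integrable_ouMeasure_of_le (by fun_prop) h fun s hs x => ?_
  obtain ⟨-, h1⟩ := exp_neg_mul_mem hb hs
  rw [Real.norm_eq_abs, abs_of_nonneg (by positivity), mul_pow]
  have := Real.exp_pos (-b * s)
  exact mul_le_of_le_one_left (sq_nonneg x) (by nlinarith)

theorem integrable_id_ouMeasure {b t : ℝ} (hb : 0 < b) {ν : Measure ℝ} [SFinite ν]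
    (h : Integrable (fun x => x) ν) : Integrable (fun x => x) (ouMeasure b t ν) := by
  refine integrable_ouMeasure_of_le (by fun_prop) h.abs fun s hs x => ?_
  obtain ⟨-, h1⟩ := exp_neg_mul_mem hb hs
  rw [Real.norm_eq_abs, abs_mul, Real.abs_exp]
  exact mul_le_of_le_one_left (abs_nonneg x) h1

theorem exp_scaled_le {c x r : ℝ} (h0 : 0 ≤ r) (h1 : r ≤ 1) :
    Real.exp (-(c * (r * x))) ≤ 1 + Real.exp (-(c * x)) := by
  rcases le_total 0 (c * x) with h | h
  · have : Real.exp (-(c * (r * x))) ≤ 1 := Real.exp_le_one_iff.2 (by nlinarith)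
    linarith [Real.exp_pos (-(c * x))]
  · have : Real.exp (-(c * (r * x))) ≤ Real.exp (-(c * x)) := Real.exp_le_exp.2 (by nlinarith)
    linarith

/-- The Lévy–Khintchine formula is integrated over `s` by Fubini, and the mean is multiplied by `∫₀ᵗ
e^{-bs} ds`. The factor `e^{-bs} ≤ 1` only shrinks jumps, so the strip survives. -/
theorem IsLevyExponent.ou {b t : ℝ} (hb : 0 < b) (ht : 0 ≤ t) {ν : Measure ℝ} [SFinite ν] {γ : ℝ}
    {ψ : ℝ → ℂ} {S : Set ℝ} (h : IsLevyExponent ν γ ψ S) :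
    IsLevyExponent (ouMeasure b t ν) ((1 - Real.exp (-b * t)) / b * γ)
      (fun u => ∫ s in (0 : ℝ)..t, ψ (Real.exp (-b * s) * u)) S where
  zero := ouMeasure_singleton_zero b t h.zero
  sq := integrable_sq_ouMeasure hb h.sq
  exp_moment := fun c hc => by
    refine integrable_ouMeasure_of_le (by fun_prop) (h.sq.add (h.exp_moment c hc))
      fun s hs x => ?_
    obtain ⟨-, h1⟩ := exp_neg_mul_mem hb hs
    have h0 := Real.exp_pos (-b * s)
    rw [Real.norm_eq_abs, abs_of_nonneg (by positivity), mul_pow]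
    have h2 := exp_scaled_le (c := c) (x := x) h0.le h1
    calc Real.exp (-b * s) ^ 2 * x ^ 2 * Real.exp (-(c * (Real.exp (-b * s) * x)))
        ≤ 1 * x ^ 2 * (1 + Real.exp (-(c * x))) := by
          gcongr
          nlinarith
      _ = _ := by simp only [Pi.add_apply]; ring
  centered := fun u => by
    obtain ⟨h1, h2⟩ := integral_ouMeasure b ht (E := ℂ) (by fun_prop)
      (integrable_centered_ofReal (integrable_sq_ouMeasure (t := t) hb h.sq) u)
    rw [h2]
    have e : ∀ s : ℝ, ψ (Real.exp (-b * s) * u) = Complex.I * u * γ * (Real.exp (-b * s) : ℝ)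
        + ∫ x : ℝ, (Complex.exp (Complex.I * u * (Real.exp (-b * s) * x : ℝ)) - 1
          - Complex.I * u * (Real.exp (-b * s) * x : ℝ)) ∂ν := by
      intro s
      rw [h.centered]
      congr 1
      · push_cast; ring
      · congr 1
        funext x
        push_cast
        ring_nf
    simp_rw [e]
    rw [intervalIntegral.integral_add ((Continuous.intervalIntegrable (by fun_prop) _ _)) h1,
      intervalIntegral.integral_const_mul, intervalIntegral.integral_ofReal,
      integral_exp_neg_mul hb]
    push_cast
    ring

/-- Shrinking keeps a jump of size at most `y` inside `[-y, y]`, and its square loses at most the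
factor `e^{-2bt}`. Hence the index is unchanged. -/
theorem SmallJumpBound.ou {b t ω : ℝ} (hb : 0 < b) (ht : 0 < t) {ν : Measure ℝ} [SFinite ν]
    (h2 : Integrable (fun x => x ^ 2) ν) (h : SmallJumpBound ν ω) :
    SmallJumpBound (ouMeasure b t ν) ω := by
  obtain ⟨C, hC, h⟩ := h
  refine ⟨t * Real.exp (-b * t) ^ 2 * C, by positivity, fun y hy hy1 => ?_⟩
  have hm : StronglyMeasurable (Set.indicator (Set.Icc (-y) y) fun x : ℝ => x ^ 2) :=
    (by fun_prop : StronglyMeasurable fun x : ℝ => x ^ 2).indicator measurableSet_Icc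
  obtain ⟨h1, h3⟩ := integral_ouMeasure b ht.le hm
    ((integrable_sq_ouMeasure (t := t) hb h2).indicator measurableSet_Icc)
  rw [integral_indicator measurableSet_Icc] at h3
  rw [h3]
  have h4 : ∫ s in (0 : ℝ)..t, Real.exp (-b * t) ^ 2 * (C * y ^ (2 - ω))
      ≤ ∫ s in (0 : ℝ)..t, ∫ x, Set.indicator (Set.Icc (-y) y) (fun x : ℝ => x ^ 2)
        (Real.exp (-b * s) * x) ∂ν := by
    refine intervalIntegral.integral_mono_on_of_le_Ioo ht.le (by simp) h1 fun s hs => ?_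
    obtain ⟨e1, e2⟩ := exp_neg_mul_mem hb (Set.Ioo_subset_Ioc_self hs)
    have e0 := Real.exp_pos (-b * s)
    calc Real.exp (-b * t) ^ 2 * (C * y ^ (2 - ω))
        ≤ Real.exp (-b * t) ^ 2 * ∫ x in Set.Icc (-y) y, x ^ 2 ∂ν := by
          gcongr
          exact h y hy hy1
      _ = ∫ x, Set.indicator (Set.Icc (-y) y) (fun x => Real.exp (-b * t) ^ 2 * x ^ 2) x ∂ν := by
          rw [integral_indicator measurableSet_Icc, integral_const_mul]
      _ ≤ _ := by
          refine integral_mono_of_nonneg (ae_of_all _ fun x => ?_) ?_ (ae_of_all _ fun x => ?_)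
          · exact Set.indicator_nonneg (fun x _ => by positivity) x
          · refine h2.mono' (hm.comp_measurable (by fun_prop)).aestronglyMeasurable
              (ae_of_all _ fun x => ?_)
            rw [Real.norm_eq_abs, abs_of_nonneg (Set.indicator_nonneg (fun x _ => by positivity) _)]
            refine (Set.indicator_le_self' (fun _ _ => by positivity) _).trans ?_
            rw [mul_pow]
            exact mul_le_of_le_one_left (sq_nonneg x) (by nlinarith)
          · by_cases hx : x ∈ Set.Icc (-y) y
            · have hx' : Real.exp (-b * s) * x ∈ Set.Icc (-y) y := by
                refine abs_le.1 ?_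
                rw [abs_mul, Real.abs_exp]
                exact (mul_le_of_le_one_left (abs_nonneg x) e2).trans (abs_le.2 hx)
              simp only [Set.indicator_of_mem hx, Set.indicator_of_mem hx', mul_pow]
              gcongr
            · rw [Set.indicator_of_notMem hx]
              exact Set.indicator_nonneg (fun x _ => by positivity) _
  refine le_trans (le_of_eq ?_) h4
  rw [intervalIntegral.integral_const, smul_eq_mul]
  ring

theorem integral_id_ouMeasure {b t : ℝ} (hb : 0 < b) (ht : 0 ≤ t) {ν : Measure ℝ} [SFinite ν]
    (h : Integrable (fun x => x) ν) :
    ∫ x, x ∂ouMeasure b t ν = (1 - Real.exp (-b * t)) / b * ∫ x, x ∂ν := by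
  rw [(integral_ouMeasure b ht (f := fun x : ℝ => x) (by fun_prop)
    (integrable_id_ouMeasure hb h)).2]
  have e : ∀ s : ℝ, ∫ x : ℝ, Real.exp (-b * s) * x ∂ν = Real.exp (-b * s) * ∫ x, x ∂ν := fun s =>
    integral_const_mul _ _
  simp only [e]
  rw [intervalIntegral.integral_mul_const, integral_exp_neg_mul hb]

theorem norm_cf_ouMeasure_le {b t : ℝ} (hb : 0 < b) (ht : 0 ≤ t) {ν : Measure ℝ} [IsFiniteMeasure ν]
    {z : ℂ} (hi : Integrable (fun x => Real.exp (-(z.im * x))) ν) {K : ℝ}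
    (hK : ∀ s ∈ Set.Ioc 0 t, ‖cf ν ((Real.exp (-b * s) : ℝ) * z)‖ ≤ K) :
    ‖cf (ouMeasure b t ν) z‖ ≤ K * t := by
  have h1 : Integrable (fun x : ℝ => Complex.exp (Complex.I * z * x)) (ouMeasure b t ν) := by
    refine integrable_ouMeasure_of_le (by fun_prop) ((integrable_const (1 : ℝ)).add hi)
      fun s hs x => ?_
    obtain ⟨-, h1⟩ := exp_neg_mul_mem hb hs
    rw [norm_exp_I_mul]
    exact exp_scaled_le (Real.exp_pos _).le h1
  rw [cf, (integral_ouMeasure b ht (by fun_prop) h1).2]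
  refine (intervalIntegral.norm_integral_le_of_norm_le_const (C := K) fun s hs => ?_).trans_eq
    (by rw [sub_zero, abs_of_nonneg ht])
  rw [Set.uIoc_of_le ht] at hs
  refine le_of_eq_of_le (congrArg norm ?_) (hK s hs)
  rw [cf]
  congr 1
  funext x
  push_cast
  ring_nf

/-- Finite activity of the driver: the compound Poisson case. -/
theorem IsLevyExponent.bernoulliDecomposition_ou {b t : ℝ} (hb : 0 < b) (ht : 0 < t)
    {ν : Measure ℝ} [IsFiniteMeasure ν] {γ : ℝ} {ψ : ℝ → ℂ} {S : Set ℝ}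
    (h : IsLevyExponent ν γ ψ S) {ρ : Measure ℝ} [IsProbabilityMeasure ρ]
    (hρ : ∀ u, charFun ρ u = Complex.exp (∫ s in (0 : ℝ)..t, ψ (Real.exp (-b * s) * u)))
    (hac : ν ≪ volume) (hν : 0 < ν.real Set.univ) (hix : Integrable (fun x => x) ν)
    {ω : ℝ} (hω : 0 < ω)
    (he : ∀ a : ℝ, 2 * a ∈ S → Integrable (fun x => Real.exp (-(a * x))) ν)
    (H : ∀ a : ℝ, 2 * a ∈ S → ∃ K : ℝ, ∀ u : ℝ, 1 ≤ u → ∀ s ∈ Set.Ioc 0 t,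
      ‖cf ν ((Real.exp (-b * s) : ℝ) * ((u : ℂ) + Complex.I * a))‖ ≤ K * u ^ (-ω)) :
    FiniteActivity ρ ∧ ∃ V, BernoulliDecomposition ρ V (ν.real Set.univ * t)
      ((1 - Real.exp (-b * t)) / b * (γ - ∫ x, x ∂ν)) ∧ PowerLawErrorDecay V S ω := by
  have h' := h.ou hb ht.le
  have := h'.bernoulliDecomposition hρ (ouMeasure_absolutelyContinuous b t hac)
    (by rw [real_univ_ouMeasure b ht.le]; positivity) hω fun a ha => by
      obtain ⟨K, hK⟩ := H a ha
      set A := ∫ x, (1 + Real.exp (-(a * x))) ∂ν with hA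
      have hA0 : 0 ≤ A := integral_nonneg fun x => by positivity
      have hK0 : 0 ≤ K := by
        have := (norm_nonneg _).trans (hK 1 le_rfl t ⟨ht, le_rfl⟩)
        simpa using this
      refine ⟨(K + A) * t, fun u hu => (norm_cf_ouMeasure_le (K := (K + A) * u ^ (-ω)) hb ht.le
        (by simpa using he a ha) fun s hs => ?_).trans_eq (by ring)⟩
      have hu0 : 0 ≤ u ^ (-ω) := by positivity
      -- The decay hypothesis concerns `u ≥ 1`; below `1` the factor `u^{-ω}` is at least `1`, and
      -- the exponential moment `A` is a sufficient bound.
      rcases le_total 1 u with h1 | h1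
      · nlinarith [hK u h1 s hs, mul_nonneg hA0 hu0]
      · have h2 : 1 ≤ u ^ (-ω) :=
          Real.one_le_rpow_of_pos_of_le_one_of_nonpos hu h1 (by linarith)
        have h3 : ‖cf ν ((Real.exp (-b * s) : ℝ) * ((u : ℂ) + Complex.I * a))‖ ≤ A := by
          refine norm_integral_le_of_norm_le ((integrable_const _).add (he a ha))
            (ae_of_all _ fun x => ?_)
          rw [norm_exp_I_mul]
          have := exp_scaled_le (c := a) (x := x) (Real.exp_pos (-b * s)).le
            (exp_neg_mul_mem hb hs).2
          refine le_of_eq_of_le ?_ this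
          rw [Complex.im_ofReal_mul]
          congr 2
          simp
          ring
        nlinarith [mul_nonneg hK0 hu0]
  rw [real_univ_ouMeasure b ht.le, integral_id_ouMeasure hb ht.le hix, mul_comm t,
    ← mul_sub] at this
  exact this

namespace IsLevyExponent

variable {ν ν' : Measure ℝ} {γ γ' : ℝ} {ψ ψ' : ℝ → ℂ} {S : Set ℝ}

theorem mono (h : IsLevyExponent ν γ ψ S) {T : Set ℝ} (hT : T ⊆ S) : IsLevyExponent ν γ ψ T :=
  ⟨h.zero, h.sq, h.centered, fun c hc => h.exp_moment c (hT hc)⟩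

theorem drift (γ : ℝ) (S : Set ℝ) : IsLevyExponent 0 γ (fun u => Complex.I * u * γ) S :=
  ⟨by simp, by simp, fun u => by simp, fun c _ => by simp⟩

theorem add (h : IsLevyExponent ν γ ψ S) (h' : IsLevyExponent ν' γ' ψ' S) :
    IsLevyExponent (ν + ν') (γ + γ') (fun u => ψ u + ψ' u) S where
  zero := by simp [h.zero, h'.zero]
  sq := h.sq.add_measure h'.sq
  exp_moment := fun c hc => (h.exp_moment c hc).add_measure (h'.exp_moment c hc)
  centered := fun u => by
    beta_reduce
    rw [h.centered u, h'.centered u, integral_add_measure (integrable_centered_ofReal h.sq u)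
      (integrable_centered_ofReal h'.sq u)]
    push_cast
    ring

theorem smul (h : IsLevyExponent ν γ ψ S) {c : ℝ} (hc : 0 ≤ c) :
    IsLevyExponent (ENNReal.ofReal c • ν) (c * γ) (fun u => c * ψ u) S where
  zero := by simp [h.zero]
  sq := h.sq.smul_measure ENNReal.ofReal_ne_top
  exp_moment := fun c hc => (h.exp_moment c hc).smul_measure ENNReal.ofReal_ne_top
  centered := fun u => by
    beta_reduce
    rw [h.centered u, integral_smul_measure, ENNReal.toReal_ofReal hc, Complex.real_smul]
    push_cast
    ring

theorem neg (h : IsLevyExponent ν γ ψ S) :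
    IsLevyExponent (ν.map fun x => -x) (-γ) (fun u => ψ (-u)) {a | -a ∈ S} where
  zero := by
    rw [Measure.map_apply (by fun_prop) (measurableSet_singleton 0)]
    simpa using h.zero
  sq := by
    rw [integrable_map_measure (by fun_prop) (by fun_prop)]
    simpa [Function.comp_def] using h.sq
  exp_moment := fun c hc => by
    rw [integrable_map_measure (by fun_prop) (by fun_prop)]
    simpa [Function.comp_def] using h.exp_moment _ hc
  centered := fun u => by
    beta_reduce
    rw [h.centered (-u), integral_map (by fun_prop) (by fun_prop)]
    push_cast
    congr 1
    · ring
    · congr 1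
      funext x
      ring_nf

/-- A side that is switched off by `c = 0` has no constraint on its strip. -/
theorem smul_strip (h : IsLevyExponent ν γ ψ S) {c : ℝ} (hc : 0 ≤ c) :
    IsLevyExponent (ENNReal.ofReal c • ν) (c * γ) (fun u => c * ψ u) {a | 0 < c → a ∈ S} := by
  rcases hc.eq_or_lt with rfl | hc'
  · simpa using drift 0 {a : ℝ | (0 : ℝ) < 0 → a ∈ S}
  · exact (h.smul hc).mono fun a ha => ha hc'

/-- Continuity of the exponent is what makes the Riemann sums of the Ornstein–Uhlenbeck exponent
converge. -/
theorem continuous (h : IsLevyExponent ν γ ψ S) : Continuous ψ := by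
  rw [show ψ = fun u : ℝ => Complex.I * u * γ
    + ∫ x : ℝ, (Complex.exp (Complex.I * u * x) - 1 - Complex.I * u * x) ∂ν from
    funext h.centered]
  refine Continuous.add (by fun_prop) (continuous_iff_continuousAt.2 fun u₀ => ?_)
  refine continuousAt_of_dominated (bound := fun x => (|u₀| + 1) ^ 2 * (x ^ 2 + x ^ 2))
    (Eventually.of_forall fun u => by fun_prop) ?_ ((h.sq.add h.sq).const_mul _)
    (ae_of_all _ fun x => by fun_prop)
  filter_upwards [Metric.ball_mem_nhds u₀ one_pos] with u hu
  refine ae_of_all _ fun x => (norm_centered_le u x).trans ?_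
  rw [Complex.norm_real, Real.norm_eq_abs, Complex.ofReal_im, zero_mul, neg_zero, Real.exp_zero,
    mul_one]
  have : |u| ≤ |u₀| + 1 := by
    rw [Metric.mem_ball, Real.dist_eq] at hu
    linarith [abs_sub_abs_le_abs_sub u u₀]
  gcongr

end IsLevyExponent

/-- If `b u ψ'(u) = χ(u)` then `ψ(u) - ψ(exp(-b t) u)` is the exponent of the increment of the
Ornstein–Uhlenbeck process driven by a Lévy process with exponent `χ`. -/
theorem sub_eq_integral_of_hasDerivAt {b t : ℝ} {ψ χ D : ℝ → ℂ} (hχ : Continuous χ)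
    (hD : ∀ u, HasDerivAt ψ (D u) u) (hχD : ∀ u, b * (u * D u) = χ u) (u : ℝ) :
    ψ u - ψ (Real.exp (-b * t) * u) = ∫ s in (0 : ℝ)..t, χ (Real.exp (-b * s) * u) := by
  -- Along the flow `s ↦ e^{-bs} u` the derivative of `-ψ` is `b v ψ'(v) = χ(v)` at `v = e^{-bs} u`.
  have h1 : ∀ s : ℝ, HasDerivAt (fun s => -ψ (Real.exp (-b * s) * u))
      (χ (Real.exp (-b * s) * u)) s := by
    intro s
    have h2 : HasDerivAt (fun s : ℝ => Real.exp (-b * s) * u) (Real.exp (-b * s) * (-b * 1) * u) s :=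
      (((hasDerivAt_id s).const_mul (-b)).exp).mul_const u
    refine ((hD (Real.exp (-b * s) * u)).scomp s h2).neg.congr_deriv ?_
    rw [← hχD, Complex.real_smul]
    push_cast
    ring
  rw [intervalIntegral.integral_eq_sub_of_hasDerivAt (fun s _ => h1 s)
    (Continuous.intervalIntegrable (by fun_prop) _ _)]
  simp
  ring

theorem SmallJumpBound.mono {ν ν' : Measure ℝ} {ω : ℝ} (h : SmallJumpBound ν ω) (hle : ν ≤ ν')
    (h2 : Integrable (fun x => x ^ 2) ν') : SmallJumpBound ν' ω := by
  obtain ⟨C, hC, h⟩ := h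
  refine ⟨C, hC, fun y hy hy1 => (h y hy hy1).trans ?_⟩
  exact integral_mono_measure (Measure.restrict_mono subset_rfl hle)
    (ae_of_all _ fun x => sq_nonneg x) h2.integrableOn

theorem SmallJumpBound.smul {ν : Measure ℝ} {ω : ℝ} (h : SmallJumpBound ν ω) {c : ℝ} (hc : 0 < c) :
    SmallJumpBound (ENNReal.ofReal c • ν) ω := by
  obtain ⟨C, hC, h⟩ := h
  refine ⟨c * C, by positivity, fun y hy hy1 => ?_⟩
  rw [Measure.restrict_smul, integral_smul_measure, ENNReal.toReal_ofReal hc.le, smul_eq_mul,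
    mul_assoc]
  exact mul_le_mul_of_nonneg_left (h y hy hy1) hc.le

theorem SmallJumpBound.neg {ν : Measure ℝ} {ω : ℝ} (h : SmallJumpBound ν ω) :
    SmallJumpBound (ν.map fun x => -x) ω := by
  obtain ⟨C, hC, h⟩ := h
  refine ⟨C, hC, fun y hy hy1 => (h y hy hy1).trans_eq ?_⟩
  rw [setIntegral_map measurableSet_Icc (by fun_prop) (by fun_prop)]
  simp

/-! ### One-sided tempered stable Lévy measures -/

/-- The Lévy measure with density `exp(-β x) / x^(1+α)` on `(0, ∞)`. -/
def tsMeasure (α β : ℝ) : Measure ℝ :=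
  (volume.restrict (Set.Ioi 0)).withDensity
    fun x => ENNReal.ofReal (x ^ (-1 - α) * Real.exp (-(β * x)))

instance (α β : ℝ) : SFinite (tsMeasure α β) := by
  rw [tsMeasure]; infer_instance

theorem tsMeasure_absolutelyContinuous (α β : ℝ) : tsMeasure α β ≪ volume :=
  (withDensity_absolutelyContinuous _ _).trans Measure.absolutelyContinuous_restrict

theorem ae_tsMeasure_pos (α β : ℝ) : ∀ᵐ x ∂tsMeasure α β, 0 < x :=
  (withDensity_absolutelyContinuous _ _).ae_le (ae_restrict_mem measurableSet_Ioi)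

section tsIntegral

variable {E : Type*} [NormedAddCommGroup E] [NormedSpace ℝ E]

theorem integrable_tsMeasure_iff {α β : ℝ} {f : ℝ → E} : Integrable f (tsMeasure α β) ↔
    IntegrableOn (fun x => (x ^ (-1 - α) * Real.exp (-(β * x))) • f x) (Set.Ioi 0) := by
  rw [tsMeasure, integrable_withDensity_iff_integrable_smul' (by fun_prop) (by simp)]
  refine integrable_congr ?_
  filter_upwards [ae_restrict_mem measurableSet_Ioi] with x hx
  have hx' : 0 < x := hx
  rw [ENNReal.toReal_ofReal (by positivity)]

theorem integral_tsMeasure (α β : ℝ) (f : ℝ → E) : ∫ x, f x ∂tsMeasure α β =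
    ∫ x in Set.Ioi 0, (x ^ (-1 - α) * Real.exp (-(β * x))) • f x := by
  rw [tsMeasure, integral_withDensity_eq_integral_toReal_smul (by fun_prop) (by simp)]
  refine integral_congr_ae ?_
  filter_upwards [ae_restrict_mem measurableSet_Ioi] with x hx
  have hx' : 0 < x := hx
  rw [ENNReal.toReal_ofReal (by positivity)]

end tsIntegral

theorem integrableOn_rpow_mul_exp {s β : ℝ} (hs : 0 < s) (hβ : 0 < β) :
    IntegrableOn (fun x : ℝ => x ^ (s - 1) * Real.exp (-(β * x))) (Set.Ioi 0) := by
  have := integrableOn_rpow_mul_exp_neg_mul_rpow (p := 1) (s := s - 1) (by linarith) one_pos hβ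
  simpa using this

theorem integrable_rpow_mul_exp_tsMeasure {α β q c : ℝ} (hq : α < q) (hc : -β < c) :
    Integrable (fun x => x ^ q * Real.exp (-(c * x))) (tsMeasure α β) := by
  rw [integrable_tsMeasure_iff]
  refine (integrableOn_rpow_mul_exp (s := q - α) (β := β + c) (by linarith)
    (by linarith)).congr_fun (fun x hx => ?_) measurableSet_Ioi
  have hx' : 0 < x := hx
  simp only [smul_eq_mul]
  rw [show q - α - 1 = (-1 - α) + q by ring, Real.rpow_add hx',
    show -((β + c) * x) = -(β * x) + -(c * x) by ring, Real.exp_add]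
  ring

theorem integrable_sq_mul_exp_tsMeasure {α β c : ℝ} (hα : α < 2) (hc : -β < c) :
    Integrable (fun x => x ^ 2 * Real.exp (-(c * x))) (tsMeasure α β) := by
  simpa using integrable_rpow_mul_exp_tsMeasure hα hc

theorem integrable_id_tsMeasure {α β : ℝ} (hα : α < 1) (hβ : 0 < β) :
    Integrable (fun x => x) (tsMeasure α β) := by
  simpa using integrable_rpow_mul_exp_tsMeasure (c := 0) hα (by linarith)

theorem integrable_exp_tsMeasure {α β c : ℝ} (hα : α < 0) (hc : -β < c) :
    Integrable (fun x => Real.exp (-(c * x))) (tsMeasure α β) := by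
  simpa using integrable_rpow_mul_exp_tsMeasure hα hc

theorem isFiniteMeasure_tsMeasure {α β : ℝ} (hα : α < 0) (hβ : 0 < β) :
    IsFiniteMeasure (tsMeasure α β) := by
  have := integrable_exp_tsMeasure (c := 0) hα (by linarith : -β < 0)
  simp only [zero_mul, neg_zero, Real.exp_zero] at this
  exact (integrable_const_iff_isFiniteMeasure one_ne_zero).1 this

theorem tsMeasure_singleton_zero (α β : ℝ) : tsMeasure α β {0} = 0 :=
  tsMeasure_absolutelyContinuous α β (by simp)

theorem one_sub_div_mem_slitPlane {β : ℝ} (hβ : 0 < β) {w : ℂ} (hw : w.re < β) :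
    1 - w / β ∈ Complex.slitPlane := by
  left
  rw [Complex.sub_re, Complex.div_ofReal_re, Complex.one_re, sub_pos, div_lt_one hβ]
  exact hw

/-- The Gamma integral at a complex rate. -/
theorem integral_rpow_mul_cexp {s β : ℝ} (hs : 0 < s) (hβ : 0 < β) {w : ℂ} (hw : w.re < β) :
    ∫ x in Set.Ioi (0 : ℝ), (x ^ (s - 1) * Real.exp (-(β * x))) • Complex.exp (w * x)
      = (Real.Gamma s * β ^ (-s) : ℝ) * (1 - w / β) ^ (-s : ℂ) := by
  set m := tsMeasure (-s) β with hm
  have hint : ∀ x : ℂ, ∫ y in Set.Ioi (0 : ℝ), (y ^ (s - 1) * Real.exp (-(β * y))) •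
      Complex.exp (x * y) = complexMGF id m x := by
    intro x
    rw [complexMGF, hm, integral_tsMeasure]
    simp only [id, sub_neg_eq_add, neg_add_eq_sub]
  have hset : Set.Iio β ⊆ integrableExpSet id m := by
    intro c hc
    have := integrable_exp_tsMeasure (α := -s) (β := β) (c := -c) (by linarith)
      (neg_lt_neg hc)
    simpa [integrableExpSet] using this
  have hset' : ∀ z : ℂ, z.re < β → z.re ∈ interior (integrableExpSet id m) := fun z hz =>
    interior_maximal hset isOpen_Iio hz
  -- Both sides are analytic on this half-plane and agree for real `w`, where the integral is the
  -- classical one; the identity theorem extends the equality.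
  set U : Set ℂ := {z | z.re < β} with hU
  have hUo : IsOpen U := isOpen_lt Complex.continuous_re continuous_const
  have hUc : IsPreconnected U := (convex_halfSpace_re_lt β).isPreconnected
  have hF : AnalyticOnNhd ℂ (complexMGF id m) U := fun z hz => analyticAt_complexMGF (hset' z hz)
  have hG : AnalyticOnNhd ℂ (fun w : ℂ => (Real.Gamma s * β ^ (-s) : ℝ)
      * (1 - w / β) ^ (-s : ℂ)) U := by
    refine DifferentiableOn.analyticOnNhd (fun z hz => ?_) hUo
    have := one_sub_div_mem_slitPlane hβ hz
    refine DifferentiableAt.differentiableWithinAt ?_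
    refine DifferentiableAt.const_mul ?_ _
    exact DifferentiableAt.cpow (by fun_prop) (by fun_prop) this
  have h0 : (0 : ℂ) ∈ U := by simpa [hU] using hβ
  have hreal : ∀ r : ℝ, r < β → complexMGF id m r
      = (Real.Gamma s * β ^ (-s) : ℝ) * (1 - (r : ℂ) / β) ^ (-s : ℂ) := by
    intro r hr
    have hpos : 0 < 1 - r / β := by rw [sub_pos, div_lt_one hβ]; exact hr
    rw [← hint]
    have e : ∀ x : ℝ, (x ^ (s - 1) * Real.exp (-(β * x))) • Complex.exp (r * x)
        = ((x ^ (s - 1) * Real.exp (-((β - r) * x)) : ℝ) : ℂ) := by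
      intro x
      rw [Complex.real_smul, ← Complex.ofReal_mul, ← Complex.ofReal_exp, ← Complex.ofReal_mul,
        mul_assoc, ← Real.exp_add]
      ring_nf
    simp_rw [e]
    rw [integral_complex_ofReal, Real.integral_rpow_mul_exp_neg_mul_Ioi hs (by linarith),
      ← Complex.ofReal_one, ← Complex.ofReal_div, ← Complex.ofReal_sub, ← Complex.ofReal_neg,
      ← Complex.ofReal_cpow hpos.le, ← Complex.ofReal_mul]
    congr 1
    rw [one_div, Real.inv_rpow (by linarith), ← Real.rpow_neg (by linarith), mul_assoc,
      ← Real.mul_rpow hβ.le hpos.le, mul_sub, mul_one, mul_div_cancel₀ _ hβ.ne', mul_comm]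
  have hfreq : ∃ᶠ z in 𝓝[≠] (0 : ℂ), complexMGF id m z
      = (Real.Gamma s * β ^ (-s) : ℝ) * (1 - z / β) ^ (-s : ℂ) := by
    have ht : Tendsto (fun r : ℝ => (r : ℂ)) (𝓝[≠] 0) (𝓝[≠] 0) := by
      refine tendsto_nhdsWithin_of_tendsto_nhds_of_eventually_within _ ?_ ?_
      · exact (Complex.continuous_ofReal.tendsto' 0 0 (by simp)).mono_left nhdsWithin_le_nhds
      · filter_upwards [self_mem_nhdsWithin] with r hr
        simpa using hr
    refine ht.frequently (Eventually.frequently ?_)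
    filter_upwards [nhdsWithin_le_nhds (Iio_mem_nhds hβ)] with r hr using hreal r hr
  rw [hint]
  exact hF.eqOn_of_preconnected_of_frequently_eq hG hUc h0 hfreq hw

/-- The derivative of `tsSide α β`. -/
def tsSideDeriv (α β : ℝ) (w : ℂ) : ℂ :=
  if α = 0 then -(1 / β - 1 / β / (1 - w / β))
  else if α = 1 then -Complex.log (1 - w / β)
  else (Real.Gamma (-α) * β ^ α : ℝ) * (α / β * (1 - (1 - w / β) ^ ((α - 1 : ℝ) : ℂ)))

theorem Gamma_one_sub {α : ℝ} (h : α ≠ 0) : Real.Gamma (1 - α) = -α * Real.Gamma (-α) := by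
  rw [← Real.Gamma_add_one (neg_ne_zero.2 h)]
  congr 1
  ring

theorem Gamma_two_sub {α : ℝ} (h0 : α ≠ 0) (h1 : α ≠ 1) :
    Real.Gamma (2 - α) = (1 - α) * (-α * Real.Gamma (-α)) := by
  rw [← Gamma_one_sub h0, ← Real.Gamma_add_one (sub_ne_zero.2 h1.symm)]
  congr 1
  ring

theorem hasDerivAt_one_sub_div (β : ℝ) (w : ℂ) :
    HasDerivAt (fun w : ℂ => 1 - w / β) (-(1 / β)) w :=
  ((hasDerivAt_id w).div_const (β : ℂ)).const_sub 1

theorem hasDerivAt_tsSide (α : ℝ) {β : ℝ} (hβ : 0 < β) {w : ℂ} (hw : w.re < β) :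
    HasDerivAt (tsSide α β) (tsSideDeriv α β w) w := by
  have hs := one_sub_div_mem_slitPlane hβ hw
  have hs0 : 1 - w / β ≠ 0 := Complex.slitPlane_ne_zero hs
  have hβ' : (β : ℂ) ≠ 0 := by exact_mod_cast hβ.ne'
  have hd := hasDerivAt_one_sub_div β w
  have hid := hasDerivAt_id w
  rcases eq_or_ne α 0 with rfl | h0
  · have : tsSide 0 β = fun w => -(w / β + Complex.log (1 - w / β)) := by
      funext w; simp [tsSide]
    rw [this]
    refine ((hid.div_const (β : ℂ)).add (hd.clog hs)).neg.congr_deriv ?_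
    simp only [tsSideDeriv, if_true]
    ring
  rcases eq_or_ne α 1 with rfl | h1
  · have : tsSide 1 β = fun w => w + (β - w) * Complex.log (1 - w / β) := by
      funext w; simp [tsSide]
    rw [this]
    refine (hid.add ((hid.const_sub (β : ℂ)).mul (hd.clog hs))).congr_deriv ?_
    simp only [tsSideDeriv, one_ne_zero, if_true, if_false]
    have e : (β : ℂ) - w = β * (1 - w / β) := by field_simp
    rw [id, e]
    generalize 1 - w / (β : ℂ) = v at hs0
    field_simp
    ring
  · have : tsSide α β = fun w : ℂ => (Real.Gamma (-α) * β ^ α : ℝ)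
        * ((1 - w / β) ^ (α : ℂ) - 1 + w * (α / β)) := by
      funext w; simp [tsSide, h0, h1]
    rw [this]
    refine ((((hd.cpow_const (c := (α : ℂ)) hs).sub_const 1).add
      (hid.mul_const ((α : ℂ) / β))).const_mul _).congr_deriv ?_
    simp only [tsSideDeriv, h0, h1, if_false]
    push_cast
    ring

/-- The second derivative is a single formula for every `α`: the exceptional values `0` and `1` only
come from integrating it twice. This removes the case distinction from the Lévy–Khintchine
representation. -/
theorem hasDerivAt_tsSideDeriv (α : ℝ) {β : ℝ} (hβ : 0 < β) {w : ℂ} (hw : w.re < β) :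
    HasDerivAt (tsSideDeriv α β) ((Real.Gamma (2 - α) * β ^ (α - 2) : ℝ)
      * (1 - w / β) ^ ((α - 2 : ℝ) : ℂ)) w := by
  have hs := one_sub_div_mem_slitPlane hβ hw
  have hs0 : 1 - w / β ≠ 0 := Complex.slitPlane_ne_zero hs
  have hβ' : (β : ℂ) ≠ 0 := by exact_mod_cast hβ.ne'
  have hd := hasDerivAt_one_sub_div β w
  rcases eq_or_ne α 0 with rfl | h0
  · have : tsSideDeriv 0 β = fun w => -(1 / (β : ℂ) - 1 / β / (1 - w / β)) := by
      funext w; simp [tsSideDeriv]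
    rw [this]
    refine (((hasDerivAt_const w (1 / (β : ℂ))).div hd hs0).const_sub (1 / (β : ℂ))).neg.congr_deriv
      ?_
    have e : Real.Gamma (2 - 0) = 1 := by rw [sub_zero, Real.Gamma_two]
    rw [e, zero_sub, Real.rpow_neg hβ.le, Real.rpow_two]
    have e2 : (1 - w / β) ^ ((-2 : ℝ) : ℂ) = ((1 - w / β) ^ 2)⁻¹ := by
      rw [Complex.ofReal_neg, Complex.cpow_neg, Complex.ofReal_ofNat, Complex.cpow_ofNat]
    rw [e2]
    push_cast
    field_simp
    ring
  rcases eq_or_ne α 1 with rfl | h1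
  · have : tsSideDeriv 1 β = fun w => -Complex.log (1 - w / β) := by
      funext w; simp [tsSideDeriv]
    rw [this]
    refine (hd.clog hs).neg.congr_deriv ?_
    have e : Real.Gamma (2 - 1) = 1 := by norm_num [Real.Gamma_one]
    rw [e, show (1 : ℝ) - 2 = -1 by norm_num, Real.rpow_neg_one, Complex.ofReal_neg,
      Complex.cpow_neg, Complex.ofReal_one, Complex.cpow_one]
    push_cast
    field_simp
  · have : tsSideDeriv α β = fun w : ℂ => (Real.Gamma (-α) * β ^ α : ℝ)
        * (α / β * (1 - (1 - w / β) ^ ((α - 1 : ℝ) : ℂ))) := by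
      funext w; simp [tsSideDeriv, h0, h1]
    rw [this]
    refine ((((hd.cpow_const (c := ((α - 1 : ℝ) : ℂ)) hs).const_sub 1).const_mul
      ((α : ℂ) / β)).const_mul _).congr_deriv ?_
    rw [Gamma_two_sub h0 h1, Real.rpow_sub hβ, Real.rpow_two,
      show (((α - 1 : ℝ) : ℂ) - 1) = ((α - 2 : ℝ) : ℂ) by push_cast; ring]
    push_cast
    field_simp
    ring

theorem tsSide_zero (α β : ℝ) : tsSide α β 0 = 0 := by
  simp only [tsSide]
  split_ifs <;> simp

theorem tsSideDeriv_zero (α β : ℝ) : tsSideDeriv α β 0 = 0 := by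
  simp only [tsSideDeriv]
  split_ifs <;> simp

/-- Taylor's formula of order two with integral remainder; the function and its first derivative
vanish at zero. -/
theorem tsSide_eq_integral (α : ℝ) {β : ℝ} (hβ : 0 < β) {w : ℂ} (hw : w.re ≤ 0) :
    ∫ τ in (0 : ℝ)..1, (1 - (τ : ℂ)) * (w ^ 2 * ((Real.Gamma (2 - α) * β ^ (α - 2) : ℝ)
      * (1 - τ * w / β) ^ ((α - 2 : ℝ) : ℂ))) = tsSide α β w := by
  have hre : ∀ τ ∈ Set.uIcc (0 : ℝ) 1, ((τ : ℂ) * w).re < β := by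
    intro τ hτ
    rw [Set.uIcc_of_le zero_le_one] at hτ
    rw [Complex.re_ofReal_mul]
    nlinarith [hτ.1]
  have hd : ∀ τ ∈ Set.uIcc (0 : ℝ) 1, HasDerivAt (fun τ : ℝ => (1 - (τ : ℂ))
      * (w * tsSideDeriv α β (τ * w)) + tsSide α β (τ * w))
      ((1 - (τ : ℂ)) * (w ^ 2 * ((Real.Gamma (2 - α) * β ^ (α - 2) : ℝ)
      * (1 - τ * w / β) ^ ((α - 2 : ℝ) : ℂ)))) τ := by
    intro τ hτ
    have h0 : HasDerivAt (fun τ : ℝ => (τ : ℂ)) 1 τ := Complex.ofRealCLM.hasDerivAt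
    have h1 := h0.mul_const w
    have h2 := (hasDerivAt_tsSide α hβ (hre τ hτ)).comp τ h1
    have h3 := (hasDerivAt_tsSideDeriv α hβ (hre τ hτ)).comp τ h1
    refine (((h0.const_sub 1).mul (h3.const_mul w)).add h2).congr_deriv ?_
    simp only [Function.comp]
    ring
  rw [intervalIntegral.integral_eq_sub_of_hasDerivAt hd]
  · simp [tsSide_zero, tsSideDeriv_zero]
  · refine ContinuousOn.intervalIntegrable fun τ hτ => ?_
    have := one_sub_div_mem_slitPlane hβ (hre τ hτ)
    refine ContinuousAt.continuousWithinAt ?_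
    have hc : ContinuousAt (fun τ : ℝ => (1 - (τ : ℂ) * w / β) ^ ((α - 2 : ℝ) : ℂ)) τ :=
      ContinuousAt.cpow (by fun_prop) (by fun_prop) this
    fun_prop

/-- The Lévy–Khintchine representation of `tsSide`. -/
theorem integral_tsMeasure_centered {α β : ℝ} (hα : α < 2) (hβ : 0 < β) {w : ℂ} (hw : w.re ≤ 0) :
    ∫ x : ℝ, (Complex.exp (w * x) - 1 - w * x) ∂tsMeasure α β = tsSide α β w := by
  have h2 : Integrable (fun x => x ^ 2) (tsMeasure α β) := by
    simpa using integrable_sq_mul_exp_tsMeasure (c := 0) hα (by linarith : -β < 0)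
  rw [← tsSide_eq_integral α hβ hw]
  -- Both sides become second-order Taylor remainders. The remainder brings a factor `x²`, so after
  -- exchanging the integrals the inner one is a Gamma integral with parameter `2 - α > 0`, whatever
  -- `α < 2`.
  simp_rw [← integral_exp_remainder]
  simp_rw [intervalIntegral.integral_of_le (zero_le_one (α := ℝ))]
  have hswap : Integrable (Function.uncurry fun (x τ : ℝ) => (1 - (τ : ℂ)) * ((w * x) ^ 2
      * Complex.exp (τ * (w * x)))) ((tsMeasure α β).prod (volume.restrict (Set.Ioc 0 1))) := by
    refine ((h2.const_mul (‖w‖ ^ 2)).comp_fst (volume.restrict (Set.Ioc (0 : ℝ) 1))).mono'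
      (by fun_prop) ?_
    filter_upwards [Measure.quasiMeasurePreserving_fst.ae (ae_tsMeasure_pos α β),
      Measure.quasiMeasurePreserving_snd.ae (ae_restrict_mem measurableSet_Ioc)] with q hq1 hq2
    have hq2' : q.2 ∈ Set.Ioc (0 : ℝ) 1 := hq2
    have e1 : ‖1 - (q.2 : ℂ)‖ ≤ 1 := by
      rw [← Complex.ofReal_one, ← Complex.ofReal_sub, Complex.norm_real, Real.norm_eq_abs, abs_le]
      constructor <;> linarith [hq2'.1, hq2'.2]
    have e2 : ‖Complex.exp (q.2 * (w * q.1))‖ ≤ 1 := by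
      rw [Complex.norm_exp, Real.exp_le_one_iff, Complex.re_ofReal_mul, mul_comm w,
        Complex.re_ofReal_mul]
      exact mul_nonpos_of_nonneg_of_nonpos hq2'.1.le
        (mul_nonpos_of_nonneg_of_nonpos (le_of_lt hq1) hw)
    simp only [Function.uncurry]
    rw [norm_mul, norm_mul, norm_pow, norm_mul, Complex.norm_real, mul_pow, Real.norm_eq_abs,
      sq_abs]
    calc _ ≤ 1 * (‖w‖ ^ 2 * q.1 ^ 2 * 1) := by gcongr
      _ = _ := by ring
  rw [integral_integral_swap hswap]
  refine setIntegral_congr_fun measurableSet_Ioc fun τ hτ => ?_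
  have hre : ((τ : ℂ) * w).re < β := by
    rw [Complex.re_ofReal_mul]
    nlinarith [hτ.1]
  have hg := integral_rpow_mul_cexp (s := 2 - α) (by linarith) hβ hre
  rw [neg_sub] at hg
  have e3 : -((2 - α : ℝ) : ℂ) = ((α - 2 : ℝ) : ℂ) := by push_cast; ring
  rw [e3] at hg
  rw [← hg, integral_tsMeasure, ← mul_assoc, ← integral_const_mul]
  refine setIntegral_congr_fun measurableSet_Ioi fun x hx => ?_
  have hx' : 0 < x := hx
  have e4 : x ^ (2 - α - 1) = x ^ (-1 - α) * x ^ 2 := by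
    rw [← Real.rpow_two, ← Real.rpow_add hx']; congr 1; ring
  simp only [Complex.real_smul]
  rw [e4]
  push_cast
  ring_nf

theorem isLevyExponent_tsMeasure {α β : ℝ} (hα : α < 2) (hβ : 0 < β) :
    IsLevyExponent (tsMeasure α β) 0 (fun u => tsSide α β (Complex.I * u)) (Set.Ioi (-β)) where
  zero := tsMeasure_singleton_zero α β
  sq := by simpa using integrable_sq_mul_exp_tsMeasure (c := 0) hα (by linarith : -β < 0)
  exp_moment := fun c hc => integrable_sq_mul_exp_tsMeasure hα hc
  centered := fun u => by
    rw [integral_tsMeasure_centered hα hβ (by simp)]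
    simp

/-- On `(0, 1]` the tempering is at least `e^{-β}`, and `∫₀^y x^{1-α} dx = y^{2-α} / (2-α)`. -/
theorem smallJumpBound_tsMeasure {α β : ℝ} (hα : α < 2) (hβ : 0 < β) :
    SmallJumpBound (tsMeasure α β) α := by
  have h2 := (isLevyExponent_tsMeasure hα hβ).sq
  refine ⟨Real.exp (-β) / (2 - α), div_pos (Real.exp_pos _) (by linarith), fun y hy hy1 => ?_⟩
  have h3 : ∫ x in Set.Ioc 0 y, Real.exp (-β) * x ^ (1 - α)
      ≤ ∫ x in Set.Ioc 0 y, (x ^ (-1 - α) * Real.exp (-(β * x))) • x ^ 2 := by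
    refine setIntegral_mono_on ?_ ?_ measurableSet_Ioc fun x hx => ?_
    · rw [← intervalIntegrable_iff_integrableOn_Ioc_of_le hy.le]
      exact (intervalIntegral.intervalIntegrable_rpow' (by linarith)).const_mul _
    · exact (integrable_tsMeasure_iff.1 h2).mono_set Set.Ioc_subset_Ioi_self
    · have e4 : x ^ (1 - α) = x ^ (-1 - α) * x ^ 2 := by
        rw [← Real.rpow_two, ← Real.rpow_add hx.1]; congr 1; ring
      have e5 : Real.exp (-β) ≤ Real.exp (-(β * x)) := by
        refine Real.exp_le_exp.2 ?_
        nlinarith [hx.1, hx.2]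
      rw [e4, smul_eq_mul]
      have : 0 ≤ x ^ (-1 - α) * x ^ 2 := mul_nonneg (Real.rpow_nonneg hx.1.le _) (sq_nonneg x)
      nlinarith
  have h4 : ∫ x in Set.Ioc 0 y, (x ^ (-1 - α) * Real.exp (-(β * x))) • x ^ 2
      = ∫ x in Set.Icc (-y) y, x ^ 2 ∂tsMeasure α β := by
    rw [← integral_indicator measurableSet_Icc, integral_tsMeasure,
      ← integral_indicator measurableSet_Ioc, ← integral_indicator measurableSet_Ioi]
    congr 1
    funext x
    by_cases hx0 : 0 < x
    · by_cases hxy : x ≤ y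
      · have : -y ≤ x := by linarith
        simp [Set.indicator, hx0, hxy, this]
      · simp [Set.indicator, hx0, hxy]
    · simp [Set.indicator, hx0]
  rw [← h4]
  refine le_trans (le_of_eq ?_) h3
  rw [integral_const_mul, ← intervalIntegral.integral_of_le hy.le, integral_rpow (by left; linarith),
    Real.zero_rpow (by linarith), show 1 - α + 1 = 2 - α by ring]
  ring

theorem cf_tsMeasure {α β : ℝ} (hα : α < 0) (hβ : 0 < β) {z : ℂ} (hz : -z.im < β) :
    cf (tsMeasure α β) z
      = (Real.Gamma (-α) * β ^ α : ℝ) * (1 - Complex.I * z / β) ^ (α : ℂ) := by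
  have := integral_rpow_mul_cexp (s := -α) (w := Complex.I * z) (by linarith) hβ (by simpa using hz)
  rw [neg_neg] at this
  rw [cf, integral_tsMeasure, show -1 - α = -α - 1 by ring, this]
  simp

/-- The transform is `Γ(-α) (β - iz)^α`, and `|β - iz| ≥ |Re z|` is raised to a negative power. The
bound does not depend on `Im z` or `β`. -/
theorem norm_cf_tsMeasure_le {α β : ℝ} (hα : α < 0) (hβ : 0 < β) {z : ℂ} (hz : -z.im < β)
    (hre : z.re ≠ 0) : ‖cf (tsMeasure α β) z‖ ≤ Real.Gamma (-α) * |z.re| ^ α := by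
  have hG : 0 < Real.Gamma (-α) := Real.Gamma_pos_of_pos (by linarith)
  rw [cf_tsMeasure hα hβ hz, norm_mul, Complex.norm_real, Complex.norm_cpow_real, Real.norm_eq_abs,
    abs_of_pos (by positivity), mul_assoc, ← Real.mul_rpow hβ.le (norm_nonneg _)]
  refine mul_le_mul_of_nonneg_left (Real.rpow_le_rpow_of_nonpos (abs_pos.2 hre) ?_ hα.le) hG.le
  have h1 : |(1 - Complex.I * z / β).im| ≤ ‖1 - Complex.I * z / β‖ := Complex.abs_im_le_norm _
  have h2 : (1 - Complex.I * z / β).im = -(z.re / β) := by simp [Complex.div_ofReal_im]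
  rw [h2, abs_neg, abs_div, abs_of_pos hβ, div_le_iff₀ hβ] at h1
  linarith

theorem real_univ_tsMeasure {α β : ℝ} (hα : α < 0) (hβ : 0 < β) :
    (tsMeasure α β).real Set.univ = Real.Gamma (-α) * β ^ α := by
  have := cf_tsMeasure hα hβ (z := 0) (by simpa using hβ)
  rw [cf_zero] at this
  simp only [mul_zero, zero_div, sub_zero, Complex.one_cpow, mul_one] at this
  exact_mod_cast this

theorem integral_id_tsMeasure {α β : ℝ} (hα : α < 1) (hβ : 0 < β) :
    ∫ x, x ∂tsMeasure α β = Real.Gamma (1 - α) * β ^ (α - 1) := by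
  rw [integral_tsMeasure]
  have := Real.integral_rpow_mul_exp_neg_mul_Ioi (a := 1 - α) (by linarith) hβ
  rw [one_div, Real.inv_rpow hβ.le, ← Real.rpow_neg hβ.le, neg_sub] at this
  rw [mul_comm, ← this]
  refine setIntegral_congr_fun measurableSet_Ioi fun x hx => ?_
  have hx' : 0 < x := hx
  have : x ^ (1 - α - 1) = x ^ (-1 - α) * x := by
    nth_rw 3 [← Real.rpow_one x]
    rw [← Real.rpow_add hx']; congr 1; ring
  simp only [smul_eq_mul]
  rw [this]
  ring

/-- The logarithmic growth that makes the Gamma case decay as a power. -/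
theorem le_integral_one_sub_cos_tsMeasure {β c v : ℝ} (hc : -β < c) (hv : 0 < v) :
    Real.log (v / (β + c)) ≤ ∫ x, (1 - Real.cos (v * x)) * Real.exp (-(c * x)) ∂tsMeasure 0 β := by
  have hβ' : 0 < β + c := by linarith
  -- The tilt by `e^{-cx}` turns the rate `β` into `β + c`. At index zero the real part of the
  -- exponent is `-log |1 - iv/(β + c)|`, and the modulus is at least `v/(β + c)`.
  have h1 := integral_tsMeasure_centered (α := 0) (by norm_num) hβ' (w := Complex.I * v) (by simp)
  have hi := integrable_centered_ofReal
    (isLevyExponent_tsMeasure (α := 0) (by norm_num) hβ').sq v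
  have h2 : ∫ x, (1 - Real.cos (v * x)) ∂tsMeasure 0 (β + c)
      = Real.log ‖1 - Complex.I * v / (β + c : ℝ)‖ := by
    have h3 := congrArg Complex.re h1
    have h3' := integral_re hi
    simp only [RCLike.re_to_complex] at h3'
    rw [← h3'] at h3
    have e : ∀ x : ℝ, (Complex.exp (Complex.I * v * x) - 1 - Complex.I * v * x).re
        = -(1 - Real.cos (v * x)) := by
      intro x
      rw [show Complex.I * (v : ℂ) * x = ((v * x : ℝ) : ℂ) * Complex.I by push_cast; ring,
        Complex.sub_re, Complex.sub_re, Complex.exp_ofReal_mul_I_re]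
      simp
    simp_rw [e] at h3
    rw [integral_neg] at h3
    simp only [tsSide, if_true, Complex.neg_re, Complex.add_re, Complex.log_re] at h3
    rw [Complex.div_ofReal_re] at h3
    simp only [Complex.I_mul_re, Complex.ofReal_im, neg_zero, zero_div, zero_add] at h3
    exact neg_injective h3
  have h4 : ∫ x, (1 - Real.cos (v * x)) ∂tsMeasure 0 (β + c)
      = ∫ x, (1 - Real.cos (v * x)) * Real.exp (-(c * x)) ∂tsMeasure 0 β := by
    rw [integral_tsMeasure, integral_tsMeasure]
    congr 1
    funext x
    rw [show -((β + c) * x) = -(β * x) + -(c * x) by ring, Real.exp_add]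
    simp only [smul_eq_mul]
    ring
  rw [← h4, h2]
  refine Real.log_le_log (by positivity) ?_
  have h5 := Complex.abs_im_le_norm (1 - Complex.I * v / (β + c : ℝ))
  have h6 : (1 - Complex.I * v / (β + c : ℝ)).im = -(v / (β + c)) := by
    rw [Complex.sub_im, Complex.div_ofReal_im]; simp
  rwa [h6, abs_neg, abs_of_pos (by positivity)] at h5

theorem IsLevyExponent.bilateral {νp νn : Measure ℝ} {ψp ψn : ℝ → ℂ} {Sp Sn : Set ℝ}
    (hp : IsLevyExponent νp 0 ψp Sp) (hn : IsLevyExponent νn 0 ψn Sn) (γ : ℝ) :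
    IsLevyExponent (νp + νn.map fun x => -x) γ
      (fun u => Complex.I * u * γ + ψp u + ψn (-u)) {a | a ∈ Sp ∧ -a ∈ Sn} := by
  have h := ((IsLevyExponent.drift γ {a | a ∈ Sp ∧ -a ∈ Sn}).add
    (hp.mono fun a ha => ha.1)).add (hn.neg.mono fun a ha => ha.2)
  simpa only [zero_add, add_zero, neg_zero] using h

/-- The tempered stable Lévy measure on one side, of weight `c`. -/
def sideMeasure (c α β : ℝ) : Measure ℝ := ENNReal.ofReal c • tsMeasure α β

instance (c α β : ℝ) : SFinite (sideMeasure c α β) := by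
  rw [sideMeasure]; infer_instance

theorem isLevyExponent_sideMeasure {c α β : ℝ} (hc : 0 ≤ c) (hα : α < 2) (hβ : 0 < β) :
    IsLevyExponent (sideMeasure c α β) 0 (fun u => c * tsSide α β (Complex.I * u))
      {a | 0 < c → -β < a} := by
  simpa [sideMeasure] using (isLevyExponent_tsMeasure hα hβ).smul_strip hc

theorem sideMeasure_zero (α β : ℝ) : sideMeasure 0 α β = 0 := by simp [sideMeasure]

theorem integrable_id_sideMeasure {c α β : ℝ} (hc : 0 ≤ c) (hα : 0 < c → α < 1) (hβ : 0 < β) :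
    Integrable (fun x => x) (sideMeasure c α β) := by
  rcases hc.eq_or_lt with rfl | hc
  · simp [sideMeasure_zero]
  · exact (integrable_id_tsMeasure (hα hc) hβ).smul_measure ENNReal.ofReal_ne_top

theorem integral_id_sideMeasure {c α β : ℝ} (hc : 0 ≤ c) (hα : 0 < c → α < 1) (hβ : 0 < β) :
    ∫ x, x ∂sideMeasure c α β = c * Real.Gamma (1 - α) * β ^ (α - 1) := by
  rcases hc.eq_or_lt with rfl | hc
  · simp [sideMeasure_zero]
  · rw [sideMeasure, integral_smul_measure, ENNReal.toReal_ofReal hc.le,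
      integral_id_tsMeasure (hα hc) hβ, smul_eq_mul, mul_assoc]

theorem isFiniteMeasure_sideMeasure {c α β : ℝ} (hc : 0 ≤ c) (hα : 0 < c → α < 0) (hβ : 0 < β) :
    IsFiniteMeasure (sideMeasure c α β) := by
  rcases hc.eq_or_lt with rfl | hc
  · rw [sideMeasure_zero]; infer_instance
  · have := isFiniteMeasure_tsMeasure (hα hc) hβ
    exact Measure.smul_finite _ ENNReal.ofReal_ne_top

theorem real_univ_sideMeasure {c α β : ℝ} (hc : 0 ≤ c) (hα : 0 < c → α < 0) (hβ : 0 < β) :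
    (sideMeasure c α β).real Set.univ = c * Real.Gamma (-α) * β ^ α := by
  rcases hc.eq_or_lt with rfl | hc
  · simp [sideMeasure_zero]
  · rw [sideMeasure, measureReal_ennreal_smul_apply, ENNReal.toReal_ofReal hc.le,
      real_univ_tsMeasure (hα hc) hβ, mul_assoc]

theorem integrable_exp_sideMeasure {c α β a : ℝ} (hc : 0 ≤ c) (hα : 0 < c → α < 0)
    (ha : 0 < c → -β < a) : Integrable (fun x => Real.exp (-(a * x))) (sideMeasure c α β) := by
  rcases hc.eq_or_lt with rfl | hc
  · simp [sideMeasure_zero]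
  · exact (integrable_exp_tsMeasure (hα hc) (ha hc)).smul_measure ENNReal.ofReal_ne_top

theorem norm_cf_sideMeasure_le {c α β : ℝ} (hc : 0 ≤ c) (hα : 0 < c → α < 0) (hβ : 0 < β) {z : ℂ}
    (hz : 0 < c → -z.im < β) (hre : z.re ≠ 0) :
    ‖cf (sideMeasure c α β) z‖ ≤ c * (Real.Gamma (-α) * |z.re| ^ α) := by
  rcases hc.eq_or_lt with rfl | hc
  · simp [sideMeasure_zero, cf]
  · rw [cf, sideMeasure, integral_smul_measure, ENNReal.toReal_ofReal hc.le, norm_smul,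
      Real.norm_eq_abs, abs_of_pos hc]
    exact mul_le_mul_of_nonneg_left (norm_cf_tsMeasure_le (hα hc) hβ (hz hc) hre) hc.le

/-- A side of index zero contributes the logarithm; any other side is dropped by positivity. The
constant `M` lets both sides use the same logarithm. -/
theorem le_integral_one_sub_cos_sideMeasure {c α β a v M : ℝ} (hc : 0 ≤ c)
    (ha : 0 < c → -β < a) (hv : 0 < v) (hM : β + a ≤ M) :
    (if α = 0 then c else 0) * (Real.log v - Real.log M)
      ≤ ∫ x, (1 - Real.cos (v * x)) * Real.exp (-(a * x)) ∂sideMeasure c α β := by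
  rcases hc.eq_or_lt with rfl | hc
  · simp [sideMeasure_zero]
  split_ifs with h0
  · subst h0
    rw [sideMeasure, integral_smul_measure, ENNReal.toReal_ofReal hc.le, smul_eq_mul]
    refine mul_le_mul_of_nonneg_left (le_trans ?_ (le_integral_one_sub_cos_tsMeasure (ha hc) hv))
      hc.le
    have hpos : 0 < β + a := by linarith [ha hc]
    rw [Real.log_div hv.ne' hpos.ne']
    linarith [Real.log_le_log hpos hM]
  · rw [zero_mul]
    exact integral_nonneg fun x =>
      mul_nonneg (by linarith [Real.cos_le_one (v * x)]) (Real.exp_pos _).le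

/-! ### Ornstein–Uhlenbeck processes with a tempered stable driver -/

namespace TSParams

variable (p : TSParams)

/-- The Lévy measure of the tempered stable law. -/
def levyMeasure : Measure ℝ :=
  sideMeasure p.cp p.αp p.βp + (sideMeasure p.cn p.αn p.βn).map fun x => -x

instance : SFinite p.levyMeasure := by
  rw [levyMeasure]; infer_instance

theorem strip_eq : p.strip = {a | a ∈ {a | 0 < p.cp → -p.βp < a} ∧ -a ∈ {a | 0 < p.cn → -p.βn < a}} := by
  ext a
  simp [strip]

theorem isLevyExponent : IsLevyExponent p.levyMeasure p.γc p.exponent p.strip := by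
  have := (isLevyExponent_sideMeasure p.cp_nonneg p.αp_lt p.βp_pos).bilateral
    (isLevyExponent_sideMeasure p.cn_nonneg p.αn_lt p.βn_pos) p.γc
  rw [strip_eq, levyMeasure]
  convert this using 1
  funext u
  simp [exponent]

theorem index_eq : (0 < p.cp ∧ p.index = p.αp) ∨ (0 < p.cn ∧ p.index = p.αn) := by
  have h1 := p.cp_nonneg.eq_or_lt
  have h2 := p.cn_nonneg.eq_or_lt
  have h3 := p.nondegenerate
  simp only [index]
  split_ifs with h4 h5
  · left; rw [h4] at h3; simpa using h3
  · right; rw [h5] at h3; simpa using h3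
  · rcases max_choice p.αp p.αn with h | h <;> rw [h]
    · left; exact ⟨p.cp_nonneg.lt_of_ne' h5, rfl⟩
    · right; exact ⟨p.cn_nonneg.lt_of_ne' h4, rfl⟩

theorem le_index : (0 < p.cp → p.αp ≤ p.index) ∧ (0 < p.cn → p.αn ≤ p.index) := by
  simp only [index]
  split_ifs with h4 h5
  · exact ⟨fun _ => le_rfl, fun h => absurd h4 h.ne'⟩
  · exact ⟨fun h => absurd h5 h.ne', fun _ => le_rfl⟩
  · exact ⟨fun _ => le_max_left _ _, fun _ => le_max_right _ _⟩

/-- One of the sides present attains the index; the other one only adds mass. -/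
theorem smallJumpBound : SmallJumpBound p.levyMeasure p.index := by
  rcases p.index_eq with ⟨h, e⟩ | ⟨h, e⟩
  · rw [e]
    exact ((smallJumpBound_tsMeasure p.αp_lt p.βp_pos).smul h).mono
      (Measure.le_add_right le_rfl) p.isLevyExponent.sq
  · rw [e]
    exact ((smallJumpBound_tsMeasure p.αn_lt p.βn_pos).smul h).neg.mono
      (Measure.le_add_left le_rfl) p.isLevyExponent.sq

theorem integrable_map_neg {m : Measure ℝ} {E : Type*} [NormedAddCommGroup E] {f : ℝ → E} :
    Integrable f (m.map fun x => -x) ↔ Integrable (fun x => f (-x)) m :=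
  (MeasurableEquiv.neg ℝ).measurableEmbedding.integrable_map_iff

theorem integral_map_neg {m : Measure ℝ} {E : Type*} [NormedAddCommGroup E] [NormedSpace ℝ E]
    (f : ℝ → E) : ∫ x, f x ∂(m.map fun x => -x) = ∫ x, f (-x) ∂m :=
  (MeasurableEquiv.neg ℝ).measurableEmbedding.integral_map f

theorem integrable_id (h : p.index < 1) : Integrable (fun x => x) p.levyMeasure := by
  refine (integrable_id_sideMeasure p.cp_nonneg (fun hc => (p.le_index.1 hc).trans_lt h)
    p.βp_pos).add_measure (integrable_map_neg.2 ?_)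
  exact (integrable_id_sideMeasure p.cn_nonneg (fun hc => (p.le_index.2 hc).trans_lt h)
    p.βn_pos).neg

theorem integral_id (h : p.index < 1) : p.γc - ∫ x, x ∂p.levyMeasure = p.drift := by
  have h1 := integrable_id_sideMeasure p.cp_nonneg (fun hc => (p.le_index.1 hc).trans_lt h) p.βp_pos
  have h2 := integrable_id_sideMeasure p.cn_nonneg (fun hc => (p.le_index.2 hc).trans_lt h) p.βn_pos
  rw [levyMeasure, integral_add_measure h1 (integrable_map_neg.2 h2.neg), integral_map_neg,
    integral_neg, integral_id_sideMeasure p.cp_nonneg (fun hc => (p.le_index.1 hc).trans_lt h)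
    p.βp_pos, integral_id_sideMeasure p.cn_nonneg (fun hc => (p.le_index.2 hc).trans_lt h)
    p.βn_pos, drift]
  ring

theorem levyMeasure_absolutelyContinuous : p.levyMeasure ≪ volume := by
  refine Measure.AbsolutelyContinuous.add_left
    ((tsMeasure_absolutelyContinuous _ _).smul_left _) ?_
  have h := ((tsMeasure_absolutelyContinuous p.αn p.βn).smul_left (ENNReal.ofReal p.cn)).map
    (measurable_neg (G := ℝ))
  have e : Measure.map Neg.neg (volume : Measure ℝ) = volume := Measure.map_neg_eq_self _
  rwa [e] at h

theorem half_mem {b s β a : ℝ} (hb : 0 < b) (hs : 0 < s) (hβ : 0 < β) (ha : -β < 2 * a) :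
    -β < Real.exp (-b * s) * a := by
  have h1 : Real.exp (-b * s) ≤ 1 := Real.exp_le_one_iff.2 (by nlinarith)
  nlinarith [Real.exp_pos (-b * s)]

/-- The transform of the jump measure of each side is at most a multiple of `|Re z|^α`. At `z =
e^{-bs}(u + ia)` the scaling costs at most a power of `e^{-bt}`, and the slowest side determines the
exponent. -/
theorem finiteActivity {b t : ℝ} (hb : 0 < b) (ht : 0 < t) {ρ : Measure ℝ}
    [IsProbabilityMeasure ρ]
    (hρ : ∀ u, charFun ρ u = Complex.exp (∫ s in (0 : ℝ)..t, p.exponent (Real.exp (-b * s) * u)))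
    (h : p.index < 0) :
    FiniteActivity ρ ∧ ∃ V, BernoulliDecomposition ρ V (p.intensity * t)
      ((1 - Real.exp (-b * t)) / b * p.drift) ∧ PowerLawErrorDecay V p.strip (-p.index) := by
  have hp : 0 < p.cp → p.αp < 0 := fun hc => (p.le_index.1 hc).trans_lt h
  have hn : 0 < p.cn → p.αn < 0 := fun hc => (p.le_index.2 hc).trans_lt h
  have i1 := isFiniteMeasure_sideMeasure p.cp_nonneg hp p.βp_pos
  have i2 := isFiniteMeasure_sideMeasure p.cn_nonneg hn p.βn_pos
  have i3 : IsFiniteMeasure p.levyMeasure := by rw [levyMeasure]; infer_instance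
  have hmass : p.levyMeasure.real Set.univ = p.intensity := by
    rw [levyMeasure, measureReal_add_apply, map_measureReal_apply (by fun_prop) MeasurableSet.univ,
      Set.preimage_univ, real_univ_sideMeasure p.cp_nonneg hp p.βp_pos,
      real_univ_sideMeasure p.cn_nonneg hn p.βn_pos, intensity]
  have hpos : 0 < p.levyMeasure.real Set.univ := by
    have e1 : 0 ≤ (sideMeasure p.cp p.αp p.βp).real Set.univ := measureReal_nonneg
    have e2 : 0 ≤ (sideMeasure p.cn p.αn p.βn).real Set.univ := measureReal_nonneg
    rw [real_univ_sideMeasure p.cp_nonneg hp p.βp_pos] at e1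
    rw [real_univ_sideMeasure p.cn_nonneg hn p.βn_pos] at e2
    have := p.βp_pos
    have := p.βn_pos
    rw [hmass, intensity]
    rcases p.nondegenerate with hc | hc
    · have : 0 < Real.Gamma (-p.αp) := Real.Gamma_pos_of_pos (by linarith [hp hc])
      have : 0 < p.cp * Real.Gamma (-p.αp) * p.βp ^ p.αp := by positivity
      linarith
    · have : 0 < Real.Gamma (-p.αn) := Real.Gamma_pos_of_pos (by linarith [hn hc])
      have : 0 < p.cn * Real.Gamma (-p.αn) * p.βn ^ p.αn := by positivity
      linarith
  have he1 : ∀ a : ℝ, (0 < p.cp → -p.βp < a) →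
      Integrable (fun x => Real.exp (-(a * x))) (sideMeasure p.cp p.αp p.βp) := fun a ha =>
    integrable_exp_sideMeasure p.cp_nonneg hp ha
  have he2 : ∀ a : ℝ, (0 < p.cn → a < p.βn) → Integrable (fun x => Real.exp (-(a * x)))
      ((sideMeasure p.cn p.αn p.βn).map fun x => -x) := fun a ha => by
    rw [integrable_map_neg]
    simpa using integrable_exp_sideMeasure (a := -a) p.cn_nonneg hn
      (fun hc => neg_lt_neg (ha hc))
  have := p.isLevyExponent.bernoulliDecomposition_ou hb ht hρ p.levyMeasure_absolutelyContinuous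
    hpos (p.integrable_id (by linarith)) (ω := -p.index) (by linarith)
    (fun a ha => (he1 a fun hc => by linarith [ha.1 hc, p.βp_pos]).add_measure
      (he2 a fun hc => by linarith [ha.2 hc, p.βn_pos])) ?_
  · rwa [hmass, p.integral_id (by linarith)] at this
  intro a ha
  refine ⟨p.cp * (Real.Gamma (-p.αp) * Real.exp (-b * t) ^ p.αp)
    + p.cn * (Real.Gamma (-p.αn) * Real.exp (-b * t) ^ p.αn), fun u hu s hs => ?_⟩
  set z : ℂ := (Real.exp (-b * s) : ℝ) * ((u : ℂ) + Complex.I * a) with hz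
  have hre : z.re = Real.exp (-b * s) * u := by rw [hz, Complex.re_ofReal_mul]; simp
  have him : z.im = Real.exp (-b * s) * a := by rw [hz, Complex.im_ofReal_mul]; simp
  have hu0 : 0 < u := by linarith
  have hrepos : 0 < z.re := by rw [hre]; positivity
  have k1 : 0 < p.cp → -p.βp < z.im := fun hc => by
    rw [him]; exact half_mem hb hs.1 p.βp_pos (ha.1 hc)
  have k2 : 0 < p.cn → z.im < p.βn := fun hc => by
    rw [him]
    have := half_mem (a := -a) hb hs.1 p.βn_pos (by linarith [ha.2 hc])
    linarith
  have hsum : cf p.levyMeasure z = cf (sideMeasure p.cp p.αp p.βp) z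
      + cf (sideMeasure p.cn p.αn p.βn) (-z) := by
    rw [cf, levyMeasure, integral_add_measure (integrable_exp_I_mul_iff.2 (he1 _ k1))
      (integrable_exp_I_mul_iff.2 (he2 _ k2)), integral_map_neg, cf, cf]
    congr 2
    funext x
    push_cast
    ring_nf
  -- All exponents are negative: the base is replaced by the smaller `e^{-bt} u`, and `u ≥ 1`
  -- permits raising `α` to the index.
  have hside : ∀ α, (α ≤ p.index) → |z.re| ^ α ≤ Real.exp (-b * t) ^ α * u ^ (p.index) := by
    intro α hα
    rw [abs_of_pos hrepos, hre]
    calc (Real.exp (-b * s) * u) ^ α ≤ (Real.exp (-b * t) * u) ^ α := by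
          refine Real.rpow_le_rpow_of_nonpos (by positivity) ?_ (by linarith)
          have := (exp_neg_mul_mem hb hs).1
          gcongr
      _ = Real.exp (-b * t) ^ α * u ^ α := Real.mul_rpow (Real.exp_pos _).le hu0.le
      _ ≤ _ := by
          refine mul_le_mul_of_nonneg_left (Real.rpow_le_rpow_of_exponent_le hu hα) (by positivity)
  have hside' : ∀ c α, 0 ≤ c → (0 < c → α ≤ p.index) → c * (Real.Gamma (-α) * |z.re| ^ α)
      ≤ c * (Real.Gamma (-α) * Real.exp (-b * t) ^ α) * u ^ (p.index) := by
    intro c α hc hα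
    rcases hc.eq_or_lt with rfl | hc
    · simp
    · have : 0 < Real.Gamma (-α) := Real.Gamma_pos_of_pos (by linarith [hα hc])
      rw [mul_assoc, mul_assoc]
      have := hside α (hα hc)
      gcongr
  rw [hsum, neg_neg, add_mul]
  refine (norm_add_le _ _).trans (add_le_add ?_ ?_)
  · exact (norm_cf_sideMeasure_le p.cp_nonneg hp p.βp_pos (fun hc => by linarith [k1 hc])
      hrepos.ne').trans (hside' _ _ p.cp_nonneg p.le_index.1)
  · refine (norm_cf_sideMeasure_le p.cn_nonneg hn p.βn_pos (fun hc => ?_) ?_).trans ?_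
    · rw [Complex.neg_im, neg_neg]; exact k2 hc
    · rw [Complex.neg_re]; exact neg_ne_zero.2 hrepos.ne'
    · rw [Complex.neg_re, abs_neg]
      exact hside' _ _ p.cn_nonneg p.le_index.2

theorem gammaMass_pos (h : p.index = 0) : 0 < p.gammaMass := by
  have h1 := p.cp_nonneg
  have h2 := p.cn_nonneg
  rw [gammaMass]
  rcases p.index_eq with ⟨hc, e⟩ | ⟨hc, e⟩
  · rw [if_pos (e.symm.trans h)]
    have : 0 ≤ if p.αn = 0 then p.cn else 0 := by split_ifs <;> simp [h2]
    linarith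
  · rw [if_pos (c := p.αn = 0) (e.symm.trans h)]
    have : 0 ≤ if p.αp = 0 then p.cp else 0 := by split_ifs <;> simp [h1]
    linarith

/-- At time `s` the sides of index zero give at least `gammaMass · (log u - bs - log M)`.
Integration over `[0, t]` produces `gammaMass · t · log u` up to a constant, hence the power. -/
theorem exp_neg_integral_le {b t : ℝ} (hb : 0 < b) (ht : 0 < t) {a : ℝ} (ha : 2 * a ∈ p.strip) :
    ∃ K, ∀ u > 0, Real.exp (-∫ x, (1 - Real.cos (u * x)) * Real.exp (-(a * x))
      ∂ouMeasure b t p.levyMeasure) ≤ K * u ^ (-(p.gammaMass * t)) := by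
  -- `M` dominates the tilted rates `βp + e^{-bs} a` and `βn - e^{-bs} a` for all `s` at once.
  set M := p.βp + p.βn + |a| with hM
  have hM0 : 0 < M := by have := p.βp_pos; have := p.βn_pos; positivity
  refine ⟨Real.exp (p.gammaMass * (b * t + Real.log M) * t), fun u hu => ?_⟩
  have hZ := p.isLevyExponent.ou hb ht.le
  obtain ⟨h1, h2⟩ := integral_ouMeasure b ht.le (by fun_prop)
    (hZ.integrable_one_sub_cos_mul_exp ha u)
  rw [h2, Real.rpow_def_of_pos hu, ← Real.exp_add]
  refine Real.exp_le_exp.2 ?_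
  have hg0 : 0 ≤ p.gammaMass := by
    have := p.cp_nonneg
    have := p.cn_nonneg
    rw [gammaMass]
    split_ifs <;> positivity
  have key : ∫ s in (0 : ℝ)..t, p.gammaMass * (Real.log u - (b * t + Real.log M))
      ≤ ∫ s in (0 : ℝ)..t, ∫ x, (1 - Real.cos (u * (Real.exp (-b * s) * x)))
        * Real.exp (-(a * (Real.exp (-b * s) * x))) ∂p.levyMeasure := by
    refine intervalIntegral.integral_mono_on_of_le_Ioo ht.le (by simp) h1 fun s hs => ?_
    set r := Real.exp (-b * s) with hr
    have hr0 : 0 < r := Real.exp_pos _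
    obtain ⟨hr2, hr1⟩ := exp_neg_mul_mem hb (Set.Ioo_subset_Ioc_self hs)
    have hv : 0 < u * r := by positivity
    have hra : |r * a| ≤ |a| := by
      rw [abs_mul, abs_of_pos hr0]; exact mul_le_of_le_one_left (abs_nonneg a) hr1
    have k1 : 0 < p.cp → -p.βp < r * a := fun hc => half_mem hb hs.1 p.βp_pos (ha.1 hc)
    have k2 : 0 < p.cn → -p.βn < -(r * a) := fun hc => by
      have := half_mem (a := -a) hb hs.1 p.βn_pos (by linarith [ha.2 hc])
      linarith
    have k3 : 0 < p.cp → -p.βp < 2 * (r * a) := fun hc => by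
      nlinarith [ha.1 hc, p.βp_pos]
    have k4 : 0 < p.cn → 2 * (r * a) < p.βn := fun hc => by
      nlinarith [ha.2 hc, p.βn_pos]
    have l1 := le_integral_one_sub_cos_sideMeasure (α := p.αp) (M := M) p.cp_nonneg k1 hv
      (by linarith [le_abs_self (r * a), p.βn_pos])
    have l2 := le_integral_one_sub_cos_sideMeasure (α := p.αn) (M := M) p.cn_nonneg k2 hv
      (by linarith [neg_abs_le (r * a), p.βp_pos])
    have hi := p.isLevyExponent.integrable_one_sub_cos_mul_exp (a := r * a) ⟨k3, k4⟩ (u * r)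
    have e : ∫ x, (1 - Real.cos (u * (r * x))) * Real.exp (-(a * (r * x))) ∂p.levyMeasure
        = (∫ x, (1 - Real.cos (u * r * x)) * Real.exp (-(r * a * x))
          ∂sideMeasure p.cp p.αp p.βp)
          + ∫ x, (1 - Real.cos (u * r * x)) * Real.exp (-(-(r * a) * x))
          ∂sideMeasure p.cn p.αn p.βn := by
      rw [levyMeasure] at hi ⊢
      rw [integrable_add_measure] at hi
      have e1 : ∀ x : ℝ, (1 - Real.cos (u * (r * x))) * Real.exp (-(a * (r * x)))
        = (1 - Real.cos (u * r * x)) * Real.exp (-(r * a * x)) := fun x => by ring_nf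
      simp_rw [e1]
      rw [integral_add_measure hi.1 hi.2, integral_map_neg]
      congr 2
      funext x
      rw [mul_neg, Real.cos_neg]
      ring_nf
    rw [e]
    refine le_trans ?_ (add_le_add l1 l2)
    rw [← add_mul, ← gammaMass]
    refine mul_le_mul_of_nonneg_left ?_ hg0
    have hlog : Real.log (u * r) = Real.log u - b * s := by
      rw [Real.log_mul hu.ne' hr0.ne', hr, Real.log_exp]; ring
    rw [hlog]
    nlinarith [hs.2]
  rw [intervalIntegral.integral_const, smul_eq_mul, sub_zero] at key
  linarith

theorem ou_cases {b t : ℝ} (hb : 0 < b) (ht : 0 < t) {ρ : Measure ℝ} [IsProbabilityMeasure ρ]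
    (hρ : ∀ u, charFun ρ u = Complex.exp (∫ s in (0 : ℝ)..t, p.exponent (Real.exp (-b * s) * u))) :
    (p.index = 0 → InfiniteActivityFiniteVariation ρ ∧
      PowerLawErrorDecay ρ p.strip (p.gammaMass * t)) ∧
    (0 < p.index → p.index < 1 → InfiniteActivityFiniteVariation ρ ∧
      ExponentialErrorDecay ρ p.strip p.index) ∧
    (1 ≤ p.index → InfiniteActivityInfiniteVariation ρ ∧
      ExponentialErrorDecay ρ p.strip p.index) := by
  have hZ := p.isLevyExponent.ou hb ht.le
  have hS := p.smallJumpBound.ou hb ht p.isLevyExponent.sq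
  refine ⟨fun h => ⟨?_, ?_⟩, fun h0 h1 => ⟨?_, ?_⟩, fun h1 => ⟨?_, ?_⟩⟩
  · exact hZ.infiniteActivityFiniteVariation hρ h.ge hS
      (integrable_id_ouMeasure hb (p.integrable_id (by linarith)))
  · exact hZ.powerLawErrorDecay hρ (mul_pos (p.gammaMass_pos h) ht)
      fun a ha => p.exp_neg_integral_le hb ht ha
  · exact hZ.infiniteActivityFiniteVariation hρ h0.le hS
      (integrable_id_ouMeasure hb (p.integrable_id h1))
  · exact hZ.exponentialErrorDecay hρ h0 hS
  · exact hZ.infiniteActivityInfiniteVariation hρ h1 hS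
  · exact hZ.exponentialErrorDecay hρ (by linarith) hS

end TSParams

/-! ### Ornstein–Uhlenbeck processes with a tempered stable stationary law -/

/-- In terms of Lévy densities, `w ∂_w` turns `k(x)` into `-(x k(x))'`. For `k(x) = e^{-βx}
x^{-1-α}` this is `α k(x) + β x k(x)`, a combination of tempered stable densities with indices `α`
and `α - 1`. It is a Lévy density when `α ≥ 0`. -/
theorem mul_tsSideDeriv {α β : ℝ} (hα : α < 2) (hβ : 0 < β) {w : ℂ} (hw : w.re < β) :
    w * tsSideDeriv α β w = α * tsSide α β w + β * tsSide (α - 1) β w := by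
  have hs0 : 1 - w / β ≠ 0 := Complex.slitPlane_ne_zero (one_sub_div_mem_slitPlane hβ hw)
  have hβ' : (β : ℂ) ≠ 0 := by exact_mod_cast hβ.ne'
  have e : w = β * (1 - (1 - w / β)) := by field_simp; ring
  generalize 1 - w / (β : ℂ) = v at hs0 e
  subst e
  have e1 : 1 - β * (1 - v) / (β : ℂ) = v := by field_simp; ring
  rcases eq_or_ne α 0 with rfl | h0
  · simp only [tsSideDeriv, tsSide, if_true, zero_sub, neg_eq_zero, one_ne_zero, if_false, e1,
      neg_neg, Real.Gamma_one, Complex.ofReal_zero, zero_mul, zero_add]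
    rw [if_neg (by norm_num), Real.rpow_neg_one, Complex.ofReal_neg, Complex.cpow_neg,
      Complex.ofReal_one, Complex.cpow_one]
    push_cast
    field_simp
    ring
  rcases eq_or_ne α 1 with rfl | h1
  · simp only [tsSideDeriv, tsSide, one_ne_zero, if_true, sub_self, if_false, e1]
    push_cast
    field_simp
    ring
  · have h2 : α - 1 ≠ 0 := sub_ne_zero.2 h1
    have h3 : α - 1 ≠ 1 := by intro h; linarith
    simp only [tsSideDeriv, tsSide, h0, h1, h2, h3, if_false, e1]
    rw [neg_sub, Gamma_one_sub h0, Real.rpow_sub_one hβ.ne',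
      show v ^ (α : ℂ) = v ^ ((α - 1 : ℝ) : ℂ) * v by
        rw [Complex.ofReal_sub, Complex.ofReal_one, Complex.cpow_sub _ _ hs0, Complex.cpow_one,
          div_mul_cancel₀ _ hs0]]
    push_cast
    field_simp
    ring

/-- The Lévy measure of the driver of a process whose stationary law has a tempered stable side. -/
def driverSideMeasure (b c α β : ℝ) : Measure ℝ :=
  sideMeasure (c * b * α) α β + sideMeasure (c * b * β) (α - 1) β

instance (b c α β : ℝ) : SFinite (driverSideMeasure b c α β) := by
  rw [driverSideMeasure]; infer_instance

theorem isLevyExponent_driverSideMeasure {b c α β : ℝ} (hb : 0 < b) (hc : 0 ≤ c)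
    (hα0 : 0 < c → 0 ≤ α) (hα : α < 2) (hβ : 0 < β) :
    IsLevyExponent (driverSideMeasure b c α β) 0
      (fun u => c * b * (Complex.I * u * tsSideDeriv α β (Complex.I * u)))
      {a | 0 < c → -β < a} := by
  have h0 : 0 ≤ c * b * α := by
    rcases hc.eq_or_lt with rfl | hc
    · simp
    · have := hα0 hc; positivity
  have hpos : ∀ y, 0 < c * b * y → 0 < c := fun y hy => by
    rcases hc.eq_or_lt with rfl | hc
    · simp at hy
    · exact hc
  have h := ((isLevyExponent_sideMeasure h0 hα hβ).mono (T := {a | 0 < c → -β < a})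
      fun a ha h => ha (hpos _ h)).add
    ((isLevyExponent_sideMeasure (c := c * b * β) (α := α - 1) (by positivity) (by linarith)
      hβ).mono (T := {a | 0 < c → -β < a}) fun a ha h => ha (hpos _ h))
  rw [add_zero] at h
  rw [driverSideMeasure]
  convert h using 1
  funext u
  rw [mul_tsSideDeriv hα hβ (by simpa using hβ)]
  push_cast
  ring

theorem integrable_id_driverSideMeasure {b c α β : ℝ} (hb : 0 < b) (hc : 0 ≤ c)
    (hα0 : 0 < c → 0 ≤ α) (hα1 : 0 < c → α < 1) (hβ : 0 < β) :
    Integrable (fun x => x) (driverSideMeasure b c α β) := by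
  rcases hc.eq_or_lt with rfl | hc
  · simp [driverSideMeasure, sideMeasure_zero]
  · have := hα0 hc
    exact (integrable_id_sideMeasure (by positivity) (fun _ => hα1 hc) hβ).add_measure
      (integrable_id_sideMeasure (by positivity) (fun _ => by linarith [hα1 hc]) hβ)

theorem smallJumpBound_driverSideMeasure {b c α β : ℝ} (hb : 0 < b) (hc : 0 < c) (hα0 : 0 < α)
    (hα : α < 2) (hβ : 0 < β) : SmallJumpBound (driverSideMeasure b c α β) α :=
  ((smallJumpBound_tsMeasure hα hβ).smul (by positivity)).mono (Measure.le_add_right le_rfl)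
    (isLevyExponent_driverSideMeasure hb hc.le (fun _ => hα0.le) hα hβ).sq

namespace TSParams

variable (p : TSParams)

/-- The derivative of the exponent. -/
def exponentDeriv (u : ℝ) : ℂ :=
  Complex.I * p.γc + p.cp * (Complex.I * tsSideDeriv p.αp p.βp (Complex.I * u))
    + p.cn * (-Complex.I * tsSideDeriv p.αn p.βn (-(Complex.I * u)))

theorem hasDerivAt_exponent (u : ℝ) : HasDerivAt p.exponent (p.exponentDeriv u) u := by
  have h0 : HasDerivAt (fun u : ℝ => (u : ℂ)) 1 u := Complex.ofRealCLM.hasDerivAt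
  have h1 : HasDerivAt (fun u : ℝ => Complex.I * (u : ℂ)) (Complex.I * 1) u := h0.const_mul _
  have h2 := (hasDerivAt_tsSide p.αp p.βp_pos (w := Complex.I * u) (by simpa using p.βp_pos)).comp u h1
  have h3 := (hasDerivAt_tsSide p.αn p.βn_pos (w := -(Complex.I * u))
    (by simpa using p.βn_pos)).comp u h1.neg
  refine (((h1.mul_const (p.γc : ℂ)).add (h2.const_mul (p.cp : ℂ))).add
    (h3.const_mul (p.cn : ℂ))).congr_deriv ?_
  rw [exponentDeriv]
  ring

/-- The Lévy measure of the driver of a process with tempered stable stationary law. -/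
def driverMeasure (b : ℝ) : Measure ℝ :=
  driverSideMeasure b p.cp p.αp p.βp + (driverSideMeasure b p.cn p.αn p.βn).map fun x => -x

instance (b : ℝ) : SFinite (p.driverMeasure b) := by
  rw [driverMeasure]; infer_instance

variable {p}

theorem isLevyExponent_driver (h : p.NonnegStability) {b : ℝ} (hb : 0 < b) :
    IsLevyExponent (p.driverMeasure b) (b * p.γc) (fun u => b * (u * p.exponentDeriv u)) p.strip := by
  have := (isLevyExponent_driverSideMeasure hb p.cp_nonneg h.1 p.αp_lt p.βp_pos).bilateral
    (isLevyExponent_driverSideMeasure hb p.cn_nonneg h.2 p.αn_lt p.βn_pos) (b * p.γc)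
  rw [strip_eq, driverMeasure]
  convert this using 1
  funext u
  rw [exponentDeriv]
  push_cast
  ring_nf

/-- The increment has the law of one driven by a process with exponent `b u ψ'(u)`, so the analysis
of Ornstein–Uhlenbeck increments applies without identifying the exponent of `L` itself. -/
theorem charFun_eq_of_stationary (h : p.NonnegStability) {b t : ℝ} (hb : 0 < b) {ρ : Measure ℝ}
    (hρ : ∀ u, charFun ρ u = Complex.exp (p.exponent u - p.exponent (Real.exp (-b * t) * u)))
    (u : ℝ) : charFun ρ u = Complex.exp (∫ s in (0 : ℝ)..t,
      (fun u : ℝ => (b : ℂ) * (u * p.exponentDeriv u)) (Real.exp (-b * s) * u)) := by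
  rw [hρ, ← sub_eq_integral_of_hasDerivAt (b := b) (isLevyExponent_driver h hb).continuous
    p.hasDerivAt_exponent fun u => rfl]

theorem smallJumpBound_driver (h : p.NonnegStability) (h0 : 0 < p.index) {b : ℝ} (hb : 0 < b) :
    SmallJumpBound (p.driverMeasure b) p.index := by
  have hsq := (isLevyExponent_driver h hb).sq
  rcases p.index_eq with ⟨hc, e⟩ | ⟨hc, e⟩
  · rw [e] at h0 ⊢
    exact (smallJumpBound_driverSideMeasure hb hc h0 p.αp_lt p.βp_pos).mono
      (Measure.le_add_right le_rfl) hsq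
  · rw [e] at h0 ⊢
    exact (smallJumpBound_driverSideMeasure hb hc h0 p.αn_lt p.βn_pos).neg.mono
      (Measure.le_add_left le_rfl) hsq

theorem integrable_id_driver (h : p.NonnegStability) (h1 : p.index < 1) {b : ℝ} (hb : 0 < b) :
    Integrable (fun x => x) (p.driverMeasure b) := by
  refine (integrable_id_driverSideMeasure hb p.cp_nonneg h.1
    (fun hc => (p.le_index.1 hc).trans_lt h1) p.βp_pos).add_measure (integrable_map_neg.2 ?_)
  exact (integrable_id_driverSideMeasure hb p.cn_nonneg h.2
    (fun hc => (p.le_index.2 hc).trans_lt h1) p.βn_pos).neg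

theorem stationary_cases (h : p.NonnegStability) {b t : ℝ} (hb : 0 < b) (ht : 0 < t)
    {ρ : Measure ℝ} [IsProbabilityMeasure ρ]
    (hρ : ∀ u, charFun ρ u = Complex.exp (p.exponent u - p.exponent (Real.exp (-b * t) * u))) :
    (0 < p.index → p.index < 1 → InfiniteActivityFiniteVariation ρ ∧
      ExponentialErrorDecay ρ p.strip p.index) ∧
    (1 ≤ p.index → InfiniteActivityInfiniteVariation ρ ∧
      ExponentialErrorDecay ρ p.strip p.index) := by
  have hρ' := charFun_eq_of_stationary h hb hρ
  have hZ := (isLevyExponent_driver h hb).ou hb ht.le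
  have hsq := (isLevyExponent_driver h hb).sq
  refine ⟨fun h0 h1 => ⟨?_, ?_⟩, fun h1 => ⟨?_, ?_⟩⟩
  · exact hZ.infiniteActivityFiniteVariation hρ' h0.le
      ((smallJumpBound_driver h h0 hb).ou hb ht hsq)
      (integrable_id_ouMeasure hb (integrable_id_driver h h1 hb))
  · exact hZ.exponentialErrorDecay hρ' h0 ((smallJumpBound_driver h h0 hb).ou hb ht hsq)
  · exact hZ.infiniteActivityInfiniteVariation hρ' h1
      ((smallJumpBound_driver h (by linarith) hb).ou hb ht hsq)
  · exact hZ.exponentialErrorDecay hρ' (by linarith)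
      ((smallJumpBound_driver h (by linarith) hb).ou hb ht hsq)

/-- The compound Poisson driver of a process with bilateral Gamma stationary law. -/
def gammaDriver (p : TSParams) {b : ℝ} (hb : 0 < b) : TSParams where
  αp := -1
  αn := -1
  βp := p.βp
  βn := p.βn
  cp := p.cp * b * p.βp
  cn := p.cn * b * p.βn
  γc := b * p.γc
  αp_lt := by norm_num
  αn_lt := by norm_num
  βp_pos := p.βp_pos
  βn_pos := p.βn_pos
  cp_nonneg := mul_nonneg (mul_nonneg p.cp_nonneg hb.le) p.βp_pos.le
  cn_nonneg := mul_nonneg (mul_nonneg p.cn_nonneg hb.le) p.βn_pos.le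
  nondegenerate := p.nondegenerate.imp (fun h => mul_pos (mul_pos h hb) p.βp_pos)
    fun h => mul_pos (mul_pos h hb) p.βn_pos

/-- At index zero the first term of `α g_α + β g_{α-1}` vanishes. The driver that remains has
exponential jumps, that is, index `-1`, with rates `c b` on each side, and the finite activity case
gives the exponent `1`. -/
theorem stationary_gamma (h : p.NonnegStability) {b t : ℝ} (hb : 0 < b) (ht : 0 < t)
    {ρ : Measure ℝ} [IsProbabilityMeasure ρ]
    (hρ : ∀ u, charFun ρ u = Complex.exp (p.exponent u - p.exponent (Real.exp (-b * t) * u)))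
    (hi : p.index = 0) :
    FiniteActivity ρ ∧ ∃ V, BernoulliDecomposition ρ V ((p.cp + p.cn) * b * t)
      ((1 - Real.exp (-b * t)) * p.drift) ∧ PowerLawErrorDecay V p.strip 1 := by
  set q := p.gammaDriver hb with hq
  have hp0 : 0 < p.cp → p.αp = 0 := fun hc => le_antisymm (hi ▸ p.le_index.1 hc) (h.1 hc)
  have hn0 : 0 < p.cn → p.αn = 0 := fun hc => le_antisymm (hi ▸ p.le_index.2 hc) (h.2 hc)
  have hside : ∀ (c α β : ℝ) (w : ℂ), 0 ≤ c → (0 < c → α = 0) → 0 < β → w.re < β →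
      (b : ℂ) * (c * (w * tsSideDeriv α β w)) = (c * b * β : ℝ) * tsSide (-1) β w := by
    intro c α β w hc hα hβ hw
    rcases hc.eq_or_lt with rfl | hc
    · simp
    · rw [hα hc, mul_tsSideDeriv (by norm_num) hβ hw]
      push_cast
      simp only [zero_sub]
      ring
  have hexp : ∀ u, q.exponent u = b * (u * p.exponentDeriv u) := by
    intro u
    have e1 := hside p.cp p.αp p.βp (Complex.I * u) p.cp_nonneg hp0 p.βp_pos (by simpa using p.βp_pos)
    have e2 := hside p.cn p.αn p.βn (-(Complex.I * u)) p.cn_nonneg hn0 p.βn_pos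
      (by simpa using p.βn_pos)
    simp only [exponent, hq, gammaDriver]
    rw [← e1, ← e2, exponentDeriv]
    push_cast
    ring
  have hρ' : ∀ u, charFun ρ u
      = Complex.exp (∫ s in (0 : ℝ)..t, q.exponent (Real.exp (-b * s) * u)) := by
    intro u
    rw [charFun_eq_of_stationary h hb hρ]
    simp only [hexp]
  have hindex : q.index = -1 := by simp [hq, gammaDriver, index]
  have hstrip : q.strip = p.strip := by
    have k1 : 0 < p.cp * b * p.βp ↔ 0 < p.cp := by
      rw [mul_assoc, mul_pos_iff_of_pos_right (mul_pos hb p.βp_pos)]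
    have k2 : 0 < p.cn * b * p.βn ↔ 0 < p.cn := by
      rw [mul_assoc, mul_pos_iff_of_pos_right (mul_pos hb p.βn_pos)]
    ext a
    simp [hq, gammaDriver, strip, k1, k2]
  have hβp := p.βp_pos.ne'
  have hβn := p.βn_pos.ne'
  have hint : q.intensity = (p.cp + p.cn) * b := by
    simp only [hq, gammaDriver, intensity, neg_neg, Real.Gamma_one, Real.rpow_neg_one]
    field_simp
  have hdrift : q.drift = b * p.drift := by
    have hs : ∀ c α β : ℝ, 0 ≤ c → (0 < c → α = 0) → 0 < β →
        c * b * β * Real.Gamma (1 - -1) * β ^ (-1 - 1 : ℝ)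
          = b * (c * Real.Gamma (1 - α) * β ^ (α - 1)) := by
      intro c α β hc hα hβ
      rcases hc.eq_or_lt with rfl | hc
      · simp
      · rw [hα hc, show (1 : ℝ) - -1 = 2 by norm_num, show (-1 : ℝ) - 1 = -2 by norm_num,
          Real.Gamma_two, sub_zero, Real.Gamma_one, zero_sub, Real.rpow_neg_one,
          Real.rpow_neg hβ.le, Real.rpow_two]
        field_simp
    simp only [hq, gammaDriver, drift]
    rw [hs _ _ _ p.cp_nonneg hp0 p.βp_pos, hs _ _ _ p.cn_nonneg hn0 p.βn_pos]
    ring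
  have := q.finiteActivity hb ht hρ' (by rw [hindex]; norm_num)
  rw [hint, hdrift, hindex, hstrip, neg_neg, ← mul_assoc, div_mul_cancel₀ _ hb.ne'] at this
  exact this

end TSParams

/-! ### Brownian subordination -/

/-- The value at time `s` of a Brownian motion with drift `θ` and volatility `σ`, as a function of
`s` and a standard normal variable. -/
def brownianValue (θ σ : ℝ) (q : ℝ × ℝ) : ℝ := θ * q.1 + σ * √q.1 * q.2

theorem measurable_brownianValue (θ σ : ℝ) : Measurable (brownianValue θ σ) := by
  unfold brownianValue; fun_prop

/-- The Lévy measure of a Brownian motion with drift, subordinated to a process with Lévy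
measure `m`. -/
def subordinatedMeasure (θ σ : ℝ) (m : Measure ℝ) : Measure ℝ :=
  (m.prod (gaussianReal 0 1)).map (brownianValue θ σ)

instance (θ σ : ℝ) (m : Measure ℝ) [SFinite m] : SFinite (subordinatedMeasure θ σ m) := by
  rw [subordinatedMeasure]; infer_instance

theorem integral_cexp_brownianValue (θ σ : ℝ) {s : ℝ} (hs : 0 ≤ s) (w : ℂ) :
    ∫ ξ, Complex.exp (Complex.I * w * brownianValue θ σ (s, ξ)) ∂gaussianReal 0 1
      = Complex.exp ((Complex.I * w * θ - σ ^ 2 * w ^ 2 / 2) * s) := by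
  have h := complexMGF_id_gaussianReal (μ := 0) (v := 1) (Complex.I * w * σ * (√s : ℝ))
  have hsq : ((√s : ℝ) : ℂ) ^ 2 = s := by rw [← Complex.ofReal_pow, Real.sq_sqrt hs]
  simp only [complexMGF, id] at h
  have e : ∀ ξ : ℝ, Complex.exp (Complex.I * w * brownianValue θ σ (s, ξ))
      = Complex.exp (Complex.I * w * θ * s) * Complex.exp (Complex.I * w * σ * (√s : ℝ) * ξ) := by
    intro ξ
    rw [← Complex.exp_add]
    congr 1
    simp only [brownianValue]
    push_cast
    ring
  simp_rw [e]
  rw [integral_const_mul, h, ← Complex.exp_add]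
  congr 1
  simp only [Complex.ofReal_zero, NNReal.coe_one, Complex.ofReal_one]
  linear_combination (σ ^ 2 * w ^ 2 * s / 2) * Complex.I_sq
    + (Complex.I ^ 2 * w ^ 2 * σ ^ 2 / 2) * hsq

theorem integrable_exp_brownianValue (θ σ c s : ℝ) :
    Integrable (fun ξ => Real.exp (-(c * brownianValue θ σ (s, ξ)))) (gaussianReal 0 1) := by
  refine ((integrable_exp_mul_gaussianReal (μ := 0) (v := 1) (-(c * (σ * √s)))).const_mul
    (Real.exp (-(c * (θ * s))))).congr (ae_of_all _ fun ξ => ?_)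
  simp only [brownianValue]
  rw [← Real.exp_add]
  ring_nf

theorem integral_exp_brownianValue (θ σ c : ℝ) {s : ℝ} (hs : 0 ≤ s) :
    ∫ ξ, Real.exp (-(c * brownianValue θ σ (s, ξ))) ∂gaussianReal 0 1
      = Real.exp ((σ ^ 2 * c ^ 2 / 2 - θ * c) * s) := by
  have h := integral_cexp_brownianValue θ σ hs (Complex.I * c)
  rw [← Complex.ofReal_inj, ← integral_complex_ofReal]
  have e : ∀ x : ℝ, Complex.exp (Complex.I * (Complex.I * c) * x)
      = ((Real.exp (-(c * x)) : ℝ) : ℂ) := by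
    intro x
    push_cast
    congr 1
    linear_combination (c : ℂ) * x * Complex.I_sq
  simp_rw [e] at h
  rw [h]
  push_cast
  congr 1
  linear_combination (θ * c * s - σ ^ 2 * c ^ 2 * s / 2 : ℂ) * Complex.I_sq

/-- Used to dominate `x² e^{-cx}` by a second difference of exponentials, whose Gaussian averages
are explicit. -/
theorem sq_le_exp_add_exp (y : ℝ) : y ^ 2 ≤ Real.exp y + Real.exp (-y) - 2 := by
  have h1 : Real.exp y + Real.exp (-y) - 2 = 4 * Real.sinh (y / 2) ^ 2 := by
    have e1 : Real.exp y = Real.exp (y / 2) ^ 2 := by rw [← Real.exp_nat_mul]; congr 1; push_cast; ring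
    have e2 : Real.exp (-y) = Real.exp (-(y / 2)) ^ 2 := by
      rw [← Real.exp_nat_mul]; congr 1; push_cast; ring
    have e3 : Real.exp (y / 2) * Real.exp (-(y / 2)) = 1 := by rw [← Real.exp_add]; simp
    rw [e1, e2, Real.sinh_eq]
    linear_combination (2 : ℝ) * e3
  have h2 : (y / 2) ^ 2 ≤ Real.sinh (y / 2) ^ 2 := by
    rcases le_total 0 (y / 2) with h | h
    · exact pow_le_pow_left₀ h (Real.self_le_sinh_iff.2 h) 2
    · have := Real.sinh_le_self_iff.2 h
      nlinarith
  rw [h1]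
  linarith

variable {m : Measure ℝ}

theorem integrable_exp_sub_one_of_lt {g : ℝ} (hpos : ∀ᵐ s ∂m, 0 < s)
    (h1 : Integrable (fun s => s) m) (hg : Integrable (fun s => s * Real.exp (g * s)) m) :
    Integrable (fun s => Real.exp (g * s) - 1) m := by
  refine ((h1.add hg).const_mul |g|).mono' (by fun_prop) ?_
  filter_upwards [hpos] with s hs
  simp only [Pi.add_apply, Real.norm_eq_abs]
  have e := Real.exp_pos (g * s)
  have l1 := Real.add_one_le_exp (g * s)
  have l2 : Real.exp (g * s) - 1 ≤ g * s * Real.exp (g * s) := by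
    have := Real.add_one_le_exp (-(g * s))
    have e2 : Real.exp (g * s) * Real.exp (-(g * s)) = 1 := by rw [← Real.exp_add]; simp
    nlinarith
  rw [abs_le]
  rcases le_total 0 g with h | h
  · rw [abs_of_nonneg h]
    constructor <;> nlinarith [mul_nonneg h hs.le, mul_nonneg (mul_nonneg h hs.le) e.le]
  · rw [abs_of_nonpos h]
    constructor <;> nlinarith [mul_nonneg (neg_nonneg.2 h) hs.le,
      mul_nonneg (mul_nonneg (neg_nonneg.2 h) hs.le) e.le]

theorem integrable_exp_subordinatedMeasure {θ σ c : ℝ} (hpos : ∀ᵐ s ∂m, 0 < s)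
    (h : Integrable (fun s => Real.exp ((σ ^ 2 * c ^ 2 / 2 - θ * c) * s)) m) :
    Integrable (fun x => Real.exp (-(c * x))) (subordinatedMeasure θ σ m) := by
  have hb := measurable_brownianValue θ σ
  rw [subordinatedMeasure, integrable_map_measure (by fun_prop) hb.aemeasurable,
    integrable_prod_iff (by fun_prop)]
  refine ⟨ae_of_all _ fun s => integrable_exp_brownianValue θ σ c s, h.congr ?_⟩
  filter_upwards [hpos] with s hs
  simp only [Function.comp, Real.norm_eq_abs, Real.abs_exp]
  exact (integral_exp_brownianValue θ σ c hs.le).symm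

/-- The second difference of `c ↦ e^{-cx}` with step `ε` dominates `ε² x² e^{-cx}`. Its Gaussian
average is a combination of `e^{gs}` with weights `1, 1, -2`; as these add up to zero, `e^{gs} - 1`
may be used instead, which is integrable near `0` even when `m` is infinite. -/
theorem integrable_sq_mul_exp_subordinatedMeasure {θ σ c ε : ℝ} (hε : 0 < ε)
    (hpos : ∀ᵐ s ∂m, 0 < s)
    (h : ∀ d ∈ Set.Icc (c - ε) (c + ε),
      Integrable (fun s => Real.exp ((σ ^ 2 * d ^ 2 / 2 - θ * d) * s) - 1) m) :
    Integrable (fun x => x ^ 2 * Real.exp (-(c * x))) (subordinatedMeasure θ σ m) := by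
  have hb := measurable_brownianValue θ σ
  set F : ℝ → ℝ := fun x => Real.exp (-((c - ε) * x)) + Real.exp (-((c + ε) * x))
    - 2 * Real.exp (-(c * x)) with hF
  have hFle : ∀ x, ε ^ 2 * (x ^ 2 * Real.exp (-(c * x))) ≤ F x := by
    intro x
    have e1 : F x = Real.exp (-(c * x)) * (Real.exp (ε * x) + Real.exp (-(ε * x)) - 2) := by
      simp only [hF]
      rw [show -((c - ε) * x) = -(c * x) + ε * x by ring,
        show -((c + ε) * x) = -(c * x) + -(ε * x) by ring, Real.exp_add, Real.exp_add]
      ring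
    rw [e1]
    have := mul_le_mul_of_nonneg_left (sq_le_exp_add_exp (ε * x)) (Real.exp_pos (-(c * x))).le
    linarith [mul_pow ε x 2]
  have hF0 : ∀ x, 0 ≤ F x := fun x => le_trans (by positivity) (hFle x)
  have hFi : Integrable F (subordinatedMeasure θ σ m) := by
    rw [subordinatedMeasure, integrable_map_measure (by fun_prop) hb.aemeasurable,
      integrable_prod_iff (by fun_prop)]
    have hi : ∀ s, Integrable (fun ξ => F (brownianValue θ σ (s, ξ))) (gaussianReal 0 1) := fun s =>
      ((integrable_exp_brownianValue θ σ _ s).add (integrable_exp_brownianValue θ σ _ s)).sub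
        ((integrable_exp_brownianValue θ σ _ s).const_mul 2)
    refine ⟨ae_of_all _ hi, ?_⟩
    refine (((h (c - ε) ⟨le_rfl, by linarith⟩).add (h (c + ε) ⟨by linarith, le_rfl⟩)).sub
      ((h c ⟨by linarith, by linarith⟩).const_mul 2)).congr ?_
    filter_upwards [hpos] with s hs
    simp only [Function.comp, Real.norm_eq_abs, abs_of_nonneg (hF0 _), Pi.add_apply, Pi.sub_apply]
    simp only [hF]
    have i2 : Integrable (fun ξ => Real.exp (-((c - ε) * brownianValue θ σ (s, ξ)))
        + Real.exp (-((c + ε) * brownianValue θ σ (s, ξ)))) (gaussianReal 0 1) :=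
      (integrable_exp_brownianValue θ σ _ s).add (integrable_exp_brownianValue θ σ _ s)
    rw [integral_sub i2 ((integrable_exp_brownianValue θ σ _ s).const_mul 2),
      integral_add (integrable_exp_brownianValue θ σ _ s) (integrable_exp_brownianValue θ σ _ s),
      integral_const_mul, integral_exp_brownianValue θ σ _ hs.le,
      integral_exp_brownianValue θ σ _ hs.le, integral_exp_brownianValue θ σ _ hs.le]
    ring
  refine (hFi.const_mul (ε ^ 2)⁻¹).mono' (by fun_prop) (ae_of_all _ fun x => ?_)
  rw [Real.norm_eq_abs, abs_of_nonneg (by positivity), inv_mul_eq_div, le_div_iff₀ (by positivity)]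
  linarith [hFle x]

theorem subordinatedMeasure_absolutelyContinuous {θ σ : ℝ} (hσ : σ ≠ 0) (hpos : ∀ᵐ s ∂m, 0 < s) :
    subordinatedMeasure θ σ m ≪ volume := by
  have hb := measurable_brownianValue θ σ
  refine Measure.AbsolutelyContinuous.mk fun A hA h0 => ?_
  rw [subordinatedMeasure, Measure.map_apply hb hA, Measure.measure_prod_null (hb hA)]
  filter_upwards [hpos] with s hs
  refine gaussianReal_absolutelyContinuous 0 one_ne_zero ?_
  have hk : σ * √s ≠ 0 := mul_ne_zero hσ (Real.sqrt_pos.2 hs).ne'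
  have e : Prod.mk s ⁻¹' (brownianValue θ σ ⁻¹' A)
      = (fun ξ => σ * √s * ξ) ⁻¹' ((fun x => θ * s + x) ⁻¹' A) := rfl
  rw [e, Real.volume_preimage_mul_left hk, measure_preimage_add, h0, mul_zero]

theorem integral_cexp_subordinatedMeasure [SFinite m] {θ σ : ℝ} (hpos : ∀ᵐ s ∂m, 0 < s) {w : ℂ}
    (h : Integrable (fun x => Real.exp (-(w.im * x))) (subordinatedMeasure θ σ m)) :
    cf (subordinatedMeasure θ σ m) w
      = ∫ s : ℝ, Complex.exp ((Complex.I * w * θ - σ ^ 2 * w ^ 2 / 2) * s) ∂m := by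
  have hb := measurable_brownianValue θ σ
  have h' := integrable_exp_I_mul_iff.2 h
  rw [subordinatedMeasure, integrable_map_measure (by fun_prop) hb.aemeasurable,
    Function.comp_def] at h'
  rw [cf, subordinatedMeasure, integral_map hb.aemeasurable (by fun_prop), integral_prod _ h']
  refine integral_congr_ae ?_
  filter_upwards [hpos] with s hs using integral_cexp_brownianValue θ σ hs.le w

theorem integrable_id_gaussian : Integrable (fun ξ : ℝ => ξ) (gaussianReal 0 1) :=
  (memLp_id_gaussianReal' 1 (by simp)).integrable le_rfl

/-- The drift contributes `s` and the noise `√s`. The integrability of `√s` is what fixes the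
threshold `α = 1/2` for finite variation. -/
theorem integrable_id_subordinatedMeasure {θ σ : ℝ}
    (h1 : Integrable (fun s => s) m) (h2 : Integrable (fun s => √s) m) :
    Integrable (fun x => x) (subordinatedMeasure θ σ m) := by
  have hb := measurable_brownianValue θ σ
  rw [subordinatedMeasure, integrable_map_measure (by fun_prop) hb.aemeasurable]
  exact ((h1.const_mul θ).comp_fst (gaussianReal 0 1)).add
    ((h2.const_mul σ).mul_prod integrable_id_gaussian)

theorem integral_id_brownianValue (θ σ s : ℝ) :
    ∫ ξ, brownianValue θ σ (s, ξ) ∂gaussianReal 0 1 = θ * s := by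
  simp only [brownianValue]
  rw [integral_add (integrable_const _) (integrable_id_gaussian.const_mul _), integral_const,
    integral_const_mul, integral_id_gaussianReal]
  simp

theorem integral_id_subordinatedMeasure [SFinite m] {θ σ : ℝ}
    (h : Integrable (fun x => x) (subordinatedMeasure θ σ m)) :
    ∫ x, x ∂subordinatedMeasure θ σ m = θ * ∫ s, s ∂m := by
  have hb := measurable_brownianValue θ σ
  rw [subordinatedMeasure, integrable_map_measure (by fun_prop) hb.aemeasurable,
    Function.comp_def] at h
  rw [subordinatedMeasure, integral_map hb.aemeasurable (by fun_prop), integral_prod _ h]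
  simp_rw [integral_id_brownianValue]
  rw [integral_const_mul]

theorem integral_centered_subordinatedMeasure [SFinite m] {θ σ : ℝ} (hpos : ∀ᵐ s ∂m, 0 < s)
    (h2 : Integrable (fun x => x ^ 2) (subordinatedMeasure θ σ m)) (u : ℝ) :
    ∫ x : ℝ, (Complex.exp (Complex.I * u * x) - 1 - Complex.I * u * x) ∂subordinatedMeasure θ σ m
      = ∫ s : ℝ, (Complex.exp ((Complex.I * u * θ - σ ^ 2 * u ^ 2 / 2) * s) - 1
        - Complex.I * u * θ * s) ∂m := by
  have hb := measurable_brownianValue θ σ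
  have h' := integrable_centered_ofReal h2 u
  rw [subordinatedMeasure, integrable_map_measure (by fun_prop) hb.aemeasurable,
    Function.comp_def] at h'
  rw [subordinatedMeasure, integral_map hb.aemeasurable (by fun_prop), integral_prod _ h']
  refine integral_congr_ae ?_
  filter_upwards [hpos] with s hs
  have i1 : Integrable (fun ξ : ℝ => Complex.exp (Complex.I * u * brownianValue θ σ (s, ξ)))
      (gaussianReal 0 1) := by
    refine (integrable_const (1 : ℝ)).mono' (by simp only [brownianValue]; fun_prop)
      (ae_of_all _ fun ξ => ?_)
    rw [norm_exp_I_mul]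
    simp
  have i2 : Integrable (fun ξ : ℝ => brownianValue θ σ (s, ξ)) (gaussianReal 0 1) := by
    simp only [brownianValue]
    exact (integrable_const _).add (integrable_id_gaussian.const_mul _)
  have i3 : Integrable (fun ξ : ℝ => Complex.I * u * (brownianValue θ σ (s, ξ) : ℂ))
      (gaussianReal 0 1) := i2.ofReal.const_mul _
  have i4 : Integrable (fun ξ : ℝ => Complex.exp (Complex.I * u * brownianValue θ σ (s, ξ)) - 1)
      (gaussianReal 0 1) := i1.sub (integrable_const _)
  rw [integral_sub i4 i3, integral_sub i1 (integrable_const _), integral_cexp_brownianValue θ σ hs.le,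
    integral_const_mul, integral_complex_ofReal, integral_id_brownianValue]
  simp
  ring

theorem integrable_sq_subordinatedMeasure {θ σ : ℝ} (hpos : ∀ᵐ s ∂m, 0 < s)
    (h1 : Integrable (fun s => s) m) (h2 : Integrable (fun s => s ^ 2) m) :
    Integrable (fun x => x ^ 2) (subordinatedMeasure θ σ m) := by
  have hb := measurable_brownianValue θ σ
  have hg : Integrable (fun ξ : ℝ => ξ ^ 2) (gaussianReal 0 1) :=
    (memLp_id_gaussianReal' 2 (by simp)).integrable_sq
  rw [subordinatedMeasure, integrable_map_measure (by fun_prop) hb.aemeasurable]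
  refine (((h2.const_mul (2 * θ ^ 2)).comp_fst (gaussianReal 0 1)).add
    ((h1.const_mul (2 * σ ^ 2)).mul_prod hg)).mono' (by fun_prop) ?_
  filter_upwards [Measure.quasiMeasurePreserving_fst.ae hpos] with q hq
  have hsq := Real.sq_sqrt (le_of_lt hq)
  simp only [Function.comp, brownianValue, Pi.add_apply, Real.norm_eq_abs]
  rw [abs_of_nonneg (sq_nonneg _)]
  have : (θ * q.1 + σ * √q.1 * q.2) ^ 2 ≤ 2 * (θ * q.1) ^ 2 + 2 * (σ * √q.1 * q.2) ^ 2 := by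
    nlinarith [sq_nonneg (θ * q.1 - σ * √q.1 * q.2)]
  refine this.trans_eq ?_
  rw [mul_pow, mul_pow, mul_pow, hsq]
  ring

/-- Small jumps of a subordinated Brownian motion. -/
theorem SmallJumpBound.subordinated [SFinite m] {θ σ α : ℝ} (hσ : 0 < σ) (hpos : ∀ᵐ s ∂m, 0 < s)
    (h1 : Integrable (fun s => s) m) (h2 : Integrable (fun s => s ^ 2) m)
    (h : SmallJumpBound m α) : SmallJumpBound (subordinatedMeasure θ σ m) (2 * α) := by
  obtain ⟨C, hC, h⟩ := h
  have hb := measurable_brownianValue θ σ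
  have hsqi := integrable_sq_subordinatedMeasure (θ := θ) (σ := σ) hpos h1 h2
  -- For `√s ≤ d y` and a normal variable in `[1, 2]` the noise dominates the drift: `hd2` keeps the
  -- value below `y`, and `hd3` keeps it above `σ √s / 2`.
  obtain ⟨d, hd0, hd1, hd2, hd3⟩ : ∃ d : ℝ, 0 < d ∧ d ≤ 1 ∧ (|θ| + 2 * σ) * d ≤ 1 ∧
      |θ| * d ≤ σ / 2 := by
    refine ⟨min 1 (min (1 / (|θ| + 2 * σ)) (σ / 2 / (|θ| + 1))), by positivity, min_le_left _ _,
      ?_, ?_⟩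
    · have := (min_le_right 1 (min (1 / (|θ| + 2 * σ)) (σ / 2 / (|θ| + 1)))).trans (min_le_left _ _)
      calc _ ≤ (|θ| + 2 * σ) * (1 / (|θ| + 2 * σ)) := by gcongr
        _ = 1 := by field_simp
    · have := (min_le_right 1 (min (1 / (|θ| + 2 * σ)) (σ / 2 / (|θ| + 1)))).trans (min_le_right _ _)
      calc _ ≤ (|θ| + 1) * (σ / 2 / (|θ| + 1)) := by gcongr; linarith
        _ = σ / 2 := by field_simp
  set G := (gaussianReal 0 1).real (Set.Icc 1 2) with hG
  have hGpos : 0 < G := by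
    rw [hG, measureReal_def, ENNReal.toReal_pos_iff]
    refine ⟨?_, measure_lt_top _ _⟩
    by_contra hne
    have h0 : gaussianReal 0 1 (Set.Icc 1 2) = 0 := nonpos_iff_eq_zero.1 (not_lt.1 hne)
    have := gaussianReal_absolutelyContinuous' 0 one_ne_zero h0
    norm_num at this
  refine ⟨σ ^ 2 / 4 * G * C * (d ^ 2) ^ (1 - α), by positivity, fun y hy hy1 => ?_⟩
  -- Brownian scaling: times up to order `y²` produce jumps up to order `y`. This doubles the index.
  set η := d ^ 2 * y ^ 2 with hη
  have hη0 : 0 < η := by positivity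
  have hη1 : η ≤ 1 := by
    rw [hη, ← mul_pow]
    exact pow_le_one₀ (by positivity) (by nlinarith)
  have hm := h η hη0 hη1
  rw [subordinatedMeasure, setIntegral_map measurableSet_Icc (by fun_prop) hb.aemeasurable]
  rw [subordinatedMeasure, integrable_map_measure (by fun_prop) hb.aemeasurable] at hsqi
  have hbound : ∀ s ∈ Set.Ioc 0 η, ∀ ξ ∈ Set.Icc (1 : ℝ) 2,
      |brownianValue θ σ (s, ξ)| ≤ y ∧ σ ^ 2 / 4 * s ≤ brownianValue θ σ (s, ξ) ^ 2 := by
    intro s hs ξ hξ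
    have hr0 : 0 < √s := Real.sqrt_pos.2 hs.1
    have hr2 := Real.sq_sqrt hs.1.le
    have hr1 : √s ≤ d * y := by
      rw [Real.sqrt_le_left (by positivity), mul_pow]; exact hs.2
    set q := √s with hq
    have hdy : d * y ≤ d := by nlinarith
    have e : brownianValue θ σ (s, ξ) = q * (θ * q + σ * ξ) := by
      simp only [brownianValue, ← hq]; rw [← hr2]; ring
    have ht1 : |θ * q| ≤ σ / 2 := by
      rw [abs_mul, abs_of_pos hr0]
      exact (mul_le_mul_of_nonneg_left (hr1.trans hdy) (abs_nonneg θ)).trans hd3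
    have hlow : σ / 2 ≤ θ * q + σ * ξ := by
      nlinarith [neg_abs_le (θ * q), hξ.1]
    have hup : θ * q + σ * ξ ≤ |θ| + 2 * σ := by
      have : |θ * q| ≤ |θ| := by
        rw [abs_mul, abs_of_pos hr0]
        exact mul_le_of_le_one_right (abs_nonneg θ) (hr1.trans (hdy.trans hd1))
      nlinarith [le_abs_self (θ * q), hξ.2]
    constructor
    · rw [e, abs_of_pos (mul_pos hr0 (by linarith))]
      calc q * (θ * q + σ * ξ) ≤ d * y * (|θ| + 2 * σ) := by gcongr; linarith
        _ = (|θ| + 2 * σ) * d * y := by ring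
        _ ≤ 1 * y := by gcongr
        _ = y := one_mul y
    · rw [e, mul_pow, hr2]
      nlinarith [mul_le_mul_of_nonneg_left (pow_le_pow_left₀ (by positivity) hlow 2) hs.1.le]
  -- The square of the jump is at least `σ² s / 4`. Replacing `s` by the smaller `s² / η` makes the
  -- truncated second moment of `m` appear.
  have hsub : ∫ q in Set.Icc (-η) η ×ˢ Set.Icc (1 : ℝ) 2, σ ^ 2 / 4 * (q.1 ^ 2 / η) * 1
        ∂m.prod (gaussianReal 0 1)
      ≤ ∫ q in brownianValue θ σ ⁻¹' Set.Icc (-y) y, brownianValue θ σ q ^ 2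
        ∂m.prod (gaussianReal 0 1) := by
    rw [← integral_indicator (measurableSet_Icc.prod measurableSet_Icc),
      ← integral_indicator (hb measurableSet_Icc)]
    refine integral_mono_of_nonneg (ae_of_all _ fun q => ?_) (hsqi.indicator (hb measurableSet_Icc))
      ?_
    · exact Set.indicator_nonneg (fun q _ => by positivity) q
    filter_upwards [Measure.quasiMeasurePreserving_fst.ae hpos] with q hq
    by_cases hmem : q ∈ Set.Icc (-η) η ×ˢ Set.Icc (1 : ℝ) 2
    · obtain ⟨k1, k2⟩ := hbound q.1 ⟨hq, hmem.1.2⟩ q.2 hmem.2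
      have hmem' : q ∈ brownianValue θ σ ⁻¹' Set.Icc (-y) y := abs_le.1 k1
      rw [Set.indicator_of_mem hmem, Set.indicator_of_mem hmem']
      refine le_trans ?_ k2
      rw [mul_one]
      gcongr
      rw [div_le_iff₀ hη0, sq]
      have hq' : 0 < q.1 := hq
      exact mul_le_mul_of_nonneg_left hmem.1.2 hq'.le
    · rw [Set.indicator_of_notMem hmem]
      exact Set.indicator_nonneg (fun q _ => by positivity) q
  refine le_trans ?_ hsub
  rw [setIntegral_prod_mul (fun s : ℝ => σ ^ 2 / 4 * (s ^ 2 / η)) (fun _ => (1 : ℝ)),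
    integral_const_mul, integral_div, setIntegral_const, smul_eq_mul, mul_one, ← hG]
  have hη' : η ^ (2 - α) / η = (d ^ 2) ^ (1 - α) * y ^ (2 - 2 * α) := by
    rw [← Real.rpow_sub_one hη0.ne', hη, Real.mul_rpow (by positivity) (by positivity)]
    rw [show 2 - α - 1 = 1 - α by ring]
    congr 1
    rw [← Real.rpow_natCast, ← Real.rpow_mul hy.le]
    congr 1
    push_cast
    ring
  calc σ ^ 2 / 4 * G * C * (d ^ 2) ^ (1 - α) * y ^ (2 - 2 * α)
      = σ ^ 2 / 4 * (C * η ^ (2 - α) / η) * G := by rw [mul_div_assoc, hη']; ring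
    _ ≤ _ := by gcongr

theorem ae_sideMeasure_pos (c α β : ℝ) : ∀ᵐ s ∂sideMeasure c α β, 0 < s :=
  Measure.ae_smul_measure (ae_tsMeasure_pos α β) _

/-! ### Normal tempered stable laws as subordinated Brownian motions -/

namespace NTSParams

variable (p : NTSParams)

/-- The rate of the exponential tempering of the subordinator. -/
def rate : ℝ := (1 - p.α) / p.κ

theorem rate_pos : 0 < p.rate := div_pos (by linarith [p.α_lt]) p.κ_pos

/-- The weight of the Lévy measure of the subordinator, which makes its mean equal to `1`. -/
def weight : ℝ := p.rate ^ (1 - p.α) / Real.Gamma (1 - p.α)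

theorem weight_pos : 0 < p.weight :=
  div_pos (Real.rpow_pos_of_pos p.rate_pos _) (Real.Gamma_pos_of_pos (by linarith [p.α_lt]))

/-- The Lévy measure of the tempered stable subordinator. -/
def subordinator : Measure ℝ := sideMeasure p.weight p.α p.rate

instance : SFinite p.subordinator := by rw [subordinator]; infer_instance

theorem subordinator_pos : ∀ᵐ s ∂p.subordinator, 0 < s := ae_sideMeasure_pos _ _ _

theorem integrable_subordinator {q g : ℝ} (hq : p.α < q) (hg : g < p.rate) :
    Integrable (fun s => s ^ q * Real.exp (g * s)) p.subordinator := by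
  have := integrable_rpow_mul_exp_tsMeasure (β := p.rate) (c := -g) hq (by linarith)
  simp only [neg_mul, neg_neg] at this
  exact this.smul_measure ENNReal.ofReal_ne_top

theorem integrable_id_subordinator : Integrable (fun s => s) p.subordinator := by
  simpa using p.integrable_subordinator (q := 1) (g := 0) p.α_lt p.rate_pos

theorem integrable_sq_subordinator : Integrable (fun s => s ^ 2) p.subordinator := by
  simpa using p.integrable_subordinator (q := 2) (g := 0) (by linarith [p.α_lt]) p.rate_pos

theorem integral_id_subordinator : ∫ s, s ∂p.subordinator = 1 := by
  have hG := Real.Gamma_pos_of_pos (by linarith [p.α_lt] : 0 < 1 - p.α)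
  rw [subordinator, integral_id_sideMeasure p.weight_pos.le (fun _ => p.α_lt) p.rate_pos, weight,
    div_mul_cancel₀ _ hG.ne', ← Real.rpow_add p.rate_pos]
  simp

theorem integrable_exp_sub_one_subordinator {g : ℝ} (hg : g < p.rate) :
    Integrable (fun s => Real.exp (g * s) - 1) p.subordinator :=
  integrable_exp_sub_one_of_lt p.subordinator_pos p.integrable_id_subordinator
    (by simpa using p.integrable_subordinator (q := 1) p.α_lt hg)

/-- The strip is where the quadratic exponent of the Brownian motion stays below the rate of the
subordinator. -/
theorem mem_strip_iff (c : ℝ) : c ∈ p.strip ↔ p.σ ^ 2 * c ^ 2 / 2 - p.θ * c < p.rate := by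
  have hσ := p.σ_pos
  have hr := p.rate_pos
  have hA0 : 0 ≤ p.θ ^ 2 + 2 * p.σ ^ 2 * (1 - p.α) / p.κ := by
    have := p.κ_pos
    have : 0 < 1 - p.α := by linarith [p.α_lt]
    positivity
  rw [strip, Set.mem_Ioo, div_lt_iff₀ (by positivity), lt_div_iff₀ (by positivity)]
  have h1 : p.θ - √(p.θ ^ 2 + 2 * p.σ ^ 2 * (1 - p.α) / p.κ) < c * p.σ ^ 2 ∧
      c * p.σ ^ 2 < p.θ + √(p.θ ^ 2 + 2 * p.σ ^ 2 * (1 - p.α) / p.κ) ↔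
      |c * p.σ ^ 2 - p.θ| < √(p.θ ^ 2 + 2 * p.σ ^ 2 * (1 - p.α) / p.κ) := by
    rw [abs_lt]
    constructor <;> rintro ⟨h, h'⟩ <;> constructor <;> linarith
  rw [h1, Real.lt_sqrt (abs_nonneg _), sq_abs]
  have h2 : 2 * p.σ ^ 2 * (1 - p.α) / p.κ = 2 * p.σ ^ 2 * p.rate := by rw [rate]; ring
  rw [h2]
  have hσ2 : 0 < 2 * p.σ ^ 2 := by positivity
  constructor
  · intro h
    refine lt_of_mul_lt_mul_left ?_ hσ2.le
    linarith [show (c * p.σ ^ 2 - p.θ) ^ 2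
      = 2 * p.σ ^ 2 * (p.σ ^ 2 * c ^ 2 / 2 - p.θ * c) + p.θ ^ 2 by ring]
  · intro h
    have := mul_lt_mul_of_pos_left h hσ2
    linarith [show (c * p.σ ^ 2 - p.θ) ^ 2
      = 2 * p.σ ^ 2 * (p.σ ^ 2 * c ^ 2 / 2 - p.θ * c) + p.θ ^ 2 by ring]

theorem isOpen_strip : IsOpen p.strip := isOpen_Ioo

/-- The quadratic `σ² c² / 2 - θ c` is convex and vanishes at zero, so at `r c` it is at most `r`
times its value at `c`. -/
theorem scaled_mem_strip {c r : ℝ} (h0 : 0 ≤ r) (h1 : r ≤ 1) (hc : c ∈ p.strip) :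
    r * c ∈ p.strip := by
  rw [mem_strip_iff] at hc ⊢
  have e : p.σ ^ 2 * (r * c) ^ 2 / 2 - p.θ * (r * c)
      ≤ r * (p.σ ^ 2 * c ^ 2 / 2 - p.θ * c) := by
    have : 0 ≤ r * (1 - r) * (p.σ ^ 2 * c ^ 2 / 2) :=
      mul_nonneg (mul_nonneg h0 (by linarith)) (by positivity)
    nlinarith
  refine lt_of_le_of_lt e ?_
  rcases h0.eq_or_lt with rfl | h0
  · simpa using p.rate_pos
  · exact (mul_lt_mul_of_pos_left hc h0).trans_le (mul_le_of_le_one_left p.rate_pos.le h1)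

theorem half_mem_strip {a : ℝ} (h : 2 * a ∈ p.strip) : a ∈ p.strip := by
  have := p.scaled_mem_strip (r := 1 / 2) (by norm_num) (by norm_num) h
  rwa [show 1 / 2 * (2 * a) = a by ring] at this

/-- The Lévy measure of the normal tempered stable law. -/
def levyMeasure : Measure ℝ := subordinatedMeasure p.θ p.σ p.subordinator

instance : SFinite p.levyMeasure := by rw [levyMeasure]; infer_instance

/-- The exponent of the Brownian motion with drift. -/
def brownianExponent (w : ℂ) : ℂ := Complex.I * w * p.θ - p.σ ^ 2 * w ^ 2 / 2

theorem re_brownianExponent (u a : ℝ) : (p.brownianExponent ((u : ℂ) + Complex.I * a)).re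
    = p.σ ^ 2 * a ^ 2 / 2 - p.θ * a - p.σ ^ 2 * u ^ 2 / 2 := by
  have e : p.brownianExponent ((u : ℂ) + Complex.I * a)
      = ((p.σ ^ 2 * a ^ 2 / 2 - p.θ * a - p.σ ^ 2 * u ^ 2 / 2 : ℝ) : ℂ)
        + ((u * p.θ - p.σ ^ 2 * u * a : ℝ) : ℂ) * Complex.I := by
    rw [brownianExponent]
    push_cast
    linear_combination (a * p.θ - p.σ ^ 2 * a ^ 2 / 2 : ℂ) * Complex.I_sq
  rw [e, Complex.add_re, Complex.ofReal_re, Complex.re_ofReal_mul]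
  simp

theorem weight_mul_Gamma (hα : p.α ≠ 0) : (p.weight : ℂ)
    * ((Real.Gamma (-p.α) * p.rate ^ p.α : ℝ) : ℂ) = -((p.rate : ℂ) / p.α) := by
  have hG : Real.Gamma (1 - p.α) ≠ 0 := (Real.Gamma_pos_of_pos (by linarith [p.α_lt])).ne'
  have hG0 : Real.Gamma (-p.α) ≠ 0 := by
    intro h; rw [Gamma_one_sub hα, h, mul_zero] at hG; exact hG rfl
  have hr := p.rate_pos
  have hw : p.weight * (Real.Gamma (-p.α) * p.rate ^ p.α) = -(p.rate / p.α) := by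
    rw [weight, Gamma_one_sub hα, Real.rpow_sub hr, Real.rpow_one]
    have : p.rate ^ p.α ≠ 0 := (Real.rpow_pos_of_pos hr _).ne'
    field_simp
  exact_mod_cast congrArg Complex.ofReal hw

/-- The subordinator has mean `1`, so its Laplace exponent at `z` is `z` plus the centred tempered
stable term; it is evaluated at the exponent of the Brownian motion. -/
theorem exponent_eq (hα : p.α ≠ 0) (u : ℝ) : p.exponent u
    = p.brownianExponent u + p.weight * tsSide p.α p.rate (p.brownianExponent u) := by
  have h1 : p.α ≠ 1 := p.α_lt.ne
  have hw' := p.weight_mul_Gamma hα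
  simp only [exponent, tsSide, hα, h1, if_false]
  rw [← mul_assoc, hw']
  have hκ : (p.κ : ℂ) ≠ 0 := by exact_mod_cast p.κ_pos.ne'
  have hα' : (p.α : ℂ) ≠ 0 := by exact_mod_cast hα
  have h1' : (1 : ℂ) - p.α ≠ 0 := by
    rw [← Complex.ofReal_one, ← Complex.ofReal_sub]; exact_mod_cast sub_ne_zero.2 h1.symm
  have hr' : (p.rate : ℂ) = (1 - p.α) / p.κ := by rw [rate]; push_cast; rfl
  have e : 1 - Complex.I * p.κ / (1 - p.α) * (p.θ * u + Complex.I * (u ^ 2 * p.σ ^ 2 / 2))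
      = 1 - p.brownianExponent u / p.rate := by
    rw [hr', brownianExponent]
    field_simp
    linear_combination (-(p.κ : ℂ) * p.σ ^ 2 * u ^ 2) * Complex.I_sq
  rw [e, hr']
  field_simp
  ring

theorem isLevyExponent (hα : p.α ≠ 0) :
    IsLevyExponent p.levyMeasure p.θ p.exponent p.strip := by
  have hsq : Integrable (fun x => x ^ 2) p.levyMeasure :=
    integrable_sq_subordinatedMeasure p.subordinator_pos p.integrable_id_subordinator
      p.integrable_sq_subordinator
  refine ⟨?_, hsq, fun u => ?_, fun c hc => ?_⟩
  · exact subordinatedMeasure_absolutelyContinuous p.σ_pos.ne' p.subordinator_pos (by simp)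
  · rw [levyMeasure, integral_centered_subordinatedMeasure p.subordinator_pos hsq,
      p.exponent_eq hα]
    have hz : (p.brownianExponent u).re ≤ 0 := by
      have := p.re_brownianExponent u 0
      simp only [Complex.ofReal_zero, mul_zero, add_zero] at this
      rw [this]
      have : 0 ≤ p.σ ^ 2 * u ^ 2 / 2 := by positivity
      linarith
    have hi : Integrable (fun s : ℝ => Complex.exp (p.brownianExponent u * s) - 1
        - p.brownianExponent u * s) p.subordinator := by
      refine (p.integrable_sq_subordinator.const_mul (‖p.brownianExponent u‖ ^ 2 * 2)).mono'
        (by fun_prop) ?_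
      filter_upwards [p.subordinator_pos] with s hs
      refine (norm_exp_sub_one_sub_le _).trans ?_
      rw [norm_mul, Complex.norm_real, Real.norm_eq_abs, mul_pow, sq_abs, mul_assoc, mul_assoc,
        mul_comm (2 : ℝ)]
      have : Real.exp (p.brownianExponent u * s).re ≤ 1 := by
        rw [Real.exp_le_one_iff, mul_comm, Complex.re_ofReal_mul]
        exact mul_nonpos_of_nonneg_of_nonpos hs.le hz
      gcongr
      linarith
    have hc := integral_tsMeasure_centered (α := p.α) (by linarith [p.α_lt]) p.rate_pos hz
    have hsum : ∫ s : ℝ, (Complex.exp ((Complex.I * u * p.θ - p.σ ^ 2 * u ^ 2 / 2) * s) - 1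
        - Complex.I * u * p.θ * s) ∂p.subordinator
        = p.weight * tsSide p.α p.rate (p.brownianExponent u) - p.σ ^ 2 * u ^ 2 / 2 := by
      -- The jumps of the subordinated process are compensated by their mean `iuθs`, while `tsSide`
      -- is compensated by the whole Brownian exponent. The difference is `σ² u² / 2` times the mean
      -- `1` of the subordinator.
      have e : ∀ s : ℝ, Complex.exp ((Complex.I * u * p.θ - p.σ ^ 2 * u ^ 2 / 2) * s) - 1
          - Complex.I * u * p.θ * s = (Complex.exp (p.brownianExponent u * s) - 1
          - p.brownianExponent u * s) - (p.σ ^ 2 * u ^ 2 / 2) * s := by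
        intro s
        simp only [brownianExponent]
        ring
      simp_rw [e]
      have hi' : Integrable (fun s : ℝ => ((p.σ : ℂ) ^ 2 * u ^ 2 / 2) * (s : ℂ)) p.subordinator :=
        p.integrable_id_subordinator.ofReal.const_mul _
      rw [integral_sub hi hi', integral_const_mul,
        integral_complex_ofReal, integral_id_subordinator]
      rw [subordinator, sideMeasure, integral_smul_measure, ENNReal.toReal_ofReal p.weight_pos.le,
        hc, Complex.real_smul]
      simp
    rw [hsum, brownianExponent]
    ring
  -- The domination by second differences needs a neighbourhood of `c`, which the open strip
  -- provides.
  · obtain ⟨ε, hε, hball⟩ := Metric.isOpen_iff.1 p.isOpen_strip c hc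
    refine integrable_sq_mul_exp_subordinatedMeasure (half_pos hε) p.subordinator_pos
      fun d hd => p.integrable_exp_sub_one_subordinator ((p.mem_strip_iff d).1 (hball ?_))
    rw [Metric.mem_ball, Real.dist_eq, abs_lt]
    constructor <;> linarith [hd.1, hd.2]

theorem smallJumpBound : SmallJumpBound p.levyMeasure (2 * p.α) :=
  ((smallJumpBound_tsMeasure (by linarith [p.α_lt]) p.rate_pos).smul p.weight_pos).subordinated
    p.σ_pos p.subordinator_pos p.integrable_id_subordinator p.integrable_sq_subordinator

theorem integrable_id (h : p.α < 1 / 2) : Integrable (fun x => x) p.levyMeasure := by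
  refine integrable_id_subordinatedMeasure p.integrable_id_subordinator ?_
  have := p.integrable_subordinator (g := 0) h p.rate_pos
  simpa [Real.sqrt_eq_rpow] using this

theorem ou_cases {b t : ℝ} (hb : 0 < b) (ht : 0 < t) {ρ : Measure ℝ} [IsProbabilityMeasure ρ]
    (hρ : ∀ u, charFun ρ u = Complex.exp (∫ s in (0 : ℝ)..t, p.exponent (Real.exp (-b * s) * u))) :
    (0 < p.α → p.α < 1 / 2 → InfiniteActivityFiniteVariation ρ ∧
      ExponentialErrorDecay ρ p.strip (2 * p.α)) ∧
    (1 / 2 ≤ p.α → InfiniteActivityInfiniteVariation ρ ∧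
      ExponentialErrorDecay ρ p.strip (2 * p.α)) := by
  have hZ : p.α ≠ 0 → _ := fun h => (p.isLevyExponent h).ou hb ht.le
  have hS : p.α ≠ 0 → _ := fun h => p.smallJumpBound.ou hb ht (p.isLevyExponent h).sq
  refine ⟨fun h0 h1 => ⟨?_, ?_⟩, fun h1 => ⟨?_, ?_⟩⟩
  · exact (hZ h0.ne').infiniteActivityFiniteVariation hρ (by linarith) (hS h0.ne')
      (integrable_id_ouMeasure hb (p.integrable_id h1))
  · exact (hZ h0.ne').exponentialErrorDecay hρ (by linarith) (hS h0.ne')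
  · exact (hZ (by linarith)).infiniteActivityInfiniteVariation hρ (by linarith) (hS (by linarith))
  · exact (hZ (by linarith)).exponentialErrorDecay hρ (by linarith) (hS (by linarith))

/-- The transform of the jump measure is a multiple of `(1 - z/rate)^α`, with `z` the Brownian
exponent. That exponent is quadratic in `u`, which doubles the power. The drift is zero because the
mean of the jumps is exactly `θ`. -/
theorem finiteActivity {b t : ℝ} (hb : 0 < b) (ht : 0 < t) {ρ : Measure ℝ}
    [IsProbabilityMeasure ρ]
    (hρ : ∀ u, charFun ρ u = Complex.exp (∫ s in (0 : ℝ)..t, p.exponent (Real.exp (-b * s) * u)))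
    (h : p.α < 0) :
    FiniteActivity ρ ∧ ∃ V, BernoulliDecomposition ρ V ((1 - p.α) / (p.κ * |p.α|) * t) 0 ∧
      PowerLawErrorDecay V p.strip (-(2 * p.α)) := by
  have i1 : IsFiniteMeasure p.subordinator :=
    isFiniteMeasure_sideMeasure p.weight_pos.le (fun _ => h) p.rate_pos
  have i2 : IsFiniteMeasure p.levyMeasure := by
    rw [levyMeasure, subordinatedMeasure]; infer_instance
  have hG : 0 < Real.Gamma (-p.α) := Real.Gamma_pos_of_pos (by linarith)
  have hr := p.rate_pos
  have hmass : p.levyMeasure.real Set.univ = (1 - p.α) / (p.κ * |p.α|) := by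
    have e1 : p.levyMeasure.real Set.univ = p.subordinator.real Set.univ := by
      rw [levyMeasure, subordinatedMeasure,
        map_measureReal_apply (measurable_brownianValue _ _) MeasurableSet.univ, Set.preimage_univ,
        ← Set.univ_prod_univ, measureReal_prod_prod]
      simp
    rw [e1, subordinator, real_univ_sideMeasure p.weight_pos.le (fun _ => h) hr, weight,
      Gamma_one_sub h.ne, Real.rpow_sub hr, Real.rpow_one, abs_of_neg h, rate]
    have : ((1 - p.α) / p.κ) ^ p.α ≠ 0 := (Real.rpow_pos_of_pos hr _).ne'
    have := p.κ_pos.ne'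
    have := h.ne
    field_simp
  have hpos : 0 < p.levyMeasure.real Set.univ := by
    have := p.κ_pos
    have : 0 < 1 - p.α := by linarith
    have := abs_pos.2 h.ne
    rw [hmass]
    positivity
  have hid := p.integrable_id (by linarith)
  have hexp : ∀ a ∈ p.strip, Integrable (fun x => Real.exp (-(a * x))) p.levyMeasure := by
    intro a ha
    refine integrable_exp_subordinatedMeasure p.subordinator_pos ?_
    simpa using p.integrable_subordinator (q := 0) h ((p.mem_strip_iff a).1 ha)
  have := (p.isLevyExponent h.ne).bernoulliDecomposition_ou hb ht hρ
    (subordinatedMeasure_absolutelyContinuous p.σ_pos.ne' p.subordinator_pos) hpos hid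
    (ω := -(2 * p.α)) (by linarith) (fun a ha => hexp a (p.half_mem_strip ha)) ?_
  · rwa [hmass, levyMeasure, integral_id_subordinatedMeasure hid, integral_id_subordinator, mul_one,
      sub_self, mul_zero] at this
  intro a ha
  refine ⟨p.weight * (Real.Gamma (-p.α) * (p.σ ^ 2 * Real.exp (-b * t) ^ 2 / 2) ^ p.α),
    fun u hu s hs => ?_⟩
  have hu0 : 0 < u := by linarith
  obtain ⟨hr2, hr1⟩ := exp_neg_mul_mem hb hs
  set r := Real.exp (-b * s) with hrdef
  have hr0 : 0 < r := Real.exp_pos _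
  have hstrip := p.scaled_mem_strip hr0.le hr1 (p.half_mem_strip ha)
  set w : ℂ := ((r * u : ℝ) : ℂ) + Complex.I * ((r * a : ℝ) : ℂ) with hw
  have ew : (r : ℂ) * ((u : ℂ) + Complex.I * a) = w := by rw [hw]; push_cast; ring
  have him : w.im = r * a := by simp [hw]
  have hre := p.re_brownianExponent (r * u) (r * a)
  rw [← hw] at hre
  have hlt : (p.brownianExponent w).re < p.rate := by
    rw [hre]
    have := (p.mem_strip_iff _).1 hstrip
    have : 0 ≤ p.σ ^ 2 * (r * u) ^ 2 / 2 := by positivity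
    linarith
  have hcf : cf p.levyMeasure w = p.weight * ((Real.Gamma (-p.α) * p.rate ^ p.α : ℝ)
      * (1 - p.brownianExponent w / p.rate) ^ (p.α : ℂ)) := by
    rw [levyMeasure, integral_cexp_subordinatedMeasure p.subordinator_pos
      (by rw [him]; exact hexp _ hstrip)]
    have hg := integral_rpow_mul_cexp (s := -p.α) (by linarith) hr hlt
    rw [neg_neg] at hg
    rw [subordinator, sideMeasure, integral_smul_measure, ENNReal.toReal_ofReal p.weight_pos.le,
      integral_tsMeasure, show -1 - p.α = -p.α - 1 by ring, Complex.real_smul]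
    rw [brownianExponent] at hg ⊢
    rw [hg]
    simp
  have hw0 := p.weight_pos
  rw [ew, hcf, norm_mul, Complex.norm_real, Real.norm_eq_abs, abs_of_pos hw0, mul_assoc]
  refine mul_le_mul_of_nonneg_left ?_ hw0.le
  rw [norm_mul, Complex.norm_real, Real.norm_eq_abs, abs_of_pos (by positivity),
    Complex.norm_cpow_real, mul_assoc, mul_assoc, ← Real.mul_rpow hr.le (norm_nonneg _)]
  refine mul_le_mul_of_nonneg_left ?_ hG.le
  -- Membership in the strip makes the part of `rate - Re z` free of `u` positive, so `σ² (e^{-bs}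
  -- u)² / 2` is a lower bound.
  have hge : p.σ ^ 2 * Real.exp (-b * t) ^ 2 / 2 * u ^ 2
      ≤ p.rate * ‖1 - p.brownianExponent w / p.rate‖ := by
    have h1 := Complex.re_le_norm (1 - p.brownianExponent w / p.rate)
    rw [Complex.sub_re, Complex.one_re, Complex.div_ofReal_re] at h1
    have h2 := mul_le_mul_of_nonneg_left h1 hr.le
    rw [mul_sub, mul_one, mul_div_cancel₀ _ hr.ne', hre] at h2
    refine le_trans ?_ h2
    have h3 := (p.mem_strip_iff _).1 hstrip
    have h4 : Real.exp (-b * t) ^ 2 ≤ r ^ 2 := pow_le_pow_left₀ (Real.exp_pos _).le hr2 2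
    have h5 : p.σ ^ 2 * Real.exp (-b * t) ^ 2 / 2 * u ^ 2 ≤ p.σ ^ 2 * (r * u) ^ 2 / 2 := by
      rw [mul_pow]
      calc _ ≤ p.σ ^ 2 * r ^ 2 / 2 * u ^ 2 := by gcongr
        _ = _ := by ring
    linarith
  have hσ := p.σ_pos
  refine (Real.rpow_le_rpow_of_nonpos (by positivity) hge h.le).trans_eq ?_
  rw [Real.mul_rpow (by positivity) (by positivity), neg_neg, ← Real.rpow_natCast u 2,
    ← Real.rpow_mul hu0.le]
  norm_num

end NTSParams

/-! ### Variance gamma as a bilateral Gamma law -/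

/-- Both arguments lie in `(-π/2, π/2)`, so their sum stays on the principal branch. -/
theorem log_mul_of_re_pos {x y : ℂ} (hx : 0 < x.re) (hy : 0 < y.re) :
    Complex.log (x * y) = Complex.log x + Complex.log y := by
  have hx0 : x ≠ 0 := fun h => by simp [h] at hx
  have hy0 : y ≠ 0 := fun h => by simp [h] at hy
  have h1 := abs_lt.1 (Complex.abs_arg_lt_pi_div_two_iff.2 (Or.inl hx))
  have h2 := abs_lt.1 (Complex.abs_arg_lt_pi_div_two_iff.2 (Or.inl hy))
  refine Complex.log_mul hx0 hy0 ⟨by linarith [h1.1, h2.1], by linarith [h1.2, h2.2]⟩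

namespace NTSParams

variable (p : NTSParams)

/-- The square root `A` in the end points of the strip. -/
def discr : ℝ := √(p.θ ^ 2 + 2 * p.σ ^ 2 * (1 - p.α) / p.κ)

theorem discr_sq : p.discr ^ 2 = p.θ ^ 2 + 2 * p.σ ^ 2 * p.rate := by
  have := p.rate_pos
  have e : p.θ ^ 2 + 2 * p.σ ^ 2 * (1 - p.α) / p.κ = p.θ ^ 2 + 2 * p.σ ^ 2 * p.rate := by
    rw [rate]; ring
  rw [discr, e, Real.sq_sqrt (by positivity)]

theorem abs_lt_discr : |p.θ| < p.discr := by
  have h1 := p.discr_sq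
  have h2 : 0 < 2 * p.σ ^ 2 * p.rate := by have := p.rate_pos; have := p.σ_pos; positivity
  have h3 : 0 ≤ p.discr := Real.sqrt_nonneg _
  exact abs_lt_of_sq_lt_sq (by linarith) h3

/-- The variance gamma law as a bilateral Gamma law. -/
def toTS : TSParams where
  αp := 0
  αn := 0
  βp := (p.discr - p.θ) / p.σ ^ 2
  βn := (p.discr + p.θ) / p.σ ^ 2
  cp := 1 / p.κ
  cn := 1 / p.κ
  γc := p.θ
  αp_lt := by norm_num
  αn_lt := by norm_num
  βp_pos := div_pos (by linarith [(abs_lt.1 p.abs_lt_discr).2]) (pow_pos p.σ_pos 2)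
  βn_pos := div_pos (by linarith [(abs_lt.1 p.abs_lt_discr).1]) (pow_pos p.σ_pos 2)
  cp_nonneg := (one_div_pos.2 p.κ_pos).le
  cn_nonneg := (one_div_pos.2 p.κ_pos).le
  nondegenerate := Or.inl (one_div_pos.2 p.κ_pos)

theorem toTS_index : p.toTS.index = 0 := by
  simp [toTS, TSParams.index]

theorem toTS_nonnegStability : p.toTS.NonnegStability :=
  ⟨fun _ => le_rfl, fun _ => le_rfl⟩

theorem toTS_strip : p.toTS.strip = p.strip := by
  ext a
  have := p.κ_pos
  simp only [toTS, TSParams.strip, strip, Set.mem_ofPred_eq, Set.mem_Ioo, one_div, inv_pos, this,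
    true_imp_iff]
  rw [← discr, ← neg_div, neg_sub, add_comm p.discr]

theorem toTS_gammaMass : p.toTS.gammaMass = 2 / p.κ := by
  simp only [toTS, TSParams.gammaMass, if_true]
  ring

variable {p}

/-- Vieta's relations for the quadratic under the logarithm of the variance gamma exponent. -/
theorem toTS_rates (h : p.α = 0) : p.toTS.βp * p.toTS.βn = 2 / (p.κ * p.σ ^ 2) ∧
    p.toTS.βp - p.toTS.βn = -(2 * p.θ / p.σ ^ 2) := by
  have h1 := p.discr_sq
  have hσ := p.σ_pos.ne'
  have hκ := p.κ_pos.ne'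
  have hr : p.rate = 1 / p.κ := by rw [rate, h, sub_zero]
  rw [hr] at h1
  simp only [toTS]
  constructor
  · field_simp
    field_simp at h1
    linear_combination h1
  · field_simp
    ring

theorem toTS_mean (h : p.α = 0) : 1 / p.κ * (1 / p.toTS.βp - 1 / p.toTS.βn) = p.θ := by
  obtain ⟨h1, h2⟩ := toTS_rates h
  have hp := p.toTS.βp_pos.ne'
  have hn := p.toTS.βn_pos.ne'
  have hσ := p.σ_pos.ne'
  have hκ := p.κ_pos.ne'
  have e : 1 / p.toTS.βp - 1 / p.toTS.βn = -(p.toTS.βp - p.toTS.βn) / (p.toTS.βp * p.toTS.βn) := by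
    field_simp
    ring
  rw [e, h1, h2]
  field_simp

theorem toTS_drift (h : p.α = 0) : p.toTS.drift = 0 := by
  have h1 := toTS_mean h
  rw [TSParams.drift]
  have e1 : p.toTS.αp = 0 := rfl
  have e2 : p.toTS.αn = 0 := rfl
  have e3 : p.toTS.cp = 1 / p.κ := rfl
  have e4 : p.toTS.cn = 1 / p.κ := rfl
  have e5 : p.toTS.γc = p.θ := rfl
  rw [e1, e2, e3, e4, e5, sub_zero, Real.Gamma_one, zero_sub, Real.rpow_neg_one, Real.rpow_neg_one]
  linear_combination -h1

/-- The quadratic factors as `(1 - iu/βp)(1 + iu/βn)`, so its logarithm is the sum of two Gamma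
exponents. The linear terms of the two compensated sides cancel against the mean `θ`. -/
theorem toTS_exponent (h : p.α = 0) (u : ℝ) : p.toTS.exponent u = p.exponent u := by
  obtain ⟨h1, h2⟩ := toTS_rates h
  have hm := toTS_mean h
  have hp := p.toTS.βp_pos.ne'
  have hn := p.toTS.βn_pos.ne'
  have hσ := p.σ_pos.ne'
  have hκ := p.κ_pos.ne'
  have e1 : p.toTS.αp = 0 := rfl
  have e2 : p.toTS.αn = 0 := rfl
  have e3 : p.toTS.cp = 1 / p.κ := rfl
  have e4 : p.toTS.cn = 1 / p.κ := rfl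
  have e5 : p.toTS.γc = p.θ := rfl
  rw [TSParams.exponent, e1, e2, e3, e4, e5, exponent, if_pos h]
  simp only [tsSide, if_true]
  generalize p.toTS.βp = βp at *
  generalize p.toTS.βn = βn at *
  have hpc : (βp : ℂ) ≠ 0 := by exact_mod_cast hp
  have hnc : (βn : ℂ) ≠ 0 := by exact_mod_cast hn
  have hκc : (p.κ : ℂ) ≠ 0 := by exact_mod_cast hκ
  have h1' : (1 : ℝ) / (βp * βn) = p.κ * p.σ ^ 2 / 2 := by rw [h1]; field_simp
  have h1c : (1 : ℂ) / (βp * βn) = p.κ * p.σ ^ 2 / 2 := by exact_mod_cast congrArg Complex.ofReal h1'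
  have hmc : (1 : ℂ) / p.κ * (1 / βp - 1 / βn) = p.θ := by exact_mod_cast congrArg Complex.ofReal hm
  have hprod : (1 - Complex.I * u / βp) * (1 - -(Complex.I * u) / βn)
      = p.σ ^ 2 * u ^ 2 * p.κ / 2 - Complex.I * p.θ * p.κ * u + 1 := by
    have e : (1 - Complex.I * u / βp) * (1 - -(Complex.I * u) / βn)
        = 1 - Complex.I * u * (1 / βp - 1 / βn) - Complex.I ^ 2 * u ^ 2 * (1 / (βp * βn)) := by
      field_simp
      ring
    rw [e, h1c, Complex.I_sq, ← hmc]
    field_simp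
    ring
  rw [← hprod, log_mul_of_re_pos]
  · rw [← hmc]
    push_cast
    field_simp
    ring
  · rw [Complex.sub_re, Complex.div_ofReal_re]; simp
  · rw [Complex.sub_re, Complex.div_ofReal_re]; simp

end NTSParams

/-! ### Mixtures of exponential jump laws -/

/-- The mixture with weights `k` of the exponential laws with rates `f v`. -/
def expMixture (k : Measure ℝ) (f : ℝ → ℝ) : Measure ℝ :=
  (k.prod (tsMeasure (-1) 1)).map fun q => q.2 / f q.1

instance (k : Measure ℝ) (f : ℝ → ℝ) [SFinite k] : SFinite (expMixture k f) := by
  rw [expMixture]; infer_instance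

section

variable {k : Measure ℝ} {f : ℝ → ℝ}

theorem measurable_expMixture_map (hf : Measurable f) :
    Measurable fun q : ℝ × ℝ => q.2 / f q.1 := by fun_prop

theorem integrable_id_expMixture (hf : Measurable f) (h : Integrable (fun v => 1 / f v) k) :
    Integrable (fun x => x) (expMixture k f) := by
  rw [expMixture, integrable_map_measure (by fun_prop) (measurable_expMixture_map hf).aemeasurable]
  refine (h.mul_prod (integrable_id_tsMeasure (α := -1) (β := 1) (by norm_num) one_pos)).congr
    (ae_of_all _ fun q => ?_)
  simp only [Function.comp]
  ring

/-- A jump is `y / f v` with `y` standard exponential, and the lower bound `f₀` on the rates gives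
exponential moments on `(-f₀, ∞)`. Only the mean squares of the component laws have to be integrable
over `k`, which may be infinite. -/
theorem isLevyExponent_expMixture [SFinite k] (hf : Measurable f) {f₀ : ℝ} (hf₀ : 0 < f₀)
    (hk : ∀ᵐ v ∂k, f₀ ≤ f v) (h2 : Integrable (fun v => (1 / f v) ^ 2) k) :
    IsLevyExponent (expMixture k f) 0
      (fun u => ∫ v, tsSide (-1) 1 (Complex.I * u / f v) ∂k) (Set.Ioi (-f₀)) := by
  have hm := measurable_expMixture_map hf
  have hsqE : Integrable (fun y => y ^ 2) (tsMeasure (-1) 1) :=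
    (isLevyExponent_tsMeasure (α := -1) (by norm_num) one_pos).sq
  have hsq : Integrable (fun x => x ^ 2) (expMixture k f) := by
    rw [expMixture, integrable_map_measure (by fun_prop) hm.aemeasurable]
    refine (h2.mul_prod hsqE).congr (ae_of_all _ fun q => ?_)
    simp only [Function.comp]
    ring
  refine ⟨?_, hsq, fun u => ?_, fun c hc => ?_⟩
  · rw [expMixture, Measure.map_apply hm (measurableSet_singleton 0),
      Measure.measure_prod_null (hm (measurableSet_singleton 0))]
    filter_upwards [hk] with v hv
    refine measure_mono_null (fun y hy => ?_) (tsMeasure_singleton_zero (-1) 1)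
    have hy' : y / f v = 0 := hy
    rcases div_eq_zero_iff.1 hy' with h | h
    · exact h
    · linarith
  · have h' := integrable_centered_ofReal hsq u
    rw [expMixture, integrable_map_measure (by fun_prop) hm.aemeasurable, Function.comp_def] at h'
    rw [expMixture, integral_map hm.aemeasurable (by fun_prop), integral_prod _ h']
    simp only [Complex.ofReal_zero, mul_zero, zero_add]
    congr 1
    funext v
    have hre : (Complex.I * u / f v).re ≤ 0 := by
      rw [Complex.div_ofReal_re]; simp
    rw [← integral_tsMeasure_centered (by norm_num) one_pos hre]
    congr 1
    funext y
    push_cast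
    ring_nf
  · have hc' : -f₀ < c := hc
    -- After rescaling to the standard exponential law the tilt is at most `e^{ry}`, and `r < 1`
    -- keeps it integrable.
    set r := max 0 (-c) / f₀ with hr
    have hr1 : r < 1 := by
      rw [hr, div_lt_one hf₀]
      exact max_lt hf₀ (by linarith)
    have hE := integrable_sq_mul_exp_tsMeasure (α := -1) (β := 1) (c := -r) (by norm_num)
      (by linarith)
    rw [expMixture, integrable_map_measure (by fun_prop) hm.aemeasurable]
    refine (h2.mul_prod hE).mono' (by fun_prop) ?_
    filter_upwards [Measure.quasiMeasurePreserving_fst.ae hk,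
      Measure.quasiMeasurePreserving_snd.ae (ae_tsMeasure_pos (-1) 1)] with q hq1 hq2
    have hq1' : f₀ ≤ f q.1 := hq1
    have hq2' : 0 < q.2 := hq2
    have hfq : 0 < f q.1 := by linarith
    simp only [Function.comp]
    rw [Real.norm_eq_abs, abs_of_nonneg (by positivity)]
    have e : (q.2 / f q.1) ^ 2 = (1 / f q.1) ^ 2 * q.2 ^ 2 := by ring
    rw [e, mul_assoc]
    refine mul_le_mul_of_nonneg_left (mul_le_mul_of_nonneg_left (Real.exp_le_exp.2 ?_)
      (sq_nonneg _)) (sq_nonneg _)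
    have h3 : -c ≤ r * f q.1 := by
      calc -c ≤ max 0 (-c) := le_max_right _ _
        _ = r * f₀ := by rw [hr]; field_simp
        _ ≤ r * f q.1 := by
          have : 0 ≤ r := by rw [hr]; positivity
          gcongr
    have h4 : -(c * (q.2 / f q.1)) = -c * (q.2 / f q.1) := by ring
    rw [h4, show -(-r * q.2) = r * q.2 by ring]
    calc -c * (q.2 / f q.1) ≤ r * f q.1 * (q.2 / f q.1) := by gcongr
      _ = r * q.2 := by field_simp

/-- Only exponential variables in `[1, 2]` are kept: the jump is then at least `1/f`, and at most
`2/f ≤ y` on `A`. -/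
theorem le_integral_sq_expMixture [SFinite k] (hf : Measurable f) {f₀ : ℝ} (hf₀ : 0 < f₀)
    (hk : ∀ᵐ v ∂k, f₀ ≤ f v) (h2 : Integrable (fun v => (1 / f v) ^ 2) k) {A : Set ℝ}
    (hA : MeasurableSet A) {y : ℝ} (hy : ∀ v ∈ A, 2 ≤ y * f v) :
    (∫ v in A, (1 / f v) ^ 2 ∂k) * (tsMeasure (-1) 1).real (Set.Icc 1 2)
      ≤ ∫ x in Set.Icc (-y) y, x ^ 2 ∂expMixture k f := by
  have hm := measurable_expMixture_map hf
  have hsq := (isLevyExponent_expMixture hf hf₀ hk h2).sq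
  rw [expMixture, integrable_map_measure (by fun_prop) hm.aemeasurable] at hsq
  rw [expMixture, setIntegral_map measurableSet_Icc (by fun_prop) hm.aemeasurable]
  have e : (tsMeasure (-1) 1).real (Set.Icc 1 2)
      = ∫ _ in Set.Icc (1 : ℝ) 2, (1 : ℝ) ∂tsMeasure (-1) 1 := by simp
  rw [e, ← setIntegral_prod_mul, ← integral_indicator (hA.prod measurableSet_Icc),
    ← integral_indicator (hm measurableSet_Icc)]
  refine integral_mono_of_nonneg (ae_of_all _ fun q => ?_) (hsq.indicator (hm measurableSet_Icc)) ?_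
  · exact Set.indicator_nonneg (fun q _ => by positivity) q
  filter_upwards [Measure.quasiMeasurePreserving_fst.ae hk] with q hq1
  have hq1' : f₀ ≤ f q.1 := hq1
  have hfq : 0 < f q.1 := by linarith
  by_cases hmem : q ∈ A ×ˢ Set.Icc (1 : ℝ) 2
  · have hmem' : q ∈ (fun q : ℝ × ℝ => q.2 / f q.1) ⁻¹' Set.Icc (-y) y := by
      refine abs_le.1 ?_
      rw [abs_of_nonneg (div_nonneg (by linarith [hmem.2.1]) hfq.le), div_le_iff₀ hfq]
      linarith [hmem.2.2, hy q.1 hmem.1]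
    rw [Set.indicator_of_mem hmem, Set.indicator_of_mem hmem', mul_one]
    exact pow_le_pow_left₀ (by positivity) (div_le_div_of_nonneg_right hmem.2.1 hfq.le) 2
  · rw [Set.indicator_of_notMem hmem]
    exact Set.indicator_nonneg (fun q _ => by positivity) q

end

/-! ### The Stieltjes representation of a power -/

/-- With rate zero the measure is `v^{α-1} dv`, which is infinite; the exponential supplies the
missing tempering. -/
theorem integral_tsMeasure_zero_rate {α s : ℝ} (hα : 0 < α) (hs : 0 < s) :
    Integrable (fun v => Real.exp (-(v * s))) (tsMeasure (-α) 0) ∧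
      ∫ v, Real.exp (-(v * s)) ∂tsMeasure (-α) 0 = Real.Gamma α * s ^ (-α) := by
  have h1 := integrable_exp_tsMeasure (α := -α) (β := 0) (c := s) (by linarith) (by linarith)
  refine ⟨by simpa [mul_comm] using h1, ?_⟩
  rw [integral_tsMeasure]
  have := Real.integral_rpow_mul_exp_neg_mul_Ioi hα hs
  rw [one_div, Real.inv_rpow hs.le, ← Real.rpow_neg hs.le] at this
  rw [mul_comm, ← this]
  congr 1
  funext v
  simp only [smul_eq_mul, zero_mul, neg_zero, Real.exp_zero, mul_one, sub_neg_eq_add,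
    neg_add_eq_sub]
  rw [mul_comm v]

/-- `∫₀^∞ v^(α-1) / (v + l - z) dv = Γ(α) Γ(1-α) (l - z)^(α-1)`. -/
theorem integral_resolvent {α l : ℝ} (hα : 0 < α) (hα1 : α < 1) (hl : 0 < l) {z : ℂ}
    (hz : z.re ≤ 0) :
    Integrable (fun v : ℝ => 1 / ((v : ℂ) + l - z)) (tsMeasure (-α) 0) ∧
      ∫ v : ℝ, 1 / ((v : ℂ) + l - z) ∂tsMeasure (-α) 0
        = (Real.Gamma α * Real.Gamma (1 - α) * l ^ (α - 1) : ℝ)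
          * (1 - z / l) ^ ((α - 1 : ℝ) : ℂ) := by
  -- The resolvent is written as `∫₀^∞ e^{-(v+l-z)s} ds`. Integrating over `v` first leaves `Γ(α)
  -- s^{-α} e^{-(l-z)s}`, a Gamma integral with parameter `1 - α`.
  set F : ℝ × ℝ → ℂ := fun q => Complex.exp (-((q.2 : ℂ) + l - z) * q.1) with hF
  have hFn : ∀ s v : ℝ, 0 < s → ‖F (s, v)‖ ≤ Real.exp (-(l * s)) * Real.exp (-(v * s)) := by
    intro s v hs
    rw [hF, Complex.norm_exp, ← Real.exp_add]
    refine Real.exp_le_exp.2 ?_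
    rw [mul_comm, Complex.re_ofReal_mul]
    simp only [Complex.neg_re, Complex.sub_re, Complex.add_re, Complex.ofReal_re]
    nlinarith
  have hFi : Integrable F ((volume.restrict (Set.Ioi 0)).prod (tsMeasure (-α) 0)) := by
    rw [integrable_prod_iff (by fun_prop)]
    constructor
    · filter_upwards [ae_restrict_mem measurableSet_Ioi] with s hs
      exact ((integral_tsMeasure_zero_rate hα hs).1.const_mul (Real.exp (-(l * s)))).mono'
        (by fun_prop) (ae_of_all _ fun v => hFn s v hs)
    · refine ((integrableOn_rpow_mul_exp (s := 1 - α) (by linarith) hl).const_mul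
        (Real.Gamma α)).mono' ?_ ?_
      · exact (by fun_prop : AEStronglyMeasurable F _).norm.integral_prod_right'
      · filter_upwards [ae_restrict_mem measurableSet_Ioi] with s hs
        obtain ⟨i1, i2⟩ := integral_tsMeasure_zero_rate hα hs
        rw [Real.norm_eq_abs, abs_of_nonneg (integral_nonneg fun v => norm_nonneg _)]
        refine (integral_mono_of_nonneg (ae_of_all _ fun v => norm_nonneg _)
          (i1.const_mul (Real.exp (-(l * s)))) (ae_of_all _ fun v => hFn s v hs)).trans_eq ?_
        rw [integral_const_mul, i2, show 1 - α - 1 = -α by ring]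
        ring
  have hin : ∀ᵐ v ∂tsMeasure (-α) 0, ∫ s in Set.Ioi (0 : ℝ), F (s, v) = 1 / ((v : ℂ) + l - z) := by
    filter_upwards [ae_tsMeasure_pos (-α) 0] with v hv
    have hre : (-((v : ℂ) + l - z)).re < 0 := by
      simp only [Complex.neg_re, Complex.sub_re, Complex.add_re, Complex.ofReal_re]
      linarith
    rw [hF, integral_exp_mul_complex_Ioi hre 0]
    simp only [Complex.ofReal_zero, mul_zero, Complex.exp_zero]
    rw [neg_div_neg_eq]
  refine ⟨hFi.integral_prod_right.congr hin, ?_⟩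
  rw [← integral_congr_ae hin]
  rw [integral_integral_swap (f := fun v s => F (s, v)) hFi.swap]
  have hg := integral_rpow_mul_cexp (s := 1 - α) (w := z) (by linarith) hl (by linarith)
  rw [neg_sub, show -((1 - α : ℝ) : ℂ) = ((α - 1 : ℝ) : ℂ) by push_cast; ring] at hg
  have : (Real.Gamma α * Real.Gamma (1 - α) * l ^ (α - 1) : ℝ) * (1 - z / l) ^ ((α - 1 : ℝ) : ℂ)
      = (Real.Gamma α : ℂ) * ((Real.Gamma (1 - α) * l ^ (α - 1) : ℝ)
        * (1 - z / l) ^ ((α - 1 : ℝ) : ℂ)) := by push_cast; ring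
  rw [this, ← hg, ← integral_const_mul]
  refine setIntegral_congr_fun measurableSet_Ioi fun s hs => ?_
  have e : ∀ v : ℝ, F (s, v) = Complex.exp (-((l : ℂ) - z) * s) * ((Real.exp (-(v * s)) : ℝ) : ℂ) := by
    intro v
    simp only [hF]
    rw [Complex.ofReal_exp, ← Complex.exp_add]
    congr 1
    push_cast
    ring
  simp_rw [e]
  rw [integral_const_mul, integral_complex_ofReal, (integral_tsMeasure_zero_rate hα hs).2,
    show 1 - α - 1 = -α by ring, Complex.real_smul]
  have e2 : Complex.exp (-((l : ℂ) - z) * s) = Complex.exp (-(l * s)) * Complex.exp (z * s) := by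
    rw [← Complex.exp_add]; congr 1; ring
  rw [e2]
  push_cast
  ring

theorem tsSide_neg_one_one {w : ℂ} (hw : 1 - w ≠ 0) : tsSide (-1) 1 w = w ^ 2 / (1 - w) := by
  simp only [tsSide]
  rw [if_neg (by norm_num), if_neg (by norm_num), neg_neg, Real.Gamma_one, Real.one_rpow,
    Complex.ofReal_one, div_one, Complex.ofReal_neg, Complex.cpow_neg, Complex.ofReal_one,
    Complex.cpow_one]
  push_cast
  field_simp
  ring

/-! ### Ornstein–Uhlenbeck processes with a normal tempered stable stationary law -/

namespace NTSParams

variable (p : NTSParams)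

/-- The square root of the discriminant of the quadratic equation `rate + v = z`. -/
def shiftedDiscr (v : ℝ) : ℝ := √(p.θ ^ 2 + 2 * p.σ ^ 2 * (p.rate + v))

theorem shiftedDiscr_sq {v : ℝ} (hv : 0 < v) :
    p.shiftedDiscr v ^ 2 = p.θ ^ 2 + 2 * p.σ ^ 2 * (p.rate + v) := by
  have := p.rate_pos
  rw [shiftedDiscr, Real.sq_sqrt (by positivity)]

theorem discr_le_shiftedDiscr {v : ℝ} (hv : 0 < v) : p.discr ≤ p.shiftedDiscr v := by
  refine (abs_le_of_sq_le_sq' (b := p.shiftedDiscr v) ?_ (Real.sqrt_nonneg _)).2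
  have := p.σ_pos
  rw [p.shiftedDiscr_sq hv, discr_sq]
  have : 0 < p.σ ^ 2 * v := by positivity
  linarith

/-- The rates of the exponential laws which the driver mixes, upwards for `ε = -1` and downwards for
`ε = 1`. -/
def mixRate (ε v : ℝ) : ℝ := (p.shiftedDiscr v + ε * p.θ) / p.σ ^ 2

theorem measurable_mixRate (ε : ℝ) : Measurable (p.mixRate ε) := by
  unfold mixRate shiftedDiscr
  fun_prop

variable {p} in
theorem abs_mul_le {ε : ℝ} (hε : |ε| ≤ 1) : |ε * p.θ| ≤ |p.θ| := by
  rw [abs_mul]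
  exact mul_le_of_le_one_left (abs_nonneg _) hε

theorem minRate_pos {ε : ℝ} (hε : |ε| ≤ 1) : 0 < (p.discr + ε * p.θ) / p.σ ^ 2 := by
  have := p.σ_pos
  have := (abs_le.1 (abs_mul_le (p := p) hε)).1
  have := p.abs_lt_discr
  exact div_pos (by linarith) (by positivity)

theorem minRate_le_mixRate (ε : ℝ) {v : ℝ} (hv : 0 < v) :
    (p.discr + ε * p.θ) / p.σ ^ 2 ≤ p.mixRate ε v := by
  have := p.discr_le_shiftedDiscr hv
  have := p.σ_pos
  rw [mixRate]
  gcongr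

theorem mixRate_pos {ε : ℝ} (hε : |ε| ≤ 1) {v : ℝ} (hv : 0 < v) : 0 < p.mixRate ε v :=
  (p.minRate_pos hε).trans_le (p.minRate_le_mixRate ε hv)

theorem mixRate_mul {v : ℝ} (hv : 0 < v) :
    p.mixRate (-1) v * p.mixRate 1 v = 2 * (p.rate + v) / p.σ ^ 2 := by
  have := p.σ_pos.ne'
  have h := p.shiftedDiscr_sq hv
  simp only [mixRate]
  field_simp
  linear_combination h

theorem mixRate_sub (v : ℝ) : p.mixRate 1 v - p.mixRate (-1) v = 2 * p.θ / p.σ ^ 2 := by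
  simp only [mixRate]
  ring

/-- Rationalising, `1/mixRate = (D - εθ) / (2(v + rate))` with `D` the shifted discriminant root,
which is at most `D/(v + rate)`. As `D²` is affine in `v`, the square is comparable to the
resolvent. -/
theorem one_div_mixRate_sq_le {ε : ℝ} (hε : |ε| = 1) {v : ℝ} (hv : 0 < v) :
    (1 / p.mixRate ε v) ^ 2 ≤ (p.θ ^ 2 / p.rate + 2 * p.σ ^ 2) * (1 / (v + p.rate)) := by
  have hσ := p.σ_pos
  have hr := p.rate_pos
  have hD := p.shiftedDiscr_sq hv
  have hle := (p.discr_le_shiftedDiscr hv).trans' p.abs_lt_discr.le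
  have habs := abs_le.1 ((abs_mul_le (p := p) hε.le).trans hle)
  have hpos := p.mixRate_pos hε.le hv
  have hε2 : ε ^ 2 = 1 := by rw [← sq_abs, hε, one_pow]
  have e : 1 / p.mixRate ε v = (p.shiftedDiscr v - ε * p.θ) / (2 * (v + p.rate)) := by
    rw [div_eq_div_iff hpos.ne' (by positivity), mixRate]
    field_simp
    linear_combination -hD + p.θ ^ 2 * hε2
  have h1 : 1 / p.mixRate ε v ≤ p.shiftedDiscr v / (v + p.rate) := by
    rw [e, div_le_div_iff₀ (by positivity) (by positivity)]
    nlinarith [mul_nonneg (by linarith [habs.1] : 0 ≤ p.shiftedDiscr v + ε * p.θ)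
      (by positivity : 0 ≤ v + p.rate)]
  refine (pow_le_pow_left₀ (by positivity) h1 2).trans ?_
  have h2 : p.θ ^ 2 ≤ p.θ ^ 2 / p.rate * (v + p.rate) := by
    rw [mul_add, div_mul_cancel₀ _ hr.ne']
    have : 0 ≤ p.θ ^ 2 / p.rate * v := by positivity
    linarith
  rw [div_pow, hD, mul_one_div, div_le_div_iff₀ (by positivity) (by positivity)]
  have h3 := mul_le_mul_of_nonneg_right h2 (by positivity : 0 ≤ v + p.rate)
  nlinarith

variable {p}

theorem integrable_resolvent (p : NTSParams) {q : ℝ} (hq : 0 < q) (hq1 : q < 1) :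
    Integrable (fun v => 1 / (v + p.rate)) (tsMeasure (-q) 0) := by
  have := (integral_resolvent hq hq1 p.rate_pos (z := 0) le_rfl).1.re
  refine this.congr (ae_of_all _ fun v => ?_)
  have e : 1 / ((v : ℂ) + p.rate - 0) = ((1 / (v + p.rate) : ℝ) : ℂ) := by push_cast; ring
  beta_reduce
  rw [e]
  exact Complex.ofReal_re _

theorem integrable_one_div_mixRate_sq (h0 : 0 < p.α) {ε : ℝ} (hε : |ε| = 1) :
    Integrable (fun v => (1 / p.mixRate ε v) ^ 2) (tsMeasure (-p.α) 0) := by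
  refine ((p.integrable_resolvent h0 p.α_lt).const_mul
    (p.θ ^ 2 / p.rate + 2 * p.σ ^ 2)).mono'
    ((measurable_const.div (p.measurable_mixRate ε)).pow_const 2).aestronglyMeasurable ?_
  filter_upwards [ae_tsMeasure_pos (-p.α) 0] with v hv
  rw [Real.norm_eq_abs, abs_of_nonneg (by positivity)]
  exact p.one_div_mixRate_sq_le hε hv

/-- The mean jump is of order `(√rate + √v) / (v + rate)`. The factor `√v` raises the index of the
measure to `α + 1/2`, which must stay below `1`. -/
theorem integrable_one_div_mixRate (h0 : 0 < p.α) (h1 : p.α < 1 / 2) {ε : ℝ} (hε : |ε| = 1) :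
    Integrable (fun v => 1 / p.mixRate ε v) (tsMeasure (-p.α) 0) := by
  have hr := p.rate_pos
  set C := p.θ ^ 2 / p.rate + 2 * p.σ ^ 2 with hC
  have hC0 : 0 ≤ C := by positivity
  have i1 : Integrable (fun v => √v * (1 / (v + p.rate))) (tsMeasure (-p.α) 0) := by
    have := p.integrable_resolvent (q := p.α + 1 / 2) (by linarith) (by linarith)
    rw [integrable_tsMeasure_iff] at this ⊢
    refine this.congr_fun (fun v hv => ?_) measurableSet_Ioi
    have hv' : 0 < v := hv
    simp only [smul_eq_mul]
    rw [Real.sqrt_eq_rpow, show -1 - -(p.α + 1 / 2) = -1 - -p.α + 1 / 2 by ring,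
      Real.rpow_add hv']
    ring
  refine ((((p.integrable_resolvent h0 p.α_lt).const_mul (√p.rate)).add i1).const_mul √C).mono'
    (measurable_const.div (p.measurable_mixRate ε)).aestronglyMeasurable ?_
  filter_upwards [ae_tsMeasure_pos (-p.α) 0] with v hv
  have hm := p.mixRate_pos hε.le hv
  have h2 := Real.sqrt_le_sqrt (p.one_div_mixRate_sq_le hε hv)
  rw [Real.sqrt_sq (by positivity), Real.sqrt_mul hC0] at h2
  rw [Real.norm_eq_abs, abs_of_pos (by positivity)]
  refine h2.trans (mul_le_mul_of_nonneg_left ?_ (Real.sqrt_nonneg _))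
  simp only [Pi.add_apply]
  rw [← add_mul, Real.sqrt_div' _ (by positivity), Real.sqrt_one, mul_one_div,
    div_le_div_iff₀ (by positivity) (by positivity), one_mul]
  have h3 : √(v + p.rate) ≤ √p.rate + √v := by
    rw [Real.sqrt_le_left (by positivity)]
    nlinarith [Real.sq_sqrt hv.le, Real.sq_sqrt hr.le, Real.sqrt_nonneg v, Real.sqrt_nonneg p.rate,
      mul_nonneg (Real.sqrt_nonneg v) (Real.sqrt_nonneg p.rate)]
  calc v + p.rate = √(v + p.rate) * √(v + p.rate) := (Real.mul_self_sqrt (by positivity)).symm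
    _ ≤ _ := by gcongr

/-- The components with `v > 2σ²/y²` have mean jumps of order at most `y` and squares of order
`1/v`. The integral of `v^{α-2}` over this range is a multiple of `y^{2-2α}`. The condition `εθ ≥ 0`
selects the direction with the larger rates, so that `y · mixRate ≥ 2` there. -/
theorem smallJumpBound_expMixture (h0 : 0 < p.α) {ε : ℝ} (hε : |ε| = 1) (hεθ : 0 ≤ ε * p.θ) :
    SmallJumpBound (expMixture (tsMeasure (-p.α) 0) (p.mixRate ε)) (2 * p.α) := by
  have hσ := p.σ_pos
  have hr := p.rate_pos
  have h1 := p.α_lt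
  -- Chosen so that `mixRate² ≤ C v` for `v ≥ 2σ²`: the rate is at most `2D/σ²`, and the constant
  -- part of `D²` is absorbed by `v`.
  set C := 4 * ((p.θ ^ 2 + 2 * p.σ ^ 2 * p.rate) / (2 * p.σ ^ 2) + 2 * p.σ ^ 2) / p.σ ^ 4 with hC
  have hC0 : 0 < C := by positivity
  have hT : 0 < (tsMeasure (-1) 1).real (Set.Icc 1 2) := by
    have := isFiniteMeasure_tsMeasure (α := -1) (by norm_num) one_pos
    refine ENNReal.toReal_pos (fun h => ?_) (measure_ne_top _ _)
    rw [tsMeasure, withDensity_apply_eq_zero (by fun_prop)] at h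
    have h' : volume.restrict (Set.Ioi (0 : ℝ)) (Set.Icc 1 2) = 0 := by
      refine measure_mono_null (fun x hx => Set.mem_inter ?_ hx) h
      have : 0 < x := lt_of_lt_of_le one_pos hx.1
      have : 0 < x ^ (-1 - -1 : ℝ) * Real.exp (-(1 * x)) := by positivity
      exact (ENNReal.ofReal_pos.2 this).ne'
    have hsub : Set.Icc (1 : ℝ) 2 ⊆ Set.Ioi 0 := fun x hx => lt_of_lt_of_le one_pos hx.1
    rw [Measure.restrict_apply measurableSet_Icc, Set.inter_eq_left.2 hsub] at h'
    norm_num at h'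
  refine ⟨C⁻¹ * ((2 * p.σ ^ 2) ^ (p.α - 1) / (1 - p.α)) * (tsMeasure (-1) 1).real (Set.Icc 1 2),
    ?_, fun y hy hy1 => ?_⟩
  · have : 0 < 1 - p.α := by linarith
    positivity
  have ha : 0 < 2 * p.σ ^ 2 / y ^ 2 := by positivity
  refine le_trans ?_ (le_integral_sq_expMixture (p.measurable_mixRate ε) (p.minRate_pos hε.le)
    ((ae_tsMeasure_pos _ _).mono fun v hv => p.minRate_le_mixRate ε hv)
    (integrable_one_div_mixRate_sq h0 hε) (measurableSet_Ioi (a := 2 * p.σ ^ 2 / y ^ 2))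
    fun v hv => ?_)
  · have hint : ∫ v in Set.Ioi (2 * p.σ ^ 2 / y ^ 2), v⁻¹ ∂tsMeasure (-p.α) 0
        = (2 * p.σ ^ 2) ^ (p.α - 1) / (1 - p.α) * y ^ (2 - 2 * p.α) := by
      rw [← integral_indicator measurableSet_Ioi, integral_tsMeasure]
      have e : ∀ v : ℝ, (v ^ (-1 - -p.α) * Real.exp (-(0 * v)))
          • (Set.Ioi (2 * p.σ ^ 2 / y ^ 2)).indicator (fun v => v⁻¹) v
          = (Set.Ioi (2 * p.σ ^ 2 / y ^ 2)).indicator (fun v => v ^ (p.α - 2)) v := by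
        intro v
        by_cases hv : v ∈ Set.Ioi (2 * p.σ ^ 2 / y ^ 2)
        · have hv0 : 0 < v := ha.trans hv
          rw [Set.indicator_of_mem hv, Set.indicator_of_mem hv, zero_mul, neg_zero, Real.exp_zero,
            mul_one, smul_eq_mul, ← Real.rpow_neg_one v, ← Real.rpow_add hv0]
          congr 1
          ring
        · simp [Set.indicator_of_notMem hv]
      simp_rw [e]
      rw [setIntegral_indicator measurableSet_Ioi, Set.Ioi_inter_Ioi, sup_of_le_right ha.le,
        integral_Ioi_rpow_of_lt (by linarith) ha, show p.α - 2 + 1 = p.α - 1 by ring,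
        Real.div_rpow (by positivity) (by positivity), ← Real.rpow_natCast y 2, ← Real.rpow_mul hy.le,
        show (2 - 2 * p.α) = -((2 : ℕ) * (p.α - 1)) by push_cast; ring, Real.rpow_neg hy.le,
        show 1 - p.α = -(p.α - 1) by ring]
      have : p.α - 1 ≠ 0 := by linarith
      field_simp
    -- The integral of a non-integrable function is `0` by convention, so the positive value just
    -- computed proves integrability.
    have hi : IntegrableOn (fun v => v⁻¹) (Set.Ioi (2 * p.σ ^ 2 / y ^ 2)) (tsMeasure (-p.α) 0) := by
      refine Integrable.of_integral_ne_zero ?_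
      rw [hint]
      have : 0 < 1 - p.α := by linarith
      positivity
    calc _ = C⁻¹ * ((2 * p.σ ^ 2) ^ (p.α - 1) / (1 - p.α) * y ^ (2 - 2 * p.α))
          * (tsMeasure (-1) 1).real (Set.Icc 1 2) := by ring
      _ ≤ _ := by
        rw [← hint, ← integral_const_mul]
        refine mul_le_mul_of_nonneg_right ?_ hT.le
        refine setIntegral_mono_on (hi.const_mul _)
          (integrable_one_div_mixRate_sq h0 hε).integrableOn measurableSet_Ioi fun v hv => ?_
        have hv0 : 0 < v := ha.trans hv
        have hv1 : 2 * p.σ ^ 2 ≤ v := by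
          refine le_trans ?_ (le_of_lt hv)
          rw [le_div_iff₀ (by positivity)]
          exact mul_le_of_le_one_right (by positivity) (pow_le_one₀ hy.le hy1)
        have hm := p.mixRate_pos hε.le hv0
        have hle := (p.discr_le_shiftedDiscr hv0).trans' p.abs_lt_discr.le
        have hle' := (le_abs_self _).trans ((abs_mul_le (p := p) hε.le).trans hle)
        rw [div_pow, one_pow, ← mul_inv, ← one_div]
        refine one_div_le_one_div_of_le (by positivity) ?_
        calc p.mixRate ε v ^ 2 ≤ (2 * p.shiftedDiscr v / p.σ ^ 2) ^ 2 := by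
              refine pow_le_pow_left₀ hm.le ?_ 2
              rw [mixRate]
              gcongr
              linarith
          _ = 4 * (p.θ ^ 2 + 2 * p.σ ^ 2 * p.rate + 2 * p.σ ^ 2 * v) / p.σ ^ 4 := by
              rw [div_pow, mul_pow, p.shiftedDiscr_sq hv0]
              ring
          _ ≤ 4 * ((p.θ ^ 2 + 2 * p.σ ^ 2 * p.rate) / (2 * p.σ ^ 2) * v + 2 * p.σ ^ 2 * v)
              / p.σ ^ 4 := by
              gcongr
              rw [div_mul_eq_mul_div, le_div_iff₀ (by positivity)]
              gcongr
          _ = C * v := by rw [hC]; ring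
  · have hv' : 2 * p.σ ^ 2 / y ^ 2 < v := hv
    have hv0 : 0 < v := ha.trans hv'
    rw [div_lt_iff₀ (by positivity)] at hv'
    have hD : 2 * p.σ ^ 2 ≤ y * p.shiftedDiscr v := by
      refine (abs_le_of_sq_le_sq' (b := y * p.shiftedDiscr v) ?_ (mul_nonneg hy.le (Real.sqrt_nonneg _))).2
      rw [mul_pow y, p.shiftedDiscr_sq hv0]
      have : 0 ≤ y ^ 2 * (p.θ ^ 2 + 2 * p.σ ^ 2 * p.rate) := by positivity
      nlinarith [mul_le_mul_of_nonneg_left hv'.le (by positivity : 0 ≤ 2 * p.σ ^ 2)]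
    rw [mixRate, ← mul_div_assoc, le_div_iff₀ (by positivity)]
    nlinarith [mul_nonneg hy.le hεθ]

variable (p)

/-- The derivative of the exponent. -/
def exponentDeriv (u : ℝ) : ℂ := (Complex.I * p.θ - p.σ ^ 2 * u)
  * (1 - p.brownianExponent u / p.rate) ^ ((p.α - 1 : ℝ) : ℂ)

theorem re_brownianExponent_nonpos (u : ℝ) : (p.brownianExponent u).re ≤ 0 := by
  have := p.re_brownianExponent u 0
  simp only [Complex.ofReal_zero, mul_zero, add_zero] at this
  rw [this]
  have : 0 ≤ p.σ ^ 2 * u ^ 2 / 2 := by positivity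
  linarith

theorem hasDerivAt_exponent (hα : p.α ≠ 0) (u : ℝ) :
    HasDerivAt p.exponent (p.exponentDeriv u) u := by
  have hre := p.re_brownianExponent_nonpos u
  have h0 : HasDerivAt (fun u : ℝ => (u : ℂ)) 1 u := Complex.ofRealCLM.hasDerivAt
  have h1 : HasDerivAt (fun u : ℝ => p.brownianExponent u) (Complex.I * p.θ - p.σ ^ 2 * u) u := by
    refine (((h0.const_mul Complex.I).mul_const (p.θ : ℂ)).sub
      (((h0.pow 2).const_mul ((p.σ : ℂ) ^ 2)).div_const 2)).congr_deriv ?_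
    simp
    ring
  have h2 := (hasDerivAt_tsSide p.α p.rate_pos (hre.trans_lt p.rate_pos)).comp u h1
  have h3 := h1.add (h2.const_mul (p.weight : ℂ))
  have e : p.exponent = fun u : ℝ => p.brownianExponent u
      + p.weight * tsSide p.α p.rate (p.brownianExponent u) := funext (p.exponent_eq hα)
  rw [e]
  refine h3.congr_deriv ?_
  have hr : (p.rate : ℂ) ≠ 0 := by exact_mod_cast p.rate_pos.ne'
  have hα' : (p.α : ℂ) ≠ 0 := by exact_mod_cast hα
  rw [tsSideDeriv, if_neg hα, if_neg p.α_lt.ne, exponentDeriv, ← mul_assoc, ← mul_assoc (p.weight : ℂ),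
    p.weight_mul_Gamma hα]
  field_simp
  ring

/-- The Lévy measure of the driver of a process with normal tempered stable stationary law. -/
def driverMeasure (b : ℝ) : Measure ℝ :=
  ENNReal.ofReal (b / (Real.Gamma p.α * Real.Gamma (1 - p.α) * p.rate ^ (p.α - 1))) •
    (expMixture (tsMeasure (-p.α) 0) (p.mixRate (-1))
      + (expMixture (tsMeasure (-p.α) 0) (p.mixRate 1)).map fun x => -x)

instance (b : ℝ) : SFinite (p.driverMeasure b) := by
  rw [driverMeasure]; infer_instance

/-- The denominator factors as `v + rate - z(u) = (σ²/2)(x - iu)(y + iu)`, where `x` and `y` are the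
two rates. Partial fractions give an upward exponential law of rate `x` and a downward one of rate
`y`; the resolvent at `z = 0` removes the first-order part. -/
theorem tsSide_mixRate_add {v : ℝ} (hv : 0 < v) (u : ℝ) :
    tsSide (-1) 1 (Complex.I * u / p.mixRate (-1) v)
      + tsSide (-1) 1 (Complex.I * (-u : ℝ) / p.mixRate 1 v)
      = (Complex.I * u * p.θ - p.σ ^ 2 * u ^ 2) * (1 / ((v : ℂ) + p.rate - p.brownianExponent u))
        - Complex.I * u * p.θ * (1 / ((v : ℂ) + p.rate - 0)) := by
  have hσ : (p.σ : ℂ) ≠ 0 := by exact_mod_cast p.σ_pos.ne'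
  have hmul := congrArg Complex.ofReal (p.mixRate_mul hv)
  have hsub := congrArg Complex.ofReal (p.mixRate_sub v)
  have hp := p.mixRate_pos (ε := -1) (by norm_num) hv
  have hn := p.mixRate_pos (ε := 1) (by norm_num) hv
  have hp' : (p.mixRate (-1) v : ℂ) ≠ 0 := by exact_mod_cast hp.ne'
  have hn' : (p.mixRate 1 v : ℂ) ≠ 0 := by exact_mod_cast hn.ne'
  have hr : ((v + p.rate : ℝ) : ℂ) ≠ 0 := by
    exact_mod_cast (by linarith [p.rate_pos] : 0 < v + p.rate).ne'
  have hz : (v : ℂ) + p.rate - p.brownianExponent u ≠ 0 := by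
    intro h
    have := congrArg Complex.re h
    simp only [Complex.sub_re, Complex.add_re, Complex.ofReal_re, Complex.zero_re] at this
    linarith [p.re_brownianExponent_nonpos u, p.rate_pos]
  generalize p.mixRate (-1) v = x at *
  generalize p.mixRate 1 v = y at *
  have hne : ∀ (w m : ℝ), m ≠ 0 → 1 - Complex.I * (w : ℂ) / (m : ℂ) ≠ 0 := by
    intro w m hm h
    have := congrArg Complex.re h
    rw [Complex.sub_re, Complex.div_ofReal_re] at this
    simp at this
  have hx1 := hne u x hp.ne'
  have hy1 := hne (-u) y hn.ne'
  have hx2 : (x : ℂ) - Complex.I * u ≠ 0 := by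
    intro h; apply hx1; rw [show (x : ℂ) - Complex.I * u = x * (1 - Complex.I * u / x) by field_simp] at h
    exact (mul_eq_zero.1 h).resolve_left hp'
  have hy2 : (y : ℂ) + Complex.I * u ≠ 0 := by
    intro h; apply hy1
    rw [show (y : ℂ) + Complex.I * u = y * (1 - Complex.I * (-u : ℝ) / y) by
      push_cast; field_simp; ring] at h
    exact (mul_eq_zero.1 h).resolve_left hn'
  rw [tsSide_neg_one_one hx1, tsSide_neg_one_one hy1]
  push_cast at hmul hsub hr ⊢
  have e1 : (v : ℂ) + p.rate - p.brownianExponent u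
      = p.σ ^ 2 / 2 * ((x - Complex.I * u) * (y + Complex.I * u)) := by
    have : (x - Complex.I * u) * (y + Complex.I * u)
        = x * y - Complex.I * u * (y - x) - Complex.I ^ 2 * u ^ 2 := by ring
    rw [this, hmul, hsub, Complex.I_sq, brownianExponent]
    field_simp
    ring
  have e2 : (v : ℂ) + p.rate - 0 = p.σ ^ 2 / 2 * (x * y) := by
    rw [hmul]; field_simp; ring
  have e3 : (p.θ : ℂ) = p.σ ^ 2 / 2 * (y - x) := by rw [hsub]; field_simp
  have e4 : (Complex.I * u / x) ^ 2 / (1 - Complex.I * u / x)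
      = (Complex.I * u) ^ 2 / (x * (x - Complex.I * u)) := by
    field_simp
  have e5 : (Complex.I * -(u : ℂ) / y) ^ 2 / (1 - Complex.I * -(u : ℂ) / y)
      = (Complex.I * u) ^ 2 / (y * (y + Complex.I * u)) := by
    rw [show 1 - Complex.I * -(u : ℂ) / y = (y + Complex.I * u) / y by field_simp; ring]
    field_simp
  rw [e1, e2, e3, e4, e5, show (p.σ : ℂ) ^ 2 * u ^ 2 = -(p.σ ^ 2 * (Complex.I * u) ^ 2) by
    rw [mul_pow, Complex.I_sq]; ring]
  generalize Complex.I * (u : ℂ) = w at *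
  field_simp
  ring

variable {p}

theorem integrable_tsSide_mixRate (h0 : 0 < p.α) {ε : ℝ} (hε : |ε| = 1) (u : ℝ) :
    Integrable (fun v => tsSide (-1) 1 (Complex.I * u / p.mixRate ε v)) (tsMeasure (-p.α) 0) := by
  have hre : ∀ v, (1 - Complex.I * u / p.mixRate ε v).re = 1 := by
    intro v
    rw [Complex.sub_re, Complex.div_ofReal_re]
    simp
  have e : ∀ v, tsSide (-1) 1 (Complex.I * u / p.mixRate ε v)
      = (Complex.I * u / p.mixRate ε v) ^ 2 / (1 - Complex.I * u / p.mixRate ε v) := fun v =>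
    tsSide_neg_one_one fun h => by have := hre v; rw [h] at this; simp at this
  simp_rw [e]
  have hm : Measurable fun v => (p.mixRate ε v : ℂ) :=
    Complex.measurable_ofReal.comp (p.measurable_mixRate ε)
  refine ((integrable_one_div_mixRate_sq h0 hε).const_mul (u ^ 2)).mono'
    (((measurable_const.div hm).pow_const 2).div
      (measurable_const.sub (measurable_const.div hm))).aestronglyMeasurable
    (ae_of_all _ fun v => ?_)
  rw [norm_div, norm_pow, norm_div, norm_mul, Complex.norm_I, one_mul, Complex.norm_real,
    Complex.norm_real, Real.norm_eq_abs, Real.norm_eq_abs, div_pow, sq_abs, sq_abs]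
  have h1 := Complex.re_le_norm (1 - Complex.I * u / p.mixRate ε v)
  rw [hre] at h1
  refine (div_le_self (by positivity) h1).trans_eq ?_
  ring

/-- Integrated against `v^{α-1} dv`, the resolvents become `R (1 - z/rate)^{α-1}`, and `(iuθ -
σ²u²)(1 - z/rate)^{α-1}` is `u ψ'(u)`. The resolvent at `z = 0` integrates to `R`, so the
compensating term `-iuθR` is cancelled by the mean `Rθ`, which scaling turns into `bθ`. -/
theorem isLevyExponent_driver (h0 : 0 < p.α) {b : ℝ} (hb : 0 < b) :
    IsLevyExponent (p.driverMeasure b) (b * p.θ) (fun u => b * (u * p.exponentDeriv u)) p.strip := by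
  have h1 := p.α_lt
  set R := Real.Gamma p.α * Real.Gamma (1 - p.α) * p.rate ^ (p.α - 1) with hR
  have hR0 : 0 < R := mul_pos (mul_pos (Real.Gamma_pos_of_pos h0)
    (Real.Gamma_pos_of_pos (by linarith))) (Real.rpow_pos_of_pos p.rate_pos _)
  have hside : ∀ ε : ℝ, |ε| = 1 → _ := fun ε hε =>
    isLevyExponent_expMixture (p.measurable_mixRate ε) (p.minRate_pos hε.le)
      ((ae_tsMeasure_pos (-p.α) 0).mono fun v hv => p.minRate_le_mixRate ε hv)
      (integrable_one_div_mixRate_sq h0 hε)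
  have h := (((hside (-1) (by norm_num)).bilateral (hside 1 (by norm_num)) (R * p.θ)).smul
    (div_pos hb hR0).le)
  have hS : {a | a ∈ Set.Ioi (-((p.discr + -1 * p.θ) / p.σ ^ 2))
      ∧ -a ∈ Set.Ioi (-((p.discr + 1 * p.θ) / p.σ ^ 2))} = p.strip := by
    ext a
    rw [strip, ← discr, Set.mem_Ioo]
    have e : (p.θ - p.discr) / p.σ ^ 2 = -((p.discr + -1 * p.θ) / p.σ ^ 2) := by ring
    have e' : (p.θ + p.discr) / p.σ ^ 2 = (p.discr + 1 * p.θ) / p.σ ^ 2 := by ring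
    rw [e, e']
    exact and_congr Iff.rfl (Set.mem_Ioi.trans neg_lt_neg_iff)
  rw [hS, ← mul_assoc, div_mul_cancel₀ _ hR0.ne'] at h
  rw [driverMeasure, ← hR]
  convert h using 1
  funext u
  have i1 := integrable_tsSide_mixRate h0 (ε := -1) (by norm_num) u
  have i2 := integrable_tsSide_mixRate h0 (ε := 1) (by norm_num) (-u)
  obtain ⟨j1, j2⟩ := integral_resolvent h0 h1 p.rate_pos (p.re_brownianExponent_nonpos u)
  obtain ⟨k1, k2⟩ := integral_resolvent h0 h1 p.rate_pos (z := 0) le_rfl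
  rw [add_assoc, ← integral_add i1 i2, integral_congr_ae ((ae_tsMeasure_pos (-p.α) 0).mono
    fun v hv => p.tsSide_mixRate_add hv u),
    integral_sub (j1.const_mul _) (k1.const_mul _), integral_const_mul, integral_const_mul, j2, k2,
    ← hR, zero_div, sub_zero, Complex.one_cpow, exponentDeriv]
  have : (R : ℂ) ≠ 0 := by exact_mod_cast hR0.ne'
  push_cast
  field_simp
  ring

/-- The sign of `θ` decides which of the two directions satisfies `εθ ≥ 0`; one direction is enough
for a lower bound. -/
theorem smallJumpBound_driver (h0 : 0 < p.α) {b : ℝ} (hb : 0 < b) :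
    SmallJumpBound (p.driverMeasure b) (2 * p.α) := by
  have h1 := p.α_lt
  have hR0 : 0 < Real.Gamma p.α * Real.Gamma (1 - p.α) * p.rate ^ (p.α - 1) :=
    mul_pos (mul_pos (Real.Gamma_pos_of_pos h0) (Real.Gamma_pos_of_pos (by linarith)))
      (Real.rpow_pos_of_pos p.rate_pos _)
  have hb' := div_pos hb hR0
  have hsq := (isLevyExponent_driver h0 hb).sq
  have hle : ∀ {μ ν : Measure ℝ} (c : ℝ≥0∞), μ ≤ ν → c • μ ≤ c • ν := fun c h => by gcongr
  rcases le_total 0 p.θ with hθ | hθ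
  · exact ((smallJumpBound_expMixture h0 (ε := 1) (by norm_num) (by linarith)).neg.smul hb').mono
      (hle _ (Measure.le_add_left le_rfl)) hsq
  · exact ((smallJumpBound_expMixture h0 (ε := -1) (by norm_num) (by linarith)).smul hb').mono
      (hle _ (Measure.le_add_right le_rfl)) hsq

theorem integrable_id_driver (h0 : 0 < p.α) (h1 : p.α < 1 / 2) (b : ℝ) :
    Integrable (fun x => x) (p.driverMeasure b) := by
  have h : ∀ ε : ℝ, |ε| = 1 → _ := fun ε hε =>
    integrable_id_expMixture (p.measurable_mixRate ε) (integrable_one_div_mixRate h0 h1 hε)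
  exact ((h (-1) (by norm_num)).add_measure
    (TSParams.integrable_map_neg.2 (h 1 (by norm_num)).neg)).smul_measure ENNReal.ofReal_ne_top

theorem stationary_cases {b t : ℝ} (hb : 0 < b) (ht : 0 < t)
    {ρ : Measure ℝ} [IsProbabilityMeasure ρ]
    (hρ : ∀ u, charFun ρ u = Complex.exp (p.exponent u - p.exponent (Real.exp (-b * t) * u))) :
    (0 < p.α → p.α < 1 / 2 → InfiniteActivityFiniteVariation ρ ∧
      ExponentialErrorDecay ρ p.strip (2 * p.α)) ∧
    (1 / 2 ≤ p.α → InfiniteActivityInfiniteVariation ρ ∧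
      ExponentialErrorDecay ρ p.strip (2 * p.α)) := by
  have hρ' : 0 < p.α → ∀ u, charFun ρ u = Complex.exp (∫ s in (0 : ℝ)..t,
      (fun u : ℝ => (b : ℂ) * (u * p.exponentDeriv u)) (Real.exp (-b * s) * u)) := fun h0 u => by
    rw [hρ, ← sub_eq_integral_of_hasDerivAt (b := b) (isLevyExponent_driver h0 hb).continuous
      (p.hasDerivAt_exponent h0.ne') fun u => rfl]
  have hZ : 0 < p.α → _ := fun h0 => (isLevyExponent_driver h0 hb).ou hb ht.le
  have hS : 0 < p.α → _ := fun h0 =>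
    (smallJumpBound_driver h0 hb).ou hb ht (isLevyExponent_driver h0 hb).sq
  refine ⟨fun h0 h1 => ⟨?_, ?_⟩, fun h1 => ?_⟩
  · exact (hZ h0).infiniteActivityFiniteVariation (hρ' h0) (by linarith) (hS h0)
      (integrable_id_ouMeasure hb (integrable_id_driver h0 h1 b))
  · exact (hZ h0).exponentialErrorDecay (hρ' h0) (by linarith) (hS h0)
  · have h0 : 0 < p.α := by linarith
    exact ⟨(hZ h0).infiniteActivityInfiniteVariation (hρ' h0) (by linarith) (hS h0),
      (hZ h0).exponentialErrorDecay (hρ' h0) (by linarith) (hS h0)⟩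

end NTSParams

/-! ### The variance gamma cases and the conclusion -/

namespace NTSParams

variable {p : NTSParams}

theorem continuous_exponent (p : NTSParams) : Continuous p.exponent := by
  rcases eq_or_ne p.α 0 with h | h
  · rw [← funext (toTS_exponent h)]
    exact p.toTS.isLevyExponent.continuous
  · exact (p.isLevyExponent h).continuous

theorem ou_varianceGamma {b t : ℝ} (hb : 0 < b) (ht : 0 < t) {ρ : Measure ℝ}
    [IsProbabilityMeasure ρ]
    (hρ : ∀ u, charFun ρ u = Complex.exp (∫ s in (0 : ℝ)..t, p.exponent (Real.exp (-b * s) * u)))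
    (h : p.α = 0) :
    InfiniteActivityFiniteVariation ρ ∧ PowerLawErrorDecay ρ p.strip (2 * t / p.κ) := by
  rw [← funext (toTS_exponent h)] at hρ
  have := (p.toTS.ou_cases hb ht hρ).1 p.toTS_index
  rwa [toTS_strip, toTS_gammaMass, div_mul_eq_mul_div] at this

theorem stationary_varianceGamma {b t : ℝ} (hb : 0 < b) (ht : 0 < t) {ρ : Measure ℝ}
    [IsProbabilityMeasure ρ]
    (hρ : ∀ u, charFun ρ u = Complex.exp (p.exponent u - p.exponent (Real.exp (-b * t) * u)))
    (h : p.α = 0) :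
    FiniteActivity ρ ∧ ∃ V, BernoulliDecomposition ρ V (2 * b / p.κ * t) 0 ∧
      PowerLawErrorDecay V p.strip 1 := by
  rw [← funext (toTS_exponent h)] at hρ
  have := TSParams.stationary_gamma p.toTS_nonnegStability hb ht hρ p.toTS_index
  have e : (p.toTS.cp + p.toTS.cn) * b * t = 2 * b / p.κ * t := by
    simp only [toTS]
    ring
  rwa [toTS_strip, toTS_drift h, mul_zero, e] at this

end NTSParams

end LevyOU

end

open LevyOU in
theorem proposition4p2 {Ω : Type*} [MeasurableSpace Ω] (P : Measure Ω) [IsProbabilityMeasure P]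
    (b : ℝ) (hb : 0 < b) (L X : ℝ≥0 → Ω → ℝ) (hX : IsOUProcess P b L X)
    (r t : ℝ≥0) (ht : 0 < t) :
    -- OU-TS
    (∀ p : TSParams, HasCharExponent P L p.exponent →
      (p.index < 0 →
        FiniteActivity (stepLaw P b X r t) ∧
        ∃ V : Measure ℝ,
          BernoulliDecomposition (stepLaw P b X r t) V (p.intensity * t)
            ((1 - Real.exp (-b * t)) / b * p.drift) ∧
          PowerLawErrorDecay V p.strip (-p.index)) ∧
      (p.index = 0 →
        InfiniteActivityFiniteVariation (stepLaw P b X r t) ∧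
        PowerLawErrorDecay (stepLaw P b X r t) p.strip (p.gammaMass * t)) ∧
      (0 < p.index → p.index < 1 →
        InfiniteActivityFiniteVariation (stepLaw P b X r t) ∧
        ExponentialErrorDecay (stepLaw P b X r t) p.strip p.index) ∧
      (1 ≤ p.index →
        InfiniteActivityInfiniteVariation (stepLaw P b X r t) ∧
        ExponentialErrorDecay (stepLaw P b X r t) p.strip p.index)) ∧
    -- TS-OU
    (∀ (p : TSParams) (π : Measure ℝ), p.NonnegStability →
      (∀ u, charFun π u = Complex.exp (p.exponent u)) → IsStationaryLaw P b X π →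
      (p.index = 0 →
        FiniteActivity (stepLaw P b X r t) ∧
        ∃ V : Measure ℝ,
          BernoulliDecomposition (stepLaw P b X r t) V ((p.cp + p.cn) * b * t)
            ((1 - Real.exp (-b * t)) * p.drift) ∧
          PowerLawErrorDecay V p.strip 1) ∧
      (0 < p.index → p.index < 1 →
        InfiniteActivityFiniteVariation (stepLaw P b X r t) ∧
        ExponentialErrorDecay (stepLaw P b X r t) p.strip p.index) ∧
      (1 ≤ p.index →
        InfiniteActivityInfiniteVariation (stepLaw P b X r t) ∧
        ExponentialErrorDecay (stepLaw P b X r t) p.strip p.index)) ∧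
    -- OU-NTS
    (∀ p : NTSParams, HasCharExponent P L p.exponent →
      (p.α < 0 →
        FiniteActivity (stepLaw P b X r t) ∧
        ∃ V : Measure ℝ,
          BernoulliDecomposition (stepLaw P b X r t) V ((1 - p.α) / (p.κ * |p.α|) * t) 0 ∧
          PowerLawErrorDecay V p.strip (-(2 * p.α))) ∧
      (p.α = 0 →
        InfiniteActivityFiniteVariation (stepLaw P b X r t) ∧
        PowerLawErrorDecay (stepLaw P b X r t) p.strip (2 * t / p.κ)) ∧
      (0 < p.α → p.α < 1 / 2 →
        InfiniteActivityFiniteVariation (stepLaw P b X r t) ∧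
        ExponentialErrorDecay (stepLaw P b X r t) p.strip (2 * p.α)) ∧
      (1 / 2 ≤ p.α →
        InfiniteActivityInfiniteVariation (stepLaw P b X r t) ∧
        ExponentialErrorDecay (stepLaw P b X r t) p.strip (2 * p.α))) ∧
    -- NTS-OU
    (∀ (p : NTSParams) (π : Measure ℝ), 0 ≤ p.α →
      (∀ u, charFun π u = Complex.exp (p.exponent u)) → IsStationaryLaw P b X π →
      (p.α = 0 →
        FiniteActivity (stepLaw P b X r t) ∧
        ∃ V : Measure ℝ,
          BernoulliDecomposition (stepLaw P b X r t) V (2 * b / p.κ * t) 0 ∧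
          PowerLawErrorDecay V p.strip 1) ∧
      (0 < p.α → p.α < 1 / 2 →
        InfiniteActivityFiniteVariation (stepLaw P b X r t) ∧
        ExponentialErrorDecay (stepLaw P b X r t) p.strip (2 * p.α)) ∧
      (1 / 2 ≤ p.α →
        InfiniteActivityInfiniteVariation (stepLaw P b X r t) ∧
        ExponentialErrorDecay (stepLaw P b X r t) p.strip (2 * p.α))) := by
  have ht' : (0 : ℝ) < t := ht
  have := isProbabilityMeasure_stepLaw hX r t
  refine ⟨fun p hL => ?_, fun p π hp hπ hst => ?_, fun p hL => ?_, fun p π _ hπ hst => ?_⟩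
  · have hρ := charFun_stepLaw hb hX r t ht p.isLevyExponent.continuous hL
    exact ⟨p.finiteActivity hb ht' hρ, p.ou_cases hb ht' hρ⟩
  · have hρ := charFun_stepLaw_of_isStationaryLaw hb hX r t ht hst hπ
    exact ⟨TSParams.stationary_gamma hp hb ht' hρ, TSParams.stationary_cases hp hb ht' hρ⟩
  · have hρ := charFun_stepLaw hb hX r t ht p.continuous_exponent hL
    exact ⟨p.finiteActivity hb ht' hρ, NTSParams.ou_varianceGamma hb ht' hρ,
      p.ou_cases hb ht' hρ⟩
  · have hρ := charFun_stepLaw_of_isStationaryLaw hb hX r t ht hst hπ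
    exact ⟨NTSParams.stationary_varianceGamma hb ht' hρ, NTSParams.stationary_cases hb ht' hρ⟩
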